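/- Let $d\ge 1$ and let $\chi\in C_c^\infty(\mathbb R^d)$, $\varphi\in C_c^\infty(\mathbb R^d\setminus\{0\})$ be radial nonnegative functions with $\chi(\xi)+\sum_{q\ge 0}\varphi(2^{-q}\xi)=1$ for all $\xi$, $\operatorname{supp}\chi\cap\operatorname{supp}\varphi(2^{-q}\cdot)=\varnothing$ for $q\ge 1$, and $\operatorname{supp}\varphi(2^{-j}\cdot)\cap\operatorname{supp}\varphi(2^{-k}\cdot)=\varnothing$ for $|j-k|\ge 2$. For $q\in\mathbb N$ let $\Delta_q=\varphi(2^{-q}D)$ be the Fourier multiplier with symbol $\varphi(2^{-q}\xi)$, and let $|D|$ be the Fourier multiplier with symbol $|\xi|$. For every $p\in\,]1,\infty[$ there is a constant $C$, depending only on $d$, $\chi$, $\varphi$ and $p$, with the following property. Let $t>0$, let $v:[0,t]\times\mathbb R^d\to\mathbb R^d$ be a smooth ($C^\infty$ and bounded) vector field with $\operatorname{div} v(\tau,\cdot)=0$ for all $\tau\in[0,t]$, let $\omega=(\partial_j v^i-\partial_i v^j)_{i,j}$ be its vorticity, and let $\theta:[0,t]\times\mathbb R^d\to\mathbb R$ be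 a smooth solution ($C^\infty$, bounded together with its first-order derivatives) of $$\partial_t\theta+v\cdot\nabla\theta+|D|\theta=0,\qquad \theta_{|t=0}=\theta^0 .$$ Then $$\sup_{q\in\mathbb N}2^q\|\Delta_q\theta\|_{L^1_tL^p}\le C\|\theta^0\|_{L^p}+C\|\theta^0\|_{L^\infty}\|\omega\|_{L^1_tL^p},$$ where $\|f\|_{L^1_tL^p}=\int_0^t\|f(\tau)\|_{L^p(\mathbb R^d)}\,d\tau$, and where a norm is $+\infty$ for a function outside the corresponding space (with $0\cdot\infty=0$). -/

import Mathlib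

open MeasureTheory Set
open scoped ENNReal NNReal FourierTransform SchwartzMap ContDiff

noncomputable section

/-- The Euclidean space `ℝ^d`. -/
abbrev Rd (d : ℕ) : Type := EuclideanSpace ℝ (Fin d)

/-- The dilated function `ξ ↦ f (2^{-q} ξ)`. -/
def dyadicDilate {d : ℕ} (f : Rd d → ℝ) (q : ℤ) : Rd d → ℝ :=
  fun ξ => f ((2 : ℝ) ^ (-q) • ξ)

/-- A dyadic partition of unity: `χ` and `φ` are radial, nonnegative, smooth and compactly
supported, `φ` is supported away from the origin, `χ(ξ) + ∑_{q ≥ 0} φ(2^{-q} ξ) = 1`, and the usual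
disjointness conditions on the supports hold. -/
structure DyadicPartition (d : ℕ) where
  χ : Rd d → ℝ
  φ : Rd d → ℝ
  χ_smooth : ContDiff ℝ ∞ χ
  φ_smooth : ContDiff ℝ ∞ φ
  χ_compact : HasCompactSupport χ
  φ_compact : HasCompactSupport φ
  φ_away : (0 : Rd d) ∉ tsupport φ
  χ_radial : ∀ ξ η : Rd d, ‖ξ‖ = ‖η‖ → χ ξ = χ η
  φ_radial : ∀ ξ η : Rd d, ‖ξ‖ = ‖η‖ → φ ξ = φ η
  χ_nonneg : ∀ ξ, 0 ≤ χ ξ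
  φ_nonneg : ∀ ξ, 0 ≤ φ ξ
  sum_eq_one : ∀ ξ, HasSum (fun q : ℕ => dyadicDilate φ q ξ) (1 - χ ξ)
  χ_disjoint : ∀ q : ℕ, 1 ≤ q → Disjoint (tsupport χ) (tsupport (dyadicDilate φ q))
  φ_disjoint : ∀ j k : ℤ, 2 ≤ |j - k| →
    Disjoint (tsupport (dyadicDilate φ j)) (tsupport (dyadicDilate φ k))

/-- The convolution kernel of the Fourier multiplier `φ(2^{-q} D)`, that is
`x ↦ (2π)^{-d} ∫ e^{i x·ξ} φ(2^{-q} ξ) dξ`. Mathlib's inverse Fourier transform is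
`∫ e^{2π i x·ξ} f(ξ) dξ`, hence the factor `2π` in the argument. -/
def blockKernel {d : ℕ} (P : DyadicPartition d) (q : ℕ) : Rd d → ℂ :=
  𝓕⁻ (fun ξ : Rd d => (dyadicDilate P.φ q ((2 * Real.pi) • ξ) : ℂ))

/-- The dyadic block `Δ_q f = φ(2^{-q} D) f`, `q ≥ 0`, of a bounded function `f`, as the
convolution of `f` with the (Schwartz) kernel of the multiplier. -/
def dyadicBlock {d : ℕ} (P : DyadicPartition d) (q : ℕ) (f : Rd d → ℝ) : Rd d → ℂ :=
  fun x => ∫ y, blockKernel P q (x - y) * (f y : ℂ)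

/-- `|D| ψ` for a Schwartz function `ψ`: the Fourier multiplier with symbol `|ξ|`
(which is `2π |ξ|` in Mathlib's normalization of the Fourier transform). -/
def absDSchwartz {d : ℕ} (ψ : 𝓢(Rd d, ℂ)) : Rd d → ℂ :=
  𝓕⁻ (fun ξ : Rd d => ((2 * Real.pi * ‖ξ‖ : ℝ) : ℂ) * 𝓕 (ψ : Rd d → ℂ) ξ)

/-- `|D| f = g` in the sense of tempered distributions, for a bounded function `f`: the multiplier
`|D|` is moved to the Schwartz test function (its symbol is even, so it is its own transpose). -/
def HasAbsD {d : ℕ} (f g : Rd d → ℝ) : Prop :=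
  ∀ ψ : 𝓢(Rd d, ℂ), Integrable (fun x => (g x : ℂ) * ψ x) ∧
    ∫ x, (g x : ℂ) * ψ x = ∫ x, (f x : ℂ) * absDSchwartz ψ x

/-- The divergence `∑ i, ∂_i u^i` of a vector field. -/
def divergence {d : ℕ} (u : Rd d → Rd d) (x : Rd d) : ℝ :=
  ∑ i, (fderiv ℝ u x (EuclideanSpace.single i 1)) i

/-- The vorticity: twice the antisymmetric part of the gradient, with components
`∂_j u^i - ∂_i u^j`. Its operator norm is `|∂_1 u^2 - ∂_2 u^1|` for `d = 2` and `|curl u|` for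
`d = 3`. -/
def vorticity {d : ℕ} (u : Rd d → Rd d) (x : Rd d) : Rd d →L[ℝ] Rd d :=
  fderiv ℝ u x - ContinuousLinearMap.adjoint (fderiv ℝ u x)

/-- The time derivative `∂_t θ(t, x)`, one-sided at the end points of `[0, T]`. -/
def timeDeriv {d : ℕ} (T : ℝ) (θ : ℝ → Rd d → ℝ) (t : ℝ) (x : Rd d) : ℝ :=
  derivWithin (fun s => θ s x) (Icc 0 T) t

/-- A smooth divergence-free vector field on `[0, T] × ℝ^d`: `C^∞` up to the end points, bounded,
with vanishing divergence at all times. -/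
structure IsSmoothDivFree {d : ℕ} (T : ℝ) (v : ℝ → Rd d → Rd d) : Prop where
  smooth : ContDiffOn ℝ ∞ (fun z : ℝ × Rd d => v z.1 z.2) (Icc 0 T ×ˢ univ)
  bounded : ∃ K : ℝ, ∀ t ∈ Icc 0 T, ∀ x, ‖v t x‖ ≤ K
  div_eq_zero : ∀ t ∈ Icc 0 T, ∀ x, divergence (v t) x = 0

/-- A smooth solution on `[0, T] × ℝ^d` of `∂_t θ + v·∇θ + |D| θ = 0`: `C^∞` up to the end points,
bounded together with its first-order derivatives, and at each time
`|D| θ = -(∂_t θ + v·∇θ)`. -/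
structure IsSmoothSolution {d : ℕ} (T : ℝ) (v : ℝ → Rd d → Rd d) (θ : ℝ → Rd d → ℝ) : Prop where
  smooth : ContDiffOn ℝ ∞ (fun z : ℝ × Rd d => θ z.1 z.2) (Icc 0 T ×ˢ univ)
  bounded : ∃ K : ℝ, ∀ t ∈ Icc 0 T, ∀ x,
    |θ t x| ≤ K ∧ ‖fderiv ℝ (θ t) x‖ ≤ K ∧ |timeDeriv T θ t x| ≤ K
  equation : ∀ t ∈ Icc 0 T,
    HasAbsD (θ t) (fun x => -(timeDeriv T θ t x + fderiv ℝ (θ t) x (v t x)))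

/-- The norm of `L^1([0, T]; L^p)`, with value `∞` outside the space. -/
def normL1Lp {d : ℕ} {F : Type*} [NormedAddCommGroup F] (T : ℝ) (p : ℝ≥0∞)
    (f : ℝ → Rd d → F) : ℝ≥0∞ :=
  ∫⁻ t in Icc 0 T, eLpNorm (f t) p volume

end

/-! Write θ_q for the dyadic block of θ. Convolving the equation with the kernel h_q of the block
gives ∂_t θ_q + v·∇θ_q + |D|θ_q = F_q, where F_q is the commutator of v·∇ with the convolution
(`kernelConv_equation`). Since θ_q has no frequencies below a multiple of 2^q, the diffusion damps
its L^p norm at rate c2^q, and integrating in time bounds c2^q‖θ_q‖ in L¹L^p by the initial norm of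
θ_q plus the L¹L^p norm of F_q. The theorem then follows from a bound of F_q by ‖θ⁰‖_∞ times the
vorticity, uniformly in q.

Damping. In integral form |D| averages the symmetric second differences u(x) - (u(x+z) + u(x-z))/2
against the Lévy density ν(z) = c|z|^(-d-1). A part η of ν, of mass proportional to 2^q, can be
chosen with η * h_q = 0 (`exists_gain_kernel`): it is a small multiple of |𝓕ρ|² for a bump ρ so
narrow that its autocorrelation, which is the Fourier transform of |𝓕ρ|², misses the support of the
symbol. On θ_q the part η acts as multiplication by its mass, and the rest ν - η is nonnegative, so
it still dissipates the L^p norm by convexity of |a|^p. No integrability of θ_q at positive times is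
known beforehand. The energy computation is therefore run against weights w(rx), where w decays like
the Lévy density. Transport and diffusion move such a weight by O(r) only
(`IsSlowWeight.energy_le`), and r → 0 is a monotone limit (`lintegral_rpow_le_of_transport_levyOp`).

Commutator. As div v = 0, F_q(x) is the integral of ∇h_q(z)·(v(x) - v(x-z)) θ(x-z). Writing the
increment of v as an integral of its gradient along a segment and using Minkowski, ‖F_q‖_p ≤ ‖θ‖_∞
‖∇v‖_p ∫|z||∇h_q(z)|dz, and the last factor does not depend on q
(`lintegral_transportCommutator_rpow_le`). The sup norm of θ does not grow, by a maximum principle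
in which log(1+|x|²) serves as penalization at infinity (`le_of_transport_levyOp`).

Gradient and vorticity. For a bounded divergence-free field, Δv^i is the sum over j of ∂_j ω_ij.
Differentiating ∂_k e^(sΔ)v^i in s thus produces ∂_j∂_k e^(sΔ)ω_ij; the gradient of the flow tends
to ∂_k v^i as s → 0 and to 0 as s → ∞, so ∂_k v^i is a limit of truncated second-order Riesz
transforms of the vorticity (`eLpNorm_fderiv_le_vorticity`). Their L^p bounds come by duality from
`bilinear_heat_embedding`, an estimate of the space-time integral of |∂_i e^(sΔ)f ∂_j e^(sΔ)g|. It
is proved by weighting the two Dirichlet energies with inverse powers of a single positive heat flow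
that dominates both factors. -/

noncomputable section

open Filter Topology

/-! ### Polynomial decay and convolutions -/

/-- The polynomially decaying function `(1 + ‖x‖)^{-N}`. -/
def polyDecay {d : ℕ} (N : ℕ) (x : Rd d) : ℝ := ((1 + ‖x‖) ^ N)⁻¹

lemma polyDecay_pos {d : ℕ} (N : ℕ) (x : Rd d) : 0 < polyDecay N x := by
  unfold polyDecay; positivity

lemma polyDecay_le_one {d : ℕ} (N : ℕ) (x : Rd d) : polyDecay N x ≤ 1 := by
  unfold polyDecay
  exact inv_le_one_of_one_le₀ (one_le_pow₀ (by linarith [norm_nonneg x]))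

lemma continuous_polyDecay {d : ℕ} (N : ℕ) : Continuous (polyDecay N : Rd d → ℝ) := by
  unfold polyDecay
  exact Continuous.inv₀ (by fun_prop) (fun x => by positivity)

lemma integrable_polyDecay {d N : ℕ} (h : d < N) : Integrable (polyDecay N : Rd d → ℝ) := by
  have := integrable_one_add_norm (E := Rd d) (μ := volume) (r := N) (by simpa using h)
  refine this.congr (Eventually.of_forall fun x => ?_)
  simp [polyDecay, Real.rpow_neg (show (0 : ℝ) ≤ 1 + ‖x‖ by positivity)]

lemma polyDecay_add {d N M : ℕ} (x : Rd d) :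
    polyDecay (N + M) x = polyDecay N x * polyDecay M x := by
  simp [polyDecay, pow_add, mul_comm]

lemma one_add_norm_pow_mul_polyDecay {d N : ℕ} (x : Rd d) :
    (1 + ‖x‖) ^ N * polyDecay N x = 1 := by
  unfold polyDecay; field_simp

/-- Since 1+|x| ≤ (1+|x+h|)(1+|h|), a bounded displacement costs only a constant. This supplies the
dominating functions whenever a base point varies in a ball. -/
lemma polyDecay_translate {d : ℕ} (N : ℕ) (x h : Rd d) :
    polyDecay N (x + h) ≤ (1 + ‖h‖) ^ N * polyDecay N x := by
  unfold polyDecay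
  rw [← div_eq_mul_inv, inv_eq_one_div, div_le_div_iff₀ (by positivity) (by positivity), one_mul,
    ← mul_pow]
  refine pow_le_pow_left₀ (by positivity) ?_ _
  have : ‖x‖ ≤ ‖x + h‖ + ‖h‖ := by simpa using norm_sub_le (x + h) h
  nlinarith [norm_nonneg h, norm_nonneg (x + h)]

/-- The convolution of a kernel with a function. -/
def kernelConv {d : ℕ} (k f : Rd d → ℝ) (x : Rd d) : ℝ := ∫ y, k (x - y) * f y

lemma kernelConv_eq {d : ℕ} (k f : Rd d → ℝ) (x : Rd d) :
    kernelConv k f x = ∫ z, k z * f (x - z) := by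
  unfold kernelConv
  rw [← integral_sub_left_eq_self (fun z => k z * f (x - z)) volume x]
  simp

lemma integrable_mul_of_bounded {d : ℕ} {k f : Rd d → ℝ} {M : ℝ} (hk : Integrable k)
    (hf : Measurable f) (hM : ∀ y, |f y| ≤ M) : Integrable (fun y => k y * f y) :=
  hk.mul_bdd (c := M) hf.aestronglyMeasurable (Eventually.of_forall hM)

lemma integrable_kernelConv {d : ℕ} {k f : Rd d → ℝ} {M : ℝ} (hk : Integrable k)
    (hf : Measurable f) (hM : ∀ y, |f y| ≤ M) (x : Rd d) :
    Integrable (fun y => k (x - y) * f y) :=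
  integrable_mul_of_bounded (hk.comp_sub_left x) hf hM

lemma abs_kernelConv_le {d : ℕ} {k f : Rd d → ℝ} {M : ℝ} (hk : Integrable k)
    (hM : ∀ y, |f y| ≤ M) (x : Rd d) :
    |kernelConv k f x| ≤ (∫ z, |k z|) * M := by
  rw [kernelConv_eq, ← integral_mul_const, ← Real.norm_eq_abs]
  refine (norm_integral_le_integral_norm _).trans ?_
  refine integral_mono_of_nonneg (Eventually.of_forall fun z => norm_nonneg _)
    (hk.abs.mul_const M) (Eventually.of_forall fun z => ?_)
  simp only [Real.norm_eq_abs, abs_mul]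
  exact mul_le_mul_of_nonneg_left (hM _) (abs_nonneg _)

/-- Differentiation of a convolution with respect to a parameter. -/
lemma hasDerivAt_kernelConv_param {d : ℕ} {S : Set ℝ} {s₀ : ℝ} (hS : S ∈ 𝓝 s₀)
    {k k' : ℝ → Rd d → ℝ} {f : Rd d → ℝ} {B : Rd d → ℝ} {M : ℝ}
    (hk : ∀ s ∈ S, Continuous (k s)) (hk' : ∀ s ∈ S, Continuous (k' s))
    (hki : Integrable (k s₀))
    (hB : ∀ s ∈ S, ∀ z, |k' s z| ≤ B z) (hBi : Integrable B)
    (hder : ∀ s ∈ S, ∀ z, HasDerivAt (fun r => k r z) (k' s z) s)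
    (hf : Measurable f) (hM : ∀ y, |f y| ≤ M) (x : Rd d) :
    HasDerivAt (fun s => kernelConv (k s) f x) (kernelConv (k' s₀) f x) s₀ := by
  unfold kernelConv
  have hs₀ := mem_of_mem_nhds hS
  refine (hasDerivAt_integral_of_dominated_loc_of_deriv_le (F := fun s y => k s (x - y) * f y)
    (F' := fun s y => k' s (x - y) * f y)
    (bound := fun y => B (x - y) * M) hS ?_ ?_ ?_ ?_ ?_ ?_).2
  · filter_upwards [hS] with s hs
    exact (((hk s hs).measurable.comp (by fun_prop)).mul hf).aestronglyMeasurable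
  · exact integrable_kernelConv hki hf hM x
  · exact (((hk' s₀ hs₀).measurable.comp (by fun_prop)).mul hf).aestronglyMeasurable
  · refine Eventually.of_forall fun y s hs => ?_
    rw [Real.norm_eq_abs, abs_mul]
    exact mul_le_mul (hB s hs _) (hM y) (abs_nonneg _) ((abs_nonneg _).trans (hB s hs _))
  · exact (hBi.comp_sub_left x).mul_const M
  · exact Eventually.of_forall fun y s hs => (hder s hs _).mul_const _

/-- Differentiation of a convolution along a line. -/
lemma hasLineDerivAt_kernelConv {d : ℕ} {k k' : Rd d → ℝ} {f : Rd d → ℝ} {C M : ℝ} {e : Rd d}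
    (hk : Continuous k) (hk' : Continuous k') (hki : Integrable k)
    (hC : ∀ z, |k' z| ≤ C * polyDecay (d + 1) z)
    (hder : ∀ z, HasLineDerivAt ℝ k (k' z) z e)
    (hf : Measurable f) (hM : ∀ y, |f y| ≤ M) (x : Rd d) :
    HasLineDerivAt ℝ (kernelConv k f) (kernelConv k' f x) x e := by
  have hC0 : 0 ≤ C := by
    have := (abs_nonneg _).trans (hC 0)
    exact nonneg_of_mul_nonneg_left this (polyDecay_pos _ _)
  -- The derivative along e is the parameter derivative at 0 of the family of translated kernels z ↦
  -- k(z + se).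
  have key := hasDerivAt_kernelConv_param (S := Ioo (-1) 1) (s₀ := 0)
    (Ioo_mem_nhds (by norm_num) (by norm_num)) (k := fun t z => k (z + t • e))
    (k' := fun t z => k' (z + t • e)) (f := f)
    (B := fun z => C * ((1 + ‖e‖) ^ (d + 1) * polyDecay (d + 1) z)) (M := M)
    (fun s _ => by fun_prop) (fun s _ => by fun_prop) (by simpa using hki) ?_ ?_ ?_ hf hM x
  · have h0 : kernelConv (fun z => k' (z + (0 : ℝ) • e)) f x = kernelConv k' f x := by simp
    rw [h0] at key
    refine key.congr_of_eventuallyEq (Eventually.of_forall fun t => ?_)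
    simp only [kernelConv]
    congr 1; ext y; congr 2; abel
  · intro s hs z
    refine (hC _).trans (mul_le_mul_of_nonneg_left ?_ hC0)
    refine (polyDecay_translate _ _ _).trans ?_
    refine mul_le_mul_of_nonneg_right ?_ (polyDecay_pos _ _).le
    refine pow_le_pow_left₀ (by positivity) ?_ _
    rw [norm_smul]
    have : |s| ≤ 1 := abs_le.2 ⟨hs.1.le, hs.2.le⟩
    have := mul_le_mul_of_nonneg_right this (norm_nonneg e)
    simp at this ⊢; linarith
  · exact ((integrable_polyDecay (Nat.lt_succ_self d)).const_mul _).const_mul C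
  · intro s hs z
    have := (hder (z + s • e))
    unfold HasLineDerivAt at this
    have h2 : HasDerivAt (fun t : ℝ => k (z + s • e + (t - s) • e)) (k' (z + s • e)) s := by
      have h3 := HasDerivAt.comp_sub_const s s (f := fun t => k (z + s • e + t • e))
        (f' := k' (z + s • e)) (by simpa using this)
      exact h3
    refine h2.congr_of_eventuallyEq (Eventually.of_forall fun t => ?_)
    simp only [sub_smul]; congr 1; abel

/-- The Fréchet derivative of a convolution with a `C¹` kernel. -/
lemma hasFDerivAt_kernelConv {d : ℕ} {k : Rd d → ℝ} {f : Rd d → ℝ} {C M : ℝ}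
    (hk : ContDiff ℝ 1 k) (hki : Integrable k)
    (hC : ∀ z, ‖fderiv ℝ k z‖ ≤ C * polyDecay (d + 1) z)
    (hf : Measurable f) (hM : ∀ y, |f y| ≤ M) (x : Rd d) :
    HasFDerivAt (kernelConv k f) (∫ y, f y • fderiv ℝ k (x - y)) x := by
  have hC0 : 0 ≤ C := by
    have := (norm_nonneg _).trans (hC 0)
    exact nonneg_of_mul_nonneg_left this (polyDecay_pos _ _)
  have hM0 : 0 ≤ M := (abs_nonneg _).trans (hM 0)
  have hc : Continuous (fderiv ℝ k) := hk.continuous_fderiv (by simp)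
  unfold kernelConv
  -- The base point stays within distance 1 of x, which costs the factor 2^(d+1) in
  -- `polyDecay_translate`.
  refine hasFDerivAt_integral_of_dominated_of_fderiv_le (F := fun x y => k (x - y) * f y)
    (F' := fun x y => f y • fderiv ℝ k (x - y)) (s := Metric.ball x 1)
    (bound := fun y => M * (C * (2 ^ (d + 1) * polyDecay (d + 1) (x - y))))
    (Metric.ball_mem_nhds x one_pos) ?_ ?_ ?_ ?_ ?_ ?_
  · exact Eventually.of_forall fun s =>
      ((hk.continuous.measurable.comp (by fun_prop)).mul hf).aestronglyMeasurable
  · exact integrable_kernelConv hki hf hM x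
  · exact hf.aestronglyMeasurable.smul (hc.comp (by fun_prop)).aestronglyMeasurable
  · refine Eventually.of_forall fun y s hs => ?_
    rw [norm_smul]
    refine mul_le_mul (hM y) ?_ (norm_nonneg _) hM0
    refine (hC _).trans (mul_le_mul_of_nonneg_left ?_ hC0)
    have h1 := polyDecay_translate (d + 1) (x - y) (s - x)
    rw [show x - y + (s - x) = s - y by abel] at h1
    refine h1.trans (mul_le_mul_of_nonneg_right ?_ (polyDecay_pos _ _).le)
    refine pow_le_pow_left₀ (by positivity) ?_ _
    have : ‖s - x‖ < 1 := by simpa [dist_eq_norm] using hs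
    linarith
  · exact ((((integrable_polyDecay (Nat.lt_succ_self d)).comp_sub_left x).const_mul _).const_mul
      C).const_mul M
  · refine Eventually.of_forall fun y s hs => ?_
    have h1 : HasFDerivAt k (fderiv ℝ k (s - y)) (s - y) :=
      (hk.differentiable (by simp)).differentiableAt.hasFDerivAt
    have h2 : HasFDerivAt (fun s : Rd d => k (s - y)) (fderiv ℝ k (s - y)) s := by
      have h3 := h1.comp s ((hasFDerivAt_id s).sub_const y)
      rw [ContinuousLinearMap.comp_id] at h3
      exact h3
    exact h2.mul_const' (f y) |>.congr_fderiv (by ext; simp)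

lemma fderiv_kernelConv_apply {d : ℕ} {k : Rd d → ℝ} {f : Rd d → ℝ} {C M : ℝ}
    (hk : ContDiff ℝ 1 k) (hki : Integrable k)
    (hC : ∀ z, ‖fderiv ℝ k z‖ ≤ C * polyDecay (d + 1) z)
    (hf : Measurable f) (hM : ∀ y, |f y| ≤ M) (x e : Rd d) :
    fderiv ℝ (kernelConv k f) x e = kernelConv (fun z => fderiv ℝ k z e) f x := by
  rw [(hasFDerivAt_kernelConv hk hki hC hf hM x).fderiv]
  have hc : Continuous (fderiv ℝ k) := hk.continuous_fderiv (by simp)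
  have hi : Integrable (fun y => f y • fderiv ℝ k (x - y)) := by
    have h1 : Integrable (fderiv ℝ k) :=
      ((integrable_polyDecay (Nat.lt_succ_self d)).const_mul C).mono' hc.aestronglyMeasurable
        (Eventually.of_forall hC)
    exact (h1.comp_sub_left x).bdd_smul M hf.aestronglyMeasurable
      (Eventually.of_forall hM)
  rw [ContinuousLinearMap.integral_apply hi]
  simp [kernelConv, mul_comm]

/-! ### The divergence theorem and integral inequalities -/

lemma sum_apply_single_mul {d : ℕ} (L : Rd d →L[ℝ] ℝ) (w : Rd d) :
    ∑ i, L (EuclideanSpace.single i 1) * w i = L w := by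
  have h : w = ∑ i, w i • (EuclideanSpace.single i (1 : ℝ)) := by
    ext j; simp [Finset.sum_apply, Pi.single_apply]
  conv_rhs => rw [h]
  simp [map_sum, mul_comm]

/-- A cutoff sequence: equal to `1` eventually at each point, with small gradient. -/
lemma exists_cutoff (d : ℕ) : ∃ (ρ : ℕ → Rd d → ℝ) (C : ℝ), 0 ≤ C ∧ (∀ n, ContDiff ℝ ∞ (ρ n)) ∧
    (∀ n, HasCompactSupport (ρ n)) ∧ (∀ n x, |ρ n x| ≤ 1) ∧
    (∀ n x, ‖fderiv ℝ (ρ n) x‖ ≤ C / (n + 1)) ∧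
    (∀ x, ∀ᶠ n in atTop, ρ n x = 1) := by
  let b : ContDiffBump (0 : Rd d) := ⟨1, 2, one_pos, one_lt_two⟩
  have hb : ContDiff ℝ ∞ b := b.contDiff
  obtain ⟨C, hC⟩ := (b.hasCompactSupport.fderiv ℝ).exists_bound_of_continuous
    (hb.continuous_fderiv (by simp))
  have hpos : ∀ n : ℕ, (0 : ℝ) < (n : ℝ) + 1 := fun n => by positivity
  refine ⟨fun n x => b (((n : ℝ) + 1)⁻¹ • x), C, (norm_nonneg _).trans (hC 0), ?_, ?_, ?_, ?_, ?_⟩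
  · intro n; exact hb.comp (contDiff_const_smul _)
  · intro n
    exact b.hasCompactSupport.comp_smul (inv_ne_zero (hpos n).ne')
  · intro n x
    rw [abs_of_nonneg b.nonneg]; exact b.le_one
  · intro n x
    rw [fderiv_comp_smul, norm_smul, div_eq_inv_mul]
    refine mul_le_mul ?_ (hC _) (norm_nonneg _) (inv_nonneg.2 (hpos n).le)
    rw [norm_inv, Real.norm_of_nonneg (hpos n).le]
  · intro x
    obtain ⟨N, hN⟩ := exists_nat_ge ‖x‖
    filter_upwards [eventually_ge_atTop N] with n hn
    refine b.one_of_mem_closedBall ?_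
    simp only [Metric.mem_closedBall, dist_zero_right]
    rw [norm_smul, norm_inv, Real.norm_of_nonneg (hpos n).le, inv_mul_le_iff₀ (hpos n)]
    have : (N : ℝ) ≤ n := by exact_mod_cast hn
    change ‖x‖ ≤ _ * (1 : ℝ)
    linarith

/-- The divergence theorem on the whole space. -/
theorem integral_divergence_eq_zero {d : ℕ} {X : Rd d → Rd d} (hX : ContDiff ℝ 1 X)
    (hi : Integrable X) (hdiv : Integrable (divergence X)) : ∫ x, divergence X x = 0 := by
  obtain ⟨ρ, C, hC0, hρ, hρc, hρ1, hρd, hρe⟩ := exists_cutoff d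
  have hXi : ∀ i, ContDiff ℝ 1 (fun x => X x i) := fun i =>
    (EuclideanSpace.proj (𝕜 := ℝ) i).contDiff.comp hX
  have hfd : ∀ i x e, fderiv ℝ (fun x => X x i) x e = (fderiv ℝ X x e) i := by
    intro i x e
    have h := ((EuclideanSpace.proj (𝕜 := ℝ) i).hasFDerivAt (x := X x)).comp x
      (hX.differentiable (by simp) x).hasFDerivAt
    have h2 : HasFDerivAt (fun x => X x i) _ x := h
    rw [h2.fderiv]; rfl
  have key : ∀ n, ∫ x, ρ n x * divergence X x = - ∫ x, fderiv ℝ (ρ n) x (X x) := by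
    intro n
    have hρ1 : ContDiff ℝ 1 (ρ n) := (hρ n).of_le (by simp)
    have hcρ : Continuous (fderiv ℝ (ρ n)) := hρ1.continuous_fderiv (by simp)
    have hcX : ∀ i, Continuous (fderiv ℝ fun x => X x i) := fun i =>
      (hXi i).continuous_fderiv (by simp)
    have i1 : ∀ i, Integrable
        (fun x => ρ n x * fderiv ℝ (fun x => X x i) x (EuclideanSpace.single i 1)) := fun i =>
      (((hρ n).continuous.mul ((hcX i).clm_apply continuous_const))).integrable_of_hasCompactSupport
        ((hρc n).mul_right)
    have i2 : ∀ i, Integrable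
        (fun x => fderiv ℝ (ρ n) x (EuclideanSpace.single i 1) * X x i) := fun i =>
      ((hcρ.clm_apply continuous_const).mul (hXi i).continuous).integrable_of_hasCompactSupport
        (((hρc n).fderiv_apply ℝ _).mul_right)
    have i3 : ∀ i, Integrable (fun x => ρ n x * X x i) := fun i =>
      ((hρ n).continuous.mul (hXi i).continuous).integrable_of_hasCompactSupport
        ((hρc n).mul_right)
    calc ∫ x, ρ n x * divergence X x
        = ∫ x, ∑ i, ρ n x * fderiv ℝ (fun x => X x i) x (EuclideanSpace.single i 1) := by
          simp only [divergence, Finset.mul_sum, hfd]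
      _ = ∑ i, ∫ x, ρ n x * fderiv ℝ (fun x => X x i) x (EuclideanSpace.single i 1) :=
          integral_finsetSum _ fun i _ => i1 i
      _ = ∑ i, - ∫ x, fderiv ℝ (ρ n) x (EuclideanSpace.single i 1) * X x i := by
          refine Finset.sum_congr rfl fun i _ => ?_
          exact integral_mul_fderiv_eq_neg_fderiv_mul_of_integrable (i2 i) (i1 i) (i3 i)
            (fun x _ => hρ1.differentiable (by simp) x)
            (fun x _ => (hXi i).differentiable (by simp) x)
      _ = - ∫ x, fderiv ℝ (ρ n) x (X x) := by
          rw [Finset.sum_neg_distrib, ← integral_finsetSum _ fun i _ => i2 i]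
          simp only [sum_apply_single_mul]
  have t1 : Tendsto (fun n => ∫ x, ρ n x * divergence X x) atTop (𝓝 (∫ x, divergence X x)) := by
    refine tendsto_integral_of_dominated_convergence (fun x => |divergence X x|) ?_ hdiv.abs ?_ ?_
    · exact fun n => (hρ n).continuous.aestronglyMeasurable.mul hdiv.aestronglyMeasurable
    · intro n
      refine Eventually.of_forall fun x => ?_
      rw [Real.norm_eq_abs, abs_mul]
      exact mul_le_of_le_one_left (abs_nonneg _) (hρ1 n x)
    · refine Eventually.of_forall fun x => ?_
      refine tendsto_const_nhds.congr' ?_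
      filter_upwards [hρe x] with n hn
      simp [hn]
  -- The boundary term is at most C/(n+1) times the L¹ norm of X, so integrability of X is enough;
  -- no decay rate is needed.
  have t2 : Tendsto (fun n => ∫ x, ρ n x * divergence X x) atTop (𝓝 0) := by
    have hlim : Tendsto (fun n : ℕ => C * (∫ x, ‖X x‖) * (1 / ((n : ℝ) + 1))) atTop (𝓝 0) := by
      simpa using tendsto_one_div_add_atTop_nhds_zero_nat.const_mul (C * ∫ x, ‖X x‖)
    refine squeeze_zero_norm (fun n => ?_) hlim
    rw [key n, norm_neg]
    refine (norm_integral_le_integral_norm _).trans ?_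
    rw [show C * (∫ x, ‖X x‖) * (1 / ((n : ℝ) + 1)) = ∫ x, C / (n + 1) * ‖X x‖ by
      rw [integral_const_mul]; ring]
    refine integral_mono_of_nonneg (Eventually.of_forall fun x => norm_nonneg _)
      (hi.norm.const_mul _) (Eventually.of_forall fun x => ?_)
    exact (ContinuousLinearMap.le_opNorm _ _).trans
      (mul_le_mul_of_nonneg_right (hρd n x) (norm_nonneg _))
  exact tendsto_nhds_unique t1 t2

/-- The divergence of a scalar function times a vector field. -/
lemma divergence_smul {d : ℕ} {f : Rd d → ℝ} {X : Rd d → Rd d} {x : Rd d}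
    (hf : DifferentiableAt ℝ f x) (hX : DifferentiableAt ℝ X x) :
    divergence (fun y => f y • X y) x = f x * divergence X x + fderiv ℝ f x (X x) := by
  unfold divergence
  rw [show fderiv ℝ (fun y => f y • X y) x = _ from
    (hf.hasFDerivAt.smul hX.hasFDerivAt).fderiv, ← sum_apply_single_mul (fderiv ℝ f x) (X x),
    Finset.mul_sum, ← Finset.sum_add_distrib]
  exact Finset.sum_congr rfl fun i _ => by simp

/-- The integral of a line derivative vanishes. -/
lemma integral_lineDeriv_eq_zero {d : ℕ} {F F' : Rd d → ℝ} {e : Rd d} (hF : Integrable F)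
    (hF' : Integrable F') (h : ∀ x, HasLineDerivAt ℝ F (F' x) x e) : ∫ x, F' x = 0 := by
  -- Integration by parts against the constant function 1.
  have := integral_bilinear_hasLineDerivAt_right_eq_neg_left_of_integrable (μ := volume)
    (f := fun _ : Rd d => (1 : ℝ)) (f' := fun _ => 0) (g := F) (g' := F') (v := e)
    (B := ContinuousLinearMap.mul ℝ ℝ) (by simp) (by simpa using hF') (by simpa using hF)
    (fun x _ => hasDerivAt_const _ _) (fun x _ => h x)
  simpa using this

/-! ### Jensen and Minkowski inequalities for lower integrals -/

section Inequalities
variable {α β : Type*} [MeasurableSpace α] [MeasurableSpace β] {μ : Measure α} {κ : Measure β}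

/-- Jensen's inequality with a weight of arbitrary mass. -/
lemma rpow_lintegral_mul_le {p : ℝ} (hp : 1 ≤ p) {a b : α → ℝ≥0∞} (ha : Measurable a)
    (hb : Measurable b) :
    (∫⁻ x, a x * b x ∂μ) ^ p ≤ (∫⁻ x, a x ∂μ) ^ (p - 1) * ∫⁻ x, a x * b x ^ p ∂μ := by
  rcases hp.eq_or_lt with rfl | hp
  · simp
  have hpq := Real.HolderConjugate.conjExponent hp
  set q := Real.conjExponent p
  have hp0 : 0 < p := hpq.pos
  have hq0 : 0 < q := hpq.symm.pos
  -- Hölder after splitting the weight as a = a^(1/q) a^(1/p), so that b is measured against a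
  -- itself.
  have h := ENNReal.lintegral_mul_le_Lp_mul_Lq μ hpq.symm (f := fun x => a x ^ (1 / q))
    (g := fun x => a x ^ (1 / p) * b x) (by fun_prop) (by fun_prop)
  have e1 : ∀ x, ((fun x => a x ^ (1 / q)) * fun x => a x ^ (1 / p) * b x) x = a x * b x := by
    intro x
    simp only [Pi.mul_apply]
    rw [← mul_assoc, ← ENNReal.rpow_add_of_nonneg _ _ (by positivity) (by positivity)]
    have : 1 / q + 1 / p = 1 := by
      have := hpq.inv_add_inv_eq_one
      simp only [one_div]; linarith
    rw [this, ENNReal.rpow_one]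
  have e2 : ∀ x, (a x ^ (1 / q)) ^ q = a x := by
    intro x; rw [← ENNReal.rpow_mul, one_div_mul_cancel hq0.ne', ENNReal.rpow_one]
  have e3 : ∀ x, (a x ^ (1 / p) * b x) ^ p = a x * b x ^ p := by
    intro x
    rw [ENNReal.mul_rpow_of_nonneg _ _ hp0.le, ← ENNReal.rpow_mul, one_div_mul_cancel hp0.ne',
      ENNReal.rpow_one]
  simp only [e1, e2, e3] at h
  calc (∫⁻ x, a x * b x ∂μ) ^ p
      ≤ ((∫⁻ x, a x ∂μ) ^ (1 / q) * (∫⁻ x, a x * b x ^ p ∂μ) ^ (1 / p)) ^ p :=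
        ENNReal.rpow_le_rpow h hp0.le
    _ = _ := by
        rw [ENNReal.mul_rpow_of_nonneg _ _ hp0.le, ← ENNReal.rpow_mul, ← ENNReal.rpow_mul,
          one_div_mul_cancel hp0.ne', ENNReal.rpow_one]
        congr 2
        rw [one_div, inv_mul_eq_div, hpq.div_conj_eq_sub_one]

/-- Minkowski's integral inequality for a uniformly bounded family. -/
lemma lintegral_rpow_lintegral_mul_le [SFinite μ] [SFinite κ] {p : ℝ} (hp : 1 ≤ p) {a : β → ℝ≥0∞}
    {F : α → β → ℝ≥0∞} (ha : Measurable a) (hF : Measurable (Function.uncurry F)) {M : ℝ≥0∞}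
    (hM : ∀ z, ∫⁻ x, F x z ^ p ∂μ ≤ M) :
    ∫⁻ x, (∫⁻ z, a z * F x z ∂κ) ^ p ∂μ ≤ (∫⁻ z, a z ∂κ) ^ p * M := by
  set A := ∫⁻ z, a z ∂κ
  have hF1 : ∀ x, Measurable (F x) := fun x => hF.of_uncurry_left
  have hm : Measurable (fun y : α × β => a y.2 * F y.1 y.2 ^ p) :=
    (ha.comp measurable_snd).mul (hF.pow_const p)
  -- Jensen in z for the weight a, then Tonelli, so that the hypothesis is used for each fixed z.
  calc ∫⁻ x, (∫⁻ z, a z * F x z ∂κ) ^ p ∂μ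
      ≤ ∫⁻ x, A ^ (p - 1) * ∫⁻ z, a z * F x z ^ p ∂κ ∂μ :=
        lintegral_mono fun x => rpow_lintegral_mul_le hp ha (hF1 x)
    _ = A ^ (p - 1) * ∫⁻ x, ∫⁻ z, a z * F x z ^ p ∂κ ∂μ :=
        lintegral_const_mul _ hm.lintegral_prod_right'
    _ = A ^ (p - 1) * ∫⁻ z, ∫⁻ x, a z * F x z ^ p ∂μ ∂κ := by
        rw [lintegral_lintegral_swap hm.aemeasurable]
    _ = A ^ (p - 1) * ∫⁻ z, a z * ∫⁻ x, F x z ^ p ∂μ ∂κ := by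
        congr 1
        refine lintegral_congr fun z => lintegral_const_mul _ ?_
        exact (hF.of_uncurry_right).pow_const p
    _ ≤ A ^ (p - 1) * ∫⁻ z, a z * M ∂κ := by
        gcongr with z; exact hM z
    _ = A ^ p * M := by
        rw [lintegral_mul_const _ ha, ← mul_assoc]
        congr 1
        change A ^ (p - 1) * A = A ^ p
        calc A ^ (p - 1) * A = A ^ (p - 1) * A ^ (1 : ℝ) := by rw [ENNReal.rpow_one]
          _ = A ^ p := by
            rw [← ENNReal.rpow_add_of_nonneg _ _ (by linarith) zero_le_one, sub_add_cancel]

end Inequalities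

/-- Young's inequality. -/
lemma lintegral_rpow_kernelConv_le {d : ℕ} {k f : Rd d → ℝ} {p : ℝ} (hp : 1 ≤ p)
    (hk : Measurable k) (hf : Measurable f) :
    ∫⁻ x, ‖kernelConv k f x‖ₑ ^ p ≤ (∫⁻ z, ‖k z‖ₑ) ^ p * ∫⁻ x, ‖f x‖ₑ ^ p := by
  refine le_trans (lintegral_mono fun x => ?_)
    (lintegral_rpow_lintegral_mul_le (κ := volume) (F := fun x z => ‖f (x - z)‖ₑ) hp hk.enorm ?_
      (M := ∫⁻ x, ‖f x‖ₑ ^ p) fun z => ?_)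
  · refine ENNReal.rpow_le_rpow ?_ (by linarith)
    rw [kernelConv_eq]
    refine (enorm_integral_le_lintegral_enorm _).trans_eq ?_
    simp [enorm_mul]
  · exact (hf.comp (measurable_fst.sub measurable_snd)).enorm
  · exact (lintegral_sub_right_eq_self (fun x => ‖f x‖ₑ ^ p) z).le

/-! ### The heat kernel -/

/-- The heat kernel on `ℝ^d`. -/
def heatKernel {d : ℕ} (s : ℝ) (z : Rd d) : ℝ :=
  (4 * Real.pi * s) ^ (-(d : ℝ) / 2) * Real.exp (-(‖z‖ ^ 2 / (4 * s)))

/-- The first partial derivatives of the heat kernel. -/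
def heatKernelD {d : ℕ} (i : Fin d) (s : ℝ) (z : Rd d) : ℝ :=
  -(z i / (2 * s)) * heatKernel s z

/-- The Kronecker symbol. -/
def kron {d : ℕ} (i j : Fin d) : ℝ := if i = j then 1 else 0

/-- The second partial derivatives of the heat kernel. -/
def heatKernelDD {d : ℕ} (i j : Fin d) (s : ℝ) (z : Rd d) : ℝ :=
  (z i * z j / (4 * s ^ 2) - kron i j / (2 * s)) * heatKernel s z

/-- The third partial derivatives of the heat kernel. -/
def heatKernelDDD {d : ℕ} (i j k : Fin d) (s : ℝ) (z : Rd d) : ℝ :=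
  (-(z i * z j * z k / (8 * s ^ 3)) +
    (kron i j * z k + kron i k * z j + kron j k * z i) / (4 * s ^ 2)) * heatKernel s z

lemma heatKernel_pos {d : ℕ} {s : ℝ} (hs : 0 < s) (z : Rd d) : 0 < heatKernel s z := by
  unfold heatKernel; positivity

lemma heatKernel_neg {d : ℕ} (s : ℝ) (z : Rd d) : heatKernel s (-z) = heatKernel s z := by
  simp [heatKernel]

lemma integral_heatKernel {d : ℕ} {s : ℝ} (hs : 0 < s) :
    ∫ z : Rd d, heatKernel s z = 1 := by
  have h := GaussianFourier.integral_rexp_neg_mul_sq_norm (V := Rd d) (b := 1 / (4 * s))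
    (by positivity)
  have e : ∀ z : Rd d, -(‖z‖ ^ 2 / (4 * s)) = -(1 / (4 * s)) * ‖z‖ ^ 2 := fun z => by ring
  simp only [heatKernel, e]
  rw [integral_const_mul, h, show Real.pi / (1 / (4 * s)) = 4 * Real.pi * s by field_simp,
    ← Real.rpow_add (by positivity)]
  simp [neg_div]

lemma hasLineDerivAt_coord {d : ℕ} (i j : Fin d) (z : Rd d) :
    HasLineDerivAt ℝ (fun z : Rd d => z j) (kron i j) z (EuclideanSpace.single i (1 : ℝ)) := by
  have h := ((EuclideanSpace.proj (𝕜 := ℝ) j).hasFDerivAt (x := z)).hasLineDerivAt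
    (EuclideanSpace.single i (1 : ℝ))
  have e : (EuclideanSpace.proj (𝕜 := ℝ) j) (EuclideanSpace.single i (1 : ℝ)) = kron i j := by
    simp [kron, eq_comm]
  rw [e] at h
  exact h

lemma hasLineDerivAt_heatKernel {d : ℕ} {s : ℝ} (i : Fin d) (z : Rd d) :
    HasLineDerivAt ℝ (heatKernel s) (heatKernelD i s z) z (EuclideanSpace.single i (1 : ℝ)) := by
  have h0 : HasFDerivAt (fun z : Rd d => ‖z‖ ^ 2) _ z := (hasStrictFDerivAt_norm_sq z).hasFDerivAt
  have h1 := h0.hasLineDerivAt (EuclideanSpace.single i (1 : ℝ))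
  have e : (2 • (innerSL ℝ) z) (EuclideanSpace.single i (1 : ℝ)) = 2 * z i := by
    simp [EuclideanSpace.inner_single_right]
  rw [e] at h1
  unfold HasLineDerivAt at h1 ⊢
  have h2 := ((h1.div_const (4 * s)).neg.exp).const_mul ((4 * Real.pi * s) ^ (-(d : ℝ) / 2))
  refine h2.congr_deriv ?_
  simp only [heatKernelD, heatKernel, Pi.neg_apply, zero_smul, add_zero]
  ring

lemma hasLineDerivAt_heatKernelD {d : ℕ} {s : ℝ} (i j : Fin d) (z : Rd d) :
    HasLineDerivAt ℝ (heatKernelD j s) (heatKernelDD i j s z) z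
      (EuclideanSpace.single i (1 : ℝ)) := by
  have h1 := hasLineDerivAt_heatKernel (s := s) i z
  have h2 := hasLineDerivAt_coord i j z
  unfold HasLineDerivAt at h1 h2 ⊢
  refine (((h2.div_const (2 * s)).neg.mul h1)).congr_deriv ?_
  simp only [heatKernelD, heatKernelDD, zero_smul, add_zero, Pi.neg_apply]
  -- At s = 0 every quotient is 0 by convention and both sides vanish, so no sign of s is required.
  rcases eq_or_ne s 0 with rfl | hs
  · simp
  field_simp; ring

lemma hasLineDerivAt_heatKernelDD {d : ℕ} {s : ℝ} (i j k : Fin d) (z : Rd d) :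
    HasLineDerivAt ℝ (heatKernelDD j k s) (heatKernelDDD i j k s z) z
      (EuclideanSpace.single i (1 : ℝ)) := by
  have h1 := hasLineDerivAt_heatKernel (s := s) i z
  have h2 := hasLineDerivAt_coord i j z
  have h3 := hasLineDerivAt_coord i k z
  unfold HasLineDerivAt at h1 h2 h3 ⊢
  refine ((((h2.mul h3).div_const (4 * s ^ 2)).sub_const (kron j k / (2 * s))).mul h1).congr_deriv ?_
  simp only [heatKernelD, heatKernelDDD, zero_smul, add_zero, Pi.mul_apply]
  rcases eq_or_ne s 0 with rfl | hs
  · simp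
  field_simp; ring

lemma sum_sq_eq_norm_sq {d : ℕ} (z : Rd d) : ∑ i, z i * z i = ‖z‖ ^ 2 := by
  rw [EuclideanSpace.norm_sq_eq]; simp [sq]

lemma hasDerivAt_heatKernel {d : ℕ} {s : ℝ} (hs : 0 < s) (z : Rd d) :
    HasDerivAt (fun s => heatKernel s z) (∑ i, heatKernelDD i i s z) s := by
  have h0 : (4 * Real.pi * s) ≠ 0 := by positivity
  have h1 : HasDerivAt (fun s : ℝ => 4 * Real.pi * s) (4 * Real.pi) s := by
    simpa using (hasDerivAt_id s).const_mul (4 * Real.pi)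
  have h2 : HasDerivAt (fun s : ℝ => 4 * s) 4 s := by
    simpa using (hasDerivAt_id s).const_mul (4 : ℝ)
  have h3 := h1.rpow_const (p := -(d : ℝ) / 2) (Or.inl h0)
  have h4 := (((hasDerivAt_const s (‖z‖ ^ 2)).div h2 (by positivity)).neg).exp
  refine (h3.mul h4).congr_deriv ?_
  have e : ∑ i, heatKernelDD i i s z
      = (‖z‖ ^ 2 / (4 * s ^ 2) - d / (2 * s)) * heatKernel s z := by
    simp only [heatKernelDD]
    rw [← Finset.sum_mul, Finset.sum_sub_distrib, ← Finset.sum_div, sum_sq_eq_norm_sq]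
    simp [kron, div_eq_mul_inv]
  rw [e, Real.rpow_sub_one h0]
  simp only [heatKernel, Pi.neg_apply, Pi.div_apply]
  field_simp
  ring

/-- The heat equation differentiated in x_k. It turns the time derivative of the gradient of a heat
flow into third space derivatives, where the divergence structure of a velocity field can be used.
-/
lemma hasDerivAt_heatKernelD {d : ℕ} {s : ℝ} (hs : 0 < s) (k : Fin d) (z : Rd d) :
    HasDerivAt (fun s => heatKernelD k s z) (∑ i, heatKernelDDD i i k s z) s := by
  have h2 : HasDerivAt (fun s : ℝ => 2 * s) 2 s := by
    simpa using (hasDerivAt_id s).const_mul (2 : ℝ)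
  have h3 := (((hasDerivAt_const s (z k)).div h2 (by positivity)).neg).mul (hasDerivAt_heatKernel hs z)
  refine h3.congr_deriv ?_
  have e : ∑ i, heatKernelDD i i s z
      = (‖z‖ ^ 2 / (4 * s ^ 2) - d / (2 * s)) * heatKernel s z := by
    simp only [heatKernelDD]
    rw [← Finset.sum_mul, Finset.sum_sub_distrib, ← Finset.sum_div, sum_sq_eq_norm_sq]
    simp [kron, div_eq_mul_inv]
  have e2 : ∑ i, heatKernelDDD i i k s z
      = (-(‖z‖ ^ 2 * z k / (8 * s ^ 3)) + (d * z k + z k + z k) / (4 * s ^ 2)) *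
        heatKernel s z := by
    simp only [heatKernelDDD]
    rw [← Finset.sum_mul, Finset.sum_add_distrib, Finset.sum_neg_distrib, ← Finset.sum_div,
      ← Finset.sum_div, ← Finset.sum_mul, sum_sq_eq_norm_sq, Finset.sum_add_distrib,
      Finset.sum_add_distrib]
    simp [kron]
  rw [e, e2]
  simp only [Pi.neg_apply, Pi.div_apply]
  field_simp
  ring

/-- Kernels depending on a positive time that are rapidly decreasing, locally uniformly in time. -/
structure IsRapidKernel {d : ℕ} (k : ℝ → Rd d → ℝ) : Prop where
  cont : ContinuousOn (fun p : ℝ × Rd d => k p.1 p.2) (Ioi 0 ×ˢ univ)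
  decay : ∀ (a b : ℝ) (N : ℕ), 0 < a → ∃ C, ∀ s ∈ Icc a b, ∀ z, |k s z| ≤ C * polyDecay N z

namespace IsRapidKernel
variable {d : ℕ} {k k' : ℝ → Rd d → ℝ}

lemma continuous (h : IsRapidKernel k) {s : ℝ} (hs : 0 < s) : Continuous (k s) := by
  rw [← continuousOn_univ]
  exact h.cont.comp (f := fun z => (s, z)) (by fun_prop) fun z _ => ⟨hs, mem_univ _⟩

lemma continuousOn_time (h : IsRapidKernel k) (z : Rd d) :
    ContinuousOn (fun s => k s z) (Ioi 0) :=
  h.cont.comp (f := fun s => (s, z)) (by fun_prop) fun s hs => ⟨hs, mem_univ _⟩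

lemma integrable (h : IsRapidKernel k) {s : ℝ} (hs : 0 < s) : Integrable (k s) := by
  obtain ⟨C, hC⟩ := h.decay s s (d + 1) hs
  exact ((integrable_polyDecay (Nat.lt_succ_self d)).const_mul C).mono'
    (h.continuous hs).aestronglyMeasurable
    (Eventually.of_forall fun z => hC s ⟨le_rfl, le_rfl⟩ z)

lemma add (h : IsRapidKernel k) (h' : IsRapidKernel k') :
    IsRapidKernel (fun s z => k s z + k' s z) where
  cont := h.cont.add h'.cont
  decay a b N ha := by
    obtain ⟨C, hC⟩ := h.decay a b N ha
    obtain ⟨C', hC'⟩ := h'.decay a b N ha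
    refine ⟨C + C', fun s hs z => (abs_add_le _ _).trans ?_⟩
    rw [add_mul]; exact add_le_add (hC s hs z) (hC' s hs z)

lemma sum {ι : Type*} (t : Finset ι) {k : ι → ℝ → Rd d → ℝ} (h : ∀ i ∈ t, IsRapidKernel (k i)) :
    IsRapidKernel (fun s z => ∑ i ∈ t, k i s z) := by
  classical
  induction t using Finset.induction_on with
  | empty =>
    exact ⟨by simpa using continuousOn_const, fun a b N ha => ⟨0, fun s hs z => by simp⟩⟩
  | insert i t hi ih =>
    simp only [Finset.sum_insert hi]
    exact (h i (by simp)).add (ih fun j hj => h j (by simp [hj]))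

lemma time_mul {c : ℝ → ℝ} (hc : ContinuousOn c (Ioi 0)) (h : IsRapidKernel k) :
    IsRapidKernel (fun s z => c s * k s z) where
  cont := (hc.comp (f := fun p : ℝ × Rd d => p.1) (by fun_prop) fun p hp => hp.1).mul h.cont
  decay a b N ha := by
    obtain ⟨C, hC⟩ := h.decay a b N ha
    obtain ⟨M, hM⟩ := isCompact_Icc.exists_bound_of_continuousOn
      (hc.mono fun s (hs : s ∈ Icc a b) => ha.trans_le hs.1)
    refine ⟨M * C, fun s hs z => ?_⟩
    rw [abs_mul, mul_assoc]
    exact mul_le_mul (hM s hs) (hC s hs z) (abs_nonneg _) ((norm_nonneg _).trans (hM s hs))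

/-- One extra order of decay pays for |z_i| ≤ 1+|z|; the order is arbitrary, so the class is closed
under polynomial factors. -/
lemma coord_mul (i : Fin d) (h : IsRapidKernel k) : IsRapidKernel (fun s z => z i * k s z) where
  cont := (Continuous.continuousOn (by fun_prop)).mul h.cont
  decay a b N ha := by
    obtain ⟨C, hC⟩ := h.decay a b (N + 1) ha
    refine ⟨C, fun s hs z => ?_⟩
    rw [abs_mul]
    have h1 : |z i| ≤ 1 + ‖z‖ := (PiLp.norm_apply_le z i).trans (by simp)
    calc |z i| * |k s z| ≤ (1 + ‖z‖) * (C * polyDecay (N + 1) z) :=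
          mul_le_mul h1 (hC s hs z) (abs_nonneg _) (by positivity)
      _ = C * polyDecay N z := by
          rw [polyDecay_add]
          have := one_add_norm_pow_mul_polyDecay (N := 1) z
          rw [pow_one] at this
          linear_combination (C * polyDecay N z) * this

lemma congr (h : IsRapidKernel k) (e : ∀ s, 0 < s → ∀ z, k' s z = k s z) : IsRapidKernel k' where
  cont := h.cont.congr fun p hp => e _ hp.1 _
  decay a b N ha := by
    obtain ⟨C, hC⟩ := h.decay a b N ha
    exact ⟨C, fun s hs z => by rw [e s (ha.trans_le hs.1)]; exact hC s hs z⟩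

end IsRapidKernel

lemma isRapidKernel_heatKernel (d : ℕ) : IsRapidKernel (heatKernel (d := d)) where
  cont := by
    unfold heatKernel
    refine ContinuousOn.mul ?_ ?_
    · refine ContinuousOn.rpow_const (Continuous.continuousOn (by fun_prop)) fun p hp => Or.inl ?_
      have : 0 < p.1 := hp.1
      positivity
    · refine Real.continuous_exp.comp_continuousOn (ContinuousOn.neg ?_)
      refine ContinuousOn.div (Continuous.continuousOn (by fun_prop))
        (Continuous.continuousOn (by fun_prop)) fun p hp => ?_
      have : 0 < p.1 := hp.1
      positivity
  decay a b N ha := by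
    refine ⟨(4 * Real.pi * a) ^ (-(d : ℝ) / 2) * Real.exp (N ^ 2 * b), fun s hs z => ?_⟩
    have hs0 : 0 < s := ha.trans_le hs.1
    rw [abs_of_pos (heatKernel_pos hs0 z), mul_assoc]
    unfold heatKernel
    refine mul_le_mul ?_ ?_ (by positivity) (by positivity)
    · refine Real.rpow_le_rpow_of_nonpos (by positivity) ?_ ?_
      · have := hs.1; gcongr
      · have : (0 : ℝ) ≤ d := by positivity
        linarith
    · unfold polyDecay
      rw [← div_eq_mul_inv, le_div_iff₀ (by positivity)]
      have h1 : (1 + ‖z‖) ^ N ≤ Real.exp (N * ‖z‖) := by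
        rw [Real.exp_nat_mul]
        refine pow_le_pow_left₀ (by positivity) ?_ _
        linarith [Real.add_one_le_exp ‖z‖]
      calc _ ≤ Real.exp (-(‖z‖ ^ 2 / (4 * s))) * Real.exp (N * ‖z‖) := by gcongr
        _ = Real.exp (-(‖z‖ ^ 2 / (4 * s)) + N * ‖z‖) := (Real.exp_add _ _).symm
        _ ≤ Real.exp (N ^ 2 * b) := by
          refine Real.exp_le_exp.2 ?_
          -- Completing the square: the Gaussian absorbs e^(N|z|), which dominates (1+|z|)^N, at the
          -- price of e^(N²s).
          have h3 : -(‖z‖ ^ 2 / (4 * s)) + N * ‖z‖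
              = N ^ 2 * s - (‖z‖ - 2 * s * N) ^ 2 / (4 * s) := by field_simp; ring
          rw [h3]
          have h4 : (N : ℝ) ^ 2 * s ≤ N ^ 2 * b := by have := hs.2; gcongr
          have h5 : 0 ≤ (‖z‖ - 2 * s * N) ^ 2 / (4 * s) := by positivity
          linarith

lemma continuousOn_inv_pow (c : ℝ) (n : ℕ) : ContinuousOn (fun s : ℝ => c / s ^ n) (Ioi 0) :=
  ContinuousOn.div continuousOn_const (by fun_prop) fun s hs => (pow_pos hs n).ne'

lemma isRapidKernel_heatKernelD {d : ℕ} (i : Fin d) : IsRapidKernel (heatKernelD i) := by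
  refine (((isRapidKernel_heatKernel d).coord_mul i).time_mul
    (continuousOn_inv_pow (-(1 / 2)) 1)).congr fun s hs z => ?_
  simp only [heatKernelD]; field_simp

lemma isRapidKernel_heatKernelDD {d : ℕ} (i j : Fin d) : IsRapidKernel (heatKernelDD i j) := by
  refine (((((isRapidKernel_heatKernel d).coord_mul j).coord_mul i).time_mul
    (continuousOn_inv_pow (1 / 4) 2)).add ((isRapidKernel_heatKernel d).time_mul
    (continuousOn_inv_pow (-(kron i j / 2)) 1))).congr fun s hs z => ?_
  simp only [heatKernelDD]; field_simp; ring

lemma isRapidKernel_heatKernelDDD {d : ℕ} (i j k : Fin d) :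
    IsRapidKernel (heatKernelDDD i j k) := by
  have h := isRapidKernel_heatKernel d
  refine (((((h.coord_mul k).coord_mul j).coord_mul i).time_mul
    (continuousOn_inv_pow (-(1 / 8)) 3)).add
    ((((h.coord_mul k).time_mul (continuousOn_inv_pow (kron i j / 4) 2)).add
    ((h.coord_mul j).time_mul (continuousOn_inv_pow (kron i k / 4) 2))).add
    ((h.coord_mul i).time_mul (continuousOn_inv_pow (kron j k / 4) 2)))).congr fun s hs z => ?_
  simp only [heatKernelDDD]; field_simp

/-! ### The heat flow of a bounded function -/

section Flow
variable {d : ℕ} {f : Rd d → ℝ} {M r : ℝ}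

lemma IsRapidKernel.continuousOn_kernelConv {k : ℝ → Rd d → ℝ} (h : IsRapidKernel k)
    (hf : Measurable f) (hM : ∀ y, |f y| ≤ M) :
    ContinuousOn (fun p : ℝ × Rd d => kernelConv (k p.1) f p.2) (Ioi 0 ×ˢ univ) := by
  rintro ⟨s₀, x₀⟩ ⟨hs₀, -⟩
  have hs₀ : 0 < s₀ := hs₀
  refine ContinuousAt.continuousWithinAt ?_
  obtain ⟨C, hC⟩ := h.decay (s₀ / 2) (2 * s₀) (d + 1) (by positivity)
  have hC0 : 0 ≤ C := nonneg_of_mul_nonneg_left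
    ((abs_nonneg _).trans (hC s₀ ⟨by linarith, by linarith⟩ 0)) (polyDecay_pos _ _)
  have hnhds : Ioo (s₀ / 2) (2 * s₀) ×ˢ Metric.ball x₀ 1 ∈ 𝓝 (s₀, x₀) :=
    prod_mem_nhds (Ioo_mem_nhds (by linarith) (by linarith)) (Metric.ball_mem_nhds _ one_pos)
  unfold kernelConv
  refine continuousAt_of_dominated
    (bound := fun y => C * (2 ^ (d + 1) * polyDecay (d + 1) (x₀ - y)) * M) ?_ ?_ ?_ ?_
  · filter_upwards [hnhds] with p hp
    have : 0 < p.1 := by have := hp.1.1; linarith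
    exact (((h.continuous this).measurable.comp (by fun_prop)).mul hf).aestronglyMeasurable
  · filter_upwards [hnhds] with p hp
    refine Eventually.of_forall fun y => ?_
    rw [Real.norm_eq_abs, abs_mul]
    refine mul_le_mul ?_ (hM y) (abs_nonneg _)
      (mul_nonneg hC0 (mul_nonneg (by positivity) (polyDecay_pos _ _).le))
    refine (hC p.1 ⟨hp.1.1.le, hp.1.2.le⟩ _).trans (mul_le_mul_of_nonneg_left ?_ hC0)
    have h1 := polyDecay_translate (d + 1) (x₀ - y) (p.2 - x₀)
    rw [show x₀ - y + (p.2 - x₀) = p.2 - y by abel] at h1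
    refine h1.trans (mul_le_mul_of_nonneg_right ?_ (polyDecay_pos _ _).le)
    refine pow_le_pow_left₀ (by positivity) ?_ _
    have : ‖p.2 - x₀‖ < 1 := by simpa [dist_eq_norm] using hp.2
    linarith
  · exact (((integrable_polyDecay (Nat.lt_succ_self d)).comp_sub_left x₀).const_mul _).const_mul
      C |>.mul_const M
  · refine Eventually.of_forall fun y => ?_
    refine ContinuousAt.mul ?_ continuousAt_const
    have h1 : ContinuousAt (fun p : ℝ × Rd d => k p.1 p.2) (s₀, x₀ - y) :=
      h.cont.continuousAt (prod_mem_nhds (Ioi_mem_nhds hs₀) univ_mem)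
    have h2 : ContinuousAt (fun p : ℝ × Rd d => (p.1, p.2 - y)) (s₀, x₀) := by fun_prop
    exact ContinuousAt.comp (f := fun p : ℝ × Rd d => (p.1, p.2 - y))
      (g := fun p : ℝ × Rd d => k p.1 p.2) h1 h2

lemma IsRapidKernel.hasLineDerivAt_kernelConv {k k' : ℝ → Rd d → ℝ} {e : Rd d}
    (h : IsRapidKernel k) (h' : IsRapidKernel k') {s : ℝ} (hs : 0 < s)
    (hder : ∀ z, HasLineDerivAt ℝ (k s) (k' s z) z e)
    (hf : Measurable f) (hM : ∀ y, |f y| ≤ M) (x : Rd d) :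
    HasLineDerivAt ℝ (kernelConv (k s) f) (kernelConv (k' s) f x) x e := by
  obtain ⟨C, hC⟩ := h'.decay s s (d + 1) hs
  exact _root_.hasLineDerivAt_kernelConv (h.continuous hs) (h'.continuous hs) (h.integrable hs)
    (hC s ⟨le_rfl, le_rfl⟩) hder hf hM x

lemma IsRapidKernel.hasDerivAt_kernelConv {k k' : ℝ → Rd d → ℝ}
    (h : IsRapidKernel k) (h' : IsRapidKernel k') {s : ℝ} (hs : 0 < s)
    (hder : ∀ s, 0 < s → ∀ z, HasDerivAt (fun s => k s z) (k' s z) s)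
    (hf : Measurable f) (hM : ∀ y, |f y| ≤ M) (x : Rd d) :
    HasDerivAt (fun s => kernelConv (k s) f x) (kernelConv (k' s) f x) s := by
  obtain ⟨C, hC⟩ := h'.decay (s / 2) (2 * s) (d + 1) (by positivity)
  have hpos : ∀ t ∈ Icc (s / 2) (2 * s), 0 < t := fun t ht => by have := ht.1; linarith
  exact hasDerivAt_kernelConv_param (Icc_mem_nhds (by linarith) (by linarith))
    (fun t ht => h.continuous (hpos t ht)) (fun t ht => h'.continuous (hpos t ht))
    (h.integrable hs) hC ((integrable_polyDecay (Nat.lt_succ_self d)).const_mul C)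
    (fun t ht z => hder t (hpos t ht) z) hf hM x

/-- Convolution of a rapidly decreasing kernel with a compactly supported bounded function. -/
lemma IsRapidKernel.kernelConv {k : ℝ → Rd d → ℝ} (h : IsRapidKernel k)
    (hf : Measurable f) (hM : ∀ y, |f y| ≤ M) (hr : ∀ y, r < ‖y‖ → f y = 0) :
    IsRapidKernel (fun s x => kernelConv (k s) f x) where
  cont := h.continuousOn_kernelConv hf hM
  decay a b N ha := by
    -- N orders are moved from x - y to x, which is harmless because y ranges over a bounded set;
    -- the other d+1 orders make the integral in y converge.
    obtain ⟨C, hC⟩ := h.decay a b (N + (d + 1)) ha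
    refine ⟨(∫ z : Rd d, polyDecay (d + 1) z) * (C * (1 + |r|) ^ N * M), fun s hs x => ?_⟩
    have hC0 : 0 ≤ C := nonneg_of_mul_nonneg_left
      ((abs_nonneg _).trans (hC s hs 0)) (polyDecay_pos _ _)
    have hM0 : 0 ≤ M := (abs_nonneg _).trans (hM 0)
    have hi := ((integrable_polyDecay (Nat.lt_succ_self d)).comp_sub_left x).mul_const
      (C * (1 + |r|) ^ N * M * polyDecay N x)
    rw [mul_assoc, ← integral_sub_left_eq_self (fun z : Rd d => polyDecay (d + 1) z) volume x,
      ← integral_mul_const, ← Real.norm_eq_abs]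
    refine (norm_integral_le_integral_norm _).trans ?_
    refine integral_mono_of_nonneg (Eventually.of_forall fun z => norm_nonneg _) hi
      (Eventually.of_forall fun y => ?_)
    simp only [Real.norm_eq_abs, abs_mul]
    rcases lt_or_ge r ‖y‖ with hy | hy
    · rw [hr y hy, abs_zero, mul_zero]
      have := (polyDecay_pos (d + 1) (x - y)).le
      have := (polyDecay_pos N x).le
      positivity
    · have h1 := polyDecay_translate N x (-y)
      rw [← sub_eq_add_neg, norm_neg] at h1
      have h2 : (1 + ‖y‖) ^ N ≤ (1 + |r|) ^ N :=
        pow_le_pow_left₀ (by positivity) (by linarith [le_abs_self r]) _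
      have h3 := (polyDecay_pos N x).le
      have h4 := (polyDecay_pos (d + 1) (x - y)).le
      calc |k s (x - y)| * |f y|
          ≤ (C * (polyDecay N (x - y) * polyDecay (d + 1) (x - y))) * M := by
            rw [← polyDecay_add]
            exact mul_le_mul (hC s hs _) (hM y) (abs_nonneg _)
              (mul_nonneg hC0 (polyDecay_pos _ _).le)
        _ ≤ (C * (((1 + |r|) ^ N * polyDecay N x) * polyDecay (d + 1) (x - y))) * M := by
            gcongr
            exact h1.trans (mul_le_mul_of_nonneg_right h2 h3)
        _ = _ := by ring

/-- The heat flow. -/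
def heatFlow (f : Rd d → ℝ) (s : ℝ) (x : Rd d) : ℝ := kernelConv (heatKernel s) f x

/-- First derivatives of the heat flow. -/
def heatFlowD (i : Fin d) (f : Rd d → ℝ) (s : ℝ) (x : Rd d) : ℝ := kernelConv (heatKernelD i s) f x

/-- Second derivatives of the heat flow. -/
def heatFlowDD (i j : Fin d) (f : Rd d → ℝ) (s : ℝ) (x : Rd d) : ℝ :=
  kernelConv (heatKernelDD i j s) f x

lemma hasLineDerivAt_heatFlow (hf : Measurable f) (hM : ∀ y, |f y| ≤ M) {s : ℝ} (hs : 0 < s)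
    (i : Fin d) (x : Rd d) :
    HasLineDerivAt ℝ (heatFlow f s) (heatFlowD i f s x) x (EuclideanSpace.single i (1 : ℝ)) :=
  (isRapidKernel_heatKernel d).hasLineDerivAt_kernelConv (isRapidKernel_heatKernelD i) hs
    (hasLineDerivAt_heatKernel i) hf hM x

lemma hasLineDerivAt_heatFlowD (hf : Measurable f) (hM : ∀ y, |f y| ≤ M) {s : ℝ} (hs : 0 < s)
    (i j : Fin d) (x : Rd d) :
    HasLineDerivAt ℝ (heatFlowD j f s) (heatFlowDD i j f s x) x
      (EuclideanSpace.single i (1 : ℝ)) :=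
  (isRapidKernel_heatKernelD j).hasLineDerivAt_kernelConv (isRapidKernel_heatKernelDD i j) hs
    (hasLineDerivAt_heatKernelD i j) hf hM x

lemma kernelConv_sum {ι : Type*} (t : Finset ι) {k : ι → Rd d → ℝ} (hk : ∀ i ∈ t, Integrable (k i))
    (hf : Measurable f) (hM : ∀ y, |f y| ≤ M) (x : Rd d) :
    kernelConv (fun z => ∑ i ∈ t, k i z) f x = ∑ i ∈ t, kernelConv (k i) f x := by
  unfold kernelConv
  simp only [Finset.sum_mul]
  exact integral_finsetSum _ fun i hi => integrable_kernelConv (hk i hi) hf hM x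

lemma hasDerivAt_heatFlow (hf : Measurable f) (hM : ∀ y, |f y| ≤ M) {s : ℝ} (hs : 0 < s)
    (x : Rd d) :
    HasDerivAt (fun s => heatFlow f s x) (∑ i, heatFlowDD i i f s x) s := by
  have h := (isRapidKernel_heatKernel d).hasDerivAt_kernelConv
    (IsRapidKernel.sum Finset.univ fun i _ => isRapidKernel_heatKernelDD i i) hs
    (fun s hs z => hasDerivAt_heatKernel hs z) hf hM x
  rwa [kernelConv_sum _ (fun i _ => (isRapidKernel_heatKernelDD i i).integrable hs) hf hM] at h

lemma heatFlow_nonneg (hf0 : ∀ y, 0 ≤ f y) {s : ℝ} (hs : 0 < s) (x : Rd d) :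
    0 ≤ heatFlow f s x :=
  integral_nonneg fun y => mul_nonneg (heatKernel_pos hs _).le (hf0 y)

lemma heatFlow_pos (hf : Measurable f) (hM : ∀ y, |f y| ≤ M) (hf0 : ∀ y, 0 ≤ f y)
    (hne : ¬ f =ᵐ[volume] 0) {s : ℝ} (hs : 0 < s) (x : Rd d) :
    0 < heatFlow f s x := by
  refine (heatFlow_nonneg hf0 hs x).lt_of_ne' fun h => hne ?_
  have hi := integrable_kernelConv ((isRapidKernel_heatKernel d).integrable hs) hf hM x
  have := (integral_eq_zero_iff_of_nonneg
    (fun y => mul_nonneg (heatKernel_pos hs _).le (hf0 y)) hi).1 h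
  filter_upwards [this] with y hy
  exact (mul_eq_zero.1 hy).resolve_left (heatKernel_pos hs _).ne'

lemma heatFlow_mono {g : Rd d → ℝ} {M' : ℝ} (hf : Measurable f) (hM : ∀ y, |f y| ≤ M)
    (hg : Measurable g) (hM' : ∀ y, |g y| ≤ M') (hfg : ∀ y, f y ≤ g y) {s : ℝ} (hs : 0 < s)
    (x : Rd d) : heatFlow f s x ≤ heatFlow g s x := by
  have hk := (isRapidKernel_heatKernel d).integrable hs
  exact integral_mono (integrable_kernelConv hk hf hM x) (integrable_kernelConv hk hg hM' x)
    fun y => mul_le_mul_of_nonneg_left (hfg y) (heatKernel_pos hs _).le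

/-- Kernels dominated by a polynomial times the heat kernel. -/
lemma abs_kernelConv_le_heatFlow {k : Rd d → ℝ} {s C : ℝ} (hs : 0 < s) (hC : 0 ≤ C)
    (hk : ∀ z, |k z| ≤ C * (1 + ‖z‖) ^ 2 * heatKernel s z)
    (hf : Measurable f) (hM : ∀ y, |f y| ≤ M) (hr : ∀ y, r < ‖y‖ → f y = 0) (x : Rd d) :
    |kernelConv k f x| ≤ C * (1 + |r|) ^ 2 * (1 + ‖x‖) ^ 2 * heatFlow (fun y => |f y|) s x := by
  unfold heatFlow kernelConv
  rw [← integral_const_mul, ← Real.norm_eq_abs]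
  refine (norm_integral_le_integral_norm _).trans ?_
  refine integral_mono_of_nonneg (Eventually.of_forall fun z => norm_nonneg _) ?_
    (Eventually.of_forall fun y => ?_)
  · exact (integrable_kernelConv ((isRapidKernel_heatKernel d).integrable hs) hf.abs
      (fun y => by rw [abs_abs]; exact hM y) x).const_mul _
  · simp only [Real.norm_eq_abs, abs_mul]
    rcases lt_or_ge r ‖y‖ with hy | hy
    · simp [hr y hy]
    · have h1 : 1 + ‖x - y‖ ≤ (1 + |r|) * (1 + ‖x‖) := by
        have := norm_sub_le x y
        have := le_abs_self r
        nlinarith [norm_nonneg x, abs_nonneg r]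
      have h2 : (1 + ‖x - y‖) ^ 2 ≤ ((1 + |r|) * (1 + ‖x‖)) ^ 2 :=
        pow_le_pow_left₀ (by positivity) h1 _
      have h3 := (heatKernel_pos hs (x - y)).le
      calc |k (x - y)| * |f y| ≤ (C * (1 + ‖x - y‖) ^ 2 * heatKernel s (x - y)) * |f y| := by
            gcongr; exact hk _
        _ ≤ (C * ((1 + |r|) * (1 + ‖x‖)) ^ 2 * heatKernel s (x - y)) * |f y| := by
            gcongr
        _ = _ := by ring

lemma abs_coord_le (z : Rd d) (i : Fin d) : |z i| ≤ ‖z‖ := PiLp.norm_apply_le z i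

lemma abs_kron_le (i j : Fin d) : |kron i j| ≤ 1 := by
  unfold kron; split_ifs <;> simp

/-- The derivative of the heat kernel is the kernel times z_i/(2s), and on a bounded support a
polynomial in x - y is controlled by one in x. Consequently the logarithmic derivatives of a
positive heat flow grow at most polynomially, which Gaussian decay of the flow alone would not give.
-/
lemma abs_heatFlowD_le (hf : Measurable f) (hM : ∀ y, |f y| ≤ M) (hr : ∀ y, r < ‖y‖ → f y = 0)
    {a : ℝ} (ha : 0 < a) : ∃ C, 0 ≤ C ∧ ∀ i, ∀ s, a ≤ s → ∀ x,
      |heatFlowD i f s x| ≤ C * (1 + ‖x‖) ^ 2 * heatFlow (fun y => |f y|) s x := by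
  refine ⟨(1 / (2 * a)) * (1 + |r|) ^ 2, by positivity, fun i s has x => ?_⟩
  have hs : 0 < s := ha.trans_le has
  refine abs_kernelConv_le_heatFlow hs (by positivity) (fun z => ?_) hf hM hr x
  unfold heatKernelD
  rw [abs_mul, abs_of_pos (heatKernel_pos hs z), abs_neg, abs_div, abs_of_pos (a := 2 * s)
    (by positivity)]
  refine mul_le_mul_of_nonneg_right ?_ (heatKernel_pos hs z).le
  have h1 : |z i| ≤ (1 + ‖z‖) ^ 2 := by
    have := abs_coord_le z i
    nlinarith [norm_nonneg z]
  rw [div_eq_mul_one_div, mul_comm]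
  have h2 : 1 / (2 * s) ≤ 1 / (2 * a) := by gcongr
  exact mul_le_mul h2 h1 (abs_nonneg _) (by positivity)

lemma abs_heatFlowDD_le (hf : Measurable f) (hM : ∀ y, |f y| ≤ M) (hr : ∀ y, r < ‖y‖ → f y = 0)
    {a : ℝ} (ha : 0 < a) : ∃ C, 0 ≤ C ∧ ∀ i j, ∀ s, a ≤ s → ∀ x,
      |heatFlowDD i j f s x| ≤ C * (1 + ‖x‖) ^ 2 * heatFlow (fun y => |f y|) s x := by
  refine ⟨(1 / (4 * a ^ 2) + 1 / (2 * a)) * (1 + |r|) ^ 2, by positivity, fun i j s has x => ?_⟩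
  have hs : 0 < s := ha.trans_le has
  refine abs_kernelConv_le_heatFlow hs (by positivity) (fun z => ?_) hf hM hr x
  unfold heatKernelDD
  rw [abs_mul, abs_of_pos (heatKernel_pos hs z)]
  refine mul_le_mul_of_nonneg_right ?_ (heatKernel_pos hs z).le
  refine (abs_sub _ _).trans ?_
  rw [add_mul]
  refine add_le_add ?_ ?_
  · rw [abs_div, abs_mul, abs_of_pos (a := 4 * s ^ 2) (by positivity), div_eq_mul_one_div, mul_comm]
    refine mul_le_mul (by gcongr) ?_ (by positivity) (by positivity)
    have := mul_le_mul (abs_coord_le z i) (abs_coord_le z j) (abs_nonneg _) (norm_nonneg _)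
    nlinarith [norm_nonneg z]
  · rw [abs_div, abs_of_pos (a := 2 * s) (by positivity), div_eq_mul_one_div, mul_comm]
    refine mul_le_mul (by gcongr) ?_ (by positivity) (by positivity)
    have := abs_kron_le i j
    nlinarith [norm_nonneg z]

end Flow

/-- A rapidly decreasing function on space-time, integrated in space, is continuous in time. -/
lemma IsRapidKernel.continuousOn_integral {d : ℕ} {k : ℝ → Rd d → ℝ} (h : IsRapidKernel k) :
    ContinuousOn (fun s => ∫ x, k s x) (Ioi 0) := by
  intro s₀ hs₀
  have hs₀ : 0 < s₀ := hs₀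
  refine ContinuousAt.continuousWithinAt ?_
  obtain ⟨C, hC⟩ := h.decay (s₀ / 2) (2 * s₀) (d + 1) (by positivity)
  have hn : Icc (s₀ / 2) (2 * s₀) ∈ 𝓝 s₀ := Icc_mem_nhds (by linarith) (by linarith)
  refine continuousAt_of_dominated (bound := fun x => C * polyDecay (d + 1) x) ?_ ?_ ?_ ?_
  · filter_upwards [Ioi_mem_nhds hs₀] with s hs
    exact (h.continuous hs).aestronglyMeasurable
  · filter_upwards [hn] with s hs
    exact Eventually.of_forall fun x => hC s hs x
  · exact (integrable_polyDecay (Nat.lt_succ_self d)).const_mul C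
  · exact Eventually.of_forall fun x => (h.continuousOn_time x).continuousAt (Ioi_mem_nhds hs₀)

lemma IsRapidKernel.integrable_prod {d : ℕ} {k : ℝ → Rd d → ℝ} (h : IsRapidKernel k) {a b : ℝ}
    (ha : 0 < a) : Integrable (fun p : ℝ × Rd d => k p.1 p.2)
      ((volume.restrict (Icc a b)).prod volume) := by
  obtain ⟨C, hC⟩ := h.decay a b (d + 1) ha
  have hi : Integrable (fun p : ℝ × Rd d => (1 : ℝ) * (C * polyDecay (d + 1) p.2))
      ((volume.restrict (Icc a b)).prod volume) :=
    (integrable_const (1 : ℝ)).mul_prod ((integrable_polyDecay (Nat.lt_succ_self d)).const_mul C)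
  have hmeas : (volume.restrict (Icc a b)).prod (volume : Measure (Rd d)) =
      (volume.prod volume).restrict (Icc a b ×ˢ univ) := by
    rw [← Measure.prod_restrict, Measure.restrict_univ]
  have hms : MeasurableSet (Icc a b ×ˢ (univ : Set (Rd d))) := measurableSet_Icc.prod .univ
  refine hi.mono' ?_ ?_
  · rw [hmeas]
    exact (h.cont.mono (prod_mono (fun s (hs : s ∈ Icc a b) => ha.trans_le hs.1)
      le_rfl)).aestronglyMeasurable hms
  · rw [hmeas]
    filter_upwards [ae_restrict_mem hms] with p hp
    rw [one_mul]
    exact hC p.1 hp.1 p.2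

/-- The integral in space-time of the heat defect `ΔF - ∂ₛF`. -/
theorem integral_heat_defect {d : ℕ} {F Fs : ℝ → Rd d → ℝ} {Fi Fii : Fin d → ℝ → Rd d → ℝ}
    (hF : IsRapidKernel F) (hFs : IsRapidKernel Fs) (hFi : ∀ i, IsRapidKernel (Fi i))
    (hFii : ∀ i, IsRapidKernel (Fii i))
    (hs : ∀ s, 0 < s → ∀ x, HasDerivAt (fun s => F s x) (Fs s x) s)
    (h2 : ∀ i, ∀ s, 0 < s → ∀ x,
      HasLineDerivAt ℝ (Fi i s) (Fii i s x) x (EuclideanSpace.single i (1 : ℝ)))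
    {a b : ℝ} (ha : 0 < a) (hab : a ≤ b) :
    ∫ s in a..b, ∫ x, (∑ i, Fii i s x - Fs s x) = (∫ x, F a x) - ∫ x, F b x := by
  have hpos : ∀ s ∈ uIcc a b, 0 < s := fun s hs => by
    rw [uIcc_of_le hab] at hs; exact ha.trans_le hs.1
  -- The Laplacian part integrates to zero in space, so only the time derivative survives.
  have e1 : ∀ s ∈ uIcc a b, ∫ x, (∑ i, Fii i s x - Fs s x) = -∫ x, Fs s x := by
    intro s hs'
    have hs0 := hpos s hs'
    rw [integral_sub (integrable_finsetSum _ fun i _ => (hFii i).integrable hs0)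
      (hFs.integrable hs0), integral_finsetSum _ fun i _ => (hFii i).integrable hs0]
    simp [integral_lineDeriv_eq_zero ((hFi _).integrable hs0) ((hFii _).integrable hs0)
      (h2 _ s hs0)]
  rw [intervalIntegral.integral_congr (g := fun s => -∫ x, Fs s x) e1,
    intervalIntegral.integral_neg]
  have hder : ∀ s ∈ uIcc a b, HasDerivAt (fun s => ∫ x, F s x) (∫ x, Fs s x) s := by
    intro s hs'
    have hs0 := hpos s hs'
    obtain ⟨C, hC⟩ := hFs.decay (s / 2) (2 * s) (d + 1) (by positivity)
    have hp : ∀ t ∈ Icc (s / 2) (2 * s), 0 < t := fun t ht => by have := ht.1; linarith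
    refine (hasDerivAt_integral_of_dominated_loc_of_deriv_le
      (bound := fun x => C * polyDecay (d + 1) x)
      (Icc_mem_nhds (a := s / 2) (b := 2 * s) (by linarith) (by linarith)) ?_
      (hF.integrable hs0) (hFs.integrable hs0).aestronglyMeasurable ?_ ?_ ?_).2
    · filter_upwards [Ioi_mem_nhds hs0] with t ht
      exact (hF.continuous ht).aestronglyMeasurable
    · exact Eventually.of_forall fun x t ht => hC t ht x
    · exact (integrable_polyDecay (Nat.lt_succ_self d)).const_mul C
    · exact Eventually.of_forall fun x t ht => hs t (hp t ht) x
  rw [intervalIntegral.integral_eq_sub_of_hasDerivAt hder]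
  · ring
  · exact (hFs.continuousOn_integral.mono hpos).intervalIntegrable

/-! ### Energy estimates for the heat flow -/

/-- `A` is dominated by a polynomial multiple of `Z`, locally uniformly in time. -/
structure PolyDominated {d : ℕ} (Z A : ℝ → Rd d → ℝ) : Prop where
  cont : ContinuousOn (fun p : ℝ × Rd d => A p.1 p.2) (Ioi 0 ×ˢ univ)
  dom : ∀ a b, 0 < a → ∃ (m : ℕ) (C : ℝ), 0 ≤ C ∧ ∀ s ∈ Icc a b, ∀ x,
    |A s x| ≤ C * (1 + ‖x‖) ^ m * |Z s x|

namespace PolyDominated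
variable {d : ℕ} {Z Z' A B : ℝ → Rd d → ℝ}

lemma refl (h : ContinuousOn (fun p : ℝ × Rd d => A p.1 p.2) (Ioi 0 ×ˢ univ)) :
    PolyDominated A A :=
  ⟨h, fun a b _ => ⟨0, 1, zero_le_one, fun s _ x => by simp⟩⟩

lemma mul (h : PolyDominated Z A) (h' : PolyDominated Z' B) :
    PolyDominated (fun s x => Z s x * Z' s x) (fun s x => A s x * B s x) where
  cont := h.cont.mul h'.cont
  dom a b ha := by
    obtain ⟨m, C, hC0, hC⟩ := h.dom a b ha
    obtain ⟨m', C', hC0', hC'⟩ := h'.dom a b ha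
    refine ⟨m + m', C * C', mul_nonneg hC0 hC0', fun s hs x => ?_⟩
    rw [abs_mul, abs_mul]
    calc |A s x| * |B s x| ≤ (C * (1 + ‖x‖) ^ m * |Z s x|) * (C' * (1 + ‖x‖) ^ m' * |Z' s x|) :=
          mul_le_mul (hC s hs x) (hC' s hs x) (abs_nonneg _) (by positivity)
      _ = _ := by ring

lemma add (h : PolyDominated Z A) (h' : PolyDominated Z B) :
    PolyDominated Z (fun s x => A s x + B s x) where
  cont := h.cont.add h'.cont
  dom a b ha := by
    obtain ⟨m, C, hC0, hC⟩ := h.dom a b ha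
    obtain ⟨m', C', hC0', hC'⟩ := h'.dom a b ha
    refine ⟨max m m', C + C', add_nonneg hC0 hC0', fun s hs x => (abs_add_le _ _).trans ?_⟩
    have h1 : (1 : ℝ) ≤ 1 + ‖x‖ := by simp
    rw [add_mul, add_mul]
    refine add_le_add ((hC s hs x).trans ?_) ((hC' s hs x).trans ?_)
    · gcongr
      exact le_max_left _ _
    · gcongr
      exact le_max_right _ _

lemma const (c : ℝ) : PolyDominated (fun _ _ => 1 : ℝ → Rd d → ℝ) (fun _ _ => c) :=
  ⟨continuousOn_const, fun a b _ => ⟨0, |c|, abs_nonneg _, fun s _ x => by simp⟩⟩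

lemma mono (h : PolyDominated Z A) {C : ℝ} (hC : 0 ≤ C)
    (hZ : ∀ s, 0 < s → ∀ x, |Z s x| ≤ C * |Z' s x|) : PolyDominated Z' A where
  cont := h.cont
  dom a b ha := by
    obtain ⟨m, C', hC0', hC'⟩ := h.dom a b ha
    refine ⟨m, C' * C, mul_nonneg hC0' hC, fun s hs x => (hC' s hs x).trans ?_⟩
    calc C' * (1 + ‖x‖) ^ m * |Z s x| ≤ C' * (1 + ‖x‖) ^ m * (C * |Z' s x|) := by
          gcongr; exact hZ s (ha.trans_le hs.1) x
      _ = _ := by ring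

lemma isRapidKernel (h : PolyDominated Z A) (hZ : IsRapidKernel Z) : IsRapidKernel A where
  cont := h.cont
  decay a b N ha := by
    obtain ⟨m, C, hC0, hC⟩ := h.dom a b ha
    obtain ⟨C', hC'⟩ := hZ.decay a b (m + N) ha
    refine ⟨C * C', fun s hs x => (hC s hs x).trans ?_⟩
    calc C * (1 + ‖x‖) ^ m * |Z s x| ≤ C * (1 + ‖x‖) ^ m * (C' * polyDecay (m + N) x) := by
          gcongr; exact hC' s hs x
      _ = C * C' * polyDecay N x := by
          rw [polyDecay_add]
          linear_combination (C * C' * polyDecay N x) * one_add_norm_pow_mul_polyDecay (N := m) x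

end PolyDominated

section Energy
variable {d : ℕ} {f g G : Rd d → ℝ} {M r : ℝ}

lemma abs_heatFlow_le {s : ℝ} (hs : 0 < s) (x : Rd d) :
    |heatFlow f s x| ≤ heatFlow (fun y => |f y|) s x := by
  unfold heatFlow kernelConv
  rw [← Real.norm_eq_abs]
  refine (norm_integral_le_integral_norm _).trans ?_
  refine le_of_eq (integral_congr_ae (Eventually.of_forall fun y => ?_))
  simp [abs_of_pos (heatKernel_pos hs _)]

lemma polyDominated_heatFlow (hf : Measurable f) (hM : ∀ y, |f y| ≤ M) :
    PolyDominated (heatFlow fun y => |f y|) (heatFlow f) where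
  cont := (isRapidKernel_heatKernel d).continuousOn_kernelConv hf hM
  dom a b ha := ⟨0, 1, zero_le_one, fun s hs x => by
    have hs0 : 0 < s := ha.trans_le hs.1
    rw [pow_zero, one_mul, one_mul, abs_of_nonneg (heatFlow_nonneg (fun y => abs_nonneg _) hs0 x)]
    exact abs_heatFlow_le hs0 x⟩

lemma polyDominated_heatFlowD (hf : Measurable f) (hM : ∀ y, |f y| ≤ M)
    (hr : ∀ y, r < ‖y‖ → f y = 0) (i : Fin d) :
    PolyDominated (heatFlow fun y => |f y|) (heatFlowD i f) where
  cont := (isRapidKernel_heatKernelD i).continuousOn_kernelConv hf hM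
  dom a b ha := by
    obtain ⟨C, hC0, hC⟩ := abs_heatFlowD_le hf hM hr ha
    refine ⟨2, C, hC0, fun s hs x => ?_⟩
    rw [abs_of_nonneg (heatFlow_nonneg (fun y => abs_nonneg _) (ha.trans_le hs.1) x)]
    exact hC i s hs.1 x

lemma polyDominated_heatFlowDD (hf : Measurable f) (hM : ∀ y, |f y| ≤ M)
    (hr : ∀ y, r < ‖y‖ → f y = 0) (i j : Fin d) :
    PolyDominated (heatFlow fun y => |f y|) (heatFlowDD i j f) where
  cont := (isRapidKernel_heatKernelDD i j).continuousOn_kernelConv hf hM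
  dom a b ha := by
    obtain ⟨C, hC0, hC⟩ := abs_heatFlowDD_le hf hM hr ha
    refine ⟨2, C, hC0, fun s hs x => ?_⟩
    rw [abs_of_nonneg (heatFlow_nonneg (fun y => abs_nonneg _) (ha.trans_le hs.1) x)]
    exact hC i j s hs.1 x

lemma isRapidKernel_heatFlow (hf : Measurable f) (hM : ∀ y, |f y| ≤ M)
    (hr : ∀ y, r < ‖y‖ → f y = 0) : IsRapidKernel (heatFlow f) :=
  (isRapidKernel_heatKernel d).kernelConv hf hM hr

lemma heatFlow_le (hM : ∀ y, |f y| ≤ M) {s : ℝ} (hs : 0 < s) (x : Rd d) :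
    |heatFlow f s x| ≤ M := by
  have h := abs_kernelConv_le ((isRapidKernel_heatKernel d).integrable hs) hM x
  simp only [abs_of_pos (heatKernel_pos hs _), integral_heatKernel hs, one_mul] at h
  exact h

/-- A positive heat flow and its logarithmic derivatives. -/
structure IsPositiveDatum (G : Rd d → ℝ) (M r : ℝ) : Prop where
  meas : Measurable G
  nonneg : ∀ y, 0 ≤ G y
  bound : ∀ y, |G y| ≤ M
  supp : ∀ y, r < ‖y‖ → G y = 0
  ne_zero : ¬ G =ᵐ[volume] 0

namespace IsPositiveDatum

lemma pos (h : IsPositiveDatum G M r) {s : ℝ} (hs : 0 < s) (x : Rd d) : 0 < heatFlow G s x :=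
  heatFlow_pos h.meas h.bound h.nonneg h.ne_zero hs x

lemma M_nonneg (h : IsPositiveDatum G M r) : 0 ≤ M := (abs_nonneg _).trans (h.bound 0)

lemma rapid (h : IsPositiveDatum G M r) : IsRapidKernel (heatFlow G) :=
  isRapidKernel_heatFlow h.meas h.bound h.supp

lemma contOn (h : IsPositiveDatum G M r) (γ : ℝ) :
    ContinuousOn (fun p : ℝ × Rd d => heatFlow G p.1 p.2 ^ γ) (Ioi 0 ×ˢ univ) :=
  h.rapid.cont.rpow_const fun p hp => Or.inl (h.pos hp.1 p.2).ne'

/-- With W ≤ M one has W^q ≤ M^(q-1) W, so the decay of W passes to W^q. This is the integrable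
majorant for all the weighted quantities below. -/
lemma rapid_rpow (h : IsPositiveDatum G M r) {q : ℝ} (hq : 1 < q) :
    IsRapidKernel (fun s x => heatFlow G s x ^ q) := by
  refine PolyDominated.isRapidKernel (Z := heatFlow G) ((PolyDominated.refl (h.contOn q)).mono
    (C := M ^ (q - 1)) (Real.rpow_nonneg h.M_nonneg _) fun s hs x => ?_) h.rapid
  have hp := h.pos hs x
  rw [abs_of_pos (Real.rpow_pos_of_pos hp q), abs_of_pos hp]
  have e : heatFlow G s x ^ q = heatFlow G s x ^ (q - 1) * heatFlow G s x := by
    rw [Real.rpow_sub_one hp.ne']; field_simp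
  rw [e]
  refine mul_le_mul_of_nonneg_right (Real.rpow_le_rpow hp.le ?_ (by linarith)) hp.le
  exact (le_abs_self _).trans (heatFlow_le h.bound hs x)

lemma abs_eq (h : IsPositiveDatum G M r) : (fun y => |G y|) = G := by
  ext y; exact abs_of_nonneg (h.nonneg y)

/-- Division by the flow is safe when the numerator is a derivative of the flow: the quotient has
polynomial growth, and any rapidly decreasing factor absorbs it. -/
lemma dom_ratio (h : IsPositiveDatum G M r) {A : ℝ → Rd d → ℝ}
    (hA : PolyDominated (heatFlow G) A) :
    PolyDominated (fun _ _ => 1) (fun s x => A s x / heatFlow G s x) where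
  cont := hA.cont.div h.rapid.cont fun p hp => (h.pos hp.1 p.2).ne'
  dom a b ha := by
    obtain ⟨m, C, hC0, hC⟩ := hA.dom a b ha
    refine ⟨m, C, hC0, fun s hs x => ?_⟩
    have hp := h.pos (ha.trans_le hs.1) x
    rw [abs_div, abs_of_pos hp, div_le_iff₀ hp, abs_one, mul_one]
    have := hC s hs x
    rwa [abs_of_pos hp] at this

lemma dom_D (h : IsPositiveDatum G M r) (i : Fin d) :
    PolyDominated (fun _ _ => 1) (fun s x => heatFlowD i G s x / heatFlow G s x) := by
  have := polyDominated_heatFlowD h.meas h.bound h.supp i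
  rw [h.abs_eq] at this
  exact h.dom_ratio this

lemma dom_DD (h : IsPositiveDatum G M r) (i j : Fin d) :
    PolyDominated (fun _ _ => 1) (fun s x => heatFlowDD i j G s x / heatFlow G s x) := by
  have := polyDominated_heatFlowDD h.meas h.bound h.supp i j
  rw [h.abs_eq] at this
  exact h.dom_ratio this

/-- The derivative is written as W^γ times a logarithmic derivative, rather than with W^(γ-1), so
that `dom_D` and `dom_DD` apply to it directly, for every real γ. -/
lemma lineDeriv_rpow (h : IsPositiveDatum G M r) (γ : ℝ) (i : Fin d) {s : ℝ} (hs : 0 < s)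
    (x : Rd d) : HasLineDerivAt ℝ (fun x => heatFlow G s x ^ γ)
      (γ * heatFlow G s x ^ γ * (heatFlowD i G s x / heatFlow G s x)) x
      (EuclideanSpace.single i (1 : ℝ)) := by
  have h1 := hasLineDerivAt_heatFlow h.meas h.bound hs i x
  unfold HasLineDerivAt at h1 ⊢
  refine (h1.rpow_const (p := γ) (Or.inl (h.pos hs _).ne')).congr_deriv ?_
  simp only [zero_smul, add_zero]
  rw [Real.rpow_sub_one (h.pos hs x).ne']
  have := (h.pos hs x).ne'
  field_simp

lemma timeDeriv_rpow (h : IsPositiveDatum G M r) (γ : ℝ) {s : ℝ} (hs : 0 < s)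
    (x : Rd d) : HasDerivAt (fun s => heatFlow G s x ^ γ)
      (γ * heatFlow G s x ^ γ * ∑ i, (heatFlowDD i i G s x / heatFlow G s x)) s := by
  have h1 := hasDerivAt_heatFlow h.meas h.bound hs x
  refine (h1.rpow_const (p := γ) (Or.inl (h.pos hs _).ne')).congr_deriv ?_
  rw [Real.rpow_sub_one (h.pos hs x).ne', ← Finset.sum_div]
  have := (h.pos hs x).ne'
  field_simp

lemma lineDeriv_ratio (h : IsPositiveDatum G M r) (i : Fin d) {s : ℝ} (hs : 0 < s)
    (x : Rd d) : HasLineDerivAt ℝ (fun x => heatFlowD i G s x / heatFlow G s x)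
      (heatFlowDD i i G s x / heatFlow G s x - (heatFlowD i G s x / heatFlow G s x) ^ 2) x
      (EuclideanSpace.single i (1 : ℝ)) := by
  have h1 := hasLineDerivAt_heatFlow h.meas h.bound hs i x
  have h2 := hasLineDerivAt_heatFlowD h.meas h.bound hs i i x
  unfold HasLineDerivAt at h1 h2 ⊢
  refine (h2.div h1 (h.pos hs _).ne').congr_deriv ?_
  simp only [zero_smul, add_zero]
  have := (h.pos hs x).ne'
  field_simp

end IsPositiveDatum

lemma integral_rpow_nonneg {F : Rd d → ℝ} {q : ℝ} (hF : ∀ x, 0 ≤ F x) :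
    0 ≤ ∫ x, F x ^ q := integral_nonneg fun x => Real.rpow_nonneg (hF x) q

lemma PolyDominated.mul' {Z A B : ℝ → Rd d → ℝ} (h : PolyDominated Z A)
    (h' : PolyDominated (fun _ _ => 1) B) : PolyDominated Z (fun s x => A s x * B s x) := by
  simpa using h.mul h'

lemma PolyDominated.const_mul {Z A : ℝ → Rd d → ℝ} (h : PolyDominated Z A) (c : ℝ) :
    PolyDominated Z (fun s x => c * A s x) := by
  simpa using (PolyDominated.const (d := d) c).mul h

lemma PolyDominated.sum {Z : ℝ → Rd d → ℝ} {ι : Type*} (t : Finset ι) {A : ι → ℝ → Rd d → ℝ}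
    (h : ∀ i ∈ t, PolyDominated Z (A i)) : PolyDominated Z (fun s x => ∑ i ∈ t, A i s x) := by
  classical
  induction t using Finset.induction_on with
  | empty =>
    exact ⟨by simpa using continuousOn_const, fun a b _ => ⟨0, 0, le_rfl, fun s _ x => by simp⟩⟩
  | insert i t hi ih =>
    simp only [Finset.sum_insert hi]
    exact (h i (by simp)).add (ih fun j hj => h j (by simp [hj]))

/-- The logarithmic energy density `W^q |∇W|²/W²`. -/
def logEnergy (G : Rd d → ℝ) (q : ℝ) (s : ℝ) (x : Rd d) : ℝ :=
  ∑ i, heatFlow G s x ^ q * (heatFlowD i G s x / heatFlow G s x) ^ 2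

lemma isRapidKernel_logEnergy (h : IsPositiveDatum G M r) {q : ℝ} (hq : 1 < q) :
    IsRapidKernel (logEnergy G q) := by
  refine PolyDominated.isRapidKernel (PolyDominated.sum _ fun i _ => ?_) (h.rapid_rpow hq)
  simp only [sq]
  exact (PolyDominated.refl (h.contOn q)).mul' ((h.dom_D i).mul' (h.dom_D i))

/-- The `L^q` energy estimate for a positive solution of the heat equation. -/
theorem integral_logEnergy_le (h : IsPositiveDatum G M r) {q : ℝ} (hq : 1 < q)
    {a b : ℝ} (ha : 0 < a) (hab : a ≤ b) :
    q * (q - 1) * ∫ s in a..b, ∫ x, logEnergy G q s x ≤ ∫ x, heatFlow G a x ^ q := by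
  have hR := h.rapid_rpow hq
  have hd : PolyDominated (fun s x => heatFlow G s x ^ q) (fun s x => heatFlow G s x ^ q) :=
    PolyDominated.refl (h.contOn q)
  -- As W solves the heat equation, (Δ - ∂_s)W^q = q(q-1) W^q |∇W|²/W²: the defect of W^q is exactly
  -- the logarithmic energy.
  have key := integral_heat_defect (F := fun s x => heatFlow G s x ^ q)
    (Fs := fun s x => q * heatFlow G s x ^ q * ∑ i, (heatFlowDD i i G s x / heatFlow G s x))
    (Fi := fun i s x => q * heatFlow G s x ^ q * (heatFlowD i G s x / heatFlow G s x))
    (Fii := fun i s x => q * heatFlow G s x ^ q * (heatFlowDD i i G s x / heatFlow G s x) +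
      q * (q - 1) * (heatFlow G s x ^ q * ((heatFlowD i G s x / heatFlow G s x) *
        (heatFlowD i G s x / heatFlow G s x))))
    hR (((hd.const_mul q).mul' (PolyDominated.sum _ fun i _ => h.dom_DD i i)).isRapidKernel hR)
    (fun i => ((hd.const_mul q).mul' (h.dom_D i)).isRapidKernel hR)
    (fun i => (((hd.const_mul q).mul' (h.dom_DD i i)).add
      ((hd.mul' ((h.dom_D i).mul' (h.dom_D i))).const_mul _)).isRapidKernel hR)
    (fun s hs x => h.timeDeriv_rpow q hs x) ?_ ha hab
  · have e : ∀ s x, (∑ i, (q * heatFlow G s x ^ q * (heatFlowDD i i G s x / heatFlow G s x) +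
        q * (q - 1) * (heatFlow G s x ^ q * ((heatFlowD i G s x / heatFlow G s x) *
        (heatFlowD i G s x / heatFlow G s x)))) -
        q * heatFlow G s x ^ q * ∑ i, (heatFlowDD i i G s x / heatFlow G s x))
        = q * (q - 1) * logEnergy G q s x := by
      intro s x
      rw [Finset.sum_add_distrib, ← Finset.mul_sum, ← Finset.mul_sum, logEnergy]
      simp only [sq]; ring
    simp only [e] at key
    have e2 : ∀ s, ∫ x, q * (q - 1) * logEnergy G q s x = q * (q - 1) * ∫ x, logEnergy G q s x :=
      fun s => integral_const_mul _ _
    simp only [e2, intervalIntegral.integral_const_mul] at key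
    rw [key]
    have : 0 ≤ ∫ x, heatFlow G b x ^ q :=
      integral_rpow_nonneg fun x => (h.pos (ha.trans_le hab) x).le
    linarith
  · intro i s hs x
    have h1 := h.lineDeriv_rpow q i hs x
    have h2 := h.lineDeriv_ratio i hs x
    unfold HasLineDerivAt at h1 h2 ⊢
    refine ((h1.const_mul q).mul h2).congr_deriv ?_
    simp only [zero_smul, add_zero]
    ring

/-- The weighted Dirichlet energy density `|∇z|² W^γ`. -/
def weightedEnergy (f G : Rd d → ℝ) (γ : ℝ) (s : ℝ) (x : Rd d) : ℝ :=
  ∑ i, heatFlowD i f s x ^ 2 * heatFlow G s x ^ γ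

section Weighted
variable {Mf rf : ℝ} {q γ : ℝ}

/-- Every term of the weighted energy computation is a polynomial multiple of Z² W^γ, with Z the
flow of |f|. The comparison Z² W^γ ≤ W^q brings all of them under the single rapid majorant W^q,
even when γ is negative. -/
lemma weighted_mono (h : IsPositiveDatum G M r)
    (hZ : ∀ s, 0 < s → ∀ x, heatFlow (fun y => |f y|) s x ^ 2 * heatFlow G s x ^ γ
      ≤ heatFlow G s x ^ q) {A : ℝ → Rd d → ℝ}
    (hA : PolyDominated (fun s x => heatFlow (fun y => |f y|) s x *
      heatFlow (fun y => |f y|) s x * heatFlow G s x ^ γ) A) (hq : 1 < q) : IsRapidKernel A := by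
  refine PolyDominated.isRapidKernel (hA.mono zero_le_one fun s hs x => ?_) (h.rapid_rpow hq)
  have hp := h.pos hs x
  rw [one_mul, abs_of_pos (Real.rpow_pos_of_pos hp q), ← sq, abs_of_nonneg]
  · exact hZ s hs x
  · have := Real.rpow_pos_of_pos hp γ
    positivity

lemma isRapidKernel_weightedEnergy (h : IsPositiveDatum G M r) (hq : 1 < q)
    (hf : Measurable f) (hM : ∀ y, |f y| ≤ Mf) (hr : ∀ y, rf < ‖y‖ → f y = 0)
    (hZ : ∀ s, 0 < s → ∀ x, heatFlow (fun y => |f y|) s x ^ 2 * heatFlow G s x ^ γ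
      ≤ heatFlow G s x ^ q) : IsRapidKernel (weightedEnergy f G γ) := by
  refine weighted_mono h hZ (PolyDominated.sum _ fun i _ => ?_) hq
  have h1 := polyDominated_heatFlowD hf hM hr i
  simp only [sq]
  exact (h1.mul h1).mul (PolyDominated.refl (h.contOn γ))

/-- The weighted energy estimate for the heat flow. -/
theorem integral_weightedEnergy_le (h : IsPositiveDatum G M r) (hq : 1 < q) (hγ : |γ| ≤ 1)
    (hf : Measurable f) (hM : ∀ y, |f y| ≤ Mf) (hr : ∀ y, rf < ‖y‖ → f y = 0)
    (hZ : ∀ s, 0 < s → ∀ x, heatFlow (fun y => |f y|) s x ^ 2 * heatFlow G s x ^ γ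
      ≤ heatFlow G s x ^ q)
    {a b : ℝ} (ha : 0 < a) (hab : a ≤ b) :
    ∫ s in a..b, ∫ x, weightedEnergy f G γ s x
      ≤ (1 + 4 / (q * (q - 1))) * ∫ x, heatFlow G a x ^ q := by
  have hz := polyDominated_heatFlow hf hM
  have hz1 := fun i => polyDominated_heatFlowD hf hM hr i
  have hz2 := fun i j => polyDominated_heatFlowDD hf hM hr i j
  have hw : PolyDominated (fun s x => heatFlow G s x ^ γ) (fun s x => heatFlow G s x ^ γ) :=
    PolyDominated.refl (h.contOn γ)
  have hb : 0 < b := ha.trans_le hab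
  let z := heatFlow f
  let zi : Fin d → ℝ → Rd d → ℝ := fun i => heatFlowD i f
  let zii : Fin d → ℝ → Rd d → ℝ := fun i => heatFlowDD i i f
  let w : ℝ → Rd d → ℝ := fun s x => heatFlow G s x ^ γ
  let ri : Fin d → ℝ → Rd d → ℝ := fun i s x => heatFlowD i G s x / heatFlow G s x
  let rii : Fin d → ℝ → Rd d → ℝ := fun i s x => heatFlowDD i i G s x / heatFlow G s x
  have hFR : IsRapidKernel (fun s x => z s x * z s x * w s x) :=
    weighted_mono h hZ ((hz.mul hz).mul hw) hq
  -- The functional is z² W^γ for two solutions z and W of the heat equation. In its heat defect the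
  -- second derivatives of z and of W cancel.
  have key := integral_heat_defect (F := fun s x => z s x * z s x * w s x)
    (Fs := fun s x => 2 * (z s x * ∑ i, zii i s x) * w s x +
      γ * (z s x * z s x * w s x * ∑ i, rii i s x))
    (Fi := fun i s x => 2 * (z s x * zi i s x) * w s x + γ * (z s x * z s x * w s x * ri i s x))
    (Fii := fun i s x => 2 * (zi i s x * zi i s x * w s x) + 2 * (z s x * zii i s x * w s x) +
      4 * γ * (z s x * zi i s x * w s x * ri i s x) +
      γ * (γ - 1) * (z s x * z s x * w s x * (ri i s x * ri i s x)) +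
      γ * (z s x * z s x * w s x * rii i s x))
    hFR ?_ ?_ ?_ ?_ ?_ ha hab
  · have e : ∀ s x, ∑ i, (2 * (zi i s x * zi i s x * w s x) + 2 * (z s x * zii i s x * w s x) +
        4 * γ * (z s x * zi i s x * w s x * ri i s x) +
        γ * (γ - 1) * (z s x * z s x * w s x * (ri i s x * ri i s x)) +
        γ * (z s x * z s x * w s x * rii i s x)) - (2 * (z s x * ∑ i, zii i s x) * w s x +
        γ * (z s x * z s x * w s x * ∑ i, rii i s x))
        = ∑ i, (2 * (zi i s x * zi i s x * w s x) +
        4 * γ * (z s x * zi i s x * w s x * ri i s x) +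
        γ * (γ - 1) * (z s x * z s x * w s x * (ri i s x * ri i s x))) := by
      intro s x
      simp only [Finset.mul_sum, Finset.sum_mul]
      rw [← Finset.sum_add_distrib, ← Finset.sum_sub_distrib]
      exact Finset.sum_congr rfl fun i _ => by ring
    simp only [e] at key
    set H : ℝ → Rd d → ℝ := fun s x => ∑ i, (2 * (zi i s x * zi i s x * w s x) +
        4 * γ * (z s x * zi i s x * w s x * ri i s x) +
        γ * (γ - 1) * (z s x * z s x * w s x * (ri i s x * ri i s x))) with hH
    have hHR : IsRapidKernel H := weighted_mono h hZ (PolyDominated.sum _ fun i _ =>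
      (((((hz1 i).mul (hz1 i)).mul hw).const_mul 2).add
        ((((hz.mul (hz1 i)).mul hw).mul' (h.dom_D i)).const_mul _)).add
        ((((hz.mul hz).mul hw).mul' ((h.dom_D i).mul' (h.dom_D i))).const_mul _)) hq
    have hDR := isRapidKernel_weightedEnergy h hq hf hM hr hZ
    have hLR := isRapidKernel_logEnergy h hq
    -- The cross term in z ∂_i z has no sign; the logarithmic energy of W pays for it.
    have hpt : ∀ s, 0 < s → ∀ x, weightedEnergy f G γ s x ≤ H s x + 4 * logEnergy G q s x := by
      intro s hs x
      simp only [weightedEnergy, hH, logEnergy, Finset.mul_sum]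
      rw [← Finset.sum_add_distrib]
      refine Finset.sum_le_sum fun i _ => ?_
      change zi i s x ^ 2 * w s x ≤ _ + 4 * (_ * ri i s x ^ 2)
      have hw0 : 0 < w s x := Real.rpow_pos_of_pos (h.pos hs x) γ
      have h1 : z s x ^ 2 * w s x ≤ heatFlow G s x ^ q := by
        refine le_trans (mul_le_mul_of_nonneg_right ?_ hw0.le) (hZ s hs x)
        have h3 : |z s x| ≤ heatFlow (fun y => |f y|) s x := abs_heatFlow_le hs x
        rw [← sq_abs]
        exact pow_le_pow_left₀ (abs_nonneg _) h3 2
      have h2 := mul_le_mul_of_nonneg_right h1 (sq_nonneg (ri i s x))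
      have hγ2 : γ ^ 2 ≤ 1 := by rw [← sq_abs]; nlinarith [abs_nonneg γ]
      have hγ1 : γ ≤ 1 := (le_abs_self γ).trans hγ
      -- With a = ∂_i z and b = z ∂_i W/W, one has 2a² + 4γab + γ(γ-1)b² = a² + (a+2γb)² -
      -- (3γ²+γ)b². The last coefficient is at most 4 for |γ| ≤ 1, whence the factor 4 in front of
      -- the logarithmic energy.
      have h3 : 0 ≤ w s x * (zi i s x + 2 * γ * z s x * ri i s x) ^ 2 := by positivity
      have h4 : 0 ≤ (4 - 3 * γ ^ 2 - γ) * (z s x ^ 2 * w s x * ri i s x ^ 2) := by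
        have : 0 ≤ 4 - 3 * γ ^ 2 - γ := by linarith
        positivity
      nlinarith [h2, h3, h4]
    have hii : ∀ {k : ℝ → Rd d → ℝ}, IsRapidKernel k →
        IntervalIntegrable (fun s => ∫ x, k s x) volume a b := fun hk =>
      (hk.continuousOn_integral.mono fun s hs => by
        rw [uIcc_of_le hab] at hs; exact ha.trans_le hs.1).intervalIntegrable
    have h1 : ∫ s in a..b, ∫ x, weightedEnergy f G γ s x ≤
        ∫ s in a..b, ((∫ x, H s x) + 4 * ∫ x, logEnergy G q s x) := by
      refine intervalIntegral.integral_mono_on hab (hii hDR) ((hii hHR).add ((hii hLR).const_mul 4))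
        fun s hs => ?_
      have hs0 : 0 < s := ha.trans_le hs.1
      rw [← integral_const_mul, ← integral_add (hHR.integrable hs0)
        ((hLR.integrable hs0).const_mul 4)]
      exact integral_mono (hDR.integrable hs0)
        ((hHR.integrable hs0).add ((hLR.integrable hs0).const_mul 4)) (hpt s hs0)
    rw [intervalIntegral.integral_add (hii hHR) ((hii hLR).const_mul 4),
      intervalIntegral.integral_const_mul, key] at h1
    have h2 := integral_logEnergy_le h hq ha hab
    have h3 : ∫ x, z a x * z a x * w a x ≤ ∫ x, heatFlow G a x ^ q := by
      refine integral_mono (hFR.integrable ha) ((h.rapid_rpow hq).integrable ha) fun x => ?_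
      refine le_trans ?_ (hZ a ha x)
      refine mul_le_mul_of_nonneg_right ?_ (Real.rpow_pos_of_pos (h.pos ha x) γ).le
      have h3 : |z a x| ≤ heatFlow (fun y => |f y|) a x := abs_heatFlow_le ha x
      rw [← sq, ← sq_abs]
      exact pow_le_pow_left₀ (abs_nonneg _) h3 2
    have h4 : 0 ≤ ∫ x, z b x * z b x * w b x := integral_nonneg fun x =>
      mul_nonneg (mul_self_nonneg _) (Real.rpow_pos_of_pos (h.pos hb x) γ).le
    have hq0 : 0 < q * (q - 1) := mul_pos (by linarith) (by linarith)
    have h5 : ∫ s in a..b, ∫ x, logEnergy G q s x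
        ≤ (∫ x, heatFlow G a x ^ q) / (q * (q - 1)) := by
      rw [le_div_iff₀ hq0]; linarith
    have h6 : (1 + 4 / (q * (q - 1))) * ∫ x, heatFlow G a x ^ q =
      (∫ x, heatFlow G a x ^ q) + 4 * ((∫ x, heatFlow G a x ^ q) / (q * (q - 1))) := by ring
    rw [h6]
    linarith
  · exact weighted_mono h hZ ((((hz.mul (PolyDominated.sum _ fun i _ => hz2 i i)).const_mul
      2).mul hw).add (((((hz.mul hz).mul hw).mul' (PolyDominated.sum _ fun i _ =>
      h.dom_DD i i))).const_mul γ)) hq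
  · exact fun i => weighted_mono h hZ ((((hz.mul (hz1 i)).const_mul 2).mul hw).add
      ((((hz.mul hz).mul hw).mul' (h.dom_D i)).const_mul γ)) hq
  · exact fun i => weighted_mono h hZ ((((((((hz1 i).mul (hz1 i)).mul hw).const_mul 2).add
      (((hz.mul (hz2 i i)).mul hw).const_mul 2)).add
        ((((hz.mul (hz1 i)).mul hw).mul' (h.dom_D i)).const_mul _)).add
        ((((hz.mul hz).mul hw).mul' ((h.dom_D i).mul' (h.dom_D i))).const_mul _)).add
        ((((hz.mul hz).mul hw).mul' (h.dom_DD i i)).const_mul _)) hq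
  · intro s hs x
    have h1 := hasDerivAt_heatFlow hf hM hs x
    have h2 := h.timeDeriv_rpow γ hs x
    refine ((h1.mul h1).mul h2).congr_deriv ?_
    simp only [z, zii, w, rii, Pi.mul_apply]
    ring
  · intro i s hs x
    have h0 := hasLineDerivAt_heatFlow hf hM hs i x
    have h1 := hasLineDerivAt_heatFlowD hf hM hs i i x
    have h2 := h.lineDeriv_rpow γ i hs x
    have h3 := h.lineDeriv_ratio i hs x
    unfold HasLineDerivAt at h0 h1 h2 h3 ⊢
    refine ((((h0.mul h1).const_mul 2).mul h2).add
      ((((h0.mul h0).mul h2).mul h3).const_mul γ)).congr_deriv ?_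
    simp only [z, zi, zii, w, ri, rii, Pi.mul_apply, zero_smul, add_zero]
    ring

end Weighted
end Energy

/-! ### The bilinear heat embedding -/

/-- Bounded measurable functions with bounded support. -/
structure IsBddCompact {d : ℕ} (f : Rd d → ℝ) : Prop where
  meas : Measurable f
  bdd : ∃ M, ∀ y, |f y| ≤ M
  supp : ∃ r, ∀ y, r < ‖y‖ → f y = 0

namespace IsBddCompact
variable {d : ℕ} {f g : Rd d → ℝ}

lemma integrable (h : IsBddCompact f) : Integrable f := by
  obtain ⟨M, hM⟩ := h.bdd
  obtain ⟨r, hr⟩ := h.supp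
  have h1 : IntegrableOn f (Metric.closedBall 0 r) :=
    IntegrableOn.of_bound measure_closedBall_lt_top h.meas.aestronglyMeasurable M
      (Eventually.of_forall hM)
  refine h1.integrable_of_forall_notMem_eq_zero fun x hx => hr x ?_
  simpa using hx

lemma rpow (h : IsBddCompact f) {q : ℝ} (hq : 0 < q) : IsBddCompact (fun y => |f y| ^ q) where
  meas := h.meas.abs.pow_const q
  bdd := by
    obtain ⟨M, hM⟩ := h.bdd
    refine ⟨M ^ q, fun y => ?_⟩
    rw [abs_of_nonneg (Real.rpow_nonneg (abs_nonneg _) _)]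
    exact Real.rpow_le_rpow (abs_nonneg _) (hM y) hq.le
  supp := by
    obtain ⟨r, hr⟩ := h.supp
    exact ⟨r, fun y hy => by rw [hr y hy, abs_zero, Real.zero_rpow hq.ne']⟩

lemma abs (h : IsBddCompact f) : IsBddCompact (fun y => |f y|) := by
  simpa using h.rpow zero_lt_one

lemma add (h : IsBddCompact f) (h' : IsBddCompact g) : IsBddCompact (fun y => f y + g y) where
  meas := h.meas.add h'.meas
  bdd := by
    obtain ⟨M, hM⟩ := h.bdd
    obtain ⟨M', hM'⟩ := h'.bdd
    exact ⟨M + M', fun y => (abs_add_le _ _).trans (add_le_add (hM y) (hM' y))⟩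
  supp := by
    obtain ⟨r, hr⟩ := h.supp
    obtain ⟨r', hr'⟩ := h'.supp
    exact ⟨max r r', fun y hy => by
      rw [hr y ((le_max_left _ _).trans_lt hy), hr' y ((le_max_right _ _).trans_lt hy), add_zero]⟩

end IsBddCompact

section Bilinear
variable {d : ℕ} {f g : Rd d → ℝ} {M r : ℝ}

/-- Jensen's inequality for the heat flow. -/
lemma heatFlow_rpow_le {m : ℝ} (hm : 1 ≤ m) (hf : Measurable f) (hM : ∀ y, |f y| ≤ M)
    (hf0 : ∀ y, 0 ≤ f y) {s : ℝ} (hs : 0 < s) (x : Rd d) :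
    heatFlow f s x ^ m ≤ heatFlow (fun y => f y ^ m) s x := by
  have hk := (isRapidKernel_heatKernel d).integrable hs
  rcases (heatFlow_nonneg hf0 hs x).eq_or_lt with h0 | h0
  · rw [← h0, Real.zero_rpow (by linarith)]
    exact heatFlow_nonneg (fun y => Real.rpow_nonneg (hf0 y) m) hs x
  set Z := heatFlow f s x with hZ
  -- Tangent line of the convex function t^m at the mean Z, obtained from Bernoulli's inequality.
  -- The heat kernel has mass one, so integrating it against the tangent line gives back Z^m.
  have hpt : ∀ y, Z ^ m * (1 - m) + m * Z ^ (m - 1) * f y ≤ f y ^ m := by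
    intro y
    have h1 := one_add_mul_self_le_rpow_one_add (s := f y / Z - 1)
      (by have := div_nonneg (hf0 y) h0.le; linarith) hm
    rw [add_sub_cancel, Real.div_rpow (hf0 y) h0.le, le_div_iff₀ (Real.rpow_pos_of_pos h0 m)] at h1
    refine le_trans (le_of_eq ?_) h1
    rw [Real.rpow_sub_one h0.ne']
    field_simp
    ring
  have hbd : ∀ y, |f y ^ m| ≤ M ^ m := fun y => by
    rw [abs_of_nonneg (Real.rpow_nonneg (hf0 y) m)]
    exact Real.rpow_le_rpow (hf0 y) ((le_abs_self _).trans (hM y)) (by linarith)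
  have i1 := (hk.comp_sub_left x).mul_const (Z ^ m * (1 - m))
  have i2 := (integrable_kernelConv hk hf hM x).const_mul (m * Z ^ (m - 1))
  have i3 := integrable_kernelConv hk (hf.pow_const m) hbd x
  have h2 : ∫ y, (heatKernel s (x - y) * (Z ^ m * (1 - m)) +
      m * Z ^ (m - 1) * (heatKernel s (x - y) * f y)) ≤ ∫ y, heatKernel s (x - y) * f y ^ m := by
    refine integral_mono (i1.add i2) i3 fun y => ?_
    have := mul_le_mul_of_nonneg_left (hpt y) (heatKernel_pos hs (x - y)).le
    linarith
  rw [integral_add i1 i2, integral_mul_const, integral_const_mul,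
    integral_sub_left_eq_self (fun z => heatKernel s z) volume x, integral_heatKernel hs] at h2
  change _ + m * Z ^ (m - 1) * Z ≤ _ at h2
  refine le_trans (le_of_eq ?_) h2
  rw [Real.rpow_sub_one h0.ne']
  field_simp
  ring

lemma integrable_kernelConv_prod {k : Rd d → ℝ} (hk : Integrable k) (hf : Integrable f) :
    Integrable (fun p : Rd d × Rd d => k (p.1 - p.2) * f p.2) (volume.prod volume) := by
  have := hf.convolution_integrand (ContinuousLinearMap.mul ℝ ℝ) hk
  simpa [mul_comm] using this

lemma integral_kernelConv {k : Rd d → ℝ} (hk : Integrable k) (hf : Integrable f) :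
    ∫ x, kernelConv k f x = (∫ z, k z) * ∫ y, f y := by
  unfold kernelConv
  rw [integral_integral_swap (integrable_kernelConv_prod hk hf)]
  simp only [integral_mul_const, integral_sub_right_eq_self, integral_const_mul]

/-- Associativity of convolution. -/
lemma kernelConv_assoc {k₁ k₂ : Rd d → ℝ} (h₁ : Integrable k₁) (h₂ : Integrable k₂)
    (hf : Measurable f) (hM : ∀ y, |f y| ≤ M) (x : Rd d) :
    kernelConv k₁ (kernelConv k₂ f) x = kernelConv (kernelConv k₁ k₂) f x := by
  have hi : Integrable (fun p : Rd d × Rd d => k₁ (x - p.1) * (k₂ (p.1 - p.2) * f p.2))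
      (volume.prod volume) := by
    have h3 : Integrable (fun p : Rd d × Rd d => k₁ (x - p.1) * k₂ (p.1 - p.2))
        (volume.prod volume) := by
      have h4 : Integrable (fun p : Rd d × Rd d => k₁ (x - p.1) * k₂ p.2)
        (volume.prod volume) := (h₁.comp_sub_left x).mul_prod h₂
      -- The shear (z, y) ↦ (z, z - y) reduces joint integrability to that of a tensor product.
      have h5 : MeasurePreserving (fun z : Rd d × Rd d => (z.1, z.1 - z.2))
          (volume.prod volume) (volume.prod volume) := by
        have := (measurePreserving_prod_sub (volume : Measure (Rd d)) (volume : Measure (Rd d)))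
        have h7 := ((MeasurePreserving.id (volume : Measure (Rd d))).prod
          (Measure.measurePreserving_neg (volume : Measure (Rd d)))).comp this
        convert h7 using 2
        simp
      exact h5.integrable_comp_of_integrable h4
    have h8 := h3.mul_bdd (g := fun p : Rd d × Rd d => f p.2) (c := M)
      (hf.comp measurable_snd).aestronglyMeasurable (Eventually.of_forall fun p => hM p.2)
    simpa [mul_assoc] using h8
  unfold kernelConv
  calc ∫ z, k₁ (x - z) * ∫ y, k₂ (z - y) * f y
      = ∫ z, ∫ y, k₁ (x - z) * (k₂ (z - y) * f y) := by simp only [integral_const_mul]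
    _ = ∫ y, ∫ z, k₁ (x - z) * (k₂ (z - y) * f y) := integral_integral_swap hi
    _ = ∫ y, (∫ z, k₁ (x - y - z) * k₂ z) * f y := by
        refine integral_congr_ae (Eventually.of_forall fun y => ?_)
        simp only
        rw [← integral_mul_const, ← integral_sub_right_eq_self
          (fun z => k₁ (x - y - z) * k₂ z * f y) y]
        refine integral_congr_ae (Eventually.of_forall fun z => ?_)
        simp only [sub_sub_sub_cancel_right, mul_assoc]

lemma integral_heatFlow_rpow_le {q : ℝ} (hq : 1 ≤ q) (hf : IsBddCompact f) (hf0 : ∀ y, 0 ≤ f y)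
    {s : ℝ} (hs : 0 < s) : ∫ x, heatFlow f s x ^ q ≤ ∫ x, f x ^ q := by
  obtain ⟨M, hM⟩ := hf.bdd
  have hk := (isRapidKernel_heatKernel d).integrable hs
  have hq' : IsBddCompact (fun y => f y ^ q) := by
    have := hf.rpow (q := q) (by linarith)
    simpa only [abs_of_nonneg (hf0 _)] using this
  have h1 := integral_kernelConv hk hq'.integrable
  rw [integral_heatKernel hs, one_mul] at h1
  rw [← h1]
  refine integral_mono_of_nonneg (Eventually.of_forall fun x => Real.rpow_nonneg
    (heatFlow_nonneg hf0 hs x) q) ?_ (Eventually.of_forall fun x =>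
    heatFlow_rpow_le hq hf.meas hM hf0 hs x)
  exact (integrable_kernelConv_prod hk hq'.integrable).integral_prod_left

lemma IsRapidKernel.intervalIntegrable_integral {k : ℝ → Rd d → ℝ} (hk : IsRapidKernel k) {a b : ℝ}
    (ha : 0 < a) (hab : a ≤ b) : IntervalIntegrable (fun s => ∫ x, k s x) volume a b :=
  (hk.continuousOn_integral.mono fun s hs => by
    rw [uIcc_of_le hab] at hs; exact ha.trans_le hs.1).intervalIntegrable

lemma IsRapidKernel.mul {k k' : ℝ → Rd d → ℝ} (hk : IsRapidKernel k) (hk' : IsRapidKernel k') :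
    IsRapidKernel (fun s x => k s x * k' s x) where
  cont := hk.cont.mul hk'.cont
  decay a b N ha := by
    obtain ⟨C, hC⟩ := hk.decay a b N ha
    obtain ⟨C', hC'⟩ := hk'.decay a b 0 ha
    refine ⟨C * C', fun s hs x => ?_⟩
    have h1 : |k' s x| ≤ C' := by simpa [polyDecay] using hC' s hs x
    rw [abs_mul]
    calc _ ≤ (C * polyDecay N x) * C' :=
          mul_le_mul (hC s hs x) h1 (abs_nonneg _) ((abs_nonneg _).trans (hC s hs x))
      _ = _ := by ring

lemma IsRapidKernel.abs {k : ℝ → Rd d → ℝ} (hk : IsRapidKernel k) :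
    IsRapidKernel (fun s x => |k s x|) where
  cont := hk.cont.abs
  decay a b N ha := by
    obtain ⟨C, hC⟩ := hk.decay a b N ha
    exact ⟨C, fun s hs x => by rw [abs_abs]; exact hC s hs x⟩

lemma isRapidKernel_heatFlowD (hf : IsBddCompact f) (i : Fin d) :
    IsRapidKernel (heatFlowD i f) := by
  obtain ⟨M, hM⟩ := hf.bdd
  obtain ⟨r, hr⟩ := hf.supp
  exact (isRapidKernel_heatKernelD i).kernelConv hf.meas hM hr

lemma isRapidKernel_heatFlowDD (hf : IsBddCompact f) (i j : Fin d) :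
    IsRapidKernel (heatFlowDD i j f) := by
  obtain ⟨M, hM⟩ := hf.bdd
  obtain ⟨r, hr⟩ := hf.supp
  exact (isRapidKernel_heatKernelDD i j).kernelConv hf.meas hM hr

/-- The bilinear heat embedding, for `q ≤ 2 ≤ p`. -/
theorem bilinear_heat_embedding_of_le_two {p q : ℝ} (hpq : p.HolderConjugate q) (hq2 : q ≤ 2) :
    ∃ K : ℝ, 0 < K ∧ ∀ (f g : Rd d → ℝ), IsBddCompact f → IsBddCompact g → ∀ (i j : Fin d)
      (a b : ℝ), 0 < a → a ≤ b →
      ∫ s in a..b, ∫ x, |heatFlowD i f s x * heatFlowD j g s x| ≤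
        K * ((∫ x, |f x| ^ p) + ∫ x, |g x| ^ q) := by
  have hq1 : 1 < q := hpq.symm.lt
  have hp1 : 1 < p := hpq.lt
  have hqq : 0 < q * (q - 1) := mul_pos (by linarith) (by linarith)
  have hp2 : 1 ≤ p - 1 := by
    have := hpq.symm.sub_one_mul_conj
    nlinarith
  -- The first factor is the constant of `integral_weightedEnergy_le`; the second is the cost of
  -- (a+b)^q ≤ 2^q(a^q + b^q) for the initial datum.
  refine ⟨(1 + 4 / (q * (q - 1))) * 2 ^ q, by positivity, fun f g hf hg i j a b ha hab => ?_⟩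
  obtain ⟨Mf, hMf⟩ := hf.bdd
  obtain ⟨rf, hrf⟩ := hf.supp
  obtain ⟨Mg, hMg⟩ := hg.bdd
  obtain ⟨rg, hrg⟩ := hg.supp
  have hfp := hf.rpow (q := p - 1) (by linarith)
  have hG' := hg.abs.add hfp
  -- The datum G = |g| + |f|^(p-1) puts both functions at the scale of g: since (p-1)q = p, the
  -- integral of G^q is controlled by those of |f|^p and |g|^q.
  set G : Rd d → ℝ := fun y => |g y| + |f y| ^ (p - 1) with hGdef
  have hG0 : ∀ y, 0 ≤ G y := fun y => by
    have := Real.rpow_nonneg (abs_nonneg (f y)) (p - 1)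
    have := abs_nonneg (g y)
    simp only [hGdef]; linarith
  have hrhs : 0 ≤ (∫ x, |f x| ^ p) + ∫ x, |g x| ^ q :=
    add_nonneg (integral_rpow_nonneg fun x => abs_nonneg _)
      (integral_rpow_nonneg fun x => abs_nonneg _)
  -- The weights are real powers of the flow W of G and require W > 0, so the trivial datum is
  -- treated apart.
  by_cases hne : G =ᵐ[volume] 0
  · have hf0 : f =ᵐ[volume] 0 := by
      filter_upwards [hne] with y hy
      have h1 := Real.rpow_nonneg (abs_nonneg (f y)) (p - 1)
      have h2 := abs_nonneg (g y)
      have h3 : |f y| ^ (p - 1) = 0 := by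
        simp only [hGdef, Pi.zero_apply] at hy; linarith
      rw [Real.rpow_eq_zero (abs_nonneg _) (by linarith)] at h3
      simpa using h3
    have h0 : ∀ s x, heatFlowD i f s x = 0 := by
      intro s x
      refine integral_eq_zero_of_ae ?_
      filter_upwards [hf0] with y hy
      rw [hy]; simp
    simp only [h0, zero_mul, abs_zero, integral_zero, intervalIntegral.integral_zero]
    positivity
  obtain ⟨M, hM⟩ := hG'.bdd
  obtain ⟨r, hr⟩ := hG'.supp
  have h : IsPositiveDatum G M r := ⟨hG'.meas, hG0, hM, hr, hne⟩
  have hMf' : ∀ y, |(|f y|)| ≤ Mf := fun y => by rw [abs_abs]; exact hMf y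
  have hMg' : ∀ y, |(|g y|)| ≤ Mg := fun y => by rw [abs_abs]; exact hMg y
  -- Jensen gives Z^(p-1) ≤ W, which needs p - 1 ≥ 1, that is q ≤ 2. Since (p-1)(q-1) = 1 this reads
  -- Z ≤ W^(q-1), and 2(q-1) + (2-q) = q.
  have hZf : ∀ s, 0 < s → ∀ x, heatFlow (fun y => |f y|) s x ^ 2 * heatFlow G s x ^ (2 - q)
      ≤ heatFlow G s x ^ q := by
    intro s hs x
    have hW := h.pos hs x
    have hZ0 := heatFlow_nonneg (f := fun y => |f y|) (fun y => abs_nonneg _) hs x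
    obtain ⟨M', hM'⟩ := hfp.bdd
    have h1 : heatFlow (fun y => |f y|) s x ^ (p - 1) ≤ heatFlow G s x :=
      (heatFlow_rpow_le hp2 hf.meas.abs hMf' (fun y => abs_nonneg _) hs x).trans
        (heatFlow_mono hfp.meas hM' hG'.meas hM (fun y => by simp [hGdef]) hs x)
    have h2 : heatFlow (fun y => |f y|) s x ≤ heatFlow G s x ^ (q - 1) := by
      have h3 := Real.rpow_le_rpow (Real.rpow_nonneg hZ0 _) h1 (z := q - 1) (by linarith)
      rwa [← Real.rpow_mul hZ0, show (p - 1) * (q - 1) = 1 by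
        have := hpq.mul_eq_add; linarith, Real.rpow_one] at h3
    calc _ ≤ (heatFlow G s x ^ (q - 1)) ^ 2 * heatFlow G s x ^ (2 - q) := by
          have := Real.rpow_pos_of_pos hW (2 - q)
          gcongr
      _ = heatFlow G s x ^ q := by
          rw [← Real.rpow_natCast, ← Real.rpow_mul hW.le, ← Real.rpow_add hW]
          congr 1; push_cast; ring
  have hZg : ∀ s, 0 < s → ∀ x, heatFlow (fun y => |g y|) s x ^ 2 * heatFlow G s x ^ (q - 2)
      ≤ heatFlow G s x ^ q := by
    intro s hs x
    have hW := h.pos hs x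
    have hZ0 := heatFlow_nonneg (f := fun y => |g y|) (fun y => abs_nonneg _) hs x
    have h1 : heatFlow (fun y => |g y|) s x ≤ heatFlow G s x :=
      heatFlow_mono hg.meas.abs hMg' hG'.meas hM (fun y => by
        simp only [hGdef]; linarith [Real.rpow_nonneg (abs_nonneg (f y)) (p - 1)]) hs x
    calc _ ≤ heatFlow G s x ^ 2 * heatFlow G s x ^ (q - 2) := by
          have := Real.rpow_pos_of_pos hW (q - 2)
          gcongr
      _ = heatFlow G s x ^ q := by
          rw [← Real.rpow_natCast, ← Real.rpow_add hW]
          congr 1; push_cast; ring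
  have e1 := integral_weightedEnergy_le (γ := 2 - q) h hq1 (abs_le.2 ⟨by linarith, by linarith⟩)
    hf.meas hMf hrf hZf ha hab
  have e2 := integral_weightedEnergy_le (γ := q - 2) h hq1 (abs_le.2 ⟨by linarith, by linarith⟩)
    hg.meas hMg hrg hZg ha hab
  have r1 := isRapidKernel_weightedEnergy (γ := 2 - q) h hq1 hf.meas hMf hrf hZf
  have r2 := isRapidKernel_weightedEnergy (γ := q - 2) h hq1 hg.meas hMg hrg hZg
  have r3 := ((isRapidKernel_heatFlowD hf i).mul (isRapidKernel_heatFlowD hg j)).abs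
  have hpt : ∀ s, 0 < s → ∀ x, |heatFlowD i f s x * heatFlowD j g s x| ≤
      1 / 2 * weightedEnergy f G (2 - q) s x + 1 / 2 * weightedEnergy g G (q - 2) s x := by
    intro s hs x
    have hW := h.pos hs x
    have p1 : heatFlowD i f s x ^ 2 * heatFlow G s x ^ (2 - q) ≤ weightedEnergy f G (2 - q) s x :=
      Finset.single_le_sum (f := fun i => heatFlowD i f s x ^ 2 * heatFlow G s x ^ (2 - q))
        (fun k _ => mul_nonneg (sq_nonneg _) (Real.rpow_pos_of_pos hW _).le) (Finset.mem_univ i)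
    have p2 : heatFlowD j g s x ^ 2 * heatFlow G s x ^ (q - 2) ≤ weightedEnergy g G (q - 2) s x :=
      Finset.single_le_sum (f := fun i => heatFlowD i g s x ^ 2 * heatFlow G s x ^ (q - 2))
        (fun k _ => mul_nonneg (sq_nonneg _) (Real.rpow_pos_of_pos hW _).le) (Finset.mem_univ j)
    have p3 : heatFlow G s x ^ (q - 2) = (heatFlow G s x ^ (2 - q))⁻¹ := by
      rw [← Real.rpow_neg hW.le, neg_sub]
    have p4 := Real.rpow_pos_of_pos hW (2 - q)
    rw [p3] at p2
    set w := heatFlow G s x ^ (2 - q)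
    set A := heatFlowD i f s x
    set B := heatFlowD j g s x
    -- The two weights W^(2-q) and W^(q-2) are inverse to each other, so the weighted
    -- arithmetic-geometric inequality separates the two gradients.
    have p5 : |A * B| ≤ 1 / 2 * (A ^ 2 * w) + 1 / 2 * (B ^ 2 * w⁻¹) := by
      rw [abs_mul]
      have p6 : 0 ≤ (|A| * w - |B|) ^ 2 * w⁻¹ := mul_nonneg (sq_nonneg _) (inv_pos.2 p4).le
      have p7 : (|A| * w - |B|) ^ 2 * w⁻¹ = A ^ 2 * w - 2 * (|A| * |B|) + B ^ 2 * w⁻¹ := by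
        rw [← sq_abs A, ← sq_abs B]; field_simp; ring
      linarith
    linarith
  have hmain : ∫ s in a..b, ∫ x, |heatFlowD i f s x * heatFlowD j g s x| ≤
      ∫ s in a..b, (1 / 2 * (∫ x, weightedEnergy f G (2 - q) s x) +
        1 / 2 * ∫ x, weightedEnergy g G (q - 2) s x) := by
    refine intervalIntegral.integral_mono_on hab (r3.intervalIntegrable_integral ha hab)
      (((r1.intervalIntegrable_integral ha hab).const_mul _).add
        ((r2.intervalIntegrable_integral ha hab).const_mul _)) fun s hs => ?_
    have hs0 : 0 < s := ha.trans_le hs.1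
    rw [← integral_const_mul, ← integral_const_mul, ← integral_add
      ((r1.integrable hs0).const_mul _) ((r2.integrable hs0).const_mul _)]
    exact integral_mono (r3.integrable hs0)
      (((r1.integrable hs0).const_mul _).add ((r2.integrable hs0).const_mul _)) (hpt s hs0)
  rw [intervalIntegral.integral_add ((r1.intervalIntegrable_integral ha hab).const_mul _)
    ((r2.intervalIntegrable_integral ha hab).const_mul _), intervalIntegral.integral_const_mul,
    intervalIntegral.integral_const_mul] at hmain
  have e3 : ∫ x, heatFlow G a x ^ q ≤ 2 ^ q * ((∫ x, |f x| ^ p) + ∫ x, |g x| ^ q) := by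
    refine (integral_heatFlow_rpow_le hq1.le hG' hG0 ha).trans ?_
    have ip := (hf.rpow (q := p) (by linarith)).integrable
    have iq := (hg.rpow (q := q) (by linarith)).integrable
    rw [← integral_add ip iq, ← integral_const_mul]
    refine integral_mono_of_nonneg (Eventually.of_forall fun x => Real.rpow_nonneg (hG0 x) q)
      ((ip.add iq).const_mul _) (Eventually.of_forall fun x => ?_)
    have a1 := abs_nonneg (g x)
    have a2 := Real.rpow_nonneg (abs_nonneg (f x)) (p - 1)
    have a3 : (|f x| ^ (p - 1)) ^ q = |f x| ^ p := by
      rw [← Real.rpow_mul (abs_nonneg _), hpq.sub_one_mul_conj]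
    have a4 : G x ≤ 2 * max |g x| (|f x| ^ (p - 1)) := by
      have := le_max_left |g x| (|f x| ^ (p - 1))
      have := le_max_right |g x| (|f x| ^ (p - 1))
      simp only [hGdef]; linarith
    have a5 := Real.rpow_le_rpow (hG0 x) a4 (z := q) (by linarith)
    rw [Real.mul_rpow (by norm_num) (le_max_of_le_left a1)] at a5
    refine a5.trans (mul_le_mul_of_nonneg_left ?_ (by positivity))
    simp only [← a3]
    rcases max_cases |g x| (|f x| ^ (p - 1)) with ⟨h1, -⟩ | ⟨h1, -⟩ <;> rw [h1]
    · exact le_add_of_nonneg_left (Real.rpow_nonneg a2 _)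
    · exact le_add_of_nonneg_right (Real.rpow_nonneg a1 _)
  have hc : 0 ≤ 1 + 4 / (q * (q - 1)) := by positivity
  have e4 := mul_le_mul_of_nonneg_left e3 hc
  linarith

/-- The bilinear heat embedding. -/
theorem bilinear_heat_embedding {p q : ℝ} (hpq : p.HolderConjugate q) :
    ∃ K : ℝ, 0 < K ∧ ∀ (f g : Rd d → ℝ), IsBddCompact f → IsBddCompact g → ∀ (i j : Fin d)
      (a b : ℝ), 0 < a → a ≤ b →
      ∫ s in a..b, ∫ x, |heatFlowD i f s x * heatFlowD j g s x| ≤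
        K * ((∫ x, |f x| ^ p) + ∫ x, |g x| ^ q) := by
  rcases le_or_gt q 2 with hq | hq
  -- The statement is symmetric in (f, p) and (g, q), and one of the two conjugate exponents is at
  -- most 2.
  · exact bilinear_heat_embedding_of_le_two hpq hq
  · have hp : p ≤ 2 := by
      have h1 := hpq.mul_eq_add
      have h2 := hpq.lt
      nlinarith
    obtain ⟨K, hK, h⟩ := bilinear_heat_embedding_of_le_two (d := d) hpq.symm hp
    refine ⟨K, hK, fun f g hf hg i j a b ha hab => ?_⟩
    have := h g f hg hf j i a b ha hab
    simp only [mul_comm (heatFlowD j g _ _)] at this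
    rwa [add_comm]

end Bilinear

/-! ### Truncated second-order Riesz transforms -/

section Riesz
variable {d : ℕ} {f g : Rd d → ℝ} {M : ℝ}

lemma kernelConv_comm (k f : Rd d → ℝ) (x : Rd d) : kernelConv k f x = kernelConv f k x := by
  rw [kernelConv_eq]; simp only [kernelConv, mul_comm]

lemma IsRapidKernel.exists_bound {k : ℝ → Rd d → ℝ} (h : IsRapidKernel k) {s : ℝ} (hs : 0 < s) :
    ∃ C, ∀ z, |k s z| ≤ C := by
  obtain ⟨C, hC⟩ := h.decay s s 0 hs
  exact ⟨C, fun z => by simpa [polyDecay] using hC s ⟨le_rfl, le_rfl⟩ z⟩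

/-- The semigroup law at equal times. The exponent splits by |x-y|² + |y|² = |x|²/2 + 2|y - x/2|²,
leaving a Gaussian integral centred at x/2. -/
lemma kernelConv_heatKernel {s : ℝ} (hs : 0 < s) (x : Rd d) :
    kernelConv (heatKernel s) (heatKernel s) x = heatKernel (2 * s) x := by
  unfold kernelConv heatKernel
  set c := (4 * Real.pi * s) ^ (-(d : ℝ) / 2) with hc
  have e : ∀ y : Rd d, c * Real.exp (-(‖x - y‖ ^ 2 / (4 * s))) *
      (c * Real.exp (-(‖y‖ ^ 2 / (4 * s)))) =
      c * c * Real.exp (-(‖x‖ ^ 2 / (4 * (2 * s)))) *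
        Real.exp (-(1 / (2 * s)) * ‖y - (1 / 2 : ℝ) • x‖ ^ 2) := by
    intro y
    have h1 : Real.exp (-(‖x - y‖ ^ 2 / (4 * s))) * Real.exp (-(‖y‖ ^ 2 / (4 * s))) =
        Real.exp (-(‖x‖ ^ 2 / (4 * (2 * s)))) *
        Real.exp (-(1 / (2 * s)) * ‖y - (1 / 2 : ℝ) • x‖ ^ 2) := by
      rw [← Real.exp_add, ← Real.exp_add]
      congr 1
      rw [norm_sub_sq_real, norm_sub_sq_real, norm_smul, inner_smul_right, real_inner_comm x y]
      norm_num
      field_simp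
      ring
    linear_combination (c * c) * h1
  simp only [e]
  rw [integral_const_mul, integral_sub_right_eq_self
    (fun y : Rd d => Real.exp (-(1 / (2 * s)) * ‖y‖ ^ 2)),
    GaussianFourier.integral_rexp_neg_mul_sq_norm (by positivity)]
  have hp := Real.pi_pos
  have h2 : c * c * (Real.pi / (1 / (2 * s))) ^ (Module.finrank ℝ (Rd d) / 2 : ℝ)
      = (4 * Real.pi * (2 * s)) ^ (-(d : ℝ) / 2) := by
    have h3 : Real.pi / (1 / (2 * s)) = 2 * Real.pi * s := by field_simp
    rw [h3, finrank_euclideanSpace_fin, show ((d : ℝ) / 2) = -(-(d : ℝ) / 2) by ring,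
      Real.rpow_neg (by positivity), hc, ← Real.mul_rpow (by positivity) (by positivity),
      ← div_eq_mul_inv, ← Real.div_rpow (by positivity) (by positivity)]
    congr 1
    field_simp
    ring
  linear_combination (Real.exp (-(‖x‖ ^ 2 / (4 * (2 * s))))) * h2

lemma kernelConv_heatKernelD_left {s : ℝ} (hs : 0 < s) (i : Fin d) (x : Rd d) :
    kernelConv (heatKernelD i s) (heatKernel s) x = heatKernelD i (2 * s) x := by
  obtain ⟨C, hC⟩ := (isRapidKernel_heatKernel d).exists_bound hs
  have h1 := (isRapidKernel_heatKernel d).hasLineDerivAt_kernelConv (isRapidKernel_heatKernelD i)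
    hs (hasLineDerivAt_heatKernel i) ((isRapidKernel_heatKernel d).continuous hs).measurable hC x
  rw [show kernelConv (heatKernel s) (heatKernel s) = heatKernel (d := d) (2 * s) from
    funext (kernelConv_heatKernel hs)] at h1
  exact h1.unique (hasLineDerivAt_heatKernel i x)

/-- Both sides are line derivatives of the same function by the semigroup law, so uniqueness of the
derivative identifies them without computing an integral. -/
lemma kernelConv_heatKernelD {s : ℝ} (hs : 0 < s) (i j : Fin d) (x : Rd d) :
    kernelConv (heatKernelD i s) (heatKernelD j s) x = heatKernelDD i j (2 * s) x := by
  obtain ⟨C, hC⟩ := (isRapidKernel_heatKernelD j).exists_bound hs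
  have h1 := (isRapidKernel_heatKernel d).hasLineDerivAt_kernelConv (isRapidKernel_heatKernelD i)
    hs (hasLineDerivAt_heatKernel i) ((isRapidKernel_heatKernelD j).continuous hs).measurable hC x
  rw [show kernelConv (heatKernel s) (heatKernelD j s) = heatKernelD (d := d) j (2 * s) from
    funext fun y => by rw [kernelConv_comm, kernelConv_heatKernelD_left hs]] at h1
  exact h1.unique (hasLineDerivAt_heatKernelD i j x)

lemma heatKernelD_neg (i : Fin d) (s : ℝ) (z : Rd d) :
    heatKernelD i s (-z) = -heatKernelD i s z := by
  simp [heatKernelD, heatKernel_neg, neg_div]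

/-- Summation by parts for the heat flow. -/
lemma integral_heatFlowD_mul (hf : IsBddCompact f) (hg : IsBddCompact g) (i j : Fin d) {s : ℝ}
    (hs : 0 < s) : ∫ z, heatFlowD i f s z * heatFlowD j g s z =
      -∫ x, heatFlowDD j i f (2 * s) x * g x := by
  obtain ⟨M, hM⟩ := hf.bdd
  have hu := isRapidKernel_heatFlowD hf i
  obtain ⟨C, hC⟩ := hu.exists_bound hs
  have hum := (hu.continuous hs).measurable
  have hk := isRapidKernel_heatKernelD (d := d)
  have hi : Integrable (fun p : Rd d × Rd d =>
      heatFlowD i f s p.1 * (heatKernelD j s (p.1 - p.2) * g p.2)) (volume.prod volume) :=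
    (integrable_kernelConv_prod ((hk j).integrable hs) hg.integrable).bdd_mul (c := C)
      (hum.comp measurable_fst).aestronglyMeasurable (Eventually.of_forall fun p => hC p.1)
  calc ∫ z, heatFlowD i f s z * heatFlowD j g s z
      = ∫ z, ∫ x, heatFlowD i f s z * (heatKernelD j s (z - x) * g x) := by
        simp only [integral_const_mul]; rfl
    _ = ∫ x, ∫ z, heatFlowD i f s z * (heatKernelD j s (z - x) * g x) :=
        integral_integral_swap hi
    _ = ∫ x, -(heatFlowDD j i f (2 * s) x * g x) := by
        refine integral_congr_ae (Eventually.of_forall fun x => ?_)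
        have h1 : heatFlowDD j i f (2 * s) x = kernelConv (heatKernelD j s) (heatFlowD i f s) x := by
          have := kernelConv_assoc ((hk j).integrable hs) ((hk i).integrable hs) hf.meas hM x
          rw [show kernelConv (heatKernelD j s) (heatKernelD i s) = heatKernelDD (d := d) j i (2 * s)
            from funext (kernelConv_heatKernelD hs j i)] at this
          exact this.symm
        simp only
        rw [h1, kernelConv, ← integral_mul_const, ← integral_neg]
        refine integral_congr_ae (Eventually.of_forall fun z => ?_)
        simp only
        -- The first derivatives of the kernel are odd: moving one of them to the other factor
        -- produces the minus sign.
        rw [← neg_sub x z, heatKernelD_neg]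
        ring
    _ = _ := integral_neg _

/-- The truncated second-order Riesz transform. -/
def rieszTrunc (i j : Fin d) (a b : ℝ) (f : Rd d → ℝ) (x : Rd d) : ℝ :=
  ∫ s in a..b, heatFlowDD i j f (2 * s) x

lemma IsRapidKernel.comp_two_mul {k : ℝ → Rd d → ℝ} (h : IsRapidKernel k) :
    IsRapidKernel (fun s x => k (2 * s) x) where
  cont := h.cont.comp (f := fun p : ℝ × Rd d => (2 * p.1, p.2)) (by fun_prop) fun p hp =>
    ⟨mul_pos (two_pos (α := ℝ)) (show (0 : ℝ) < p.1 from hp.1), mem_univ _⟩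
  decay a b N ha := by
    obtain ⟨C, hC⟩ := h.decay (2 * a) (2 * b) N (by positivity)
    exact ⟨C, fun s hs x => hC _ ⟨by linarith [hs.1], by linarith [hs.2]⟩ x⟩

lemma IsRapidKernel.intervalIntegral_decay {k : ℝ → Rd d → ℝ} (h : IsRapidKernel k) {a b : ℝ}
    (ha : 0 < a) (hab : a ≤ b) (N : ℕ) : ∃ C, ∀ x, |∫ s in a..b, k s x| ≤ C * polyDecay N x := by
  obtain ⟨C, hC⟩ := h.decay a b N ha
  refine ⟨C * |b - a|, fun x => ?_⟩
  have := intervalIntegral.norm_integral_le_of_norm_le_const (a := a) (b := b)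
    (f := fun s => k s x) (C := C * polyDecay N x) fun s hs => by
      rw [uIoc_of_le hab] at hs
      exact hC s ⟨hs.1.le, hs.2⟩ x
  rw [Real.norm_eq_abs] at this
  linarith

lemma IsRapidKernel.continuous_intervalIntegral {k : ℝ → Rd d → ℝ} (h : IsRapidKernel k) {a b : ℝ}
    (ha : 0 < a) (hab : a ≤ b) : Continuous fun x => ∫ s in a..b, k s x := by
  obtain ⟨C, hC⟩ := h.decay a b 0 ha
  have hpos : ∀ s ∈ uIoc a b, 0 < s := fun s hs => by
    rw [uIoc_of_le hab] at hs; exact ha.trans hs.1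
  refine intervalIntegral.continuous_of_dominated_interval (bound := fun _ => C) ?_ ?_ ?_ ?_
  · intro x
    exact ((h.continuousOn_time x).mono hpos).aestronglyMeasurable measurableSet_uIoc
  · refine fun x => Eventually.of_forall fun s hs => ?_
    rw [uIoc_of_le hab] at hs
    simpa [polyDecay] using hC s ⟨hs.1.le, hs.2⟩ x
  · exact intervalIntegrable_const
  · exact Eventually.of_forall fun s hs => h.continuous (hpos s hs)

/-- The doubled time in `rieszTrunc` is e^(2sΔ) = e^(sΔ)e^(sΔ): one semigroup and one derivative go
to each factor, which is the form that the bilinear embedding controls. -/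
lemma abs_integral_rieszTrunc_mul_le (hf : IsBddCompact f) (hg : IsBddCompact g) (i j : Fin d)
    {a b : ℝ} (ha : 0 < a) (hab : a ≤ b) :
    |∫ x, rieszTrunc j i a b f x * g x| ≤
      ∫ s in a..b, ∫ x, |heatFlowD i f s x * heatFlowD j g s x| := by
  have hR := (isRapidKernel_heatFlowDD hf j i).comp_two_mul
  obtain ⟨M, hM⟩ := hg.bdd
  have hsub : uIoc a b = Ioc a b := uIoc_of_le hab
  have hi : Integrable (Function.uncurry fun s x => heatFlowDD j i f (2 * s) x * g x)
      ((volume.restrict (uIoc a b)).prod volume) := by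
    have h1 := (hR.integrable_prod (b := b) ha).mul_bdd (g := fun p : ℝ × Rd d => g p.2) (c := M)
      (hg.meas.comp measurable_snd).aestronglyMeasurable (Eventually.of_forall fun p => hM p.2)
    refine h1.mono_measure ?_
    rw [hsub]
    exact Measure.prod_mono (Measure.restrict_mono Ioc_subset_Icc_self le_rfl) le_rfl
  have e1 : ∫ x, rieszTrunc j i a b f x * g x
      = ∫ s in a..b, ∫ x, heatFlowDD j i f (2 * s) x * g x := by
    rw [intervalIntegral_integral_swap hi]
    simp only [rieszTrunc, intervalIntegral.integral_mul_const]
  have e2 : ∫ s in a..b, ∫ x, heatFlowDD j i f (2 * s) x * g x =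
      ∫ s in a..b, -∫ x, heatFlowD i f s x * heatFlowD j g s x := by
    refine intervalIntegral.integral_congr fun s hs => ?_
    rw [uIcc_of_le hab] at hs
    simp only [integral_heatFlowD_mul hf hg i j (ha.trans_le hs.1), neg_neg]
  rw [e1, e2, intervalIntegral.integral_neg, abs_neg]
  refine (intervalIntegral.abs_integral_le_integral_abs hab).trans ?_
  have hD := (isRapidKernel_heatFlowD hf i).mul (isRapidKernel_heatFlowD hg j)
  refine intervalIntegral.integral_mono_on hab (hD.intervalIntegrable_integral ha hab).abs
    (hD.abs.intervalIntegrable_integral ha hab) fun s _ => ?_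
  exact norm_integral_le_integral_norm (fun x => heatFlowD i f s x * heatFlowD j g s x)

/-- `L^p` bound for the truncated Riesz transforms of bounded compactly supported functions. -/
theorem integral_rieszTrunc_rpow_le {p : ℝ} (hp : 1 < p) : ∃ K : ℝ, 0 < K ∧
    ∀ f : Rd d → ℝ, IsBddCompact f → ∀ (i j : Fin d) (a b : ℝ), 0 < a → a ≤ b →
      Integrable (fun x => |rieszTrunc i j a b f x| ^ p) ∧
      ∫ x, |rieszTrunc i j a b f x| ^ p ≤ K * ∫ x, |f x| ^ p := by
  have hpq := Real.HolderConjugate.conjExponent hp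
  set q := Real.conjExponent p
  have hq1 : 1 < q := hpq.symm.lt
  obtain ⟨K, hK, hemb⟩ := bilinear_heat_embedding (d := d) hpq
  -- The value is fixed by Kc^q = c/2. The embedding is not homogeneous, and this scaling of the
  -- test function lets its own contribution be absorbed on the left.
  set c : ℝ := (2 * K) ^ (-(1 / (q - 1))) with hc
  have hc0 : 0 < c := by positivity
  have hcq : c ^ q = c * (2 * K)⁻¹ := by
    have h1 : c ^ (q - 1) = (2 * K)⁻¹ := by
      rw [hc, ← Real.rpow_mul (by positivity), neg_mul, one_div_mul_cancel (by linarith),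
        Real.rpow_neg_one]
    rw [← h1, ← Real.rpow_one_add' hc0.le (by linarith)]
    congr 1; ring
  refine ⟨2 * K / c, by positivity, fun f hf j i a b ha hab => ?_⟩
  set S := rieszTrunc j i a b f with hS
  have hR := (isRapidKernel_heatFlowDD hf j i).comp_two_mul
  have hSc : Continuous S := hR.continuous_intervalIntegral ha hab
  obtain ⟨C, hC⟩ := hR.intervalIntegral_decay ha hab (d + 1)
  change ∀ x, |S x| ≤ _ at hC
  have hC0 : 0 ≤ C := nonneg_of_mul_nonneg_left ((abs_nonneg _).trans (hC 0)) (polyDecay_pos _ _)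
  have hSb : ∀ x, |S x| ≤ C := fun x => (hC x).trans
    (mul_le_of_le_one_right hC0 (polyDecay_le_one _ _))
  have hSi : Integrable (fun x => |S x| ^ p) := by
    refine (((integrable_polyDecay (Nat.lt_succ_self d)).const_mul C).const_mul
      (C ^ (p - 1))).mono' (hSc.abs.measurable.pow_const p).aestronglyMeasurable
      (Eventually.of_forall fun x => ?_)
    rw [Real.norm_of_nonneg (Real.rpow_nonneg (abs_nonneg _) _),
      show p = (p - 1) + 1 by ring, Real.rpow_add' (abs_nonneg _) (by linarith), Real.rpow_one,
      add_sub_cancel_right]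
    exact mul_le_mul (Real.rpow_le_rpow (abs_nonneg _) (hSb x) (by linarith)) (hC x)
      (abs_nonneg _) (Real.rpow_nonneg hC0 _)
  refine ⟨hSi, ?_⟩
  have hA : 0 ≤ ∫ x, |f x| ^ p := integral_rpow_nonneg fun x => abs_nonneg _
  -- Cutting off to a ball gives the test function bounded support; the bound does not depend on the
  -- ball.
  have key : ∀ n : ℕ, ∫ x in Metric.closedBall 0 n, |S x| ^ p ≤ 2 * K / c * ∫ x, |f x| ^ p := by
    intro n
    set B : Set (Rd d) := Metric.closedBall 0 n
    have hBm : MeasurableSet B := Metric.isClosed_closedBall.measurableSet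
    -- The extremal dual function: Sg = c|S|^p and |g|^q = c^q|S|^p on the ball.
    let g : Rd d → ℝ := B.indicator fun x => c * (SignType.sign (S x) * |S x| ^ (p - 1))
    have hsm : Measurable fun x => ((SignType.sign (S x) : SignType) : ℝ) := by
      have h1 : ∀ t : ℝ, ((SignType.sign t : SignType) : ℝ) =
          if 0 < t then 1 else if t < 0 then -1 else 0 := by
        intro t
        rcases lt_trichotomy t 0 with h | h | h
        · simp [h, h.not_gt]
        · simp [h]
        · simp [h]
      simp only [h1]
      exact Measurable.ite (measurableSet_lt measurable_const hSc.measurable) measurable_const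
        (Measurable.ite (measurableSet_lt hSc.measurable measurable_const) measurable_const
          measurable_const)
    have habs : ∀ x, |c * (SignType.sign (S x) * |S x| ^ (p - 1))| = c * |S x| ^ (p - 1) := by
      intro x
      rw [abs_mul, abs_mul, abs_of_pos hc0, abs_of_nonneg (Real.rpow_nonneg (abs_nonneg _) _)]
      rcases eq_or_ne (S x) 0 with h | h
      · simp [h, Real.zero_rpow (show p - 1 ≠ 0 by linarith)]
      · have : |((SignType.sign (S x) : SignType) : ℝ)| = 1 := by
          rcases h.lt_or_gt with h | h <;> simp [h]
        rw [this, one_mul]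
    have hg : IsBddCompact g := by
      refine ⟨(((hsm.mul (hSc.abs.measurable.pow_const _))).const_mul c).indicator hBm, ?_, ?_⟩
      · refine ⟨c * C ^ (p - 1), fun y => ?_⟩
        by_cases hy : y ∈ B
        · simp only [g, indicator_of_mem hy, habs]
          exact mul_le_mul_of_nonneg_left
            (Real.rpow_le_rpow (abs_nonneg _) (hSb y) (by linarith)) hc0.le
        · simp only [g, indicator_of_notMem hy, abs_zero]
          positivity
      · refine ⟨n, fun y hy => indicator_of_notMem ?_ _⟩
        simp only [B, Metric.mem_closedBall, dist_zero_right, not_le]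
        exact hy
    have e1 : ∫ x, S x * g x = c * ∫ x in B, |S x| ^ p := by
      rw [← integral_const_mul, ← integral_indicator hBm]
      refine integral_congr_ae (Eventually.of_forall fun x => ?_)
      by_cases hx : x ∈ B
      · simp only [g, indicator_of_mem hx]
        have h1 : S x * SignType.sign (S x) = |S x| := by
          rw [mul_comm]; exact sign_mul_self (S x)
        have h2 : |S x| * |S x| ^ (p - 1) = |S x| ^ p := by
          rw [← Real.rpow_one_add' (abs_nonneg _) (by linarith)]
          congr 1; ring
        rw [← h2, ← h1]
        rw [h1]
        linear_combination (c * |S x| ^ (p - 1)) * h1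
      · simp [g, indicator_of_notMem hx]
    have e2 : ∫ x, |g x| ^ q = c ^ q * ∫ x in B, |S x| ^ p := by
      rw [← integral_const_mul, ← integral_indicator hBm]
      refine integral_congr_ae (Eventually.of_forall fun x => ?_)
      by_cases hx : x ∈ B
      · simp only [g, indicator_of_mem hx, habs]
        rw [Real.mul_rpow hc0.le (Real.rpow_nonneg (abs_nonneg _) _),
          ← Real.rpow_mul (abs_nonneg _), hpq.sub_one_mul_conj]
      · simp [g, indicator_of_notMem hx, Real.zero_rpow (show q ≠ 0 by linarith)]
    have h1 := (le_abs_self _).trans (abs_integral_rieszTrunc_mul_le hf hg i j ha hab)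
    have h2 := h1.trans (hemb f g hf hg i j a b ha hab)
    rw [← hS, e1, e2, hcq] at h2
    rw [div_mul_eq_mul_div, le_div_iff₀ hc0]
    have h3 : K * (c * (2 * K)⁻¹ * ∫ x in B, |S x| ^ p) = c / 2 * ∫ x in B, |S x| ^ p := by
      field_simp
    rw [mul_add, h3] at h2
    linarith
  have hlim := (aecover_closedBall (μ := volume) (x := (0 : Rd d))
    (tendsto_natCast_atTop_atTop (R := ℝ))).integral_tendsto_of_countably_generated hSi
  exact le_of_tendsto' hlim key

/-- A decaying kernel times an `L^p` function is integrable. -/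
lemma integrable_mul_of_memLp {k : Rd d → ℝ} {p : ℝ≥0∞} {C : ℝ} {x : Rd d} (hp : 1 ≤ p)
    (hp' : p ≠ ⊤) (hk : Measurable k) (hC : ∀ y, |k y| ≤ C * polyDecay (d + 1) (x - y))
    (hf : MemLp f p) : Integrable (fun y => k y * f y) := by
  have hp0 : p ≠ 0 := (zero_lt_one.trans_le hp).ne'
  have hpr : 1 ≤ p.toReal := by
    rw [← ENNReal.toReal_one]
    exact (ENNReal.toReal_le_toReal ENNReal.one_ne_top hp').2 hp
  have hC0 : 0 ≤ C := nonneg_of_mul_nonneg_left ((abs_nonneg _).trans (hC 0)) (polyDecay_pos _ _)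
  have h1 := (integrable_norm_rpow_iff hf.1 hp0 hp').2 hf
  refine ((((integrable_polyDecay (Nat.lt_succ_self d)).comp_sub_left x).add h1).const_mul C).mono'
    (hk.aestronglyMeasurable.mul hf.1) (Eventually.of_forall fun y => ?_)
  -- This crude bound replaces Hölder: the constant is integrated against the decaying kernel, and
  -- |f|^p against a bounded one.
  have h2 : |f y| ≤ 1 + |f y| ^ p.toReal := by
    rcases le_or_gt |f y| 1 with h | h
    · linarith [Real.rpow_nonneg (abs_nonneg (f y)) p.toReal]
    · have := Real.rpow_le_rpow_of_exponent_le h.le hpr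
      rw [Real.rpow_one] at this
      linarith
  have h3 := (polyDecay_pos (d + 1) (x - y)).le
  have h4 := polyDecay_le_one (d + 1) (x - y)
  have h5 := Real.rpow_nonneg (abs_nonneg (f y)) p.toReal
  rw [norm_mul, Real.norm_eq_abs, Real.norm_eq_abs]
  calc |k y| * |f y| ≤ (C * polyDecay (d + 1) (x - y)) * (1 + |f y| ^ p.toReal) :=
        mul_le_mul (hC y) h2 (abs_nonneg _) (mul_nonneg hC0 h3)
    _ ≤ C * (polyDecay (d + 1) (x - y) + |f y| ^ p.toReal) := by
        rw [mul_assoc]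
        refine mul_le_mul_of_nonneg_left ?_ hC0
        nlinarith

/-- `L^p` bound for the truncated Riesz transforms of continuous functions. -/
theorem eLpNorm_rieszTrunc_le {p : ℝ≥0∞} (hp : 1 < p) (hp' : p ≠ ⊤) : ∃ K : ℝ≥0,
    ∀ f : Rd d → ℝ, Continuous f → MemLp f p → ∀ (i j : Fin d) (a b : ℝ), 0 < a → a ≤ b →
      AEStronglyMeasurable (rieszTrunc i j a b f) ∧
      eLpNorm (rieszTrunc i j a b f) p ≤ K * eLpNorm f p := by
  have hp0 : p ≠ 0 := (zero_lt_one.trans hp).ne'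
  have hpr : 1 < p.toReal := by
    rw [← ENNReal.toReal_one]
    exact (ENNReal.toReal_lt_toReal ENNReal.one_ne_top hp').2 hp
  obtain ⟨K, hK, hbd⟩ := integral_rieszTrunc_rpow_le (d := d) hpr
  refine ⟨(K ^ (p.toReal⁻¹)).toNNReal, fun f hf hfp i j a b ha hab => ?_⟩
  -- Truncations to balls are bounded by continuity of f; the transforms converge pointwise and
  -- Fatou's lemma carries the L^p bound over.
  let fn : ℕ → Rd d → ℝ := fun n => (Metric.closedBall 0 (n : ℝ)).indicator f
  have hfn : ∀ n, IsBddCompact (fn n) := by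
    intro n
    refine ⟨hf.measurable.indicator Metric.isClosed_closedBall.measurableSet, ?_, ?_⟩
    · obtain ⟨C, hC⟩ := (isCompact_closedBall (0 : Rd d) (n : ℝ)).exists_bound_of_continuousOn
        hf.continuousOn
      refine ⟨max C 0, fun y => ?_⟩
      by_cases hy : y ∈ Metric.closedBall (0 : Rd d) (n : ℝ)
      · simp only [fn, indicator_of_mem hy]
        exact (hC y hy).trans (le_max_left _ _)
      · simp [fn, indicator_of_notMem hy]
    · refine ⟨n, fun y hy => indicator_of_notMem ?_ _⟩
      simp only [Metric.mem_closedBall, dist_zero_right, not_le]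
      exact hy
  have habs : ∀ n y, |fn n y| ≤ |f y| := fun n y => by
    by_cases hy : y ∈ Metric.closedBall (0 : Rd d) (n : ℝ)
    · simp [fn, indicator_of_mem hy]
    · simp [fn, indicator_of_notMem hy]
  have hptw : ∀ y, ∀ᶠ n in atTop, fn n y = f y := fun y => by
    obtain ⟨N, hN⟩ := exists_nat_ge ‖y‖
    filter_upwards [eventually_ge_atTop N] with n hn
    refine indicator_of_mem ?_ _
    simp only [Metric.mem_closedBall, dist_zero_right]
    exact hN.trans (by exact_mod_cast hn)
  have hR := (isRapidKernel_heatKernelDD (d := d) i j).comp_two_mul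
  obtain ⟨C, hC⟩ := hR.decay a b (d + 1) ha
  have hint : ∀ x, Integrable (fun y => polyDecay (d + 1) (x - y) * |f y|) := by
    intro x
    refine integrable_mul_of_memLp (C := 1) hp.le hp' ((continuous_polyDecay _).comp
      (by fun_prop)).measurable (x := x) (fun y => ?_) hfp.abs
    rw [abs_of_pos (polyDecay_pos _ _), one_mul]
  have hlim : ∀ x, Tendsto (fun n => rieszTrunc i j a b (fn n) x) atTop
      (𝓝 (rieszTrunc i j a b f x)) := by
    intro x
    unfold rieszTrunc heatFlowDD kernelConv
    refine intervalIntegral.tendsto_integral_filter_of_dominated_convergence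
      (fun _ => C * ∫ y, polyDecay (d + 1) (x - y) * |f y|) ?_ ?_ ?_ ?_
    · refine Eventually.of_forall fun n => ?_
      have := ((isRapidKernel_heatFlowDD (hfn n) i j).comp_two_mul).continuousOn_time x
      refine (this.mono fun s hs => ?_).aestronglyMeasurable measurableSet_uIoc
      rw [uIoc_of_le hab] at hs
      exact ha.trans hs.1
    · refine Eventually.of_forall fun n => Eventually.of_forall fun s hs => ?_
      rw [uIoc_of_le hab] at hs
      rw [← integral_const_mul]
      refine (norm_integral_le_integral_norm _).trans ?_
      refine integral_mono_of_nonneg (Eventually.of_forall fun z => norm_nonneg _)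
        ((hint x).const_mul C) (Eventually.of_forall fun y => ?_)
      simp only [norm_mul, Real.norm_eq_abs]
      rw [← mul_assoc]
      exact mul_le_mul (hC s ⟨hs.1.le, hs.2⟩ _) (habs n y) (abs_nonneg _)
        ((abs_nonneg _).trans (hC s ⟨hs.1.le, hs.2⟩ _))
    · exact intervalIntegrable_const
    · refine Eventually.of_forall fun s hs => ?_
      rw [uIoc_of_le hab] at hs
      have hs0 : 0 < s := ha.trans hs.1
      refine tendsto_integral_of_dominated_convergence
        (fun y => C * (polyDecay (d + 1) (x - y) * |f y|)) ?_ ((hint x).const_mul C) ?_ ?_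
      · exact fun n => (((hR.continuous hs0).measurable.comp (by fun_prop)).mul
          (hfn n).meas).aestronglyMeasurable
      · refine fun n => Eventually.of_forall fun y => ?_
        simp only [norm_mul, Real.norm_eq_abs]
        rw [← mul_assoc]
        exact mul_le_mul (hC s ⟨hs.1.le, hs.2⟩ _) (habs n y) (abs_nonneg _)
          ((abs_nonneg _).trans (hC s ⟨hs.1.le, hs.2⟩ _))
      · refine Eventually.of_forall fun y => tendsto_const_nhds.congr' ?_
        filter_upwards [hptw y] with n hn
        rw [hn]
  have hcont : ∀ n, Continuous (rieszTrunc i j a b (fn n)) := fun n =>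
    ((isRapidKernel_heatFlowDD (hfn n) i j).comp_two_mul).continuous_intervalIntegral ha hab
  refine ⟨aestronglyMeasurable_of_tendsto_ae atTop (fun n => (hcont n).aestronglyMeasurable)
    (Eventually.of_forall hlim), ?_⟩
  refine (Lp.eLpNorm_lim_le_liminf_eLpNorm (fun n => (hcont n).aestronglyMeasurable) _
    (Eventually.of_forall hlim)).trans ?_
  have hn : ∀ n, eLpNorm (rieszTrunc i j a b (fn n)) p ≤
      ((K ^ (p.toReal⁻¹)).toNNReal : ℝ≥0∞) * eLpNorm f p := by
    intro n
    obtain ⟨hi, hle⟩ := hbd (fn n) (hfn n) i j a b ha hab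
    have m1 : MemLp (rieszTrunc i j a b (fn n)) p := by
      rw [← integrable_norm_rpow_iff (hcont n).aestronglyMeasurable hp0 hp']
      exact hi
    have m2 : MemLp (fn n) p := hfp.mono (hfn n).meas.aestronglyMeasurable
      (Eventually.of_forall (habs n))
    refine le_trans ?_ (mul_le_mul_right (eLpNorm_mono (f := fn n) (habs n)) _)
    rw [m1.eLpNorm_eq_integral_rpow_norm hp0 hp', m2.eLpNorm_eq_integral_rpow_norm hp0 hp']
    change _ ≤ ENNReal.ofReal _ * _
    rw [← ENNReal.ofReal_mul (by positivity)]
    refine ENNReal.ofReal_le_ofReal ?_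
    rw [← Real.mul_rpow hK.le (integral_nonneg fun x => by positivity)]
    exact Real.rpow_le_rpow (integral_nonneg fun x => by positivity) hle (by positivity)
  exact (liminf_le_liminf (Eventually.of_forall hn)).trans (by simp)

end Riesz

/-! ### The gradient of a divergence-free field is controlled by its vorticity -/

section Elliptic
variable {d : ℕ}

lemma contDiff_coord (i : Fin d) {n : WithTop ℕ∞} : ContDiff ℝ n (fun z : Rd d => z i) :=
  (EuclideanSpace.proj (𝕜 := ℝ) i).contDiff

lemma contDiff_heatKernel (s : ℝ) {n : WithTop ℕ∞} : ContDiff ℝ n (heatKernel (d := d) s) :=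
  contDiff_const.mul (((contDiff_norm_sq ℝ).div_const _).neg.exp)

lemma contDiff_heatKernelDD (i j : Fin d) (s : ℝ) {n : WithTop ℕ∞} :
    ContDiff ℝ n (heatKernelDD i j s) :=
  (((((contDiff_coord i).mul (contDiff_coord j)).div_const _).sub contDiff_const)).mul
    (contDiff_heatKernel s)

lemma fderiv_heatKernelDD (i j k : Fin d) (s : ℝ) (z : Rd d) :
    fderiv ℝ (heatKernelDD j k s) z (EuclideanSpace.single i 1) = heatKernelDDD i j k s z := by
  have h := (((contDiff_heatKernelDD j k s (n := 1)).differentiable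
    (by simp)) z).hasFDerivAt.hasLineDerivAt (EuclideanSpace.single i (1 : ℝ))
  exact h.unique (hasLineDerivAt_heatKernelDD i j k z)

lemma heatKernelDDD_comm (i j k : Fin d) (s : ℝ) (z : Rd d) :
    heatKernelDDD i j k s z = heatKernelDDD j i k s z := by
  have h : kron i j = kron j i := by simp [kron, eq_comm]
  simp only [heatKernelDDD, h]; ring

/-- Integration by parts of a decaying kernel against a vector field. -/
lemma integral_kernel_divergence {f : Rd d → ℝ} {Y : Rd d → Rd d} (hf : ContDiff ℝ 1 f)
    (hY : ContDiff ℝ 1 Y) (x : Rd d) (h1 : Integrable fun y => f (x - y) • Y y)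
    (h2 : Integrable fun y => f (x - y) * divergence Y y)
    (h3 : Integrable fun y => fderiv ℝ f (x - y) (Y y)) :
    ∫ y, f (x - y) * divergence Y y = ∫ y, fderiv ℝ f (x - y) (Y y) := by
  have hfx : ContDiff ℝ 1 (fun y => f (x - y)) := hf.comp (contDiff_const.sub contDiff_id)
  have hfd : ∀ y w, fderiv ℝ (fun y => f (x - y)) y w = -fderiv ℝ f (x - y) w := by
    intro y w
    have h : HasFDerivAt (fun y => f (x - y)) ((fderiv ℝ f (x - y)).comp
        (-ContinuousLinearMap.id ℝ (Rd d))) y :=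
      ((hf.differentiable (by simp)) (x - y)).hasFDerivAt.comp y ((hasFDerivAt_id y).const_sub x)
    rw [h.fderiv]; simp
  have e : ∀ y, divergence (fun y => f (x - y) • Y y) y
      = f (x - y) * divergence Y y - fderiv ℝ f (x - y) (Y y) := fun y => by
    rw [divergence_smul (hfx.differentiable (by simp) y) (hY.differentiable (by simp) y), hfd]
    ring
  have hsm : ContDiff ℝ 1 (fun y => f (x - y) • Y y) := hfx.smul hY
  have h := integral_divergence_eq_zero hsm h1 (by
    rw [show divergence (fun y => f (x - y) • Y y) = _ from funext e]; exact h2.sub h3)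
  simp only [e] at h
  rw [integral_sub h2 h3] at h
  linarith

/-- The components of the vorticity. -/
def vortComp (v : Rd d → Rd d) (i j : Fin d) (y : Rd d) : ℝ :=
  fderiv ℝ v y (EuclideanSpace.single j 1) i - fderiv ℝ v y (EuclideanSpace.single i 1) j

lemma abs_vortComp_le (v : Rd d → Rd d) (i j : Fin d) (y : Rd d) :
    |vortComp v i j y| ≤ ‖vorticity v y‖ := by
  have e : vortComp v i j y = (vorticity v y (EuclideanSpace.single j 1)) i := by
    have h1 : ∀ (A : Rd d →L[ℝ] Rd d), (ContinuousLinearMap.adjoint A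
        (EuclideanSpace.single j 1)) i = A (EuclideanSpace.single i 1) j := by
      intro A
      have h2 := ContinuousLinearMap.adjoint_inner_right A (EuclideanSpace.single i (1 : ℝ))
        (EuclideanSpace.single j (1 : ℝ))
      rw [EuclideanSpace.inner_single_left, EuclideanSpace.inner_single_right] at h2
      simpa using h2
    simp [vorticity, vortComp, h1]
  rw [e]
  refine (abs_coord_le _ _).trans ((ContinuousLinearMap.le_opNorm _ _).trans ?_)
  simp

variable {v : Rd d → Rd d} {K : ℝ} {p : ℝ≥0∞}

lemma continuous_vortComp (hv : ContDiff ℝ 1 v) (i j : Fin d) : Continuous (vortComp v i j) := by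
  have hc : Continuous (fderiv ℝ v) := hv.continuous_fderiv (by simp)
  have h1 : ∀ i j : Fin d, Continuous fun y => fderiv ℝ v y (EuclideanSpace.single j 1) i :=
    fun i j => (EuclideanSpace.proj (𝕜 := ℝ) i).continuous.comp (hc.clm_apply continuous_const)
  exact (h1 i j).sub (h1 j i)

lemma abs_comp_le (hK : ∀ x, ‖v x‖ ≤ K) (i : Fin d) (y : Rd d) : |v y i| ≤ K :=
  (abs_coord_le _ _).trans (hK y)

lemma hasFDerivAt_comp (hv : ContDiff ℝ 1 v) (i : Fin d) (x : Rd d) :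
    HasFDerivAt (fun x => v x i) ((EuclideanSpace.proj (𝕜 := ℝ) i).comp (fderiv ℝ v x)) x :=
  ((EuclideanSpace.proj (𝕜 := ℝ) i).hasFDerivAt (x := v x)).comp x
    (hv.differentiable (by simp) x).hasFDerivAt

lemma integrable_kernel_mul_vortComp (hp : 1 ≤ p) (hp' : p ≠ ⊤)
    (hω : ∀ i j, MemLp (vortComp v i j) p) {k : ℝ → Rd d → ℝ} (hk : IsRapidKernel k) {s : ℝ}
    (hs : 0 < s) (i j : Fin d) (x : Rd d) :
    Integrable (fun y => k s (x - y) * vortComp v i j y) := by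
  obtain ⟨C, hC⟩ := hk.decay s s (d + 1) hs
  exact integrable_mul_of_memLp hp hp' ((hk.continuous hs).measurable.comp (by fun_prop))
    (fun y => hC s ⟨le_rfl, le_rfl⟩ _) (hω i j)

/-- The third derivatives of the heat flow of a divergence-free field, in terms of vorticity. -/
lemma sum_kernelConv_heatKernelDDD (hv : ContDiff ℝ 1 v) (hK : ∀ x, ‖v x‖ ≤ K)
    (hdiv : ∀ x, divergence v x = 0) (hp : 1 ≤ p) (hp' : p ≠ ⊤)
    (hω : ∀ i j, MemLp (vortComp v i j) p) (i k : Fin d) {s : ℝ} (hs : 0 < s) (x : Rd d) :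
    ∑ j, kernelConv (heatKernelDDD j j k s) (fun y => v y i) x =
      ∑ j, heatFlowDD j k (vortComp v i j) s x := by
  have hvm : ∀ i, Measurable fun y => v y i := fun i =>
    ((EuclideanSpace.proj (𝕜 := ℝ) i).continuous.comp hv.continuous).measurable
  have hi3 : ∀ a b c l : Fin d, Integrable fun y => heatKernelDDD a b c s (x - y) * v y l :=
    fun a b c l => integrable_kernelConv ((isRapidKernel_heatKernelDDD a b c).integrable hs)
      (hvm l) (abs_comp_le hK l) x
  have hfd : ∀ (a b : Fin d) (z w : Rd d), fderiv ℝ (heatKernelDD a b s) z w =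
      ∑ l, heatKernelDDD l a b s z * w l := fun a b z w => by
    rw [← sum_apply_single_mul]; simp only [fderiv_heatKernelDD]
  have hi2 : ∀ a b : Fin d, Integrable fun y => heatKernelDD a b s (x - y) := fun a b =>
    ((isRapidKernel_heatKernelDD a b).integrable hs).comp_sub_left x
  -- The field Y = v^i e_j - v^j e_i has divergence ω_ij, so one integration by parts moves a
  -- derivative from the vorticity to the kernel.
  have step : ∀ j, heatFlowDD j k (vortComp v i j) s x =
      kernelConv (heatKernelDDD j j k s) (fun y => v y i) x -
        kernelConv (heatKernelDDD i j k s) (fun y => v y j) x := by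
    intro j
    let Y : Rd d → Rd d := fun y => v y i • EuclideanSpace.single j (1 : ℝ) -
      v y j • EuclideanSpace.single i (1 : ℝ)
    have hYi : ∀ l, ContDiff ℝ 1 fun y => v y l := fun l =>
      (EuclideanSpace.proj (𝕜 := ℝ) l).contDiff.comp hv
    have hY : ContDiff ℝ 1 Y := ((hYi i).smul contDiff_const).sub ((hYi j).smul contDiff_const)
    have hYd : ∀ y, divergence Y y = vortComp v i j y := by
      intro y
      have h1 : HasFDerivAt Y _ y := ((hasFDerivAt_comp hv i y).smul_const
        (EuclideanSpace.single j (1 : ℝ))).sub ((hasFDerivAt_comp hv j y).smul_const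
        (EuclideanSpace.single i (1 : ℝ)))
      unfold divergence
      rw [h1.fderiv]
      simp [vortComp, Finset.sum_sub_distrib]
    have hfY : ∀ y, fderiv ℝ (heatKernelDD j k s) (x - y) (Y y) =
        heatKernelDDD j j k s (x - y) * v y i - heatKernelDDD i j k s (x - y) * v y j := by
      intro y
      simp only [Y, map_sub, map_smul, fderiv_heatKernelDD, smul_eq_mul]
      ring
    have h := integral_kernel_divergence (contDiff_heatKernelDD j k s) hY x ?_ ?_ ?_
    · simp only [hYd, hfY] at h
      rw [integral_sub (hi3 _ _ _ _) (hi3 _ _ _ _)] at h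
      exact h
    · have hb : ∀ y, ‖Y y‖ ≤ K + K := fun y => by
        refine (norm_sub_le _ _).trans (add_le_add ?_ ?_) <;>
        · rw [norm_smul]; simpa using abs_comp_le hK _ y
      exact (hi2 j k).smul_bdd (K + K) hY.continuous.aestronglyMeasurable
        (Eventually.of_forall hb)
    · simp only [hYd]
      exact integrable_kernel_mul_vortComp hp hp' hω (isRapidKernel_heatKernelDD j k) hs i j x
    · simp only [hfY]
      exact (hi3 _ _ _ _).sub (hi3 _ _ _ _)
  -- Summed over j, these terms are the convolution of ∂_i∂_k of the heat kernel with div v. This is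
  -- where incompressibility enters.
  have h0 : ∑ j, kernelConv (heatKernelDDD i j k s) (fun y => v y j) x = 0 := by
    have hfY : ∀ y, fderiv ℝ (heatKernelDD i k s) (x - y) (v y) =
        ∑ j, heatKernelDDD i j k s (x - y) * v y j := by
      intro y
      rw [hfd]
      exact Finset.sum_congr rfl fun j _ => by rw [heatKernelDDD_comm]
    have hint := integrable_finsetSum Finset.univ fun j (_ : j ∈ Finset.univ) => hi3 i j k j
    have h := integral_kernel_divergence (contDiff_heatKernelDD i k s) hv x ?_ ?_ ?_
    · simp only [hdiv, mul_zero, integral_zero, hfY] at h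
      rw [integral_finsetSum _ fun j _ => hi3 i j k j] at h
      exact h.symm
    · exact (hi2 i k).smul_bdd K hv.continuous.aestronglyMeasurable (Eventually.of_forall hK)
    · simp [hdiv]
    · simp only [hfY]; exact hint
  rw [Finset.sum_congr rfl fun j _ => step j, Finset.sum_sub_distrib, h0, sub_zero]

lemma continuousOn_heatFlowDD_vortComp (hp : 1 ≤ p) (hp' : p ≠ ⊤)
    (hω : ∀ i j, MemLp (vortComp v i j) p) (i j k l : Fin d) (x : Rd d) :
    ContinuousOn (fun s => heatFlowDD k l (vortComp v i j) s x) (Ioi 0) := by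
  intro s₀ hs₀
  have hs₀ : 0 < s₀ := hs₀
  refine ContinuousAt.continuousWithinAt ?_
  have hk := isRapidKernel_heatKernelDD k l
  obtain ⟨C, hC⟩ := hk.decay (s₀ / 2) (2 * s₀) (d + 1) (by positivity)
  have hn : Icc (s₀ / 2) (2 * s₀) ∈ 𝓝 s₀ := Icc_mem_nhds (by linarith) (by linarith)
  have hint : Integrable fun y => polyDecay (d + 1) (x - y) * vortComp v i j y :=
    integrable_mul_of_memLp (C := 1) (x := x) hp hp' ((continuous_polyDecay _).comp
      (by fun_prop)).measurable (fun y => by rw [abs_of_pos (polyDecay_pos _ _), one_mul]) (hω i j)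
  refine continuousAt_of_dominated
    (bound := fun y => C * |polyDecay (d + 1) (x - y) * vortComp v i j y|) ?_ ?_ ?_ ?_
  · filter_upwards [Ioi_mem_nhds hs₀] with s hs
    exact (integrable_kernel_mul_vortComp hp hp' hω hk hs i j x).aestronglyMeasurable
  · filter_upwards [hn] with s hs
    refine Eventually.of_forall fun y => ?_
    rw [Real.norm_eq_abs, abs_mul, abs_mul, abs_of_pos (polyDecay_pos _ _), ← mul_assoc]
    exact mul_le_mul_of_nonneg_right (hC s hs _) (abs_nonneg _)
  · exact hint.abs.const_mul C
  · exact Eventually.of_forall fun y =>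
      ((hk.continuousOn_time (x - y)).continuousAt (Ioi_mem_nhds hs₀)).mul continuousAt_const

/-- The gradient of the heat flow at two times differs by Riesz transforms of the vorticity. -/
lemma heatFlowD_sub_eq (hv : ContDiff ℝ 1 v) (hK : ∀ x, ‖v x‖ ≤ K)
    (hdiv : ∀ x, divergence v x = 0) (hp : 1 ≤ p) (hp' : p ≠ ⊤)
    (hω : ∀ i j, MemLp (vortComp v i j) p) (i k : Fin d) {a b : ℝ} (ha : 0 < a) (hab : a ≤ b)
    (x : Rd d) :
    heatFlowD k (fun y => v y i) b x - heatFlowD k (fun y => v y i) a x =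
      ∑ j, 2 * rieszTrunc j k (a / 2) (b / 2) (vortComp v i j) x := by
  have hvm : Measurable fun y => v y i :=
    ((EuclideanSpace.proj (𝕜 := ℝ) i).continuous.comp hv.continuous).measurable
  have hpos : ∀ s ∈ uIcc a b, 0 < s := fun s hs => by
    rw [uIcc_of_le hab] at hs; exact ha.trans_le hs.1
  have hder : ∀ s ∈ uIcc a b, HasDerivAt (fun s => heatFlowD k (fun y => v y i) s x)
      (∑ j, heatFlowDD j k (vortComp v i j) s x) s := by
    intro s hs
    have hs0 := hpos s hs
    have h := (isRapidKernel_heatKernelD k).hasDerivAt_kernelConv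
      (IsRapidKernel.sum Finset.univ fun j _ => isRapidKernel_heatKernelDDD j j k) hs0
      (fun s hs z => hasDerivAt_heatKernelD hs k z) hvm (abs_comp_le hK i) x
    rw [kernelConv_sum _ (fun j _ => (isRapidKernel_heatKernelDDD j j k).integrable hs0) hvm
      (abs_comp_le hK i), sum_kernelConv_heatKernelDDD hv hK hdiv hp hp' hω i k hs0] at h
    exact h
  have hc : ∀ j, ContinuousOn (fun s => heatFlowDD j k (vortComp v i j) s x) (uIcc a b) :=
    fun j => (continuousOn_heatFlowDD_vortComp hp hp' hω i j j k x).mono hpos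
  rw [← intervalIntegral.integral_eq_sub_of_hasDerivAt hder
    (continuousOn_finsetSum _ fun j _ => hc j).intervalIntegrable,
    intervalIntegral.integral_finsetSum fun j _ => (hc j).intervalIntegrable]
  refine Finset.sum_congr rfl fun j _ => ?_
  unfold rieszTrunc
  -- The substitution of 2s for s accounts for both the halved endpoints and the factor 2.
  rw [intervalIntegral.integral_comp_mul_left
    (fun s => heatFlowDD j k (vortComp v i j) s x) two_ne_zero]
  simp only [smul_eq_mul]
  rw [mul_div_cancel₀ _ (two_ne_zero), mul_div_cancel₀ _ (two_ne_zero)]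
  ring

/-! ### Short- and long-time limits of the gradient of the heat flow -/

lemma heatKernelD_scale (k : Fin d) {r : ℝ} (hr : 0 < r) (w : Rd d) :
    heatKernelD k (r ^ 2) (r • w) = r⁻¹ * (r ^ d)⁻¹ * heatKernelD k 1 w := by
  have h1 : (4 * Real.pi * r ^ 2) ^ (-(d : ℝ) / 2) =
      (4 * Real.pi * 1) ^ (-(d : ℝ) / 2) * (r ^ d)⁻¹ := by
    rw [mul_one, Real.mul_rpow (by positivity) (by positivity), ← Real.rpow_natCast r 2,
      ← Real.rpow_mul hr.le, ← Real.rpow_natCast r d, ← Real.rpow_neg hr.le]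
    congr 2; push_cast; ring
  simp only [heatKernelD, heatKernel, h1, norm_smul, PiLp.smul_apply, smul_eq_mul]
  have h2 : (‖r‖ * ‖w‖) ^ 2 / (4 * r ^ 2) = ‖w‖ ^ 2 / (4 * 1) := by
    rw [mul_pow, Real.norm_eq_abs, sq_abs]; field_simp
  rw [h2]
  field_simp

lemma heatFlowD_scale (k : Fin d) {r : ℝ} (hr : 0 < r) (f : Rd d → ℝ) (x : Rd d) :
    heatFlowD k f (r ^ 2) x = r⁻¹ * ∫ w, heatKernelD k 1 w * f (x - r • w) := by
  unfold heatFlowD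
  rw [kernelConv_eq]
  have h := Measure.integral_comp_smul_of_nonneg (volume : Measure (Rd d))
    (fun z => heatKernelD k (r ^ 2) z * f (x - z)) r (hR := hr.le)
  rw [finrank_euclideanSpace_fin, smul_eq_mul, eq_inv_mul_iff_mul_eq₀ (by positivity)] at h
  rw [← h, ← integral_const_mul, ← integral_const_mul]
  refine integral_congr_ae (Eventually.of_forall fun w => ?_)
  simp only [heatKernelD_scale k hr]
  field_simp

lemma integral_heatKernelD (k : Fin d) : ∫ w : Rd d, heatKernelD k 1 w = 0 :=
  integral_lineDeriv_eq_zero ((isRapidKernel_heatKernel d).integrable one_pos)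
    ((isRapidKernel_heatKernelD k).integrable one_pos) (hasLineDerivAt_heatKernel k)

lemma integral_heatKernelD_mul_coord (k l : Fin d) :
    ∫ w : Rd d, heatKernelD k 1 w * w l = -kron k l := by
  have h1 : IsRapidKernel (fun s (z : Rd d) => z l * heatKernel s z) :=
    (isRapidKernel_heatKernel d).coord_mul l
  have h2 : IsRapidKernel (fun s (z : Rd d) => z l * heatKernelD k s z) :=
    (isRapidKernel_heatKernelD k).coord_mul l
  have hi1 := h2.integrable one_pos
  have hi2 := ((isRapidKernel_heatKernel d).integrable one_pos).const_mul (kron k l)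
  have h := integral_lineDeriv_eq_zero (e := EuclideanSpace.single k (1 : ℝ))
    (h1.integrable one_pos) (hi2.add hi1) (fun z => by
      have a1 := hasLineDerivAt_coord k l z
      have a2 := hasLineDerivAt_heatKernel (s := 1) k z
      unfold HasLineDerivAt at a1 a2 ⊢
      refine (a1.mul a2).congr_deriv ?_
      simp only [zero_smul, add_zero, Pi.add_apply])
  have h' : ∫ w : Rd d, (kron k l * heatKernel 1 w + w l * heatKernelD k 1 w) = 0 := h
  rw [integral_add hi2 hi1, integral_const_mul, integral_heatKernel one_pos] at h'
  simp only [mul_comm (heatKernelD k 1 _)]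
  linarith

lemma integral_heatKernelD_mul_linear (k : Fin d) (L : Rd d →L[ℝ] ℝ) :
    ∫ w : Rd d, heatKernelD k 1 w * L w = -L (EuclideanSpace.single k 1) := by
  have hi : ∀ l, Integrable fun w : Rd d => heatKernelD k 1 w * w l := fun l => by
    simpa only [mul_comm] using ((isRapidKernel_heatKernelD k).coord_mul l).integrable one_pos
  calc ∫ w : Rd d, heatKernelD k 1 w * L w
      = ∫ w : Rd d, ∑ l, L (EuclideanSpace.single l 1) * (heatKernelD k 1 w * w l) := by
        refine integral_congr_ae (Eventually.of_forall fun w => ?_)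
        simp only
        rw [← sum_apply_single_mul L w, Finset.mul_sum]
        exact Finset.sum_congr rfl fun l _ => by ring
    _ = ∑ l, L (EuclideanSpace.single l 1) * -kron k l := by
        rw [integral_finsetSum _ fun l _ => (hi l).const_mul _]
        simp only [integral_const_mul, integral_heatKernelD_mul_coord]
    _ = _ := by simp [kron]

/-- By parabolic scaling the gradient at time r² is r⁻¹ times a fixed integrable kernel against a
bounded function. Boundedness of f is all that rules out a harmonic remainder. -/
lemma tendsto_heatFlowD_atTop {f : Rd d → ℝ} (hK : ∀ y, |f y| ≤ K) (k : Fin d) (x : Rd d) :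
    Tendsto (fun n : ℕ => heatFlowD k f (((n : ℝ) + 1) ^ 2) x) atTop (𝓝 0) := by
  have hi := (isRapidKernel_heatKernelD (d := d) k).integrable one_pos
  have hlim : Tendsto (fun n : ℕ => 1 / ((n : ℝ) + 1) * ((∫ w : Rd d, |heatKernelD k 1 w|) * K))
      atTop (𝓝 0) := by
    simpa using tendsto_one_div_add_atTop_nhds_zero_nat.mul_const
      ((∫ w : Rd d, |heatKernelD k 1 w|) * K)
  refine squeeze_zero_norm (fun n => ?_) hlim
  have hn : (0 : ℝ) < (n : ℝ) + 1 := by positivity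
  rw [heatFlowD_scale k hn, norm_mul, norm_inv, Real.norm_of_nonneg hn.le, one_div]
  refine mul_le_mul_of_nonneg_left ?_ (by positivity)
  refine (norm_integral_le_integral_norm _).trans ?_
  rw [← integral_mul_const]
  refine integral_mono_of_nonneg (Eventually.of_forall fun w => norm_nonneg _)
    (hi.abs.mul_const K) (Eventually.of_forall fun w => ?_)
  simp only [norm_mul, Real.norm_eq_abs]
  exact mul_le_mul_of_nonneg_left (hK _) (abs_nonneg _)

/-- Mean value inequality for increments of length at most 1, sup bound for the others. The gradient
itself need not be globally bounded. -/
lemma exists_lipschitz_at {f : Rd d → ℝ} (hf : ContDiff ℝ 1 f) (hK : ∀ y, |f y| ≤ K) (x : Rd d) :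
    ∃ C, ∀ h, |f (x - h) - f x| ≤ C * ‖h‖ := by
  obtain ⟨L, hL⟩ := (isCompact_closedBall x 1).exists_bound_of_continuousOn
    (hf.continuous_fderiv (by simp)).continuousOn
  have hK0 : 0 ≤ K := (abs_nonneg _).trans (hK 0)
  have hL0 : 0 ≤ L := (norm_nonneg _).trans (hL x (Metric.mem_closedBall_self zero_le_one))
  refine ⟨max L (2 * K), fun h => ?_⟩
  rcases le_or_gt ‖h‖ 1 with h1 | h1
  · have := (convex_closedBall x 1).norm_image_sub_le_of_norm_fderiv_le (𝕜 := ℝ) (f := f)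
      (fun y _ => hf.differentiable (by simp) y) hL (Metric.mem_closedBall_self zero_le_one)
      (y := x - h) (by simpa using h1)
    rw [Real.norm_eq_abs] at this
    refine this.trans ?_
    rw [sub_sub_cancel_left, norm_neg]
    exact mul_le_mul_of_nonneg_right (le_max_left _ _) (norm_nonneg _)
  · calc |f (x - h) - f x| ≤ 2 * K := by
          refine (abs_sub _ _).trans ?_
          linarith [hK (x - h), hK x]
      _ ≤ 2 * K * ‖h‖ := le_mul_of_one_le_right (by positivity) h1.le
      _ ≤ _ := mul_le_mul_of_nonneg_right (le_max_right _ _) (norm_nonneg _)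

/-- After scaling, the flow tests a difference quotient of f against ∂_k of the unit heat kernel.
That kernel has mean zero and first moments -1 in direction k and 0 in the others, so only the k-th
partial derivative survives in the limit. -/
lemma tendsto_heatFlowD_zero {f : Rd d → ℝ} (hf : ContDiff ℝ 1 f) (hK : ∀ y, |f y| ≤ K)
    (k : Fin d) (x : Rd d) :
    Tendsto (fun n : ℕ => heatFlowD k f ((1 / ((n : ℝ) + 1)) ^ 2) x) atTop
      (𝓝 (fderiv ℝ f x (EuclideanSpace.single k 1))) := by
  have hD := isRapidKernel_heatKernelD (d := d) k
  have hi := hD.integrable one_pos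
  have hc := hD.continuous one_pos
  obtain ⟨C, hC⟩ := exists_lipschitz_at hf hK x
  obtain ⟨C', hC'⟩ := hD.decay 1 1 (d + 1 + 1) one_pos
  have hC0 : 0 ≤ C := by
    by_contra! hlt
    -- The zero space cannot occur, since an index k in `Fin d` is given; a nonzero vector forces C
    -- ≥ 0.
    by_cases hd : ∃ h : Rd d, h ≠ 0
    · obtain ⟨h, hh⟩ := hd
      have := (abs_nonneg _).trans (hC h)
      nlinarith [norm_pos_iff.2 hh]
    · push Not at hd
      exact absurd (hd (EuclideanSpace.single k 1)) (by simp)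
  -- Subtracting f(x) is free because the kernel has mean zero.
  have e : ∀ n : ℕ, heatFlowD k f ((1 / ((n : ℝ) + 1)) ^ 2) x =
      ∫ w, heatKernelD k 1 w * (((1 / ((n : ℝ) + 1))⁻¹) *
        (f (x - (1 / ((n : ℝ) + 1)) • w) - f x)) := by
    intro n
    set r : ℝ := 1 / ((n : ℝ) + 1)
    have hr : 0 < r := by positivity
    rw [heatFlowD_scale k hr, ← integral_const_mul]
    have i1 : Integrable fun w => r⁻¹ * (heatKernelD k 1 w * f (x - r • w)) :=
      (integrable_mul_of_bounded hi ((hf.continuous.comp (by fun_prop)).measurable)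
        (fun w => hK _)).const_mul _
    have i2 : Integrable fun w : Rd d => heatKernelD k 1 w * (r⁻¹ * f x) := hi.mul_const _
    have : ∀ w, heatKernelD k 1 w * (r⁻¹ * (f (x - r • w) - f x)) =
        r⁻¹ * (heatKernelD k 1 w * f (x - r • w)) - heatKernelD k 1 w * (r⁻¹ * f x) := fun w => by
      ring
    simp only [this]
    rw [integral_sub i1 i2, integral_mul_const, integral_heatKernelD, zero_mul, sub_zero]
  simp only [e]
  have hfin : fderiv ℝ f x (EuclideanSpace.single k 1) =
      ∫ w, heatKernelD k 1 w * (-fderiv ℝ f x) w := by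
    rw [integral_heatKernelD_mul_linear]; simp
  rw [hfin]
  refine tendsto_integral_of_dominated_convergence
    (fun w => C * (C' * polyDecay (d + 1) w)) ?_ ?_ ?_ ?_
  · intro n
    exact (hc.mul (continuous_const.mul ((hf.continuous.comp (by fun_prop)).sub
      continuous_const))).aestronglyMeasurable
  · exact ((integrable_polyDecay (Nat.lt_succ_self d)).const_mul C').const_mul C
  · refine fun n => Eventually.of_forall fun w => ?_
    set r : ℝ := 1 / ((n : ℝ) + 1)
    have hr : 0 < r := by positivity
    rw [norm_mul, norm_mul, norm_inv, Real.norm_of_nonneg hr.le, Real.norm_eq_abs, Real.norm_eq_abs]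
    have h1 : r⁻¹ * |f (x - r • w) - f x| ≤ C * (1 + ‖w‖) := by
      rw [inv_mul_le_iff₀ hr]
      refine (hC _).trans ?_
      rw [norm_smul, Real.norm_of_nonneg hr.le]
      nlinarith [norm_nonneg w, mul_nonneg hC0 hr.le]
    have h2 := hC' 1 ⟨le_rfl, le_rfl⟩ w
    rw [polyDecay_add] at h2
    have h3 := one_add_norm_pow_mul_polyDecay (N := 1) w
    rw [pow_one] at h3
    calc |heatKernelD k 1 w| * (r⁻¹ * |f (x - r • w) - f x|)
        ≤ (C' * (polyDecay (d + 1) w * polyDecay 1 w)) * (C * (1 + ‖w‖)) :=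
          mul_le_mul h2 h1 (by positivity) ((abs_nonneg _).trans h2)
      _ = C * (C' * polyDecay (d + 1) w) := by
          linear_combination (C' * polyDecay (d + 1) w * C) * h3
  · refine Eventually.of_forall fun w => Tendsto.const_mul _ ?_
    have h1 : HasDerivAt (fun t : ℝ => f (x - t • w)) ((-fderiv ℝ f x) w) 0 := by
      have h2 : HasFDerivAt f (fderiv ℝ f x) (x - (0 : ℝ) • w) := by
        simpa using (hf.differentiable (by simp) x).hasFDerivAt
      have h3 : HasDerivAt (fun t : ℝ => x - t • w) (-w) 0 := by
        simpa using ((hasDerivAt_id (0 : ℝ)).smul_const w).const_sub x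
      have h4 : HasDerivAt (fun t : ℝ => f (x - t • w)) (fderiv ℝ f x (-w)) 0 :=
        h2.comp_hasDerivAt (0 : ℝ) h3
      exact h4.congr_deriv (by simp)
    have h4 := h1.tendsto_slope
    have h5 : Tendsto (fun n : ℕ => 1 / ((n : ℝ) + 1)) atTop (𝓝[≠] 0) := by
      refine tendsto_nhdsWithin_iff.2 ⟨tendsto_one_div_add_atTop_nhds_zero_nat,
        Eventually.of_forall fun n => ?_⟩
      have : (0 : ℝ) < 1 / ((n : ℝ) + 1) := by positivity
      exact this.ne'
    have h6 := h4.comp h5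
    refine h6.congr fun n => ?_
    simp [slope, Function.comp]

lemma continuous_heatFlowD {f : Rd d → ℝ} (hf : Measurable f) (hK : ∀ y, |f y| ≤ K) (k : Fin d)
    {s : ℝ} (hs : 0 < s) : Continuous (heatFlowD k f s) := by
  rw [← continuousOn_univ]
  exact ((isRapidKernel_heatKernelD k).continuousOn_kernelConv hf hK).comp
    (f := fun x => (s, x)) (by fun_prop) fun x _ => ⟨hs, mem_univ _⟩

/-! ### From increments of the heat flow to the L^p norm of the gradient -/

lemma eLpNorm_sum_two_mul_le {g : Fin d → Rd d → ℝ} {B : ℝ≥0∞} (hp : 1 ≤ p)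
    (hg : ∀ j, AEStronglyMeasurable (g j)) (hB : ∀ j, eLpNorm (g j) p ≤ B) :
    eLpNorm (fun x => ∑ j, 2 * g j x) p ≤ d * (2 * B) := by
  obtain ⟨G, hGx⟩ : ∃ G : Fin d → Rd d → ℝ, ∀ j x, G j x = 2 * g j x := ⟨fun j x => 2 * g j x,
    fun _ _ => rfl⟩
  have hG : ∀ j, AEStronglyMeasurable (G j) := fun j => by
    rw [show G j = fun x => 2 * g j x from funext (hGx j)]; exact (hg j).const_mul 2
  have hGB : ∀ j, eLpNorm (G j) p ≤ 2 * B := fun j => by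
    have h2 : ‖(2 : ℝ)‖ₑ = 2 := by
      rw [Real.enorm_eq_ofReal (by norm_num)]; simp
    have h3 := eLpNorm_const_smul (2 : ℝ) (g j) p volume
    have h4 : (2 : ℝ) • g j = G j := by ext x; simp [hGx]
    rw [h2, h4] at h3
    rw [h3]
    exact mul_le_mul_right (hB j) 2
  have e : (fun x => ∑ j, 2 * g j x) = ∑ j, G j := by
    ext x; simp [Finset.sum_apply, hGx]
  have hs : eLpNorm (∑ j, G j) p ≤ ∑ j, eLpNorm (G j) p :=
    eLpNorm_sum_le (fun j _ => hG j) hp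
  have hs2 : ∑ j, eLpNorm (G j) p ≤ ∑ _j : Fin d, 2 * B := Finset.sum_le_sum fun j _ => hGB j
  rw [e]
  exact (hs.trans hs2).trans_eq (by simp)

lemma eLpNorm_heatFlowD_sub_le {B : ℝ≥0∞} (hv : ContDiff ℝ 1 v) (hK : ∀ x, ‖v x‖ ≤ K)
    (hdiv : ∀ x, divergence v x = 0) (hp : 1 ≤ p) (hp' : p ≠ ⊤)
    (hω : ∀ i j, MemLp (vortComp v i j) p)
    (hA : ∀ (i j k : Fin d) (a b : ℝ), 0 < a → a ≤ b →
      AEStronglyMeasurable (rieszTrunc j k a b (vortComp v i j)) ∧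
      eLpNorm (rieszTrunc j k a b (vortComp v i j)) p ≤ B)
    (i k : Fin d) {a b : ℝ} (ha : 0 < a) (hab : a ≤ b) :
    eLpNorm (fun x => heatFlowD k (fun y => v y i) b x - heatFlowD k (fun y => v y i) a x) p
      ≤ d * (2 * B) := by
  have hR := fun j => hA i j k (a / 2) (b / 2) (by positivity) (by linarith)
  have h := eLpNorm_sum_two_mul_le hp (fun j => (hR j).1) (fun j => (hR j).2)
  rwa [show (fun x => ∑ j, 2 * rieszTrunc j k (a / 2) (b / 2) (vortComp v i j) x) = fun x =>
    heatFlowD k (fun y => v y i) b x - heatFlowD k (fun y => v y i) a x from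
    funext fun x => (heatFlowD_sub_eq hv hK hdiv hp hp' hω i k ha hab x).symm] at h

lemma eLpNorm_le_of_tendsto {f : ℕ → Rd d → ℝ} {g : Rd d → ℝ} {B : ℝ≥0∞}
    (hf : ∀ n, AEStronglyMeasurable (f n)) (hg : ∀ x, Tendsto (fun n => f n x) atTop (𝓝 (g x)))
    (hB : ∀ n, eLpNorm (f n) p ≤ B) : eLpNorm g p ≤ B :=
  (Lp.eLpNorm_lim_le_liminf_eLpNorm hf g (Eventually.of_forall hg)).trans
    ((liminf_le_liminf (Eventually.of_forall hB)).trans (by simp))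

/-- Send the upper time b to infinity: the gradient there vanishes pointwise, and Fatou preserves
the uniform bound. -/
lemma eLpNorm_heatFlowD_le {f : Rd d → ℝ} {B : ℝ≥0∞} (hf : Measurable f)
    (hK : ∀ x, |f x| ≤ K) (k : Fin d)
    (hB : ∀ a b : ℝ, 0 < a → a ≤ b →
      eLpNorm (fun x => heatFlowD k f b x - heatFlowD k f a x) p ≤ B) {a : ℝ} (ha : 0 < a) :
    eLpNorm (heatFlowD k f a) p ≤ B := by
  obtain ⟨n₀, hn₀⟩ := exists_nat_ge a
  have hb : ∀ n : ℕ, a ≤ (((n + n₀ : ℕ) : ℝ) + 1) ^ 2 := fun n => by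
    push_cast
    nlinarith [show (0 : ℝ) ≤ n by positivity, show (0 : ℝ) ≤ n₀ by positivity]
  rw [← eLpNorm_neg]
  refine eLpNorm_le_of_tendsto (f := fun n x => heatFlowD k f ((((n + n₀ : ℕ) : ℝ) + 1) ^ 2) x
    - heatFlowD k f a x) (fun n => ?_) (fun x => ?_) (fun n => hB _ _ ha (hb n))
  · exact ((continuous_heatFlowD hf hK k (ha.trans_le (hb n))).sub
      (continuous_heatFlowD hf hK k ha)).aestronglyMeasurable
  · have h := ((tendsto_heatFlowD_atTop hK k x).comp
      (tendsto_add_atTop_nat n₀)).sub_const (heatFlowD k f a x)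
    rw [zero_sub] at h
    exact h

/-- Send the lower time to zero in the previous bound, again by Fatou. -/
lemma eLpNorm_fderiv_apply_le {f : Rd d → ℝ} {B : ℝ≥0∞} (hf : ContDiff ℝ 1 f)
    (hK : ∀ x, |f x| ≤ K) (k : Fin d)
    (hB : ∀ a b : ℝ, 0 < a → a ≤ b →
      eLpNorm (fun x => heatFlowD k f b x - heatFlowD k f a x) p ≤ B) :
    eLpNorm (fun x => fderiv ℝ f x (EuclideanSpace.single k 1)) p ≤ B :=
  eLpNorm_le_of_tendsto (f := fun n x => heatFlowD k f ((1 / ((n : ℝ) + 1)) ^ 2) x)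
    (fun n => (continuous_heatFlowD hf.continuous.measurable hK k
      (by positivity)).aestronglyMeasurable)
    (fun x => tendsto_heatFlowD_zero hf hK k x)
    (fun n => eLpNorm_heatFlowD_le hf.continuous.measurable hK k hB (by positivity))

lemma norm_fderiv_le_sum (hv : ContDiff ℝ 1 v) (x : Rd d) :
    ‖fderiv ℝ v x‖ ≤ ∑ i, ∑ k, |fderiv ℝ (fun y => v y i) x (EuclideanSpace.single k 1)| := by
  refine ContinuousLinearMap.opNorm_le_bound _ (by positivity) fun w => ?_
  have h1 : ∀ u : Rd d, ‖u‖ ≤ ∑ i, |u i| := by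
    intro u
    have h2 : u = ∑ i, u i • (EuclideanSpace.single i (1 : ℝ)) := by
      ext j; simp [Finset.sum_apply, Pi.single_apply]
    calc ‖u‖ = ‖∑ i, u i • (EuclideanSpace.single i (1 : ℝ))‖ := by rw [← h2]
      _ ≤ ∑ i, ‖u i • (EuclideanSpace.single i (1 : ℝ))‖ := norm_sum_le _ _
      _ = ∑ i, |u i| := by simp [norm_smul]
  refine (h1 _).trans ?_
  rw [Finset.sum_mul]
  refine Finset.sum_le_sum fun i _ => ?_
  have h3 : (fderiv ℝ v x w) i = fderiv ℝ (fun y => v y i) x w := by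
    rw [(hasFDerivAt_comp hv i x).fderiv]; rfl
  rw [h3, ← sum_apply_single_mul, Finset.sum_mul]
  refine (Finset.abs_sum_le_sum_abs _ _).trans (Finset.sum_le_sum fun k _ => ?_)
  rw [abs_mul]
  exact mul_le_mul_of_nonneg_left (abs_coord_le w k) (abs_nonneg _)

lemma eLpNorm_fderiv_le_sum {B : ℝ≥0∞} (hv : ContDiff ℝ 1 v) (hp : 1 ≤ p)
    (hB : ∀ i k, eLpNorm (fun x => fderiv ℝ (fun y => v y i) x (EuclideanSpace.single k 1)) p ≤ B) :
    eLpNorm (fderiv ℝ v) p ≤ d * d * B := by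
  let G : Fin d → Fin d → Rd d → ℝ := fun i k x =>
    |fderiv ℝ (fun y => v y i) x (EuclideanSpace.single k 1)|
  have hm : ∀ i k : Fin d, Continuous (G i k) := fun i k =>
    ((((EuclideanSpace.proj (𝕜 := ℝ) i).contDiff.comp hv).continuous_fderiv
      (by simp)).clm_apply continuous_const).abs
  have hG : ∀ i k, eLpNorm (G i k) p ≤ B := fun i k =>
    (eLpNorm_mono fun x => by simp [G]).trans (hB i k)
  let H : Fin d → Rd d → ℝ := fun i => ∑ k, G i k
  have hH : ∀ i, Continuous (H i) := fun i => by
    have : H i = fun x => ∑ k, G i k x := by ext x; simp [H, Finset.sum_apply]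
    rw [this]; exact continuous_finsetSum _ fun k _ => hm i k
  have h1 : ∀ i, eLpNorm (H i) p ≤ d * B := fun i => by
    refine (eLpNorm_sum_le (s := Finset.univ) (f := G i)
      (fun k _ => (hm i k).aestronglyMeasurable) hp).trans ?_
    refine (Finset.sum_le_sum fun k _ => hG i k).trans (by simp)
  have h2 : eLpNorm (∑ i, H i) p ≤ d * (d * B) := by
    refine (eLpNorm_sum_le (s := Finset.univ) (f := H)
      (fun k _ => (hH k).aestronglyMeasurable) hp).trans ?_
    refine (Finset.sum_le_sum fun k _ => h1 k).trans (by simp)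
  rw [mul_assoc]
  refine le_trans (eLpNorm_mono fun x => ?_) h2
  refine (norm_fderiv_le_sum hv x).trans ((le_abs_self _).trans_eq ?_)
  simp only [H, G, Finset.sum_apply, Real.norm_eq_abs]

/-- **Elliptic estimate.** The gradient of a bounded divergence-free field is controlled in `L^p`
by its vorticity. -/
theorem eLpNorm_fderiv_le_vorticity (d : ℕ) {p : ℝ≥0∞} (hp : 1 < p) (hp' : p ≠ ⊤) :
    ∃ C : ℝ≥0, ∀ (v : Rd d → Rd d) (K : ℝ), ContDiff ℝ 1 v → (∀ x, ‖v x‖ ≤ K) →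
      (∀ x, divergence v x = 0) →
      eLpNorm (fderiv ℝ v) p ≤ C * eLpNorm (vorticity v) p := by
  obtain ⟨A, hA⟩ := eLpNorm_rieszTrunc_le (d := d) hp hp'
  -- The extra summand 1 keeps the constant nonzero in positive dimension, so that an infinite
  -- vorticity norm makes the right side infinite.
  refine ⟨d * d * (1 + d * (2 * A)), fun v K hv hK hdiv => ?_⟩
  by_cases htop : eLpNorm (vorticity v) p = ⊤
  · rcases eq_or_ne d 0 with rfl | hd
    · refine (eLpNorm_mono (g := fun _ => (0 : ℝ)) fun x => ?_).trans (by simp)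
      simp
    have hdpos : (0 : ℝ≥0) < d := by exact_mod_cast Nat.pos_of_ne_zero hd
    rw [htop, ENNReal.mul_top]
    · exact le_top
    · have : (0 : ℝ≥0) < d * d * (1 + d * (2 * A)) := by positivity
      exact_mod_cast this.ne'
  have hωle : ∀ i j, eLpNorm (vortComp v i j) p ≤ eLpNorm (vorticity v) p := fun i j =>
    eLpNorm_mono (abs_vortComp_le v i j)
  have hω : ∀ i j, MemLp (vortComp v i j) p := fun i j =>
    ⟨(continuous_vortComp hv i j).aestronglyMeasurable,
      (hωle i j).trans_lt (lt_top_iff_ne_top.2 htop)⟩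
  have hA' : ∀ (i j k : Fin d) (a b : ℝ), 0 < a → a ≤ b →
      AEStronglyMeasurable (rieszTrunc j k a b (vortComp v i j)) ∧
      eLpNorm (rieszTrunc j k a b (vortComp v i j)) p ≤ A * eLpNorm (vorticity v) p := by
    intro i j k a b ha hab
    obtain ⟨h1, h2⟩ := hA (vortComp v i j) (continuous_vortComp hv i j) (hω i j) j k a b ha hab
    exact ⟨h1, h2.trans (mul_le_mul_right (hωle i j) _)⟩
  refine (eLpNorm_fderiv_le_sum hv hp.le fun i k => eLpNorm_fderiv_apply_le
    ((EuclideanSpace.proj (𝕜 := ℝ) i).contDiff.comp hv) (abs_comp_le hK i) k fun a b ha hab =>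
    eLpNorm_heatFlowD_sub_le hv hK hdiv hp.le hp' hω hA' i k ha hab).trans ?_
  have : (d : ℝ≥0∞) * d * (d * (2 * (A * eLpNorm (vorticity v) p))) =
      d * d * (d * (2 * A)) * eLpNorm (vorticity v) p := by ring
  rw [this]
  push_cast
  gcongr
  exact le_add_self

end Elliptic

/-! ### The Lévy density of `|D|` -/

section Levy
variable {d : ℕ}

lemma pow_mul_levy_eq [NeZero d] {y : ℝ} (hy : 0 < y) (a : ℝ) :
    y ^ (d - 1) * (a * (y ^ (d + 1))⁻¹) = a * (y ^ 2)⁻¹ := by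
  have h : y ^ (d + 1) = y ^ (d - 1) * y ^ 2 := by
    rw [← pow_add]; congr 1
    have := NeZero.one_le (n := d)
    omega
  rw [h]; field_simp

/-- Radial functions that are `O(r²)` at zero and `O(√r)` at infinity are integrable against
`|z|^{-d-1}`. -/
lemma integrable_radial_levy [NeZero d] {g : ℝ → ℝ} {C : ℝ} (hg : Measurable g)
    (h0 : ∀ y, 0 < y → |g y| ≤ C * y ^ 2) (h1 : ∀ y, 1 < y → |g y| ≤ C * √y) :
    Integrable fun z : Rd d => g ‖z‖ * (‖z‖ ^ (d + 1))⁻¹ := by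
  refine (integrable_fun_norm_addHaar (volume : Measure (Rd d))
    (f := fun y => g y * (y ^ (d + 1))⁻¹)).2 ?_
  -- In polar coordinates the density becomes y^(-2), integrable at infinity even against √y, while
  -- the factor y² removes the singularity at zero.
  have e : IntegrableOn (fun y => g y * (y ^ 2)⁻¹) (Ioi 0) := by
    rw [← Ioc_union_Ioi_eq_Ioi zero_le_one, integrableOn_union]
    constructor
    · refine Measure.integrableOn_of_bounded (M := C) (by simp) (by fun_prop) ?_
      refine (ae_restrict_mem measurableSet_Ioc).mono fun y hy => ?_
      have hy0 : 0 < y := hy.1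
      rw [norm_mul, Real.norm_eq_abs, Real.norm_of_nonneg (by positivity), ← div_eq_mul_inv,
        div_le_iff₀ (by positivity)]
      exact h0 y hy0
    · refine Integrable.mono' (g := fun y => C * y ^ (-(3 / 2) : ℝ))
        ((integrableOn_Ioi_rpow_of_lt (by norm_num) one_pos).const_mul C) (by fun_prop) ?_
      refine (ae_restrict_mem measurableSet_Ioi).mono fun y hy => ?_
      have hy0 : 0 < y := one_pos.trans hy
      rw [norm_mul, Real.norm_eq_abs, Real.norm_of_nonneg (by positivity), ← div_eq_mul_inv,
        div_le_iff₀ (by positivity), mul_assoc, ← Real.rpow_natCast y 2, ← Real.rpow_add hy0]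
      refine (h1 y hy).trans_eq ?_
      rw [Real.sqrt_eq_rpow]; norm_num
  refine e.congr_fun (fun y hy => ?_) measurableSet_Ioi
  simp only [finrank_euclideanSpace_fin, smul_eq_mul]
  rw [pow_mul_levy_eq hy]

lemma integrable_min_levy [NeZero d] :
    Integrable fun z : Rd d => min 1 (‖z‖ ^ 2) * (‖z‖ ^ (d + 1))⁻¹ := by
  refine integrable_radial_levy (g := fun y => min 1 (y ^ 2)) (C := 1) (by fun_prop) ?_ ?_
  · intro y hy
    rw [abs_of_nonneg (by positivity), one_mul]; exact min_le_right _ _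
  · intro y hy
    rw [abs_of_nonneg (by positivity), one_mul]
    exact (min_le_left _ _).trans (by rw [Real.one_le_sqrt]; exact hy.le)

/-- The logarithm tends to infinity and yet has finite mass for the Lévy density, which makes it a
usable penalization in the maximum principle. -/
lemma integrable_log_levy [NeZero d] :
    Integrable fun z : Rd d => Real.log (1 + ‖z‖ ^ 2) * (‖z‖ ^ (d + 1))⁻¹ := by
  refine integrable_radial_levy (g := fun y => Real.log (1 + y ^ 2)) (C := 8) (by fun_prop) ?_ ?_
  · intro y hy
    rw [abs_of_nonneg (Real.log_nonneg (by nlinarith))]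
    nlinarith [Real.log_le_sub_one_of_pos (show 0 < 1 + y ^ 2 by positivity)]
  · intro y hy
    have hy0 : 0 < y := one_pos.trans hy
    rw [abs_of_nonneg (Real.log_nonneg (by nlinarith))]
    have h4 : √(4 * y) ^ 4 = (4 * y) ^ 2 := by
      rw [show 4 = 2 * 2 from rfl, pow_mul, Real.sq_sqrt (by positivity)]
    have h5 : √(4 * y) = 2 * √y := by
      rw [Real.sqrt_mul (by norm_num), show (4 : ℝ) = 2 ^ 2 by norm_num,
        Real.sqrt_sq (by norm_num)]
    calc Real.log (1 + y ^ 2) ≤ Real.log (√(4 * y) ^ 4) :=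
          Real.log_le_log (by positivity) (by rw [h4]; nlinarith)
      _ = 4 * Real.log (√(4 * y)) := by rw [Real.log_pow]; norm_num
      _ ≤ 4 * √(4 * y) := by
          gcongr
          exact (Real.log_le_sub_one_of_pos (by positivity)).trans (by linarith)
      _ = 8 * √y := by rw [h5]; ring

lemma abs_one_sub_cos_le (a : ℝ) : |1 - Real.cos a| ≤ 2 * min 1 (a ^ 2) := by
  rw [abs_of_nonneg (by linarith [Real.cos_le_one a])]
  rcases min_choice 1 (a ^ 2) with h | h <;> rw [h]
  · linarith [Real.neg_one_le_cos a]
  · nlinarith [Real.one_sub_sq_div_two_le_cos (x := a), sq_nonneg a]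

lemma min_one_mul_le {a b : ℝ} (ha : 0 ≤ a) (hb : 0 ≤ b) : min 1 (a * b) ≤ (1 + a) * min 1 b := by
  rcases le_total 1 b with h | h
  · rw [min_eq_left h]; exact (min_le_left _ _).trans (by linarith)
  · rw [min_eq_right h]; exact (min_le_right _ _).trans (by nlinarith)

lemma abs_one_sub_cos_inner_le (z ξ : Rd d) : |1 - Real.cos (2 * Real.pi * inner ℝ z ξ)| ≤
    2 * (1 + (2 * Real.pi * ‖ξ‖) ^ 2) * min 1 (‖z‖ ^ 2) := by
  refine (abs_one_sub_cos_le _).trans ?_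
  rw [mul_assoc 2 (1 + _)]
  refine mul_le_mul_of_nonneg_left ?_ (by norm_num : (0 : ℝ) ≤ 2)
  refine le_trans ?_ (min_one_mul_le (by positivity) (by positivity))
  refine min_le_min (le_refl (1 : ℝ)) ?_
  have h := pow_le_pow_left₀ (abs_nonneg _) (abs_real_inner_le_norm z ξ) 2
  rw [sq_abs] at h
  calc (2 * Real.pi * inner ℝ z ξ) ^ 2 = (2 * Real.pi) ^ 2 * inner ℝ z ξ ^ 2 := by ring
    _ ≤ (2 * Real.pi) ^ 2 * (‖z‖ * ‖ξ‖) ^ 2 := by gcongr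
    _ = _ := by ring

lemma integrable_one_sub_cos [NeZero d] (ξ : Rd d) :
    Integrable fun z : Rd d => (1 - Real.cos (2 * Real.pi * inner ℝ z ξ)) * (‖z‖ ^ (d + 1))⁻¹ := by
  refine (integrable_min_levy.const_mul (2 * (1 + (2 * Real.pi * ‖ξ‖) ^ 2))).mono'
    (Measurable.aestronglyMeasurable (by fun_prop)) (Eventually.of_forall fun z => ?_)
  rw [norm_mul, Real.norm_eq_abs, Real.norm_of_nonneg (by positivity), ← mul_assoc]
  exact mul_le_mul_of_nonneg_right (abs_one_sub_cos_inner_le z ξ) (by positivity)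

/-- There is a normalization of `|z|^{-d-1}` for which the associated symbol is `2π|ξ|`. -/
lemma exists_levyConst [NeZero d] : ∃ c : ℝ, 0 < c ∧ ∀ ξ : Rd d,
    ∫ z : Rd d, (1 - Real.cos (2 * Real.pi * inner ℝ z ξ)) * (c * (‖z‖ ^ (d + 1))⁻¹) =
      2 * Real.pi * ‖ξ‖ := by
  let G : Rd d → Rd d → ℝ := fun ξ z =>
    (1 - Real.cos (2 * Real.pi * inner ℝ z ξ)) * (‖z‖ ^ (d + 1))⁻¹
  let e : Rd d := EuclideanSpace.single 0 1
  have he : ‖e‖ = 1 := by simp [e]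
  -- Homogeneity of degree -d-1 of the density makes the symbol homogeneous of degree 1.
  have hsc : ∀ r : ℝ, 0 < r → ∫ z, G (r • e) z = r * ∫ z, G e z := by
    intro r hr
    have h := Measure.integral_comp_smul_of_nonneg (volume : Measure (Rd d)) (G e) r (hR := hr.le)
    rw [finrank_euclideanSpace_fin, smul_eq_mul, eq_inv_mul_iff_mul_eq₀ (by positivity),
      ← integral_const_mul] at h
    rw [← h, ← integral_const_mul]
    refine integral_congr_ae (Eventually.of_forall fun z => ?_)
    simp only [G, norm_smul, inner_smul_left, inner_smul_right, Real.norm_of_nonneg hr.le,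
      RCLike.conj_to_real]
    rw [mul_pow, pow_succ r]
    rcases eq_or_ne z 0 with rfl | hz
    · simp
    · have := norm_ne_zero_iff.2 hz
      field_simp
  have hrot : ∀ ξ η : Rd d, ‖ξ‖ = ‖η‖ → ∫ z, G ξ z = ∫ z, G η z := by
    intro ξ η h
    -- Two vectors of equal norm are exchanged by a reflection, under which density and measure are
    -- invariant.
    let U : Rd d ≃ₗᵢ[ℝ] Rd d := (ℝ ∙ (ξ - η))ᗮ.reflection
    have hU : U ξ = η := Submodule.reflection_sub h
    rw [← (U.measurePreserving).integral_comp U.toHomeomorph.measurableEmbedding (G η)]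
    refine integral_congr_ae (Eventually.of_forall fun z => ?_)
    simp only [G, ← hU, LinearIsometryEquiv.inner_map_map, LinearIsometryEquiv.norm_map]
  have hpos : 0 < ∫ z, G e z := by
    have hnn : ∀ z, 0 ≤ G e z := fun z =>
      mul_nonneg (by linarith [Real.cos_le_one (2 * Real.pi * inner ℝ z e)]) (by positivity)
    rw [integral_pos_iff_support_of_nonneg hnn (integrable_one_sub_cos e)]
    -- At e/2 the cosine equals -1, so the integrand is nonzero on a neighbourhood and the
    -- normalizing integral is positive.
    have hz0 : (2⁻¹ : ℝ) • e ≠ 0 := by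
      rw [← norm_ne_zero_iff, norm_smul, he]; norm_num
    have hc : ContinuousAt (G e) ((2⁻¹ : ℝ) • e) := by
      refine ContinuousAt.mul (by fun_prop) (ContinuousAt.inv₀ (by fun_prop) ?_)
      exact pow_ne_zero _ (norm_ne_zero_iff.2 hz0)
    have hv : G e ((2⁻¹ : ℝ) • e) ≠ 0 := by
      refine mul_ne_zero ?_ (inv_ne_zero (pow_ne_zero _ (norm_ne_zero_iff.2 hz0)))
      rw [inner_smul_left, real_inner_self_eq_norm_sq, he]
      simp only [RCLike.conj_to_real, one_pow, mul_one]
      rw [show 2 * Real.pi * 2⁻¹ = Real.pi by ring, Real.cos_pi]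
      norm_num
    have hmem : {z | G e z ≠ 0} ∈ 𝓝 ((2⁻¹ : ℝ) • e) := hc.eventually_ne hv
    exact Measure.measure_pos_of_mem_nhds _ hmem
  refine ⟨2 * Real.pi / ∫ z, G e z, by positivity, fun ξ => ?_⟩
  have h1 : ∫ z, G ξ z = ‖ξ‖ * ∫ z, G e z := by
    rcases eq_or_ne ξ 0 with rfl | hξ
    · simp [G]
    · rw [← hsc ‖ξ‖ (norm_pos_iff.2 hξ)]
      exact hrot _ _ (by rw [norm_smul, he]; simp)
  calc _ = ∫ z, (2 * Real.pi / ∫ z, G e z) * G ξ z :=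
        integral_congr_ae (Eventually.of_forall fun z => by simp only [G]; ring)
    _ = _ := by rw [integral_const_mul, h1]; field_simp

open Classical in
/-- The density of the Lévy measure of `|D|`. -/
def levyDensity (z : Rd d) : ℝ :=
  (if h : ∃ c : ℝ, 0 < c ∧ ∀ ξ : Rd d,
    ∫ z : Rd d, (1 - Real.cos (2 * Real.pi * inner ℝ z ξ)) * (c * (‖z‖ ^ (d + 1))⁻¹) =
      2 * Real.pi * ‖ξ‖ then h.choose else 1) * (‖z‖ ^ (d + 1))⁻¹

lemma exists_levyDensity_eq [NeZero d] : ∃ c : ℝ, 0 < c ∧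
    (∀ z : Rd d, levyDensity z = c * (‖z‖ ^ (d + 1))⁻¹) ∧
    ∀ ξ : Rd d, ∫ z : Rd d, (1 - Real.cos (2 * Real.pi * inner ℝ z ξ)) * levyDensity z =
      2 * Real.pi * ‖ξ‖ := by
  have h := exists_levyConst (d := d)
  refine ⟨h.choose, h.choose_spec.1, fun z => by simp only [levyDensity, dif_pos h], fun ξ => ?_⟩
  simp only [levyDensity, dif_pos h]
  exact h.choose_spec.2 ξ

lemma levyDensity_nonneg [NeZero d] (z : Rd d) : 0 ≤ levyDensity z := by
  obtain ⟨c, hc, h, -⟩ := exists_levyDensity_eq (d := d)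
  rw [h]; positivity

lemma measurable_levyDensity : Measurable (levyDensity (d := d)) := by
  unfold levyDensity; fun_prop

lemma integral_one_sub_cos_levy [NeZero d] (ξ : Rd d) :
    ∫ z : Rd d, (1 - Real.cos (2 * Real.pi * inner ℝ z ξ)) * levyDensity z =
      2 * Real.pi * ‖ξ‖ := exists_levyDensity_eq.choose_spec.2.2 ξ

lemma integrable_mul_levyDensity [NeZero d] {g : Rd d → ℝ}
    (h : Integrable fun z : Rd d => g z * (‖z‖ ^ (d + 1))⁻¹) :
    Integrable fun z => g z * levyDensity z := by
  obtain ⟨c, hc, e, -⟩ := exists_levyDensity_eq (d := d)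
  refine (h.const_mul c).congr (Eventually.of_forall fun z => ?_)
  simp only [e]; ring

lemma integrable_mul_levyDensity_of_le [NeZero d] {g : Rd d → ℝ} {C : ℝ}
    (hg : AEStronglyMeasurable g) (h : ∀ z, |g z| ≤ C * min 1 (‖z‖ ^ 2)) :
    Integrable fun z => g z * levyDensity z := by
  refine ((integrable_mul_levyDensity integrable_min_levy).const_mul C).mono'
    (hg.mul measurable_levyDensity.aestronglyMeasurable) (Eventually.of_forall fun z => ?_)
  rw [norm_mul, Real.norm_eq_abs, Real.norm_of_nonneg (levyDensity_nonneg z), ← mul_assoc]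
  exact mul_le_mul_of_nonneg_right (h z) (levyDensity_nonneg z)

/-- The symmetric second difference `f x - (f (x + z) + f (x - z)) / 2`. -/
def secondDiff (f : Rd d → ℝ) (x z : Rd d) : ℝ := f x - (f (x + z) + f (x - z)) / 2

/-- The operator `|D|` in its integral form. -/
def levyOp (f : Rd d → ℝ) (x : Rd d) : ℝ := ∫ z, secondDiff f x z * levyDensity z

/-- The Lévy density represents 2π|ξ| as an integral of 1 - cos(2πz·ξ), which is the multiplier of
the second difference with step z. Fubini applies because |ξ| times the Fourier transform of ψ is
integrable. -/
lemma absDSchwartz_eq_levyOp [NeZero d] (ψ : 𝓢(Rd d, ℂ)) {φ : Rd d → ℝ} (h : ∀ y, ψ y = φ y)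
    (y : Rd d) : absDSchwartz ψ y = (levyOp φ y : ℂ) := by
  have hinv : ∀ x, ∫ ξ, Complex.exp (↑(2 * Real.pi * inner ℝ ξ x) * Complex.I) *
      𝓕 (ψ : Rd d → ℂ) ξ = φ x := by
    intro x
    have h1 := congrFun (ψ.continuous.fourierInv_fourier_eq ψ.integrable
      (𝓕 ψ : 𝓢(Rd d, ℂ)).integrable) x
    rw [Real.fourierInv_eq'] at h1
    rw [← h, ← h1]; rfl
  have hexp : ∀ x, Integrable fun ξ => Complex.exp (↑(2 * Real.pi * inner ℝ ξ x) * Complex.I) *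
      𝓕 (ψ : Rd d → ℂ) ξ := by
    intro x
    refine (𝓕 ψ : 𝓢(Rd d, ℂ)).integrable.bdd_mul (c := 1)
      (Continuous.aestronglyMeasurable (by fun_prop)) (Eventually.of_forall fun ξ => ?_)
    rw [Complex.norm_exp_ofReal_mul_I]
  have hFc : Continuous (𝓕 (ψ : Rd d → ℂ)) := (𝓕 ψ : 𝓢(Rd d, ℂ)).continuous
  let F : Rd d → Rd d → ℂ := fun ξ z =>
    Complex.exp (↑(2 * Real.pi * inner ℝ ξ y) * Complex.I) * 𝓕 (ψ : Rd d → ℂ) ξ *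
      (((1 - Real.cos (2 * Real.pi * inner ℝ z ξ)) * levyDensity z : ℝ) : ℂ)
  have hlev : ∀ ξ, Integrable fun z : Rd d =>
      (1 - Real.cos (2 * Real.pi * inner ℝ z ξ)) * levyDensity z := fun ξ =>
    integrable_mul_levyDensity (integrable_one_sub_cos ξ)
  have hm : AEStronglyMeasurable (Function.uncurry F) (volume.prod volume) := by
    have := measurable_levyDensity (d := d)
    refine Measurable.aestronglyMeasurable ?_
    have h1 : Measurable fun q : Rd d × Rd d => (((1 - Real.cos (2 * Real.pi * inner ℝ q.2 q.1)) *
      levyDensity q.2 : ℝ) : ℂ) := by fun_prop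
    have h2 : Measurable fun q : Rd d × Rd d =>
        Complex.exp (↑(2 * Real.pi * inner ℝ q.1 y) * Complex.I) * 𝓕 (ψ : Rd d → ℂ) q.1 :=
      Continuous.measurable (by fun_prop)
    exact h2.mul h1
  have hnorm : ∀ ξ z, ‖F ξ z‖ = ‖𝓕 (ψ : Rd d → ℂ) ξ‖ *
      ((1 - Real.cos (2 * Real.pi * inner ℝ z ξ)) * levyDensity z) := by
    intro ξ z
    rw [norm_mul, norm_mul, Complex.norm_exp_ofReal_mul_I, one_mul, Complex.norm_real,
      Real.norm_of_nonneg]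
    exact mul_nonneg (by linarith [Real.cos_le_one (2 * Real.pi * inner ℝ z ξ)])
      (levyDensity_nonneg z)
  have hint : Integrable (Function.uncurry F) (volume.prod volume) := by
    rw [integrable_prod_iff hm]
    refine ⟨Eventually.of_forall fun ξ => ((hlev ξ).ofReal (𝕜 := ℂ)).const_mul
      (Complex.exp (↑(2 * Real.pi * inner ℝ ξ y) * Complex.I) * 𝓕 (ψ : Rd d → ℂ) ξ), ?_⟩
    have : (fun ξ => ∫ z, ‖Function.uncurry F (ξ, z)‖) = fun ξ =>
        2 * Real.pi * (‖ξ‖ ^ 1 * ‖(𝓕 ψ : 𝓢(Rd d, ℂ)) ξ‖) := by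
      funext ξ
      simp only [Function.uncurry, hnorm]
      rw [integral_const_mul, integral_one_sub_cos_levy, SchwartzMap.fourier_coe]
      ring
    rw [this]
    exact ((𝓕 ψ : 𝓢(Rd d, ℂ)).integrable_pow_mul volume 1).const_mul _
  have h1 : absDSchwartz ψ y = ∫ ξ, ∫ z, F ξ z := by
    unfold absDSchwartz
    rw [Real.fourierInv_eq']
    refine integral_congr_ae (Eventually.of_forall fun ξ => ?_)
    simp only [F]
    rw [integral_const_mul, integral_complex_ofReal, integral_one_sub_cos_levy, smul_eq_mul]
    ring
  have h2 : ∀ z, ∫ ξ, F ξ z = ((secondDiff φ y z * levyDensity z : ℝ) : ℂ) := by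
    intro z
    have e : ∀ ξ, F ξ z = (levyDensity z : ℂ) *
        (Complex.exp (↑(2 * Real.pi * inner ℝ ξ y) * Complex.I) * 𝓕 (ψ : Rd d → ℂ) ξ -
        (Complex.exp (↑(2 * Real.pi * inner ℝ ξ (y + z)) * Complex.I) * 𝓕 (ψ : Rd d → ℂ) ξ +
        Complex.exp (↑(2 * Real.pi * inner ℝ ξ (y - z)) * Complex.I) * 𝓕 (ψ : Rd d → ℂ) ξ) / 2) := by
      intro ξ
      simp only [F, inner_add_right, inner_sub_right, real_inner_comm ξ z]
      push_cast
      rw [Complex.cos, mul_add (2 * (Real.pi : ℂ)), mul_sub (2 * (Real.pi : ℂ)), add_mul _ _ Complex.I,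
        Complex.exp_add, sub_mul _ _ Complex.I, sub_eq_add_neg (_ * Complex.I), Complex.exp_add,
        neg_mul]
      ring
    simp only [e]
    have hs : Integrable fun ξ =>
        (Complex.exp (↑(2 * Real.pi * inner ℝ ξ (y + z)) * Complex.I) * 𝓕 (ψ : Rd d → ℂ) ξ +
        Complex.exp (↑(2 * Real.pi * inner ℝ ξ (y - z)) * Complex.I) * 𝓕 (ψ : Rd d → ℂ) ξ) / 2 :=
      ((hexp _).add (hexp _)).div_const 2
    rw [integral_const_mul, integral_sub (hexp y) hs,
      integral_div, integral_add (hexp _) (hexp _), hinv, hinv, hinv]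
    simp only [secondDiff]
    push_cast
    ring
  rw [h1, integral_integral_swap hint]
  simp only [h2]
  rw [integral_complex_ofReal]
  rfl

end Levy

/-! ### Second differences and the pointwise form of `|D|` -/

section SecondDiff
variable {d : ℕ} {f : Rd d → ℝ} {K M : ℝ} {x z : Rd d}

lemma abs_secondDiff_le_two_mul (hK : ∀ y, |f y| ≤ K) (x z : Rd d) : |secondDiff f x z| ≤ 2 * K := by
  have h1 := abs_le.1 (hK x); have h2 := abs_le.1 (hK (x + z)); have h3 := abs_le.1 (hK (x - z))
  unfold secondDiff
  rw [abs_le]; constructor <;> linarith [h1.1, h1.2, h2.1, h2.2, h3.1, h3.2]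

/-- Along t ↦ f(x+tz) + f(x-tz) the first-order terms cancel; the derivative is a difference of
gradients at distance at most 2|z|, hence at most 2M|z|². -/
lemma abs_secondDiff_le_mul_sq (hf : ContDiff ℝ 2 f)
    (hM : ∀ w ∈ Metric.closedBall x ‖z‖, ‖fderiv ℝ (fderiv ℝ f) w‖ ≤ M) :
    |secondDiff f x z| ≤ M * ‖z‖ ^ 2 := by
  have hd : Differentiable ℝ f := hf.differentiable (by simp)
  have hd2 : Differentiable ℝ (fderiv ℝ f) :=
    (hf.fderiv_right (m := 1) (by norm_num)).differentiable (by simp)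
  have hder : ∀ t ∈ Icc (0 : ℝ) 1, HasDerivWithinAt (fun t : ℝ => f (x + t • z) + f (x - t • z))
      (fderiv ℝ f (x + t • z) z - fderiv ℝ f (x - t • z) z) (Icc 0 1) t := by
    intro t _
    have h1 : HasDerivAt (fun t : ℝ => x + t • z) z t := by
      simpa using ((hasDerivAt_id t).smul_const z).const_add x
    have h2 : HasDerivAt (fun t : ℝ => x - t • z) (-z) t := by
      simpa using ((hasDerivAt_id t).smul_const z).const_sub x
    have h3 : HasDerivAt (fun t : ℝ => f (x + t • z)) (fderiv ℝ f (x + t • z) z) t :=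
      (hd _).hasFDerivAt.comp_hasDerivAt t h1
    have h4 : HasDerivAt (fun t : ℝ => f (x - t • z)) (fderiv ℝ f (x - t • z) (-z)) t :=
      (hd _).hasFDerivAt.comp_hasDerivAt t h2
    exact ((h3.add h4).congr_deriv (by simp [sub_eq_add_neg])).hasDerivWithinAt
  have hb : ∀ t ∈ Ico (0 : ℝ) 1, ‖fderiv ℝ f (x + t • z) z - fderiv ℝ f (x - t • z) z‖ ≤
      2 * M * ‖z‖ ^ 2 := by
    intro t ht
    have hn : ‖t • z‖ ≤ ‖z‖ := by
      rw [norm_smul, Real.norm_of_nonneg ht.1]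
      exact mul_le_of_le_one_left (norm_nonneg _) ht.2.le
    have hm := (convex_closedBall x ‖z‖).norm_image_sub_le_of_norm_fderiv_le (𝕜 := ℝ)
      (f := fderiv ℝ f) (fun y _ => hd2 y) hM (x := x - t • z) (y := x + t • z)
      (by simpa using hn) (by simpa using hn)
    have hM0 : 0 ≤ M := le_trans (norm_nonneg (fderiv ℝ (fderiv ℝ f) x)) (hM x (by simp))
    calc ‖fderiv ℝ f (x + t • z) z - fderiv ℝ f (x - t • z) z‖
        = ‖(fderiv ℝ f (x + t • z) - fderiv ℝ f (x - t • z)) z‖ := rfl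
      _ ≤ M * ‖x + t • z - (x - t • z)‖ * ‖z‖ :=
          (ContinuousLinearMap.le_opNorm _ _).trans (by gcongr)
      _ ≤ M * (‖z‖ + ‖z‖) * ‖z‖ := by
          gcongr
          rw [show x + t • z - (x - t • z) = t • z + t • z by abel]
          exact (norm_add_le _ _).trans (add_le_add hn hn)
      _ = 2 * M * ‖z‖ ^ 2 := by ring
  have h := norm_image_sub_le_of_norm_deriv_le_segment_01' hder hb
  simp only [one_smul, zero_smul, add_zero, sub_zero] at h
  rw [Real.norm_eq_abs] at h
  unfold secondDiff
  rw [show f x - (f (x + z) + f (x - z)) / 2 = -((f (x + z) + f (x - z) - (f x + f x)) / 2) by ring,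
    abs_neg, abs_div, abs_two]
  linarith

lemma abs_secondDiff_le_min (hf : ContDiff ℝ 2 f) (hK : ∀ y, |f y| ≤ K)
    (hM : ∀ w ∈ Metric.closedBall x 1, ‖fderiv ℝ (fderiv ℝ f) w‖ ≤ M) (z : Rd d) :
    |secondDiff f x z| ≤ (M + 2 * K) * min 1 (‖z‖ ^ 2) := by
  have hM0 : 0 ≤ M := le_trans (norm_nonneg (fderiv ℝ (fderiv ℝ f) x)) (hM x (by simp))
  have hK0 : 0 ≤ K := (abs_nonneg _).trans (hK x)
  rcases le_total ‖z‖ 1 with h | h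
  · rw [min_eq_right (pow_le_one₀ (norm_nonneg _) h)]
    refine (abs_secondDiff_le_mul_sq hf fun w hw =>
      hM w (Metric.closedBall_subset_closedBall h hw)).trans ?_
    gcongr; linarith
  · rw [min_eq_left (one_le_pow₀ h)]
    refine (abs_secondDiff_le_two_mul hK x z).trans ?_
    linarith

lemma continuous_secondDiff (hf : Continuous f) :
    Continuous fun q : Rd d × Rd d => secondDiff f q.1 q.2 := by
  unfold secondDiff; fun_prop

/-- A `C²` kernel which decays, together with its derivatives, faster than `|x|^{-d}`. -/
structure IsDecayingKernel (k : Rd d → ℝ) (C : ℝ) : Prop where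
  contDiff : ContDiff ℝ 2 k
  bound : ∀ x, |k x| ≤ C * polyDecay (d + 1) x
  bound_fderiv : ∀ x, ‖fderiv ℝ k x‖ ≤ C * polyDecay (d + 1) x
  bound_fderiv2 : ∀ x, ‖fderiv ℝ (fderiv ℝ k) x‖ ≤ C * polyDecay (d + 1) x

lemma SchwartzMap.exists_norm_le_polyDecay {F : Type*} [NormedAddCommGroup F] [NormedSpace ℝ F]
    (k : 𝓢(Rd d, F)) (N : ℕ) : ∃ C, ∀ x, ‖k x‖ ≤ C * polyDecay N x := by
  refine ⟨2 ^ N * (Finset.Iic (N, 0)).sup (fun m => SchwartzMap.seminorm ℝ m.1 m.2) k,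
    fun x => ?_⟩
  have h := SchwartzMap.one_add_le_sup_seminorm_apply (𝕜 := ℝ) (m := (N, 0)) (k := N) (n := 0)
    le_rfl le_rfl k x
  rw [norm_iteratedFDeriv_zero] at h
  unfold polyDecay
  rw [← div_eq_mul_inv, le_div_iff₀ (by positivity), mul_comm]
  exact h

lemma SchwartzMap.exists_isDecayingKernel (k : 𝓢(Rd d, ℝ)) : ∃ C, IsDecayingKernel k C := by
  obtain ⟨C₀, h₀⟩ := k.exists_norm_le_polyDecay (d + 1)
  obtain ⟨C₁, h₁⟩ := (SchwartzMap.fderivCLM ℝ _ _ k).exists_norm_le_polyDecay (d + 1)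
  obtain ⟨C₂, h₂⟩ := (SchwartzMap.fderivCLM ℝ _ _
    (SchwartzMap.fderivCLM ℝ _ _ k)).exists_norm_le_polyDecay (d + 1)
  have e : ⇑(SchwartzMap.fderivCLM ℝ (Rd d) ℝ k) = fderiv ℝ k := rfl
  refine ⟨max C₀ (max C₁ C₂), k.smooth 2, fun x => (h₀ x).trans ?_, fun x => (h₁ x).trans ?_,
    fun x => ?_⟩
  · exact mul_le_mul_of_nonneg_right (le_max_left _ _) (polyDecay_pos _ _).le
  · exact mul_le_mul_of_nonneg_right ((le_max_left _ _).trans (le_max_right _ _))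
      (polyDecay_pos _ _).le
  · have h := h₂ x
    rw [SchwartzMap.fderivCLM_apply, e] at h
    exact h.trans (mul_le_mul_of_nonneg_right ((le_max_right _ _).trans (le_max_right _ _))
      (polyDecay_pos _ _).le)

namespace IsDecayingKernel
variable {k : Rd d → ℝ} {C : ℝ}

lemma continuous (hk : IsDecayingKernel k C) : Continuous k := hk.contDiff.continuous

lemma nonneg (hk : IsDecayingKernel k C) : 0 ≤ C := by
  have := (abs_nonneg _).trans (hk.bound 0)
  exact nonneg_of_mul_nonneg_left this (polyDecay_pos _ _)

lemma integrable (hk : IsDecayingKernel k C) : Integrable k :=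
  ((integrable_polyDecay (Nat.lt_succ_self d)).const_mul C).mono'
    hk.continuous.aestronglyMeasurable (Eventually.of_forall hk.bound)

lemma integrable_secondDiff (hk : IsDecayingKernel k C) (z : Rd d) :
    Integrable fun x => secondDiff k x z :=
  hk.integrable.sub (((hk.integrable.comp_add_right z).add (hk.integrable.comp_sub_right z)).div_const 2)

/-- The quadratic bound for short steps, integrated by means of the decay of the second derivative,
and the triangle inequality for long ones. It makes second differences of the kernel integrable in
(x, z) against the Lévy density. -/
lemma exists_integral_secondDiff_le (hk : IsDecayingKernel k C) :
    ∃ C', 0 ≤ C' ∧ ∀ z, ∫ x, |secondDiff k x z| ≤ C' * min 1 (‖z‖ ^ 2) := by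
  have hC := hk.nonneg
  have hI : 0 ≤ ∫ x : Rd d, polyDecay (d + 1) x :=
    integral_nonneg fun x => (polyDecay_pos _ x).le
  have hI2 : 0 ≤ ∫ x, |k x| := integral_nonneg fun x => abs_nonneg _
  refine ⟨C * 2 ^ (d + 1) * (∫ x : Rd d, polyDecay (d + 1) x) + 2 * ∫ x, |k x|, by positivity,
    fun z => ?_⟩
  rcases le_total ‖z‖ 1 with h | h
  · rw [min_eq_right (pow_le_one₀ (norm_nonneg _) h)]
    have hp : ∀ x, |secondDiff k x z| ≤ C * 2 ^ (d + 1) * ‖z‖ ^ 2 * polyDecay (d + 1) x := by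
      intro x
      refine (abs_secondDiff_le_mul_sq (M := C * 2 ^ (d + 1) * polyDecay (d + 1) x) hk.contDiff
        fun w hw => (hk.bound_fderiv2 w).trans ?_).trans_eq (by ring)
      rw [mul_assoc]
      refine mul_le_mul_of_nonneg_left ?_ hC
      have hw1 : ‖w - x‖ ≤ 1 := by
        rw [Metric.mem_closedBall, dist_eq_norm] at hw; exact hw.trans h
      have := polyDecay_translate (d + 1) x (w - x)
      rw [add_sub_cancel] at this
      refine this.trans (mul_le_mul_of_nonneg_right ?_ (polyDecay_pos _ _).le)
      exact pow_le_pow_left₀ (by positivity) (by linarith) _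
    calc ∫ x, |secondDiff k x z|
        ≤ ∫ x, C * 2 ^ (d + 1) * ‖z‖ ^ 2 * polyDecay (d + 1) x :=
          integral_mono (hk.integrable_secondDiff z).abs
            ((integrable_polyDecay (Nat.lt_succ_self d)).const_mul _) hp
      _ = C * 2 ^ (d + 1) * (∫ x : Rd d, polyDecay (d + 1) x) * ‖z‖ ^ 2 := by
          rw [integral_const_mul]; ring
      _ ≤ _ := by gcongr; linarith
  · rw [min_eq_left (one_le_pow₀ h)]
    have hi := hk.integrable.abs
    have h1 := hi.comp_add_right z
    have h2 := hi.comp_sub_right z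
    have hp : ∀ x, |secondDiff k x z| ≤ |k x| + (|k (x + z)| + |k (x - z)|) / 2 := by
      intro x
      refine (abs_sub _ _).trans (add_le_add le_rfl ?_)
      rw [abs_div, abs_two]
      gcongr
      exact abs_add_le _ _
    calc ∫ x, |secondDiff k x z| ≤ ∫ x, (|k x| + (|k (x + z)| + |k (x - z)|) / 2) :=
          integral_mono (hk.integrable_secondDiff z).abs (hi.add ((h1.add h2).div_const 2)) hp
      _ = 2 * ∫ x, |k x| := by
          have h3 : Integrable fun x => (|k (x + z)| + |k (x - z)|) / 2 := (h1.add h2).div_const 2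
          rw [integral_add hi h3, integral_div, integral_add h1 h2,
            integral_add_right_eq_self (fun x => |k x|), integral_sub_right_eq_self (fun x => |k x|)]
          ring
      _ ≤ _ := by
          have : 0 ≤ C * 2 ^ (d + 1) * (∫ x : Rd d, polyDecay (d + 1) x) := by positivity
          linarith

lemma integrable_secondDiff_prod [NeZero d] (hk : IsDecayingKernel k C) :
    Integrable (fun q : Rd d × Rd d => secondDiff k q.1 q.2 * levyDensity q.2)
      (volume.prod volume) := by
  have hm : AEStronglyMeasurable (fun q : Rd d × Rd d => secondDiff k q.1 q.2 * levyDensity q.2)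
      (volume.prod volume) :=
    ((continuous_secondDiff hk.continuous).measurable.mul
      (measurable_levyDensity.comp measurable_snd)).aestronglyMeasurable
  rw [integrable_prod_iff' hm]
  refine ⟨Eventually.of_forall fun z => (hk.integrable_secondDiff z).mul_const (levyDensity z), ?_⟩
  obtain ⟨C', hC', h⟩ := hk.exists_integral_secondDiff_le
  have e : (fun z => ∫ x, ‖secondDiff k x z * levyDensity z‖) =
      fun z => (∫ x, |secondDiff k x z|) * levyDensity z := by
    funext z
    rw [← integral_mul_const]
    refine integral_congr_ae (Eventually.of_forall fun x => ?_)
    simp only [norm_mul, Real.norm_eq_abs, abs_of_nonneg (levyDensity_nonneg z)]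
  simp only [e]
  refine integrable_mul_levyDensity_of_le (C := C') ?_ fun z => ?_
  · have : StronglyMeasurable fun q : Rd d × Rd d => |secondDiff k q.2 q.1| :=
      ((continuous_secondDiff hk.continuous).comp continuous_swap).abs.stronglyMeasurable
    exact (this.integral_prod_right (ν := volume)).aestronglyMeasurable
  · rw [abs_of_nonneg (integral_nonneg fun x => abs_nonneg _)]; exact h z

lemma secondDiff_kernelConv (hk : IsDecayingKernel k C) (hf : Measurable f) (hM : ∀ y, |f y| ≤ M)
    (x z : Rd d) :
    secondDiff (kernelConv k f) x z = kernelConv (fun w => secondDiff k w z) f x := by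
  have hi := fun x => integrable_kernelConv hk.integrable hf hM x
  have h3 : Integrable fun y => (k (x + z - y) * f y + k (x - z - y) * f y) / 2 :=
    ((hi _).add (hi _)).div_const 2
  unfold kernelConv secondDiff
  rw [← integral_add (hi _) (hi _), ← integral_div, ← integral_sub (hi _) h3]
  refine integral_congr_ae (Eventually.of_forall fun y => ?_)
  simp only
  rw [show x + z - y = x - y + z by abel, show x - z - y = x - y - z by abel]
  ring

lemma exists_abs_secondDiff_kernelConv_le (hk : IsDecayingKernel k C) (hf : Measurable f)
    (hM : ∀ y, |f y| ≤ M) :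
    ∃ C', 0 ≤ C' ∧ ∀ x z, |secondDiff (kernelConv k f) x z| ≤ C' * min 1 (‖z‖ ^ 2) := by
  have hM0 : 0 ≤ M := (abs_nonneg _).trans (hM 0)
  obtain ⟨C', hC', h⟩ := hk.exists_integral_secondDiff_le
  refine ⟨C' * M, by positivity, fun x z => ?_⟩
  rw [hk.secondDiff_kernelConv hf hM]
  refine (abs_kernelConv_le (hk.integrable_secondDiff z) hM x).trans ?_
  nlinarith [h z]

/-- Fubini, justified by the L¹ bound on second differences of the kernel. All regularity is taken
from k, so f need only be bounded and measurable. -/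
lemma kernelConv_levyOp [NeZero d] (hk : IsDecayingKernel k C) (hf : Measurable f)
    (hM : ∀ y, |f y| ≤ M) (x : Rd d) :
    kernelConv (levyOp k) f x = levyOp (kernelConv k f) x := by
  have hi := hk.integrable_secondDiff_prod
  have hmp : MeasurePreserving (fun q : Rd d × Rd d => (x - q.1, q.2)) (volume.prod volume)
      (volume.prod volume) :=
    (Measure.measurePreserving_sub_left volume x).prod (MeasurePreserving.id volume)
  have hi2 := hmp.integrable_comp_of_integrable hi
  have hi3 : Integrable (Function.uncurry fun y z =>
      (secondDiff k (x - y) z * levyDensity z) * f y) (volume.prod volume) := by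
    have hfm : AEStronglyMeasurable (fun q : Rd d × Rd d => f q.1) (volume.prod volume) :=
      (hf.comp measurable_fst).aestronglyMeasurable
    exact hi2.mul_bdd hfm (Eventually.of_forall fun q => hM q.1)
  calc kernelConv (levyOp k) f x
      = ∫ y, ∫ z, (secondDiff k (x - y) z * levyDensity z) * f y := by
        unfold kernelConv levyOp
        simp only [integral_mul_const]
    _ = ∫ z, ∫ y, (secondDiff k (x - y) z * levyDensity z) * f y := integral_integral_swap hi3
    _ = levyOp (kernelConv k f) x := by
        unfold levyOp
        refine integral_congr_ae (Eventually.of_forall fun z => ?_)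
        simp only
        rw [hk.secondDiff_kernelConv hf hM, kernelConv, ← integral_mul_const]
        refine integral_congr_ae (Eventually.of_forall fun y => ?_)
        simp only; ring

end IsDecayingKernel

lemma levyOp_comp_sub_left (k : Rd d → ℝ) (x y : Rd d) :
    levyOp (fun y => k (x - y)) y = levyOp k (x - y) := by
  unfold levyOp secondDiff
  refine integral_congr_ae (Eventually.of_forall fun z => ?_)
  simp only
  rw [show x - (y + z) = x - y - z by abel, show x - (y - z) = x - y + z by abel]
  ring

/-- Smoothing the relation `|D| f = g` by a Schwartz kernel gives a pointwise relation. -/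
lemma HasAbsD.kernelConv_eq_levyOp [NeZero d] {g : Rd d → ℝ} (h : HasAbsD f g) (hf : Measurable f)
    (hM : ∀ y, |f y| ≤ M) (k : 𝓢(Rd d, ℝ)) (x : Rd d) :
    kernelConv k g x = levyOp (kernelConv k f) x := by
  obtain ⟨C, hk⟩ := k.exists_isDecayingKernel
  -- The test function is y ↦ k(x - y), which turns the distributional identity into an identity
  -- between convolutions at x.
  let ψ : 𝓢(Rd d, ℂ) := SchwartzMap.compSubConstCLM ℝ x
    (SchwartzMap.compCLMOfContinuousLinearEquiv ℝ (ContinuousLinearEquiv.neg ℝ)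
      (SchwartzMap.postcompCLM Complex.ofRealCLM k))
  have hψ : ∀ y, ψ y = ((fun y => k (x - y)) y : ℝ) := by
    intro y
    simp [ψ]
  have h1 := (h ψ).2
  rw [← hk.kernelConv_levyOp hf hM]
  have e1 : ∫ y, (g y : ℂ) * ψ y = ((kernelConv k g x : ℝ) : ℂ) := by
    unfold kernelConv
    rw [← integral_complex_ofReal]
    refine integral_congr_ae (Eventually.of_forall fun y => ?_)
    simp only [hψ]; push_cast; ring
  have e2 : ∫ y, (f y : ℂ) * absDSchwartz ψ y = ((kernelConv (levyOp k) f x : ℝ) : ℂ) := by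
    unfold kernelConv
    rw [← integral_complex_ofReal]
    refine integral_congr_ae (Eventually.of_forall fun y => ?_)
    simp only [absDSchwartz_eq_levyOp ψ hψ, levyOp_comp_sub_left]
    push_cast; ring
  rw [e1, e2] at h1
  exact_mod_cast h1

/-- The pointwise form of `|D| f = g` for smooth bounded `f`. -/
lemma HasAbsD.eq_levyOp [NeZero d] {g : Rd d → ℝ} (h : HasAbsD f g) (hf : ContDiff ℝ 2 f)
    (hM : ∀ y, |f y| ≤ M) (hg : Continuous g) (x : Rd d) : g x = levyOp f x := by
  -- An approximate identity supported in balls of radius 1/(n+1); it is compactly supported, so it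
  -- is Schwartz and the smoothed relation applies.
  let φ : ℕ → ContDiffBump (0 : Rd d) := fun n =>
    ⟨1 / ((n : ℝ) + 1) / 2, 1 / ((n : ℝ) + 1), by positivity, half_lt_self (by positivity)⟩
  have hφ : Tendsto (fun n => (φ n).rOut) atTop (𝓝 0) := tendsto_one_div_add_atTop_nhds_zero_nat
  let k : ℕ → Rd d → ℝ := fun n => (φ n).normed volume
  let S : ℕ → 𝓢(Rd d, ℝ) := fun n =>
    ((φ n).hasCompactSupport_normed (μ := volume)).toSchwartzMap (φ n).contDiff_normed
  have hS : ∀ n, ⇑(S n) = k n := fun n => rfl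
  have hlim : ∀ u : Rd d → ℝ, Continuous u → ∀ y,
      Tendsto (fun n => kernelConv (k n) u y) atTop (𝓝 (u y)) := by
    intro u hu y
    refine (ContDiffBump.convolution_tendsto_right_of_continuous (μ := volume) hφ hu y).congr
      fun n => ?_
    rw [kernelConv_eq]; rfl
  obtain ⟨B, hB⟩ := (isCompact_closedBall x 2).exists_bound_of_continuousOn
    ((hf.fderiv_right (m := 1) (by norm_num)).continuous_fderiv (by simp)).continuousOn
  -- Smoothing averages the second difference over points within distance 1 of x, so bounds on the
  -- ball of radius 2 dominate uniformly in n.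
  have hbd : ∀ n z, |secondDiff (kernelConv (k n) f) x z| ≤ (B + 2 * M) * min 1 (‖z‖ ^ 2) := by
    intro n z
    have hki : Integrable (k n) := (φ n).integrable_normed
    have hi := fun x => integrable_mul_of_bounded hki
      (f := fun w => f (x - w)) (hf.continuous.comp (by fun_prop)).measurable (fun w => hM _)
    have e : secondDiff (kernelConv (k n) f) x z = ∫ w, k n w * secondDiff f (x - w) z := by
      simp only [secondDiff, kernelConv_eq]
      have h3 : Integrable fun w => (k n w * f (x + z - w) + k n w * f (x - z - w)) / 2 :=
        ((hi _).add (hi _)).div_const 2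
      rw [← integral_add (hi _) (hi _), ← integral_div, ← integral_sub (hi _) h3]
      refine integral_congr_ae (Eventually.of_forall fun w => ?_)
      simp only
      rw [show x + z - w = x - w + z by abel, show x - z - w = x - w - z by abel]
      ring
    rw [e]
    calc |∫ w, k n w * secondDiff f (x - w) z|
        ≤ ∫ w, k n w * ((B + 2 * M) * min 1 (‖z‖ ^ 2)) := by
          rw [← Real.norm_eq_abs]
          refine norm_integral_le_of_norm_le (hki.mul_const _) (Eventually.of_forall fun w => ?_)
          rw [norm_mul, Real.norm_of_nonneg ((φ n).nonneg_normed w)]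
          by_cases hw : w ∈ Function.support (k n)
          · refine mul_le_mul_of_nonneg_left ?_ ((φ n).nonneg_normed w)
            have hw1 : ‖w‖ < 1 / ((n : ℝ) + 1) := by
              rw [ContDiffBump.support_normed_eq] at hw
              simpa [φ] using hw
            have hw2 : ‖w‖ ≤ 1 := hw1.le.trans (by
              rw [div_le_one (by positivity)]; linarith [show (0 : ℝ) ≤ n by positivity])
            refine abs_secondDiff_le_min hf hM (fun y hy => hB y ?_) z
            rw [Metric.mem_closedBall, dist_eq_norm] at hy ⊢
            calc ‖y - x‖ = ‖(y - (x - w)) - w‖ := by congr 1; abel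
              _ ≤ 1 + 1 := (norm_sub_le _ _).trans (add_le_add hy hw2)
              _ = 2 := by norm_num
          · have hw0 : (φ n).normed volume w = 0 := Function.notMem_support.1 hw
            simp [k, hw0]
      _ = _ := by
          rw [integral_mul_const, (φ n).integral_normed, one_mul]
  have h1 : Tendsto (fun n => levyOp (kernelConv (k n) f) x) atTop (𝓝 (levyOp f x)) := by
    unfold levyOp
    have hkc : ∀ n, Continuous (kernelConv (k n) f) := fun n => by
      obtain ⟨C, hC⟩ := (S n).exists_isDecayingKernel
      rw [hS] at hC
      exact continuous_iff_continuousAt.2 fun y => (hasFDerivAt_kernelConv (hC.contDiff.of_le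
        (by norm_num)) hC.integrable hC.bound_fderiv hf.continuous.measurable hM y).continuousAt
    refine tendsto_integral_of_dominated_convergence
      (fun z => (B + 2 * M) * min 1 (‖z‖ ^ 2) * levyDensity z) (fun n => ?_) ?_ (fun n => ?_) ?_
    · exact (((continuous_secondDiff (hkc n)).comp (Continuous.prodMk_right x)).measurable.mul
        measurable_levyDensity).aestronglyMeasurable
    · exact integrable_mul_levyDensity_of_le (C := |B + 2 * M|)
        (Continuous.aestronglyMeasurable (by fun_prop)) fun z => by
          rw [abs_mul, abs_of_nonneg (a := min _ _) (by positivity)]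
    · refine Eventually.of_forall fun z => ?_
      rw [norm_mul, Real.norm_eq_abs, Real.norm_of_nonneg (levyDensity_nonneg z)]
      exact mul_le_mul_of_nonneg_right (hbd n z) (levyDensity_nonneg z)
    · refine Eventually.of_forall fun z => ?_
      have := hlim f hf.continuous
      exact ((this x).sub (((this (x + z)).add (this (x - z))).div_const 2)).mul_const _
  have h2 := hlim g hg x
  refine tendsto_nhds_unique h2 (h1.congr fun n => ?_)
  have := h.kernelConv_eq_levyOp hf.continuous.measurable hM (S n) x
  rw [hS] at this
  exact this.symm

end SecondDiff

/-! ### The maximum principle -/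

section MaxPrinciple
variable {d : ℕ}

/-- The parallelogram law fixes |x+z|² + |x-z|², so the product (1+|x+z|²)(1+|x-z|²) is at most
(1+|x|²+|z|²)², hence at most the square of (1+|x|²)(1+|z|²). The bound is uniform in x. -/
lemma secondDiff_log_ge (x z : Rd d) :
    -Real.log (1 + ‖z‖ ^ 2) ≤ secondDiff (fun x : Rd d => Real.log (1 + ‖x‖ ^ 2)) x z := by
  have hpar : ‖x + z‖ ^ 2 + ‖x - z‖ ^ 2 = 2 * (‖x‖ ^ 2 + ‖z‖ ^ 2) := by
    have := parallelogram_law_with_norm ℝ x z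
    nlinarith
  have hA : 0 < 1 + ‖x + z‖ ^ 2 := by positivity
  have hB : 0 < 1 + ‖x - z‖ ^ 2 := by positivity
  have hX : 0 < 1 + ‖x‖ ^ 2 := by positivity
  have hZ : 0 < 1 + ‖z‖ ^ 2 := by positivity
  have h : Real.log ((1 + ‖x + z‖ ^ 2) * (1 + ‖x - z‖ ^ 2)) ≤
      Real.log (((1 + ‖x‖ ^ 2) * (1 + ‖z‖ ^ 2)) ^ 2) := by
    refine Real.log_le_log (by positivity) ?_
    have h1 : (1 + ‖x + z‖ ^ 2) * (1 + ‖x - z‖ ^ 2) ≤ (1 + ‖x‖ ^ 2 + ‖z‖ ^ 2) ^ 2 := by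
      nlinarith [sq_nonneg (‖x + z‖ ^ 2 - ‖x - z‖ ^ 2)]
    refine h1.trans (pow_le_pow_left₀ (by positivity) ?_ 2)
    nlinarith [mul_nonneg (sq_nonneg ‖x‖) (sq_nonneg ‖z‖)]
  rw [Real.log_mul hA.ne' hB.ne', Real.log_pow, Real.log_mul hX.ne' hZ.ne'] at h
  push_cast at h
  simp only [secondDiff]
  linarith

lemma exists_hasFDerivAt_log (x : Rd d) : ∃ L : Rd d →L[ℝ] ℝ,
    HasFDerivAt (fun x : Rd d => Real.log (1 + ‖x‖ ^ 2)) L x ∧ ∀ w, |L w| ≤ ‖w‖ := by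
  have hX : 0 < 1 + ‖x‖ ^ 2 := by positivity
  have h := ((hasStrictFDerivAt_norm_sq x).hasFDerivAt.const_add 1).log hX.ne'
  refine ⟨_, h, fun w => ?_⟩
  simp only [smul_apply, innerSL_apply_apply, smul_eq_mul, nsmul_eq_mul]
  rw [abs_mul, abs_of_pos (inv_pos.2 hX), inv_mul_le_iff₀ hX, abs_mul]
  have := abs_real_inner_le_norm x w
  have h2 : |((2 : ℕ) : ℝ)| = 2 := by norm_num
  rw [h2]
  nlinarith [sq_nonneg (‖x‖ - 1), norm_nonneg w, norm_nonneg x]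

/-- Only quotients from earlier times are used, so the final time T, where a one-sided derivative is
all there is, is covered. -/
lemma nonneg_of_isMaxOn_right {f : ℝ → ℝ} {f' T t : ℝ} (ht : t ∈ Icc 0 T) (ht0 : 0 < t)
    (hf : HasDerivWithinAt f f' (Icc 0 T) t) (hmax : ∀ s ∈ Icc 0 T, f s ≤ f t) : 0 ≤ f' := by
  have hsub : Ioo 0 t ⊆ Icc 0 T := fun s hs => ⟨hs.1.le, hs.2.le.trans ht.2⟩
  have h := (hasDerivWithinAt_iff_tendsto_slope' (by simp)).1 (hf.mono hsub)
  have : (𝓝[Ioo 0 t] t).NeBot := right_nhdsWithin_Ioo_neBot ht0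
  refine ge_of_tendsto h ?_
  filter_upwards [self_mem_nhdsWithin] with s hs
  rw [slope_def_field]
  exact div_nonneg_of_nonpos (by linarith [hmax s (hsub hs)]) (by linarith [hs.2])

lemma exists_global_max {T K M δ : ℝ} {u : ℝ × Rd d → ℝ} (hδ : 0 < δ)
    (hc : ContinuousOn u (Icc 0 T ×ˢ univ))
    (hK : ∀ t ∈ Icc 0 T, ∀ x, u (t, x) ≤ K - δ * Real.log (1 + ‖x‖ ^ 2)) {t₁ : ℝ} {x₁ : Rd d}
    (ht₁ : t₁ ∈ Icc 0 T) (hlt : M < u (t₁, x₁)) :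
    ∃ t₀ ∈ Icc 0 T, ∃ x₀, M < u (t₀, x₀) ∧ ∀ t ∈ Icc 0 T, ∀ x, u (t, x) ≤ u (t₀, x₀) := by
  -- The radius makes log(1+|x|²) exceed |(K-M)/δ| outside the ball, where the penalized function
  -- then lies below M.
  obtain ⟨R, hR₁, hR₂⟩ : ∃ R, ‖x₁‖ ≤ R ∧ Real.exp (|(K - M) / δ| + 1) ≤ R :=
    ⟨_, le_max_left _ _, le_max_right _ _⟩
  have hmem : (t₁, x₁) ∈ Icc 0 T ×ˢ Metric.closedBall (0 : Rd d) R := ⟨ht₁, by simpa using hR₁⟩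
  obtain ⟨⟨t₀, x₀⟩, hm, hmax⟩ := (isCompact_Icc.prod (isCompact_closedBall (0 : Rd d)
    R)).exists_isMaxOn ⟨_, hmem⟩ (hc.mono (prod_mono le_rfl (subset_univ _)))
  have hgt : M < u (t₀, x₀) := hlt.trans_le (hmax hmem)
  refine ⟨t₀, hm.1, x₀, hgt, fun t ht x => ?_⟩
  by_cases hx : x ∈ Metric.closedBall 0 R
  · exact hmax (⟨ht, hx⟩ : (t, x) ∈ Icc 0 T ×ˢ Metric.closedBall (0 : Rd d) R)
  · refine le_trans ?_ hgt.le
    rw [Metric.mem_closedBall, dist_zero_right, not_le] at hx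
    have h1 : |(K - M) / δ| + 1 ≤ Real.log (1 + ‖x‖ ^ 2) := by
      rw [Real.le_log_iff_exp_le (by positivity)]
      nlinarith [sq_nonneg (‖x‖ - 1)]
    have h2 : K - M ≤ δ * Real.log (1 + ‖x‖ ^ 2) := by
      rw [← div_le_iff₀' hδ]
      linarith [le_abs_self ((K - M) / δ)]
    linarith [hK t ht x]

/-- The total Lévy mass of the penalization `log (1 + |z|²)`. -/
def levyLogMass (d : ℕ) : ℝ := ∫ z : Rd d, Real.log (1 + ‖z‖ ^ 2) * levyDensity z

lemma levyLogMass_nonneg [NeZero d] : 0 ≤ levyLogMass d :=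
  integral_nonneg fun z => mul_nonneg (Real.log_nonneg (by nlinarith [sq_nonneg ‖z‖]))
    (levyDensity_nonneg z)

/-- At the maximum the gradient of f equals δ times that of the logarithm, which has norm at most 1,
and every second difference of f is at least δ times that of the logarithm. Both errors vanish with
δ. -/
lemma bounds_at_penalized_max [NeZero d] {f : Rd d → ℝ} {K δ V : ℝ} {x₀ w : Rd d}
    (hf : ContDiff ℝ 2 f) (hK : ∀ x, |f x| ≤ K) (hδ : 0 < δ) (hw : ‖w‖ ≤ V)
    (hmax : ∀ x, f x - δ * Real.log (1 + ‖x‖ ^ 2) ≤ f x₀ - δ * Real.log (1 + ‖x₀‖ ^ 2)) :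
    -(δ * V) ≤ fderiv ℝ f x₀ w ∧ -(δ * levyLogMass d) ≤ levyOp f x₀ := by
  constructor
  · obtain ⟨L, hL, hLb⟩ := exists_hasFDerivAt_log x₀
    have hd2 : fderiv ℝ f x₀ = δ • L := by
      have h1 : HasFDerivAt (fun x => f x - δ * Real.log (1 + ‖x‖ ^ 2)) (fderiv ℝ f x₀ - δ • L) x₀ :=
        (hf.differentiable (by simp) x₀).hasFDerivAt.sub (hL.const_mul δ)
      have h2 : IsLocalMax (fun x => f x - δ * Real.log (1 + ‖x‖ ^ 2)) x₀ :=
        Eventually.of_forall hmax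
      exact sub_eq_zero.1 (h2.hasFDerivAt_eq_zero h1)
    have h1 := (abs_le.1 ((hLb w).trans hw)).1
    rw [hd2, smul_apply, smul_eq_mul]
    nlinarith
  · obtain ⟨B, hB⟩ := (isCompact_closedBall x₀ 1).exists_bound_of_continuousOn
      ((hf.fderiv_right (m := 1) (by norm_num)).continuous_fderiv (by simp)).continuousOn
    have hi : Integrable fun z => secondDiff f x₀ z * levyDensity z :=
      integrable_mul_levyDensity_of_le (C := B + 2 * K)
        ((continuous_secondDiff hf.continuous).comp
          (Continuous.prodMk_right x₀)).aestronglyMeasurable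
        (abs_secondDiff_le_min hf hK hB)
    have hi2 : Integrable fun z : Rd d => Real.log (1 + ‖z‖ ^ 2) * levyDensity z :=
      integrable_mul_levyDensity integrable_log_levy
    unfold levyLogMass levyOp
    rw [← integral_const_mul, ← integral_neg]
    refine integral_mono (hi2.const_mul δ).neg hi fun z => ?_
    have h1 := mul_le_mul_of_nonneg_left (secondDiff_log_ge x₀ z) hδ.le
    have h2 := hmax (x₀ + z)
    have h3 := hmax (x₀ - z)
    have h4 : -(δ * Real.log (1 + ‖z‖ ^ 2)) ≤ secondDiff f x₀ z := by
      simp only [secondDiff] at h1 ⊢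
      linarith
    have h6 := mul_le_mul_of_nonneg_right h4 (levyDensity_nonneg z)
    simp only
    linarith

section
variable [NeZero d] {T K V M : ℝ} {v : ℝ → Rd d → Rd d} {θ θ' : ℝ → Rd d → ℝ}

lemma le_of_transport_levyOp_aux
    (hc : ContinuousOn (fun q : ℝ × Rd d => θ q.1 q.2) (Icc 0 T ×ˢ univ))
    (hsm : ∀ t ∈ Icc 0 T, ContDiff ℝ 2 (θ t)) (hK : ∀ t ∈ Icc 0 T, ∀ x, |θ t x| ≤ K)
    (hV : ∀ t ∈ Icc 0 T, ∀ x, ‖v t x‖ ≤ V)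
    (hder : ∀ t ∈ Icc 0 T, ∀ x, HasDerivWithinAt (fun s => θ s x) (θ' t x) (Icc 0 T) t)
    (heq : ∀ t ∈ Icc 0 T, ∀ x, θ' t x + fderiv ℝ (θ t) x (v t x) + levyOp (θ t) x = 0)
    (h0 : ∀ x, θ 0 x ≤ M) {δ : ℝ} (hδ : 0 < δ) {t : ℝ} (ht : t ∈ Icc 0 T) (x : Rd d) :
    θ t x - δ * Real.log (1 + ‖x‖ ^ 2) - δ * (V + levyLogMass d + 1) * t ≤ M := by
  by_contra! hlt
  have hV0 : 0 ≤ V := (norm_nonneg _).trans (hV t ht x)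
  have hI0 := levyLogMass_nonneg (d := d)
  have hψc : Continuous fun q : ℝ × Rd d => Real.log (1 + ‖q.2‖ ^ 2) :=
    Continuous.log (by fun_prop) fun x => by positivity
  -- Transport and diffusion err by at most δ(V + mass) at the penalized maximum; the additional 1
  -- makes the contradiction strict.
  set ε := δ * (V + levyLogMass d + 1) with hε
  have hε0 : 0 ≤ ε := by positivity
  let u : ℝ × Rd d → ℝ := fun q => θ q.1 q.2 - δ * Real.log (1 + ‖q.2‖ ^ 2) - ε * q.1
  have huc : ContinuousOn u (Icc 0 T ×ˢ univ) :=
    (hc.sub (hψc.const_mul δ).continuousOn).sub (continuous_fst.const_mul ε).continuousOn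
  have huK : ∀ t ∈ Icc 0 T, ∀ x, u (t, x) ≤ K - δ * Real.log (1 + ‖x‖ ^ 2) := by
    intro t ht x
    have h3 : 0 ≤ ε * t := mul_nonneg hε0 ht.1
    have h4 := (le_abs_self _).trans (hK t ht x)
    simp only [u]
    linarith
  obtain ⟨t₀, ht₀, x₀, hgt, hglob⟩ := exists_global_max hδ huc huK ht hlt
  simp only [u] at hgt hglob
  have htpos : 0 < t₀ := by
    refine lt_of_le_of_ne ht₀.1 fun h => ?_
    have h1 := h0 x₀
    have h2 := mul_nonneg hδ.le
      (Real.log_nonneg (show 1 ≤ 1 + ‖x₀‖ ^ 2 by nlinarith [sq_nonneg ‖x₀‖]))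
    rw [← h] at hgt
    linarith
  have hd1 : 0 ≤ θ' t₀ x₀ - ε := by
    refine nonneg_of_isMaxOn_right (f := fun s => θ s x₀ - ε * s) ht₀ htpos ?_ ?_
    · exact (hder t₀ ht₀ x₀).sub
        (((hasDerivAt_id t₀).const_mul ε).hasDerivWithinAt.congr_deriv (by simp))
    · intro s hs
      have := hglob s hs x₀
      linarith
  obtain ⟨hd3, hd4⟩ := bounds_at_penalized_max (hsm t₀ ht₀) (hK t₀ ht₀) hδ (hV t₀ ht₀ x₀)
    (x₀ := x₀) fun x => by linarith [hglob t₀ ht₀ x]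
  have := heq t₀ ht₀ x₀
  have : ε = δ * V + δ * levyLogMass d + δ := by rw [hε]; ring
  linarith

/-- **Maximum principle** for the transport equation with fractional diffusion. -/
theorem le_of_transport_levyOp
    (hc : ContinuousOn (fun q : ℝ × Rd d => θ q.1 q.2) (Icc 0 T ×ˢ univ))
    (hsm : ∀ t ∈ Icc 0 T, ContDiff ℝ 2 (θ t)) (hK : ∀ t ∈ Icc 0 T, ∀ x, |θ t x| ≤ K)
    (hV : ∀ t ∈ Icc 0 T, ∀ x, ‖v t x‖ ≤ V)
    (hder : ∀ t ∈ Icc 0 T, ∀ x, HasDerivWithinAt (fun s => θ s x) (θ' t x) (Icc 0 T) t)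
    (heq : ∀ t ∈ Icc 0 T, ∀ x, θ' t x + fderiv ℝ (θ t) x (v t x) + levyOp (θ t) x = 0)
    (h0 : ∀ x, θ 0 x ≤ M) {t : ℝ} (ht : t ∈ Icc 0 T) (x : Rd d) : θ t x ≤ M := by
  refine le_of_forall_pos_le_add fun e he => ?_
  have hV0 : 0 ≤ V := (norm_nonneg _).trans (hV t ht x)
  have ht0 := ht.1
  have hI0 := levyLogMass_nonneg (d := d)
  have hψ0 : 0 ≤ Real.log (1 + ‖x‖ ^ 2) := Real.log_nonneg (by nlinarith [sq_nonneg ‖x‖])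
  obtain ⟨c, hc0, hce⟩ : ∃ c, 0 ≤ c ∧
      c = Real.log (1 + ‖x‖ ^ 2) + (V + levyLogMass d + 1) * t := ⟨_, by positivity, rfl⟩
  -- The penalization parameter e/(c+1) keeps the total error below e at this fixed time and point.
  have h := le_of_transport_levyOp_aux hc hsm hK hV hder heq h0
    (show 0 < e / (c + 1) by positivity) ht x
  have h2 : e / (c + 1) * c ≤ e := by
    rw [div_mul_eq_mul_div, div_le_iff₀ (by positivity)]; nlinarith
  have h3 : e / (c + 1) * c = e / (c + 1) * Real.log (1 + ‖x‖ ^ 2) +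
      e / (c + 1) * (V + levyLogMass d + 1) * t := by
    rw [mul_assoc, ← mul_add, ← hce]
  linarith

end

end MaxPrinciple

/-! ### The kernels of the dyadic blocks -/

section Block
variable {d : ℕ} (P : DyadicPartition d) (q : ℕ)

/-- The symbol of the block `Δ_q`, in Mathlib's normalization of the Fourier transform. -/
def blockSymbolFun (ξ : Rd d) : ℂ := (dyadicDilate P.φ q ((2 * Real.pi) • ξ) : ℂ)

lemma blockSymbolFun_eq (ξ : Rd d) :
    blockSymbolFun P q ξ = (P.φ ((((2 : ℝ) ^ q)⁻¹ * (2 * Real.pi)) • ξ) : ℂ) := by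
  simp [blockSymbolFun, dyadicDilate, mul_smul]

lemma blockSymbolFun_neg (ξ : Rd d) : blockSymbolFun P q (-ξ) = blockSymbolFun P q ξ := by
  rw [blockSymbolFun_eq, blockSymbolFun_eq]
  congr 1
  exact P.φ_radial _ _ (by simp [norm_smul])

lemma contDiff_blockSymbolFun : ContDiff ℝ ∞ (blockSymbolFun P q) := by
  rw [show blockSymbolFun P q = _ from funext (blockSymbolFun_eq P q)]
  exact Complex.ofRealCLM.contDiff.comp (P.φ_smooth.comp (contDiff_const_smul _))

lemma hasCompactSupport_blockSymbolFun : HasCompactSupport (blockSymbolFun P q) := by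
  rw [show blockSymbolFun P q = _ from funext (blockSymbolFun_eq P q)]
  have hc : ((2 : ℝ) ^ q)⁻¹ * (2 * Real.pi) ≠ 0 := by positivity
  exact (P.φ_compact.comp_homeomorph (Homeomorph.smulOfNeZero _ hc)).comp_left
    (g := fun a : ℝ => (a : ℂ)) (by simp)

/-- The symbol of the block `Δ_q` as a Schwartz function. -/
def blockSymbol : 𝓢(Rd d, ℂ) :=
  (hasCompactSupport_blockSymbolFun P q).toSchwartzMap (contDiff_blockSymbolFun P q)

lemma blockSymbol_apply (ξ : Rd d) : blockSymbol P q ξ = blockSymbolFun P q ξ := rfl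

/-- The kernel of the block `Δ_q` as a real Schwartz function. -/
def blockKer : 𝓢(Rd d, ℝ) := SchwartzMap.postcompCLM Complex.reCLM (𝓕⁻ (blockSymbol P q))

lemma blockKernel_eq_fourierInv (x : Rd d) : blockKernel P q x = 𝓕⁻ (blockSymbolFun P q) x := rfl

/-- The symbol is real and, being radial, even; its inverse Fourier transform is therefore real. -/
lemma blockKernel_eq (x : Rd d) : blockKernel P q x = (blockKer P q x : ℂ) := by
  have h1 : blockKer P q x = (blockKernel P q x).re := by
    simp only [blockKer, SchwartzMap.postcompCLM_apply, SchwartzMap.fourierInv_coe]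
    rfl
  rw [h1, eq_comm, ← Complex.conj_eq_iff_re, blockKernel_eq_fourierInv, Real.fourierInv_eq',
    ← integral_conj, ← integral_neg_eq_self]
  refine integral_congr_ae (Eventually.of_forall fun v => ?_)
  simp only [smul_eq_mul, map_mul, blockSymbolFun_neg]
  congr 1
  · rw [← Complex.exp_conj]
    congr 1
    simp only [inner_neg_left, map_mul, Complex.conj_I, Complex.conj_ofReal]
    push_cast; ring
  · simp [blockSymbolFun]

lemma dyadicBlock_eq (f : Rd d → ℝ) (x : Rd d) :
    dyadicBlock P q f x = (kernelConv (blockKer P q) f x : ℂ) := by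
  unfold dyadicBlock kernelConv
  rw [← integral_complex_ofReal]
  refine integral_congr_ae (Eventually.of_forall fun y => ?_)
  simp only [blockKernel_eq]; push_cast; ring

lemma blockKer_scale (x : Rd d) :
    blockKer P q x = ((2 : ℝ) ^ q) ^ d * blockKer P 0 (((2 : ℝ) ^ q) • x) := by
  have h : blockKernel P q x = ((((2 : ℝ) ^ q) ^ d : ℝ) : ℂ) *
      blockKernel P 0 (((2 : ℝ) ^ q) • x) := by
    have hr : (0 : ℝ) < ((2 : ℝ) ^ q)⁻¹ := by positivity
    rw [blockKernel_eq_fourierInv, blockKernel_eq_fourierInv, Real.fourierInv_eq',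
      Real.fourierInv_eq']
    have h := Measure.integral_comp_smul_of_nonneg (volume : Measure (Rd d))
      (fun v => Complex.exp (↑(2 * Real.pi * inner ℝ v (((2 : ℝ) ^ q) • x)) * Complex.I) •
        blockSymbolFun P 0 v) (((2 : ℝ) ^ q)⁻¹) (hR := hr.le)
    rw [finrank_euclideanSpace_fin, inv_pow, inv_inv] at h
    rw [← Complex.real_smul, ← h]
    refine integral_congr_ae (Eventually.of_forall fun v => ?_)
    simp only
    rw [inner_smul_left, inner_smul_right, RCLike.conj_to_real,
      inv_mul_cancel_left₀ (by positivity), blockSymbolFun_eq, blockSymbolFun_eq, smul_smul]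
    congr 4
    simp [mul_comm]
  rw [blockKernel_eq, blockKernel_eq] at h
  exact_mod_cast h

lemma lintegral_comp_smul_of_pos {r : ℝ} (hr : 0 < r) (f : Rd d → ℝ≥0∞) :
    ∫⁻ x, f (r • x) = ENNReal.ofReal (r ^ d)⁻¹ * ∫⁻ x, f x := by
  have h := (Homeomorph.smulOfNeZero r hr.ne' : Rd d ≃ₜ Rd d).measurableEmbedding.lintegral_map
    (μ := volume) f
  have h2 : Measure.map (Homeomorph.smulOfNeZero r hr.ne' : Rd d ≃ₜ Rd d) volume =
      ENNReal.ofReal (r ^ d)⁻¹ • volume := by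
    have := Measure.map_addHaar_smul (volume : Measure (Rd d)) hr.ne'
    rw [finrank_euclideanSpace_fin, abs_of_pos (by positivity)] at this
    exact this
  rw [h2, lintegral_smul_measure] at h
  exact h.symm

lemma lintegral_blockKer :
    ∫⁻ z, ‖blockKer P q z‖ₑ = ∫⁻ z, ‖blockKer P 0 z‖ₑ := by
  have hr : (0 : ℝ) < (2 : ℝ) ^ q := by positivity
  calc ∫⁻ z, ‖blockKer P q z‖ₑ
      = ∫⁻ z, ENNReal.ofReal (((2 : ℝ) ^ q) ^ d) * ‖blockKer P 0 (((2 : ℝ) ^ q) • z)‖ₑ := by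
        refine lintegral_congr fun z => ?_
        rw [blockKer_scale, enorm_mul, Real.enorm_eq_ofReal (by positivity)]
    _ = _ := by
        rw [lintegral_const_mul' _ _ ENNReal.ofReal_ne_top,
          lintegral_comp_smul_of_pos hr (fun z => ‖blockKer P 0 z‖ₑ), ← mul_assoc,
          ← ENNReal.ofReal_mul (by positivity), mul_inv_cancel₀ (by positivity)]
        simp

lemma fderiv_blockKer (z : Rd d) : fderiv ℝ (blockKer P q) z =
    (((2 : ℝ) ^ q) ^ d * (2 : ℝ) ^ q) • fderiv ℝ (blockKer P 0) (((2 : ℝ) ^ q) • z) := by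
  have e : ⇑(blockKer P q) = fun x => ((2 : ℝ) ^ q) ^ d * blockKer P 0 (((2 : ℝ) ^ q) • x) :=
    funext (blockKer_scale P q)
  have h := ((blockKer P 0).differentiableAt (x := ((2 : ℝ) ^ q) • z)).hasFDerivAt.comp z
    ((hasFDerivAt_id z).const_smul ((2 : ℝ) ^ q))
  have h2 := h.const_mul (((2 : ℝ) ^ q) ^ d)
  rw [e]
  refine (HasFDerivAt.fderiv h2).trans ?_
  ext w
  simp [mul_assoc]

/-- The gradient gains 2^q and the factor |z| loses it again. This scale invariance is why the
commutator bound does not depend on q. -/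
lemma lintegral_norm_mul_fderiv_blockKer :
    ∫⁻ z, ‖z‖ₑ * ‖fderiv ℝ (blockKer P q) z‖ₑ = ∫⁻ z, ‖z‖ₑ * ‖fderiv ℝ (blockKer P 0) z‖ₑ := by
  have hr : (0 : ℝ) < (2 : ℝ) ^ q := by positivity
  calc ∫⁻ z, ‖z‖ₑ * ‖fderiv ℝ (blockKer P q) z‖ₑ
      = ∫⁻ z, ENNReal.ofReal (((2 : ℝ) ^ q) ^ d) * (‖((2 : ℝ) ^ q) • z‖ₑ *
          ‖fderiv ℝ (blockKer P 0) (((2 : ℝ) ^ q) • z)‖ₑ) := by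
        refine lintegral_congr fun z => ?_
        rw [fderiv_blockKer, enorm_smul, enorm_smul, Real.enorm_eq_ofReal (by positivity),
          Real.enorm_eq_ofReal (by positivity), ENNReal.ofReal_mul (by positivity)]
        ring
    _ = _ := by
        rw [lintegral_const_mul' _ _ ENNReal.ofReal_ne_top,
          lintegral_comp_smul_of_pos hr (fun z => ‖z‖ₑ * ‖fderiv ℝ (blockKer P 0) z‖ₑ),
          ← mul_assoc, ← ENNReal.ofReal_mul (by positivity), mul_inv_cancel₀ (by positivity)]
        simp

lemma lintegral_blockKer_lt_top : ∫⁻ z, ‖blockKer P 0 z‖ₑ < ⊤ := (blockKer P 0).integrable.2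

lemma lintegral_norm_mul_fderiv_blockKer_lt_top :
    ∫⁻ z, ‖z‖ₑ * ‖fderiv ℝ (blockKer P 0) z‖ₑ < ⊤ := by
  have h := ((SchwartzMap.fderivCLM ℝ _ _ (blockKer P 0)).integrable_pow_mul volume 1).2
  refine lt_of_le_of_lt (lintegral_mono fun z => ?_) h
  simp [enorm_mul]

end Block

/-! ### The equation satisfied by a smoothed solution -/

section Commutator
variable {d : ℕ} {k f : Rd d → ℝ} {v : Rd d → Rd d} {C M V : ℝ}

/-- The commutator of the transport operator `v · ∇` with the convolution by `k`. -/
def transportCommutator (k : Rd d → ℝ) (v : Rd d → Rd d) (f : Rd d → ℝ) (x : Rd d) : ℝ :=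
  ∫ y, fderiv ℝ k (x - y) (v x - v y) * f y

lemma IsDecayingKernel.integrable_fderiv_apply (hk : IsDecayingKernel k C) (hf : Continuous f)
    (hM : ∀ y, |f y| ≤ M) {w : Rd d → Rd d} (hw : Continuous w) (hV : ∀ y, ‖w y‖ ≤ V) (x : Rd d) :
    Integrable fun y => fderiv ℝ k (x - y) (w y) * f y := by
  have hc : Continuous (fderiv ℝ k) := hk.contDiff.continuous_fderiv (by simp)
  refine ((((integrable_polyDecay (Nat.lt_succ_self d)).comp_sub_left x).const_mul
    (C * V * M))).mono' (Continuous.aestronglyMeasurable (by fun_prop))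
    (Eventually.of_forall fun y => ?_)
  rw [norm_mul, Real.norm_eq_abs (f y)]
  have hM0 : 0 ≤ M := (abs_nonneg _).trans (hM 0)
  have hV0 : 0 ≤ V := (norm_nonneg _).trans (hV 0)
  have h1 := hk.bound_fderiv (x - y)
  calc ‖fderiv ℝ k (x - y) (w y)‖ * |f y|
      ≤ ((C * polyDecay (d + 1) (x - y)) * V) * M := by
        refine mul_le_mul ((ContinuousLinearMap.le_opNorm _ _).trans
          (mul_le_mul h1 (hV y) (norm_nonneg _) ((norm_nonneg _).trans h1))) (hM y) (abs_nonneg _) ?_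
        exact mul_nonneg ((norm_nonneg _).trans h1) hV0
    _ = _ := by ring

/-- Since div v = 0, v·∇f is the divergence of fv and the derivative can be put on the kernel;
comparing with v frozen at x leaves only increments of v. -/
lemma kernelConv_transport (hk : IsDecayingKernel k C) (hf : ContDiff ℝ 1 f)
    (hM : ∀ y, |f y| ≤ M) (hM' : ∀ y, ‖fderiv ℝ f y‖ ≤ M) (hv : ContDiff ℝ 1 v)
    (hV : ∀ y, ‖v y‖ ≤ V) (hdiv : ∀ y, divergence v y = 0) (x : Rd d) :
    kernelConv k (fun y => fderiv ℝ f y (v y)) x =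
      fderiv ℝ (kernelConv k f) x (v x) - transportCommutator k v f x := by
  have hM0 : 0 ≤ M := (abs_nonneg _).trans (hM 0)
  have hV0 : 0 ≤ V := (norm_nonneg _).trans (hV 0)
  have hfc := hf.continuous_fderiv (by simp)
  let Y : Rd d → Rd d := fun y => f y • v y
  have hY : ContDiff ℝ 1 Y := hf.smul hv
  have hYd : ∀ y, divergence Y y = fderiv ℝ f y (v y) := fun y => by
    have := divergence_smul (hf.differentiable (by simp) y) (hv.differentiable (by simp) y)
    simp only [Y]
    rw [this, hdiv, mul_zero, zero_add]
  have hi1 := hk.integrable_fderiv_apply hf.continuous hM (w := fun _ => v x) continuous_const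
    (fun _ => hV x) x
  have hi2 := hk.integrable_fderiv_apply hf.continuous hM hv.continuous hV x
  have hYe : ∀ y, fderiv ℝ k (x - y) (Y y) = fderiv ℝ k (x - y) (v y) * f y := fun y => by
    simp only [Y, map_smul, smul_eq_mul]; ring
  have h := integral_kernel_divergence (hk.contDiff.of_le (by norm_num)) hY x ?_ ?_ ?_
  · simp only [hYd, hYe] at h
    have h2 := fderiv_kernelConv_apply (hk.contDiff.of_le (by norm_num)) hk.integrable
      hk.bound_fderiv hf.continuous.measurable hM x (v x)
    rw [h2]
    unfold kernelConv transportCommutator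
    rw [h]
    rw [← integral_sub hi1]
    · refine integral_congr_ae (Eventually.of_forall fun y => ?_)
      simp only [map_sub]; ring
    · refine (hi1.sub hi2).congr (Eventually.of_forall fun y => ?_)
      simp only [map_sub, Pi.sub_apply]; ring
  · refine (hk.integrable.comp_sub_left x).smul_bdd (M * V) hY.continuous.aestronglyMeasurable
      (Eventually.of_forall fun y => ?_)
    rw [norm_smul]
    exact mul_le_mul (hM y) (hV y) (norm_nonneg _) hM0
  · simp only [hYd]
    refine integrable_mul_of_bounded (M := M * V) (hk.integrable.comp_sub_left x)
      (hfc.clm_apply hv.continuous).measurable fun y => ?_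
    exact (ContinuousLinearMap.le_opNorm _ _).trans
      (mul_le_mul (hM' y) (hV y) (norm_nonneg _) hM0)
  · simp only [hYe]; exact hi2

/-- The equation satisfied by a smoothed solution of the transport equation with diffusion. -/
lemma kernelConv_equation [NeZero d] (k : 𝓢(Rd d, ℝ)) (hf : ContDiff ℝ 1 f)
    (hM : ∀ y, |f y| ≤ M) (hM' : ∀ y, ‖fderiv ℝ f y‖ ≤ M) (hv : ContDiff ℝ 1 v)
    (hV : ∀ y, ‖v y‖ ≤ V) (hdiv : ∀ y, divergence v y = 0) {f' : Rd d → ℝ} (hf' : Continuous f')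
    (hfb : ∀ y, |f' y| ≤ M) (heq : HasAbsD f fun y => -(f' y + fderiv ℝ f y (v y))) (x : Rd d) :
    kernelConv k f' x + fderiv ℝ (kernelConv k f) x (v x) + levyOp (kernelConv k f) x =
      transportCommutator k v f x := by
  obtain ⟨C, hk⟩ := k.exists_isDecayingKernel
  have h1 := heq.kernelConv_eq_levyOp hf.continuous.measurable hM k x
  have h2 := kernelConv_transport hk hf hM hM' hv hV hdiv x
  have hM0 : 0 ≤ M := (abs_nonneg _).trans (hM 0)
  have hi1 := integrable_kernelConv hk.integrable hf'.measurable hfb x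
  have hi2 := integrable_kernelConv (M := M * V) hk.integrable
    (f := fun y => fderiv ℝ f y (v y)) ((hf.continuous_fderiv (by simp)).clm_apply
    hv.continuous).measurable (fun y => (ContinuousLinearMap.le_opNorm _ _).trans
      (mul_le_mul (hM' y) (hV y) (norm_nonneg _) hM0)) x
  have h3 : kernelConv k (fun y => -(f' y + fderiv ℝ f y (v y))) x =
      -(kernelConv k f' x + kernelConv k (fun y => fderiv ℝ f y (v y)) x) := by
    unfold kernelConv
    rw [← integral_add hi1 hi2, ← integral_neg]
    refine integral_congr_ae (Eventually.of_forall fun y => ?_)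
    simp only; ring
  rw [← h1, h3, h2]; ring

lemma enorm_sub_le_lintegral_fderiv (hv : ContDiff ℝ 1 v) (x z : Rd d) :
    ‖v x - v (x - z)‖ₑ ≤ ‖z‖ₑ * ∫⁻ s in Icc (0 : ℝ) 1, ‖fderiv ℝ v (x - s • z)‖ₑ := by
  have hc : Continuous fun s : ℝ => fderiv ℝ v (x - s • z) :=
    (hv.continuous_fderiv (by simp)).comp (by fun_prop)
  have hder : ∀ s ∈ uIcc (0 : ℝ) 1, HasDerivAt (fun s : ℝ => v (x - s • z))
      (fderiv ℝ v (x - s • z) (-z)) s := fun s _ => by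
    have h2 : HasDerivAt (fun s : ℝ => x - s • z) (-z) s := by
      simpa using ((hasDerivAt_id s).smul_const z).const_sub x
    exact (hv.differentiable (by simp) _).hasFDerivAt.comp_hasDerivAt s h2
  have h := intervalIntegral.integral_eq_sub_of_hasDerivAt hder
    ((hc.clm_apply continuous_const).intervalIntegrable _ _)
  rw [one_smul, zero_smul, sub_zero, intervalIntegral.integral_of_le zero_le_one] at h
  rw [← neg_sub, enorm_neg, ← h, ← lintegral_const_mul' _ _ enorm_ne_top]
  refine (enorm_integral_le_lintegral_enorm _).trans ?_
  refine (lintegral_mono fun s => ?_).trans (lintegral_mono_set Ioc_subset_Icc_self)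
  refine (ContinuousLinearMap.le_opENorm _ _).trans_eq ?_
  rw [enorm_neg, mul_comm]

/-- The increment v(x) - v(x-z) is an integral of ∇v over a segment of length |z|. Minkowski over
(z, s) then applies, because translates of ∇v all have the same L^p norm. -/
lemma lintegral_transportCommutator_rpow_le {p : ℝ} (hp : 1 ≤ p) (hk : ContDiff ℝ 1 k)
    (hM : ∀ y, |f y| ≤ M) (hv : ContDiff ℝ 1 v) :
    ∫⁻ x, ‖transportCommutator k v f x‖ₑ ^ p ≤
      (ENNReal.ofReal M * ∫⁻ z, ‖z‖ₑ * ‖fderiv ℝ k z‖ₑ) ^ p * ∫⁻ x, ‖fderiv ℝ v x‖ₑ ^ p := by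
  have hkc := hk.continuous_fderiv (by simp)
  have hvc := hv.continuous_fderiv (by simp)
  let κ : Measure (Rd d × ℝ) := volume.prod (volume.restrict (Icc 0 1))
  let a : Rd d × ℝ → ℝ≥0∞ := fun z => ENNReal.ofReal M * (‖z.1‖ₑ * ‖fderiv ℝ k z.1‖ₑ)
  let F : Rd d → Rd d × ℝ → ℝ≥0∞ := fun x z => ‖fderiv ℝ v (x - z.2 • z.1)‖ₑ
  have ha : Measurable a := by
    have : Continuous fun z : Rd d × ℝ => fderiv ℝ k z.1 := hkc.comp continuous_fst
    exact (measurable_fst.enorm.mul this.enorm.measurable).const_mul _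
  have hF : Measurable (Function.uncurry F) := by
    have : Continuous fun z : Rd d × (Rd d × ℝ) => fderiv ℝ v (z.1 - z.2.2 • z.2.1) :=
      hvc.comp (by fun_prop)
    exact this.enorm.measurable
  have hpt : ∀ x, ‖transportCommutator k v f x‖ₑ ≤ ∫⁻ z, a z * F x z ∂κ := by
    intro x
    have e : transportCommutator k v f x =
        ∫ z, fderiv ℝ k z (v x - v (x - z)) * f (x - z) := by
      unfold transportCommutator
      rw [← integral_sub_left_eq_self (fun z => fderiv ℝ k z (v x - v (x - z)) * f (x - z))
        volume x]
      simp
    have e2 : ∫⁻ z, a z * F x z ∂κ = ∫⁻ z, ∫⁻ s in Icc (0 : ℝ) 1, a (z, s) * F x (z, s) :=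
      lintegral_prod _ (ha.mul hF.of_uncurry_left).aemeasurable
    rw [e, e2]
    refine (enorm_integral_le_lintegral_enorm _).trans (lintegral_mono fun z => ?_)
    simp only [a, F]
    rw [lintegral_const_mul' _ _ (by finiteness), enorm_mul]
    have h1 : ‖f (x - z)‖ₑ ≤ ENNReal.ofReal M := by
      rw [Real.enorm_eq_ofReal_abs]; exact ENNReal.ofReal_le_ofReal (hM _)
    calc ‖fderiv ℝ k z (v x - v (x - z))‖ₑ * ‖f (x - z)‖ₑ
        ≤ (‖fderiv ℝ k z‖ₑ * (‖z‖ₑ * ∫⁻ s in Icc (0 : ℝ) 1, ‖fderiv ℝ v (x - s • z)‖ₑ)) *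
            ENNReal.ofReal M := by
          refine mul_le_mul' ((ContinuousLinearMap.le_opENorm _ _).trans ?_) h1
          exact mul_le_mul' le_rfl (enorm_sub_le_lintegral_fderiv hv x z)
      _ = _ := by ring
  refine (lintegral_mono fun x => ENNReal.rpow_le_rpow (hpt x) (by linarith)).trans ?_
  refine (lintegral_rpow_lintegral_mul_le hp ha hF (M := ∫⁻ x, ‖fderiv ℝ v x‖ₑ ^ p)
    fun z => ?_).trans_eq ?_
  · simp only [F]
    rw [lintegral_sub_right_eq_self (fun x => ‖fderiv ℝ v x‖ₑ ^ p)]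
  · congr 2
    have e2 : ∫⁻ z, a z ∂κ = ∫⁻ z, ∫⁻ s in Icc (0 : ℝ) 1, a (z, s) :=
      lintegral_prod _ ha.aemeasurable
    rw [e2]
    simp only [a, lintegral_const, Measure.restrict_apply_univ, Real.volume_Icc, sub_zero,
      ENNReal.ofReal_one, mul_one]
    rw [lintegral_const_mul' _ _ ENNReal.ofReal_ne_top]

end Commutator

/-! ### A kernel below the Lévy density which annihilates a dyadic block -/

section Gain
variable {d : ℕ}

lemma integral_fourier_mul_eq {f g : Rd d → ℂ} (hf : Integrable f) (hg : Integrable g) :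
    ∫ z, 𝓕 f z * g z = ∫ u, f u * 𝓕 g u := by
  simpa using! VectorFourier.integral_fourierIntegral_smul_eq_flip (L := innerₗ (Rd d))
    Real.continuous_fourierChar continuous_inner hf hg

/-- The Fourier transform of `|𝓕 ρ|²` for a real function `ρ`. -/
lemma fourier_norm_sq_fourier (ρ : 𝓢(Rd d, ℂ)) (hρ : ∀ u, (starRingEnd ℂ) (ρ u) = ρ u) (ξ : Rd d) :
    𝓕 (fun z => ((‖𝓕 (ρ : Rd d → ℂ) z‖ ^ 2 : ℝ) : ℂ)) ξ = ∫ u, ρ u * ρ (u + ξ) := by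
  have hconj : ∀ z, (starRingEnd ℂ) (𝓕 (ρ : Rd d → ℂ) z) = 𝓕⁻ (ρ : Rd d → ℂ) z := by
    intro z
    rw [Real.fourier_eq', Real.fourierInv_eq', ← integral_conj]
    refine integral_congr_ae (Eventually.of_forall fun v => ?_)
    simp only [smul_eq_mul, map_mul, hρ, ← Complex.exp_conj, Complex.conj_I, Complex.conj_ofReal]
    congr 2
    push_cast; ring
  let G : Rd d → ℂ := fun z => Real.fourierChar (-inner ℝ z ξ) • 𝓕⁻ (ρ : Rd d → ℂ) z
  have hinv : ∀ z, 𝓕⁻ (ρ : Rd d → ℂ) z = (𝓕⁻ ρ : 𝓢(Rd d, ℂ)) z := fun z => by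
    rw [SchwartzMap.fourierInv_coe]
  have hinvi : Integrable (𝓕⁻ (ρ : Rd d → ℂ)) := by
    rw [← SchwartzMap.fourierInv_coe]; exact (𝓕⁻ ρ : 𝓢(Rd d, ℂ)).integrable
  have hGi : Integrable G := by
    refine hinvi.mono (Continuous.aestronglyMeasurable ?_) (Eventually.of_forall fun z => ?_)
    · have h1 : Continuous (𝓕⁻ (ρ : Rd d → ℂ)) := by
        rw [← SchwartzMap.fourierInv_coe]; exact (𝓕⁻ ρ : 𝓢(Rd d, ℂ)).continuous
      exact (Real.continuous_fourierChar.comp (by fun_prop)).smul h1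
    · simp [G]
  have hG : ∀ u, 𝓕 G u = ρ (u + ξ) := by
    intro u
    have h1 := congrFun (ρ.continuous.fourier_fourierInv_eq ρ.integrable (by
      rw [← SchwartzMap.fourier_coe]; exact (𝓕 ρ : 𝓢(Rd d, ℂ)).integrable)) (u + ξ)
    rw [← h1, Real.fourier_eq, Real.fourier_eq]
    refine integral_congr_ae (Eventually.of_forall fun z => ?_)
    simp only [G]
    rw [smul_smul, ← AddChar.map_add_eq_mul, inner_add_right, neg_add]
  have h := integral_fourier_mul_eq ρ.integrable hGi
  simp only [hG] at h
  rw [← h, Real.fourier_eq]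
  refine integral_congr_ae (Eventually.of_forall fun z => ?_)
  simp only [G, ← hconj]
  rw [mul_smul_comm, Complex.mul_conj, Complex.normSq_eq_norm_sq]

variable (P : DyadicPartition d)

/-- By self-adjointness of the Fourier transform the convolution at x pairs 𝓕η with the modulated
symbol, and at each frequency one of the two vanishes. -/
lemma kernelConv_blockKer_eq_zero {η : Rd d → ℝ} (hη : Integrable η)
    (h : ∀ ξ, blockSymbolFun P 0 ξ ≠ 0 → 𝓕 (fun z => (η z : ℂ)) ξ = 0) (x : Rd d) :
    kernelConv η (blockKer P 0) x = 0 := by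
  let m : Rd d → ℂ := fun v => Real.fourierChar (inner ℝ v x) • blockSymbol P 0 v
  have hmi : Integrable m := by
    refine (blockSymbol P 0).integrable.mono (Continuous.aestronglyMeasurable ?_)
      (Eventually.of_forall fun z => by simp [m])
    exact (Real.continuous_fourierChar.comp (by fun_prop)).smul (blockSymbol P 0).continuous
  have hm : ∀ z, 𝓕 m z = (blockKer P 0 (x - z) : ℂ) := by
    intro z
    rw [← blockKernel_eq, blockKernel_eq_fourierInv, Real.fourier_eq, Real.fourierInv_eq]
    refine integral_congr_ae (Eventually.of_forall fun v => ?_)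
    simp only [m, blockSymbol_apply]
    rw [smul_smul, ← AddChar.map_add_eq_mul, inner_sub_right, neg_add_eq_sub]
  have hfl := integral_fourier_mul_eq (hη.ofReal (𝕜 := ℂ)) hmi
  have h0 : ∫ z, 𝓕 (fun z => (η z : ℂ)) z * m z = 0 := by
    rw [← integral_zero (Rd d) ℂ (μ := volume)]
    refine integral_congr_ae (Eventually.of_forall fun ξ => ?_)
    by_cases hξ : blockSymbolFun P 0 ξ = 0
    · simp [m, blockSymbol_apply, hξ]
    · simp [h ξ hξ]
  have h1 : ((kernelConv η (blockKer P 0) x : ℝ) : ℂ) = 0 := by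
    rw [kernelConv_eq, ← integral_complex_ofReal, ← h0]
    refine Eq.trans ?_ hfl.symm
    refine integral_congr_ae (Eventually.of_forall fun z => ?_)
    simp only [hm]
    push_cast; rfl
  exact_mod_cast h1

/-- Take a small multiple of |𝓕ρ|² for a bump ρ. It is nonnegative and decays rapidly, hence fits
below the Lévy density; its Fourier transform is the autocorrelation of ρ, supported in twice the
ball supporting ρ and so inside the hole around the origin left by the symbol. -/
lemma exists_gain_kernel_zero [NeZero d] : ∃ η : Rd d → ℝ, Continuous η ∧ (∀ z, 0 ≤ η z) ∧
    (∀ z, η (-z) = η z) ∧ Integrable η ∧ 0 < ∫ z, η z ∧ (∀ z, z ≠ 0 → η z ≤ levyDensity z) ∧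
    ∀ x, kernelConv η (blockKer P 0) x = 0 := by
  obtain ⟨r, hr, hφ⟩ : ∃ r > 0, ∀ ξ : Rd d, ‖ξ‖ < r → P.φ ξ = 0 := by
    have : (tsupport P.φ)ᶜ ∈ 𝓝 (0 : Rd d) :=
      (isClosed_tsupport _).isOpen_compl.mem_nhds P.φ_away
    obtain ⟨r, hr, h⟩ := Metric.mem_nhds_iff.1 this
    exact ⟨r, hr, fun ξ hξ => image_eq_zero_of_notMem_tsupport (h (by simpa using hξ))⟩
  -- Radius r/(4π): the autocorrelation lives in |ξ| ≤ r/(2π), and the symbol φ(2πξ) vanishes for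
  -- |ξ| < r/(2π).
  let b : ContDiffBump (0 : Rd d) := ⟨r / (4 * Real.pi) / 2, r / (4 * Real.pi), by positivity,
    half_lt_self (by positivity)⟩
  have hbs : HasCompactSupport fun u => ((b u : ℝ) : ℂ) :=
    b.hasCompactSupport.comp_left (g := fun a : ℝ => (a : ℂ)) (by simp)
  let ρ : 𝓢(Rd d, ℂ) := hbs.toSchwartzMap (Complex.ofRealCLM.contDiff.comp b.contDiff)
  have hρ : ∀ u, ρ u = (b u : ℂ) := fun u => rfl
  let η₀ : Rd d → ℝ := fun z => ‖𝓕 (ρ : Rd d → ℂ) z‖ ^ 2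
  have hc : Continuous (𝓕 (ρ : Rd d → ℂ)) := (𝓕 ρ : 𝓢(Rd d, ℂ)).continuous
  have hη₀c : Continuous η₀ := hc.norm.pow 2
  obtain ⟨C, hC⟩ := (𝓕 ρ : 𝓢(Rd d, ℂ)).exists_norm_le_polyDecay (d + 1)
  have hC' : ∀ z, ‖𝓕 (ρ : Rd d → ℂ) z‖ ≤ C * polyDecay (d + 1) z := hC
  have hC0 : 0 ≤ C := nonneg_of_mul_nonneg_left ((norm_nonneg _).trans (hC' 0)) (polyDecay_pos _ _)
  have hη₀ : ∀ z, η₀ z ≤ C ^ 2 * polyDecay (d + 1) z := by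
    intro z
    have h1 := pow_le_pow_left₀ (norm_nonneg _) (hC' z) 2
    have h2 := polyDecay_le_one (d + 1) z
    have h3 := (polyDecay_pos (d + 1) z).le
    calc η₀ z ≤ C ^ 2 * (polyDecay (d + 1) z * polyDecay (d + 1) z) := by
          refine h1.trans_eq ?_; ring
      _ ≤ _ := by gcongr; exact mul_le_of_le_one_left h3 h2
  have hη₀n : ∀ z, 0 ≤ η₀ z := fun z => by positivity
  have hη₀i : Integrable η₀ := ((integrable_polyDecay (Nat.lt_succ_self d)).const_mul (C ^ 2)).mono'
    hη₀c.aestronglyMeasurable (Eventually.of_forall fun z => by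
      rw [Real.norm_of_nonneg (hη₀n z)]; exact hη₀ z)
  have hpos : 0 < ∫ z, η₀ z := by
    rw [integral_pos_iff_support_of_nonneg hη₀n hη₀i]
    have h0 : η₀ 0 ≠ 0 := by
      have h1 : 𝓕 (ρ : Rd d → ℂ) 0 = ((∫ u, b u : ℝ) : ℂ) := by
        rw [Real.fourier_eq', ← integral_complex_ofReal]
        simp [hρ]
      simp only [η₀, h1]
      have := b.integral_pos (μ := volume)
      simp [this.ne']
    exact Measure.measure_pos_of_mem_nhds _ (hη₀c.continuousAt.eventually_ne h0)
  have heven : ∀ z, η₀ (-z) = η₀ z := by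
    intro z
    have h1 : 𝓕 (ρ : Rd d → ℂ) (-z) = (starRingEnd ℂ) (𝓕 (ρ : Rd d → ℂ) z) := by
      rw [Real.fourier_eq', Real.fourier_eq', ← integral_conj]
      refine integral_congr_ae (Eventually.of_forall fun v => ?_)
      simp only [smul_eq_mul, map_mul, hρ, ← Complex.exp_conj, Complex.conj_I,
        Complex.conj_ofReal, inner_neg_right]
      congr 2
      push_cast; ring
    simp only [η₀, h1, RCLike.norm_conj]
  obtain ⟨c, hc0, hcν, -⟩ := exists_levyDensity_eq (d := d)
  have hε : 0 < c / (C ^ 2 + 1) := by positivity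
  refine ⟨fun z => c / (C ^ 2 + 1) * η₀ z, hη₀c.const_mul _, fun z => mul_nonneg hε.le (hη₀n z),
    fun z => by simp only [heven], hη₀i.const_mul _, ?_, fun z hz => ?_, ?_⟩
  · rw [integral_const_mul]; positivity
  · have hz0 : 0 < ‖z‖ := norm_pos_iff.2 hz
    have h1 : polyDecay (d + 1) z ≤ (‖z‖ ^ (d + 1))⁻¹ :=
      inv_anti₀ (by positivity) (pow_le_pow_left₀ hz0.le (by linarith) _)
    rw [hcν]
    calc c / (C ^ 2 + 1) * η₀ z ≤ c / (C ^ 2 + 1) * ((C ^ 2 + 1) * (‖z‖ ^ (d + 1))⁻¹) := by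
          gcongr
          refine (hη₀ z).trans ?_
          exact mul_le_mul (by linarith) h1 (polyDecay_pos _ _).le (by positivity)
      _ = _ := by field_simp
  · refine kernelConv_blockKer_eq_zero P (hη₀i.const_mul _) fun ξ hξ => ?_
    have hξ1 : r ≤ 2 * Real.pi * ‖ξ‖ := by
      by_contra! hlt
      refine hξ ?_
      rw [blockSymbolFun_eq, hφ _ ?_]; · simp
      rw [norm_smul, Real.norm_of_nonneg (by positivity)]
      simpa using hlt
    have h1 := fourier_norm_sq_fourier ρ (fun u => by rw [hρ, Complex.conj_ofReal]) ξ
    have h2 : ∫ u, ρ u * ρ (u + ξ) = 0 := by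
      rw [← integral_zero (Rd d) ℂ (μ := volume)]
      refine integral_congr_ae (Eventually.of_forall fun u => ?_)
      simp only [hρ]
      have hbout : ∀ w : Rd d, r / (4 * Real.pi) ≤ ‖w‖ → b w = 0 := fun w hw =>
        b.zero_of_le_dist (by simpa using hw)
      rcases le_total (r / (4 * Real.pi)) ‖u‖ with hu | hu
      · rw [hbout u hu]; simp
      · rw [hbout (u + ξ)]; · simp
        have h3 : ‖ξ‖ ≤ ‖u + ξ‖ + ‖u‖ := by simpa using norm_sub_le (u + ξ) u
        have h4 : r / (4 * Real.pi) + r / (4 * Real.pi) ≤ ‖ξ‖ := by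
          rw [← add_div, div_le_iff₀ (by positivity)]; linarith
        linarith
    rw [h2] at h1
    rw [Real.fourier_eq] at h1 ⊢
    have e : (fun z => Real.fourierChar (-inner ℝ z ξ) • ((c / (C ^ 2 + 1) * η₀ z : ℝ) : ℂ)) =
        fun z => ((c / (C ^ 2 + 1) : ℝ) : ℂ) *
          (Real.fourierChar (-inner ℝ z ξ) • ((‖𝓕 (ρ : Rd d → ℂ) z‖ ^ 2 : ℝ) : ℂ)) := by
      funext z
      simp only [η₀]
      rw [mul_smul_comm, Complex.ofReal_mul]
    rw [e, integral_const_mul, h1, mul_zero]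

/-- There is a kernel below the Lévy density, of mass proportional to `2^q`, annihilating the
dyadic block `Δ_q`. -/
lemma exists_gain_kernel [NeZero d] : ∃ c : ℝ, 0 < c ∧ ∀ q : ℕ, ∃ η : Rd d → ℝ, Continuous η ∧
    (∀ z, 0 ≤ η z) ∧ (∀ z, η (-z) = η z) ∧ Integrable η ∧ ∫ z, η z = c * 2 ^ q ∧
    (∀ z, z ≠ 0 → η z ≤ levyDensity z) ∧ ∀ x, kernelConv η (blockKer P q) x = 0 := by
  obtain ⟨η, hc, hn, he, hi, hp, hν, hz⟩ := exists_gain_kernel_zero P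
  refine ⟨∫ z, η z, hp, fun q => ?_⟩
  have hr : (0 : ℝ) < (2 : ℝ) ^ q := by positivity
  set r : ℝ := (2 : ℝ) ^ q with hrdef
  have hscale : ∀ F : Rd d → ℝ, ∫ z, F (r • z) = (r ^ d)⁻¹ * ∫ z, F z := fun F => by
    have := Measure.integral_comp_smul_of_nonneg (volume : Measure (Rd d)) F r (hR := hr.le)
    rwa [finrank_euclideanSpace_fin, smul_eq_mul] at this
  -- The exponent d+1 matches the homogeneity of the Lévy density, so domination is preserved while
  -- the mass is multiplied by r = 2^q.
  refine ⟨fun z => r ^ (d + 1) * η (r • z), by fun_prop, fun z => mul_nonneg (by positivity) (hn _),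
    fun z => by simp only [smul_neg, he], (hi.comp_smul hr.ne').const_mul _, ?_, fun z hz0 => ?_,
    fun x => ?_⟩
  · rw [integral_const_mul, hscale η]
    field_simp
    ring
  · have h1 := hν (r • z) (smul_ne_zero hr.ne' hz0)
    obtain ⟨c, -, hcν, -⟩ := exists_levyDensity_eq (d := d)
    rw [hcν] at h1 ⊢
    have hz1 : 0 < ‖z‖ := norm_pos_iff.2 hz0
    calc r ^ (d + 1) * η (r • z) ≤ r ^ (d + 1) * (c * (‖r • z‖ ^ (d + 1))⁻¹) := by gcongr
      _ = _ := by
          rw [norm_smul, Real.norm_of_nonneg hr.le, mul_pow]; field_simp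
  · rw [kernelConv_eq]
    have h1 := hscale fun w => η w * blockKer P 0 (r • x - w)
    rw [show ∫ w, η w * blockKer P 0 (r • x - w) = 0 by
      rw [← kernelConv_eq]; exact hz (r • x), mul_zero] at h1
    have e : (fun z => r ^ (d + 1) * η (r • z) * blockKer P q (x - z)) = fun z =>
        (r ^ (d + 1) * r ^ d) * (η (r • z) * blockKer P 0 (r • x - r • z)) := by
      funext z
      rw [blockKer_scale P q, ← hrdef, smul_sub]; ring
    rw [e, integral_const_mul, h1, mul_zero]

end Gain

/-! ### Slowly varying weights -/

section Weight
variable {d : ℕ}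

/-- The power `(1 + |x|²)^{-a}`. -/
def japanese (a : ℝ) (x : Rd d) : ℝ := (1 + ‖x‖ ^ 2) ^ (-a)

lemma japanese_pos (a : ℝ) (x : Rd d) : 0 < japanese a x := Real.rpow_pos_of_pos (by positivity) _

lemma japanese_le_one {a : ℝ} (ha : 0 ≤ a) (x : Rd d) : japanese a x ≤ 1 :=
  Real.rpow_le_one_of_one_le_of_nonpos (by nlinarith [sq_nonneg ‖x‖]) (by linarith)

lemma one_add_sq_mul_japanese (a : ℝ) (x : Rd d) :
    (1 + ‖x‖ ^ 2) * japanese (a + 1) x = japanese a x := by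
  have h : (0 : ℝ) < 1 + ‖x‖ ^ 2 := by positivity
  unfold japanese
  rw [neg_add, Real.rpow_add h, Real.rpow_neg_one]
  field_simp

lemma japanese_le_of_le {a c : ℝ} (ha : 0 ≤ a) (hc : 0 < c) {x y : Rd d}
    (h : 1 + ‖x‖ ^ 2 ≤ c * (1 + ‖y‖ ^ 2)) : japanese a y ≤ c ^ a * japanese a x := by
  unfold japanese
  rw [Real.rpow_neg (by positivity), Real.rpow_neg (by positivity), ← div_eq_mul_inv,
    le_div_iff₀ (by positivity), inv_mul_le_iff₀ (by positivity), mul_comm,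
    ← Real.mul_rpow hc.le (by positivity)]
  exact Real.rpow_le_rpow (by positivity) h ha

lemma contDiff_japanese (a : ℝ) {n : WithTop ℕ∞} : ContDiff ℝ n (japanese (d := d) a) :=
  (contDiff_const.add (contDiff_norm_sq ℝ)).rpow_const_of_ne fun x => by positivity

/-- The inner product as a continuous bilinear map. -/
def innerCLM (d : ℕ) : Rd d →L[ℝ] Rd d →L[ℝ] ℝ :=
  LinearMap.mkContinuous ⟨⟨fun x => innerSL ℝ x, by simp⟩, by simp⟩ 1 (by simp)

lemma norm_innerCLM_apply (x : Rd d) : ‖innerCLM d x‖ = ‖x‖ := innerSL_apply_norm ℝ x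

lemma norm_innerCLM_le : ‖innerCLM d‖ ≤ 1 := LinearMap.mkContinuous_norm_le _ zero_le_one _

lemma hasFDerivAt_japanese (a : ℝ) (x : Rd d) :
    HasFDerivAt (japanese a) ((-(2 * a) * japanese (a + 1) x) • innerCLM d x) x := by
  have h : HasFDerivAt (fun x : Rd d => 1 + ‖x‖ ^ 2) (2 • innerSL ℝ x) x :=
    (hasStrictFDerivAt_norm_sq x).hasFDerivAt.const_add 1
  have h2 := h.rpow_const (p := -a) (Or.inl (by positivity))
  refine h2.congr_fderiv ?_
  ext w
  have e : innerCLM d x w = innerSL ℝ x w := rfl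
  simp only [smul_apply, e, smul_eq_mul, nsmul_eq_mul, japanese]
  rw [show -a - 1 = -(a + 1) by ring]
  push_cast; ring

lemma fderiv_japanese (a : ℝ) : fderiv ℝ (japanese (d := d) a) =
    fun x => (-(2 * a) * japanese (a + 1) x) • innerCLM d x :=
  funext fun x => (hasFDerivAt_japanese a x).fderiv

lemma norm_mul_japanese_le (a : ℝ) (x : Rd d) : ‖x‖ * japanese (a + 1) x ≤ japanese a x := by
  exact (mul_le_mul_of_nonneg_right (by nlinarith [sq_nonneg (‖x‖ - 1)])
    (japanese_pos _ _).le).trans_eq (one_add_sq_mul_japanese a x)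

lemma japanese_succ_le (a : ℝ) (x : Rd d) : japanese (a + 1) x ≤ japanese a x := by
  exact (le_mul_of_one_le_left (japanese_pos _ _).le (by nlinarith [sq_nonneg ‖x‖])).trans_eq
    (one_add_sq_mul_japanese a x)

lemma norm_fderiv_japanese_le {a : ℝ} (ha : 0 ≤ a) (x : Rd d) :
    ‖fderiv ℝ (japanese a) x‖ ≤ 2 * a * japanese a x := by
  rw [fderiv_japanese]
  simp only
  rw [norm_smul, norm_innerCLM_apply, norm_mul, norm_neg, Real.norm_of_nonneg (by positivity),
    Real.norm_of_nonneg (japanese_pos _ _).le, mul_assoc, mul_comm (japanese _ _)]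
  exact mul_le_mul_of_nonneg_left (norm_mul_japanese_le a x) (by positivity)

lemma norm_fderiv2_japanese_le {a : ℝ} (ha : 0 ≤ a) (x : Rd d) :
    ‖fderiv ℝ (fderiv ℝ (japanese a)) x‖ ≤ (2 * a + 4 * a * (a + 1)) * japanese a x := by
  rw [fderiv_japanese]
  have h : HasFDerivAt (fun x : Rd d => (-(2 * a) * japanese (a + 1) x) • innerCLM d x) _ x :=
    ((hasFDerivAt_japanese (a + 1) x).const_mul (-(2 * a))).smul ((innerCLM d).hasFDerivAt (x := x))
  rw [h.fderiv]
  refine (norm_add_le (E := Rd d →L[ℝ] Rd d →L[ℝ] ℝ) _ _).trans ?_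
  rw [add_mul]
  refine add_le_add ?_ ?_
  · refine (ContinuousLinearMap.opNorm_smul_le _ _).trans ?_
    rw [norm_mul, norm_neg, Real.norm_of_nonneg (by positivity),
      Real.norm_of_nonneg (japanese_pos _ _).le]
    refine (mul_le_of_le_one_right ?_ norm_innerCLM_le).trans ?_
    · exact mul_nonneg (by positivity) (japanese_pos _ _).le
    · exact mul_le_mul_of_nonneg_left (japanese_succ_le a x) (by positivity)
  · refine (ContinuousLinearMap.norm_smulRight_apply _ _).le.trans ?_
    rw [norm_smul, norm_smul, norm_innerCLM_apply, norm_neg, norm_mul (-(2 * (a + 1))), norm_neg,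
      Real.norm_of_nonneg (show 0 ≤ 2 * a by positivity),
      Real.norm_of_nonneg (show 0 ≤ 2 * (a + 1) by positivity),
      Real.norm_of_nonneg (japanese_pos _ _).le]
    have h1 : ‖x‖ ^ 2 * japanese (a + 1 + 1) x ≤ japanese a x := by
      refine le_trans ?_ (japanese_succ_le a x)
      exact (mul_le_mul_of_nonneg_right (by linarith) (japanese_pos _ _).le).trans_eq
        (one_add_sq_mul_japanese (a + 1) x)
    calc 2 * a * (2 * (a + 1) * japanese (a + 1 + 1) x * ‖x‖) * ‖x‖
        = 4 * a * (a + 1) * (‖x‖ ^ 2 * japanese (a + 1 + 1) x) := by ring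
      _ ≤ _ := mul_le_mul_of_nonneg_left h1 (by positivity)

/-- The reference weight `(1 + |x|²)^{-(d+1)/2}`. -/
def baseWeight (x : Rd d) : ℝ := japanese (((d : ℝ) + 1) / 2) x

lemma baseWeight_pos (x : Rd d) : 0 < baseWeight x := japanese_pos _ x

lemma four_rpow_half : (4 : ℝ) ^ (((d : ℝ) + 1) / 2) = 2 ^ (d + 1) := by
  rw [show (4 : ℝ) = 2 ^ (2 : ℝ) by norm_num, ← Real.rpow_mul (by norm_num), ← Real.rpow_natCast]
  congr 1; push_cast; ring

lemma sq_rpow_neg_half {r : ℝ} (hr : 0 ≤ r) :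
    (r ^ 2) ^ (-(((d : ℝ) + 1) / 2)) = (r ^ (d + 1))⁻¹ := by
  rw [← Real.rpow_natCast r 2, ← Real.rpow_mul hr, ← Real.rpow_natCast r (d + 1),
    ← Real.rpow_neg hr]
  congr 1; push_cast; ring

lemma baseWeight_le_of_le {x y : Rd d} (h : 1 + ‖x‖ ^ 2 ≤ 4 * (1 + ‖y‖ ^ 2)) :
    baseWeight y ≤ 2 ^ (d + 1) * baseWeight x := by
  rw [← four_rpow_half]
  exact japanese_le_of_le (by positivity) (by norm_num) h

lemma integrable_baseWeight : Integrable (baseWeight (d := d)) := by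
  refine ((integrable_polyDecay (Nat.lt_succ_self d)).const_mul (2 ^ (d + 1))).mono'
    (contDiff_japanese (n := 0) _).continuous.aestronglyMeasurable (Eventually.of_forall fun x => ?_)
  rw [Real.norm_of_nonneg (baseWeight_pos x).le]
  have h : ((1 + ‖x‖) / 2) ^ 2 ≤ 1 + ‖x‖ ^ 2 := by nlinarith [sq_nonneg (‖x‖ - 1)]
  refine (Real.rpow_le_rpow_of_nonpos (by positivity) h
    (show -(((d : ℝ) + 1) / 2) ≤ 0 by rw [neg_nonpos]; positivity)).trans_eq ?_
  rw [sq_rpow_neg_half (by positivity), polyDecay, div_pow, inv_div, div_eq_mul_inv]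

lemma inv_pow_le_baseWeight {x z : Rd d} (hz : 0 < ‖z‖) (h : 1 + ‖x‖ ^ 2 ≤ 4 * ‖z‖ ^ 2) :
    (‖z‖ ^ (d + 1))⁻¹ ≤ 2 ^ (d + 1) * baseWeight x := by
  rw [← sq_rpow_neg_half hz.le, ← four_rpow_half, baseWeight, japanese,
    Real.rpow_neg (by positivity), Real.rpow_neg (by positivity), ← div_eq_mul_inv,
    le_div_iff₀ (by positivity), inv_mul_le_iff₀ (by positivity), mul_comm (_ ^ _),
    ← Real.mul_rpow (by norm_num) (by positivity)]
  exact Real.rpow_le_rpow (by positivity) h (by positivity)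

lemma exists_abs_secondDiff_baseWeight_le : ∃ A : ℝ, 0 ≤ A ∧ ∀ x z : Rd d, ‖z‖ ≤ 1 →
    |secondDiff baseWeight x z| ≤ A * ‖z‖ ^ 2 * baseWeight x := by
  have ha : (0 : ℝ) ≤ ((d : ℝ) + 1) / 2 := by positivity
  obtain ⟨c, hc0, hc⟩ : ∃ c : ℝ, 0 ≤ c ∧
      ∀ x : Rd d, ‖fderiv ℝ (fderiv ℝ (baseWeight (d := d))) x‖ ≤ c * baseWeight x :=
    ⟨_, by positivity, fun x => norm_fderiv2_japanese_le ha x⟩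
  refine ⟨c * 2 ^ (d + 1), by positivity, fun x z hz => ?_⟩
  refine (abs_secondDiff_le_mul_sq (M := c * (2 ^ (d + 1) * baseWeight x)) (contDiff_japanese _)
    fun w hw => (hc w).trans (mul_le_mul_of_nonneg_left ?_ hc0)).trans_eq (by ring)
  refine baseWeight_le_of_le ?_
  rw [Metric.mem_closedBall, dist_eq_norm] at hw
  have h1 : ‖x‖ ≤ ‖w‖ + ‖w - x‖ := by simpa using norm_sub_le w (w - x)
  nlinarith [norm_nonneg x, norm_nonneg w, sq_nonneg (‖w‖ - 1)]

/-- If |y| is comparable to |x| the weight at y is controlled by that at x; otherwise |z| is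
comparable to 1+|x| and the Lévy factor itself is. This works because the weight decays exactly like
the Lévy density. -/
lemma baseWeight_mul_levy_le {x y z : Rd d} (hz : 0 < ‖z‖) (h : ‖x‖ ≤ ‖y‖ + ‖z‖) :
    baseWeight y * (‖z‖ ^ (d + 1))⁻¹ ≤
      2 ^ (d + 1) * baseWeight x * ((‖z‖ ^ (d + 1))⁻¹ + baseWeight y) := by
  have hx := (baseWeight_pos x).le
  have hy := (baseWeight_pos y).le
  have hn : (0 : ℝ) ≤ (‖z‖ ^ (d + 1))⁻¹ := by positivity
  have h2 : (0 : ℝ) ≤ 2 ^ (d + 1) := by positivity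
  rcases le_total (1 + ‖x‖ ^ 2) (4 * (1 + ‖y‖ ^ 2)) with h1 | h1
  · have := baseWeight_le_of_le h1
    nlinarith [mul_le_mul_of_nonneg_right this hn, mul_nonneg (mul_nonneg h2 hx) hy]
  · have h3 : 1 + ‖x‖ ^ 2 ≤ 4 * ‖z‖ ^ 2 := by
      have h4 : ‖x‖ ^ 2 ≤ 2 * ‖y‖ ^ 2 + 2 * ‖z‖ ^ 2 := by
        nlinarith [sq_nonneg (‖y‖ - ‖z‖), norm_nonneg x, norm_nonneg y]
      nlinarith
    have := inv_pow_le_baseWeight hz h3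
    nlinarith [mul_le_mul_of_nonneg_left this hy, mul_nonneg (mul_nonneg h2 hx) hn]

/-- A positive weight which is almost invariant under transport and diffusion. -/
structure IsSlowWeight (w : Rd d → ℝ) (δ : ℝ) : Prop where
  contDiff : ContDiff ℝ 1 w
  integrable : Integrable w
  pos : ∀ x, 0 < w x
  le_one : ∀ x, w x ≤ 1
  norm_fderiv_le : ∀ x, ‖fderiv ℝ w x‖ ≤ δ * w x
  secondDiff_le : ∃ C, ∀ x z, |secondDiff w x z| ≤ C * min 1 (‖z‖ ^ 2)
  integral_le : ∀ x, ∫ z, |secondDiff w x z| * levyDensity z ≤ δ * w x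

/-- Short steps use second derivatives of the weight, which are bounded by the weight itself. For
long steps `baseWeight_mul_levy_le` factors out the weight at x and leaves a function of z with
integral bounded uniformly in x. -/
lemma exists_isSlowWeight_baseWeight [NeZero d] : ∃ δ, 0 ≤ δ ∧
    IsSlowWeight (baseWeight (d := d)) δ := by
  obtain ⟨A, hA0, hA⟩ := exists_abs_secondDiff_baseWeight_le (d := d)
  obtain ⟨c, hc0, hν, -⟩ := exists_levyDensity_eq (d := d)
  have ha : (0 : ℝ) ≤ ((d : ℝ) + 1) / 2 := by positivity
  have hw1 : ∀ x : Rd d, baseWeight x ≤ 1 := fun x => japanese_le_one ha x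
  have hcont : Continuous (baseWeight (d := d)) := (contDiff_japanese (n := 0) _).continuous
  have hsd : ∀ x z : Rd d, |secondDiff baseWeight x z| ≤ (A + 2) * min 1 (‖z‖ ^ 2) := by
    intro x z
    rcases le_total ‖z‖ 1 with h | h
    · rw [min_eq_right (pow_le_one₀ (norm_nonneg _) h)]
      refine (hA x z h).trans ?_
      have := mul_le_of_le_one_right (show 0 ≤ A * ‖z‖ ^ 2 by positivity) (hw1 x)
      nlinarith [sq_nonneg ‖z‖]
    · rw [min_eq_left (one_le_pow₀ h)]
      refine (abs_secondDiff_le_two_mul (K := 1) (fun y => ?_) x z).trans (by linarith)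
      rw [abs_of_pos (baseWeight_pos y)]; exact hw1 y
  let B : ℝ := A + 1 + 2 ^ (d + 1)
  have hB0 : 0 ≤ B := by positivity
  let I₁ : ℝ := ∫ z : Rd d, min 1 (‖z‖ ^ 2) * levyDensity z
  let I₂ : ℝ := ∫ z : Rd d, baseWeight z
  have hmin : Integrable fun z : Rd d => min 1 (‖z‖ ^ 2) * levyDensity z :=
    integrable_mul_levyDensity integrable_min_levy
  have hI₁ : 0 ≤ I₁ := integral_nonneg fun z => mul_nonneg (by positivity) (levyDensity_nonneg z)
  have hI₂ : 0 ≤ I₂ := integral_nonneg fun z => (baseWeight_pos z).le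
  have hpt : ∀ x z : Rd d, |secondDiff baseWeight x z| * levyDensity z ≤ B * baseWeight x *
      (min 1 (‖z‖ ^ 2) * levyDensity z + c * (baseWeight (x + z) + baseWeight (x - z))) := by
    intro x z
    have hx := (baseWeight_pos x).le
    have hp := (baseWeight_pos (x + z)).le
    have hm := (baseWeight_pos (x - z)).le
    have hν0 := levyDensity_nonneg z
    have h2 : (0 : ℝ) ≤ 2 ^ (d + 1) := by positivity
    rcases le_or_gt ‖z‖ 1 with h | h
    · rw [min_eq_right (pow_le_one₀ (norm_nonneg _) h)]
      calc |secondDiff baseWeight x z| * levyDensity z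
          ≤ A * ‖z‖ ^ 2 * baseWeight x * levyDensity z := by
            gcongr; exact hA x z h
        _ = A * baseWeight x * (‖z‖ ^ 2 * levyDensity z) := by ring
        _ ≤ B * baseWeight x *
            (‖z‖ ^ 2 * levyDensity z + c * (baseWeight (x + z) + baseWeight (x - z))) := by
            refine mul_le_mul ?_ ?_ (by positivity) (by positivity)
            · exact mul_le_mul_of_nonneg_right (by simp only [B]; linarith) hx
            · have : 0 ≤ c * (baseWeight (x + z) + baseWeight (x - z)) := by positivity
              linarith
    · rw [min_eq_left (one_le_pow₀ h.le), one_mul]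
      have hz : 0 < ‖z‖ := one_pos.trans h
      have e1 := baseWeight_mul_levy_le (x := x) (y := x + z) hz (by simpa using norm_sub_le (x + z) z)
      have e2 := baseWeight_mul_levy_le (x := x) (y := x - z) hz (by simpa using norm_add_le (x - z) z)
      have e3 : |secondDiff baseWeight x z| ≤
          baseWeight x + (baseWeight (x + z) + baseWeight (x - z)) / 2 := by
        unfold secondDiff
        rw [abs_le]; constructor <;> linarith
      rw [hν] at hν0 ⊢
      set n : ℝ := (‖z‖ ^ (d + 1))⁻¹ with hn
      have hn0 : 0 ≤ n := by positivity
      have e4 := mul_le_mul_of_nonneg_right e3 hn0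
      have e5 : |secondDiff baseWeight x z| * n ≤
          B * baseWeight x * (n + (baseWeight (x + z) + baseWeight (x - z))) := by
        have e6 : (0 : ℝ) ≤ A * (baseWeight x * (n + (baseWeight (x + z) + baseWeight (x - z)))) := by
          positivity
        have e7 : (0 : ℝ) ≤ baseWeight x * (baseWeight (x + z) + baseWeight (x - z)) := by positivity
        have e8 : (0 : ℝ) ≤ 2 ^ (d + 1) *
          (baseWeight x * (baseWeight (x + z) + baseWeight (x - z))) := by positivity
        simp only [B]
        linarith
      calc |secondDiff baseWeight x z| * (c * n) = c * (|secondDiff baseWeight x z| * n) := by ring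
        _ ≤ c * (B * baseWeight x * (n + (baseWeight (x + z) + baseWeight (x - z)))) := by gcongr
        _ = _ := by ring
  have hlev : ∀ x : Rd d, ∫ z, |secondDiff baseWeight x z| * levyDensity z ≤
      B * (I₁ + c * (2 * I₂)) * baseWeight x := by
    intro x
    have i1 : Integrable fun z => baseWeight (x + z) := integrable_baseWeight.comp_add_left x
    have i2 : Integrable fun z => baseWeight (x - z) := integrable_baseWeight.comp_sub_left x
    have i3 : Integrable fun z => c * (baseWeight (x + z) + baseWeight (x - z)) :=
      (i1.add i2).const_mul c
    have hi : Integrable fun z => |secondDiff baseWeight x z| * levyDensity z := by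
      refine integrable_mul_levyDensity_of_le (C := A + 2) ?_ fun z => by rw [abs_abs]; exact hsd x z
      exact ((continuous_secondDiff hcont).comp (Continuous.prodMk_right x)).abs.aestronglyMeasurable
    refine (integral_mono hi ((hmin.add i3).const_mul _) (hpt x)).trans_eq ?_
    simp only [Pi.add_apply]
    rw [integral_const_mul, integral_add hmin i3, integral_const_mul, integral_add i1 i2,
      integral_add_left_eq_self (fun z => baseWeight z),
      integral_sub_left_eq_self (fun z => baseWeight z) volume x]
    simp only [I₁, I₂]; ring
  refine ⟨max (2 * (((d : ℝ) + 1) / 2)) (B * (I₁ + c * (2 * I₂))),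
    le_max_of_le_left (by positivity), contDiff_japanese _, integrable_baseWeight, baseWeight_pos,
    hw1, fun x => ?_, ⟨A + 2, hsd⟩, fun x => ?_⟩
  · exact (norm_fderiv_japanese_le ha x).trans
      (mul_le_mul_of_nonneg_right (le_max_left _ _) (baseWeight_pos x).le)
  · exact (hlev x).trans (mul_le_mul_of_nonneg_right (le_max_right _ _) (baseWeight_pos x).le)

/-- Both the gradient and |D| are homogeneous of order one, so flattening the weight by r multiplies
its error constant by r. -/
lemma IsSlowWeight.scale [NeZero d] {w : Rd d → ℝ} {δ : ℝ} (hw : IsSlowWeight w δ) {r : ℝ}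
    (hr : 0 < r) (hr1 : r ≤ 1) : IsSlowWeight (fun x => w (r • x)) (r * δ) := by
  have hsd : ∀ x z, secondDiff (fun x => w (r • x)) x z = secondDiff w (r • x) (r • z) := by
    intro x z
    simp only [secondDiff, smul_add, smul_sub]
  obtain ⟨C, hC⟩ := hw.secondDiff_le
  have hC0 : 0 ≤ C := by
    have := (abs_nonneg _).trans (hC 0 (EuclideanSpace.single 0 1))
    simpa using this
  refine ⟨hw.contDiff.comp (contDiff_const_smul r), hw.integrable.comp_smul hr.ne',
    fun x => hw.pos _, fun x => hw.le_one _, fun x => ?_, ⟨C, fun x z => ?_⟩, fun x => ?_⟩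
  · have h : HasFDerivAt (fun x => w (r • x)) _ x :=
      (hw.contDiff.differentiable (by simp) (r • x)).hasFDerivAt.comp x
        ((hasFDerivAt_id x).const_smul r)
    rw [h.fderiv]
    refine (ContinuousLinearMap.opNorm_comp_le _ _).trans ?_
    have h1 : ‖r • ContinuousLinearMap.id ℝ (Rd d)‖ ≤ r := by
      rw [norm_smul, Real.norm_of_nonneg hr.le]
      exact mul_le_of_le_one_right hr.le ContinuousLinearMap.norm_id_le
    calc _ ≤ δ * w (r • x) * r := mul_le_mul (hw.norm_fderiv_le _) h1 (norm_nonneg _)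
          ((norm_nonneg _).trans (hw.norm_fderiv_le _))
      _ = _ := by ring
  · rw [hsd]
    refine (hC _ _).trans (mul_le_mul_of_nonneg_left ?_ hC0)
    refine min_le_min (le_refl (1 : ℝ)) (pow_le_pow_left₀ (norm_nonneg _) ?_ 2)
    rw [norm_smul, Real.norm_of_nonneg hr.le]
    exact mul_le_of_le_one_left (norm_nonneg _) hr1
  · obtain ⟨c, -, hν, -⟩ := exists_levyDensity_eq (d := d)
    have h := Measure.integral_comp_smul_of_nonneg (volume : Measure (Rd d))
      (fun z => |secondDiff w (r • x) z| * levyDensity z) r (hR := hr.le)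
    rw [finrank_euclideanSpace_fin, smul_eq_mul] at h
    have e : (fun z => |secondDiff (fun x => w (r • x)) x z| * levyDensity z) = fun z =>
        r ^ (d + 1) * (|secondDiff w (r • x) (r • z)| * levyDensity (r • z)) := by
      funext z
      rw [hsd, hν, hν, norm_smul, Real.norm_of_nonneg hr.le, mul_pow]
      rcases eq_or_ne z 0 with rfl | hz
      · simp
      · have := norm_pos_iff.2 hz
        field_simp
    rw [e, integral_const_mul, h]
    have h2 := hw.integral_le (r • x)
    calc r ^ (d + 1) * ((r ^ d)⁻¹ * ∫ z, |secondDiff w (r • x) z| * levyDensity z)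
        = r * ∫ z, |secondDiff w (r • x) z| * levyDensity z := by field_simp; ring
      _ ≤ r * (δ * w (r • x)) := by gcongr
      _ = _ := by ring

end Weight

/-! ### A differential inequality -/

section Gronwall

lemma ofReal_integral_le_lintegral {α : Type*} [MeasurableSpace α] {μ : Measure α} {f : α → ℝ} :
    ENNReal.ofReal (∫ x, f x ∂μ) ≤ ∫⁻ x, ENNReal.ofReal (f x) ∂μ := by
  by_cases hf : Integrable f μ
  · calc ENNReal.ofReal (∫ x, f x ∂μ) ≤ ENNReal.ofReal (∫ x, max (f x) 0 ∂μ) :=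
          ENNReal.ofReal_le_ofReal (integral_mono hf hf.pos_part fun x => le_max_left _ _)
      _ = ∫⁻ x, ENNReal.ofReal (max (f x) 0) ∂μ :=
          ofReal_integral_eq_lintegral_ofReal hf.pos_part
            (Eventually.of_forall fun x => le_max_right _ _)
      _ = _ := by simp
  · rw [integral_undef hf]; simp

/-- Integration of `E' ≤ -pγE + pE^{1-1/p}Φ`. -/
lemma lintegral_rpow_le_of_deriv_le {T p γ B : ℝ} (hT : 0 < T) (hp : 1 < p) (hγ : 0 ≤ γ)
    {E E' Φ : ℝ → ℝ} (hE : ContinuousOn E (Icc 0 T)) (hE0 : ∀ t ∈ Icc 0 T, 0 ≤ E t)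
    (hd : ∀ t ∈ Ioo 0 T, HasDerivAt E (E' t) t) (hB : ∀ t ∈ Ioo 0 T, |E' t| ≤ B)
    (hΦ : ∀ t ∈ Ioo 0 T, 0 ≤ Φ t)
    (hle : ∀ t ∈ Ioo 0 T, E' t ≤ -(p * γ) * E t + p * (E t ^ (1 - 1 / p) * Φ t)) :
    ENNReal.ofReal γ * ∫⁻ t in Icc 0 T, ENNReal.ofReal (E t ^ (1 / p)) ≤
      ENNReal.ofReal (E 0 ^ (1 / p)) + ∫⁻ t in Icc 0 T, ENNReal.ofReal (Φ t) := by
  have hp0 : 0 < p := one_pos.trans hp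
  have hq : 0 < 1 / p := by positivity
  have hq1 : 1 / p < 1 := by rw [div_lt_one hp0]; exact hp
  have key : ∀ ε : ℝ, 0 < ε → ENNReal.ofReal γ * ∫⁻ t in Icc 0 T, ENNReal.ofReal (E t ^ (1 / p)) ≤
      ENNReal.ofReal ((E 0 + ε) ^ (1 / p) + γ * ε ^ (1 / p) * T) +
        ∫⁻ t in Icc 0 T, ENNReal.ofReal (Φ t) := by
    intro ε hε
    -- E may vanish, where the power 1/p is not differentiable; E + ε is used instead, at a total
    -- cost of γε^(1/p)T that disappears in the limit.
    let y : ℝ → ℝ := fun t => (E t + ε) ^ (1 / p)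
    have hyc : ContinuousOn y (Icc 0 T) :=
      (hE.add continuousOn_const).rpow_const fun t ht =>
        Or.inl (show (0 : ℝ) < E t + ε by have := hE0 t ht; linarith).ne'
    have hyd : ∀ t ∈ Ioo 0 T, HasDerivAt y (E' t * (1 / p) * (E t + ε) ^ (1 / p - 1)) t :=
      fun t ht => ((hd t ht).add_const ε).rpow_const
        (Or.inl (show (0 : ℝ) < E t + ε by
          have := hE0 t (Ioo_subset_Icc_self ht); linarith).ne')
    have hyd' : ∀ t ∈ Ioo 0 T, HasDerivAt y (deriv y t) t := fun t ht => by
      rw [(hyd t ht).deriv]; exact hyd t ht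
    have hyb : ∀ t ∈ Ioo 0 T, |deriv y t| ≤ B * ε ^ (1 / p - 1) := by
      intro t ht
      have hE1 := hE0 t (Ioo_subset_Icc_self ht)
      rw [(hyd t ht).deriv, abs_mul, abs_mul, abs_of_pos hq,
        abs_of_pos (Real.rpow_pos_of_pos (by positivity) _)]
      refine mul_le_mul ?_ (Real.rpow_le_rpow_of_nonpos hε (by linarith) (by linarith))
        (by positivity) ((abs_nonneg _).trans (hB t ht))
      exact (mul_le_of_le_one_right (abs_nonneg _) hq1.le).trans (hB t ht)
    have hint : IntegrableOn (deriv y) (Ioc 0 T) := by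
      rw [integrableOn_Ioc_iff_integrableOn_Ioo]
      refine Measure.integrableOn_of_bounded (M := B * ε ^ (1 / p - 1)) (by simp)
        (measurable_deriv y).aestronglyMeasurable ?_
      exact (ae_restrict_mem measurableSet_Ioo).mono hyb
    have hfund := intervalIntegral.integral_eq_sub_of_hasDerivAt_of_le hT.le hyc hyd'
      ((intervalIntegrable_iff_integrableOn_Ioc_of_le hT.le).2 hint)
    rw [intervalIntegral.integral_of_le hT.le] at hfund
    have hyi : IntegrableOn y (Ioc 0 T) :=
      (hyc.integrableOn_Icc).mono_set Ioc_subset_Icc_self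
    have hineq : ∀ t ∈ Ioo 0 T, γ * y t - γ * ε ^ (1 / p) + deriv y t ≤ Φ t := by
      intro t ht
      have hE1 := hE0 t (Ioo_subset_Icc_self ht)
      have hs : 0 < E t + ε := by positivity
      have hrp : 0 < (E t + ε) ^ (1 / p - 1) := Real.rpow_pos_of_pos hs _
      have h1 : y t = (E t + ε) * (E t + ε) ^ (1 / p - 1) := by
        simp only [y]
        rw [← Real.rpow_one_add' hs.le (by linarith)]; congr 1; ring
      have h2 : ε * (E t + ε) ^ (1 / p - 1) ≤ ε ^ (1 / p) := by
        calc ε * (E t + ε) ^ (1 / p - 1) ≤ ε * ε ^ (1 / p - 1) := by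
              exact mul_le_mul_of_nonneg_left
                (Real.rpow_le_rpow_of_nonpos hε (by linarith) (by linarith)) hε.le
          _ = ε ^ (1 / p) := by
              rw [← Real.rpow_one_add' hε.le (by linarith)]; congr 1; ring
      have h3 : E t ^ (1 - 1 / p) * (E t + ε) ^ (1 / p - 1) ≤ 1 := by
        calc E t ^ (1 - 1 / p) * (E t + ε) ^ (1 / p - 1)
            ≤ (E t + ε) ^ (1 - 1 / p) * (E t + ε) ^ (1 / p - 1) := by
              exact mul_le_mul_of_nonneg_right
                (Real.rpow_le_rpow hE1 (by linarith) (by linarith)) hrp.le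
          _ = 1 := by rw [← Real.rpow_add hs]; simp
      have h4 := mul_le_mul_of_nonneg_right (hle t ht) (mul_pos hq hrp).le
      have h5 : (-(p * γ) * E t + p * (E t ^ (1 - 1 / p) * Φ t)) *
          (1 / p * (E t + ε) ^ (1 / p - 1)) = -γ * (E t * (E t + ε) ^ (1 / p - 1)) +
            (E t ^ (1 - 1 / p) * (E t + ε) ^ (1 / p - 1)) * Φ t := by
        field_simp
      have h6 := mul_le_mul_of_nonneg_right h3 (hΦ t ht)
      have h7 := mul_le_mul_of_nonneg_left h2 hγ
      rw [(hyd t ht).deriv, h1]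
      rw [h5] at h4
      linarith
    have hlow : γ * ∫ t in Ioc 0 T, E t ^ (1 / p) ≤ γ * ∫ t in Ioc 0 T, y t := by
      refine mul_le_mul_of_nonneg_left ?_ hγ
      refine setIntegral_mono_on ?_ hyi measurableSet_Ioc fun t ht => ?_
      · exact ((hE.rpow_const fun t _ => Or.inr hq.le).integrableOn_Icc).mono_set Ioc_subset_Icc_self
      · have := hE0 t (Ioc_subset_Icc_self ht)
        exact Real.rpow_le_rpow this (by linarith) hq.le
    have hc : IntegrableOn (fun _ : ℝ => γ * ε ^ (1 / p)) (Ioc 0 T) :=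
      (continuous_const.integrableOn_Icc).mono_set Ioc_subset_Icc_self
    have hsum : ∫ t in Ioc 0 T, (γ * y t - γ * ε ^ (1 / p) + deriv y t) =
        γ * (∫ t in Ioc 0 T, y t) - γ * ε ^ (1 / p) * T + (y T - y 0) := by
      have hi : IntegrableOn (fun t => γ * y t - γ * ε ^ (1 / p)) (Ioc 0 T) :=
        (hyi.const_mul γ).sub hc
      rw [integral_add hi hint, integral_sub (hyi.const_mul γ) hc,
        integral_const_mul, hfund, setIntegral_const]
      simp [hT.le, mul_comm]
    have hyT : 0 ≤ y T := Real.rpow_nonneg (by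
      have := hE0 T ⟨hT.le, le_rfl⟩; positivity) _
    have hmain : γ * ∫ t in Ioc 0 T, E t ^ (1 / p) ≤ (y 0 + γ * ε ^ (1 / p) * T) +
        ∫ t in Ioc 0 T, (γ * y t - γ * ε ^ (1 / p) + deriv y t) := by linarith
    have hnn : ∀ᵐ t ∂volume.restrict (Ioc 0 T), 0 ≤ E t ^ (1 / p) :=
      (ae_restrict_mem measurableSet_Ioc).mono fun t ht =>
        Real.rpow_nonneg (hE0 t (Ioc_subset_Icc_self ht)) _
    have hEi : IntegrableOn (fun t => E t ^ (1 / p)) (Ioc 0 T) :=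
      ((hE.rpow_const fun t _ => Or.inr hq.le).integrableOn_Icc).mono_set Ioc_subset_Icc_self
    rw [setLIntegral_congr (Ioc_ae_eq_Icc (μ := volume) (a := (0 : ℝ)) (b := T)).symm,
      ← ofReal_integral_eq_lintegral_ofReal hEi hnn, ← ENNReal.ofReal_mul hγ]
    refine (ENNReal.ofReal_le_ofReal hmain).trans (ENNReal.ofReal_add_le.trans
      (add_le_add le_rfl ?_))
    -- The comparison with Φ is made pointwise inside a lower integral, so measurability of Φ is not
    -- needed.
    refine ofReal_integral_le_lintegral.trans ?_
    rw [setLIntegral_congr (Ioo_ae_eq_Ioc (μ := volume) (a := (0 : ℝ)) (b := T)).symm,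
      setLIntegral_congr (Ioo_ae_eq_Icc (μ := volume) (a := (0 : ℝ)) (b := T)).symm]
    exact setLIntegral_mono' measurableSet_Ioo fun t ht => ENNReal.ofReal_le_ofReal (hineq t ht)
  have hlim : Tendsto (fun ε : ℝ => ENNReal.ofReal ((E 0 + ε) ^ (1 / p) + γ * ε ^ (1 / p) * T) +
      ∫⁻ t in Icc 0 T, ENNReal.ofReal (Φ t)) (𝓝[>] 0)
      (𝓝 (ENNReal.ofReal (E 0 ^ (1 / p)) + ∫⁻ t in Icc 0 T, ENNReal.ofReal (Φ t))) := by
    refine Tendsto.add (ENNReal.tendsto_ofReal ?_) tendsto_const_nhds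
    have h1 : Continuous fun ε : ℝ => (E 0 + ε) ^ (1 / p) + γ * ε ^ (1 / p) * T := by
      refine Continuous.add ?_ ((continuous_const.mul ?_).mul continuous_const)
      · exact (continuous_const.add continuous_id).rpow_const fun _ => Or.inr hq.le
      · exact continuous_id.rpow_const fun _ => Or.inr hq.le
    have h2 := h1.tendsto 0
    rw [add_zero, Real.zero_rpow hq.ne', mul_zero, zero_mul, add_zero] at h2
    exact h2.mono_left nhdsWithin_le_nhds
  refine ge_of_tendsto hlim ?_
  filter_upwards [self_mem_nhdsWithin] with ε hε
  exact key ε hε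

end Gronwall

/-! ### The weighted energy inequality -/

section PowDeriv

/-- The derivative `p|a|^{p-2}a` of `|a|^p`. -/
def powDeriv (p a : ℝ) : ℝ := p * |a| ^ (p - 2) * a

variable {p : ℝ}

lemma hasDerivAt_powDeriv (hp : 1 < p) (a : ℝ) : HasDerivAt (fun x => |x| ^ p) (powDeriv p a) a :=
  hasDerivAt_abs_rpow a hp

lemma contDiff_abs_rpow (hp : 1 < p) : ContDiff ℝ 1 fun a : ℝ => |a| ^ p :=
  contDiff_norm_rpow (E := ℝ) hp

lemma continuous_powDeriv (hp : 1 < p) : Continuous (powDeriv p) := by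
  have h := (contDiff_abs_rpow hp).continuous_deriv le_rfl
  rwa [show deriv (fun a : ℝ => |a| ^ p) = powDeriv p from
    funext fun a => (hasDerivAt_powDeriv hp a).deriv] at h

lemma abs_powDeriv (hp : 1 < p) (a : ℝ) : |powDeriv p a| = p * |a| ^ (p - 1) := by
  unfold powDeriv
  rw [abs_mul, abs_mul, abs_of_pos (by linarith : 0 < p), abs_of_nonneg (by positivity), mul_assoc]
  rcases eq_or_ne a 0 with rfl | ha
  · simp [Real.zero_rpow (by linarith : p - 1 ≠ 0)]
  · rw [← Real.rpow_add_one (abs_pos.2 ha).ne']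
    congr 2; ring

lemma powDeriv_mul_self (hp : 1 < p) (a : ℝ) : powDeriv p a * a = p * |a| ^ p := by
  unfold powDeriv
  rcases eq_or_ne a 0 with rfl | ha
  · simp [Real.zero_rpow (by linarith : p ≠ 0)]
  · have : |a| ^ p = |a| ^ (p - 2) * |a| ^ 2 := by
      rw [← Real.rpow_add_natCast (abs_pos.2 ha).ne']; congr 1; push_cast; ring
    rw [this, sq_abs]; ring

lemma abs_powDeriv_le (hp : 1 < p) {a B : ℝ} (h : |a| ≤ B) : |powDeriv p a| ≤ p * B ^ (p - 1) := by
  rw [abs_powDeriv hp]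
  exact mul_le_mul_of_nonneg_left (Real.rpow_le_rpow (abs_nonneg _) h (by linarith)) (by linarith)

/-- Convexity of |a|^p: the graph lies above its tangent at a. It follows from Young's inequality
for |a|^(p-1)|b|. -/
lemma abs_rpow_sub_le (hp : 1 < p) (a b : ℝ) : |a| ^ p - |b| ^ p ≤ powDeriv p a * (a - b) := by
  have hq : (p / (p - 1)).HolderConjugate p := (Real.HolderConjugate.conjExponent hp).symm
  have h := Real.young_inequality_of_nonneg (a := |a| ^ (p - 1)) (b := |b|) (by positivity)
    (abs_nonneg b) hq
  have hp1 : p - 1 ≠ 0 := by linarith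
  rw [← Real.rpow_mul (abs_nonneg a), mul_div_cancel₀ _ hp1] at h
  have h1 : powDeriv p a * b ≤ p * (|a| ^ (p - 1) * |b|) := by
    refine (le_abs_self _).trans_eq ?_
    rw [abs_mul, abs_powDeriv hp]; ring
  have h2 : p * (|a| ^ p / (p / (p - 1)) + |b| ^ p / p) = (p - 1) * |a| ^ p + |b| ^ p := by
    have : p ≠ 0 := by linarith
    field_simp
  have h3 := mul_le_mul_of_nonneg_left h (by linarith : 0 ≤ p)
  rw [h2] at h3
  rw [mul_sub, powDeriv_mul_self hp]
  linarith

/-- The pointwise convexity inequality for nonlocal diffusions (Córdoba–Córdoba), step by step in z;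
it can thus be integrated against any nonnegative density, not only the full Lévy density. -/
lemma secondDiff_abs_rpow_le {d : ℕ} (hp : 1 < p) (u : Rd d → ℝ) (x z : Rd d) :
    secondDiff (fun x => |u x| ^ p) x z ≤ powDeriv p (u x) * secondDiff u x z := by
  have h1 := abs_rpow_sub_le hp (u x) (u (x + z))
  have h2 := abs_rpow_sub_le hp (u x) (u (x - z))
  unfold secondDiff
  linarith

end PowDeriv

/-! ### Weighted energy balance: diffusion, transport and forcing -/

section Energy
variable {d : ℕ} {p B D δ : ℝ} {w u : Rd d → ℝ}

lemma integral_mul_secondDiff_comm {f g : Rd d → ℝ} {M : ℝ} (hf : Integrable f)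
    (hg : Continuous g) (hM : ∀ x, |g x| ≤ M) (z : Rd d) :
    ∫ x, f x * secondDiff g x z = ∫ x, g x * secondDiff f x z := by
  have i0 : Integrable fun x => f x * g x := integrable_mul_of_bounded hf hg.measurable hM
  have i1 : Integrable fun x => f x * g (x + z) :=
    integrable_mul_of_bounded hf (hg.comp (by fun_prop)).measurable fun x => hM _
  have i2 : Integrable fun x => f x * g (x - z) :=
    integrable_mul_of_bounded hf (hg.comp (by fun_prop)).measurable fun x => hM _
  have i3 : Integrable fun x => f (x + z) * g x :=
    integrable_mul_of_bounded (hf.comp_add_right z) hg.measurable hM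
  have i4 : Integrable fun x => f (x - z) * g x :=
    integrable_mul_of_bounded (hf.comp_sub_right z) hg.measurable hM
  have e1 : ∫ x, f x * g (x + z) = ∫ x, f (x - z) * g x := by
    rw [← integral_sub_right_eq_self (fun x => f x * g (x + z)) z]; simp
  have e2 : ∫ x, f x * g (x - z) = ∫ x, f (x + z) * g x := by
    rw [← integral_add_right_eq_self (fun x => f x * g (x - z)) z]; simp
  have l : ∫ x, f x * secondDiff g x z =
      (∫ x, f x * g x) - ((∫ x, f x * g (x + z)) + ∫ x, f x * g (x - z)) / 2 := by
    have i5 : Integrable fun x => (f x * g (x + z) + f x * g (x - z)) / 2 := (i1.add i2).div_const 2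
    rw [← integral_add i1 i2, ← integral_div, ← integral_sub i0 i5]
    congr 1; funext x; simp only [secondDiff]; ring
  have r : ∫ x, g x * secondDiff f x z =
      (∫ x, f x * g x) - ((∫ x, f (x + z) * g x) + ∫ x, f (x - z) * g x) / 2 := by
    have i5 : Integrable fun x => (f (x + z) * g x + f (x - z) * g x) / 2 := (i3.add i4).div_const 2
    rw [← integral_add i3 i4, ← integral_div, ← integral_sub i0 i5]
    congr 1; funext x; simp only [secondDiff]; ring
  rw [l, r, e1, e2, add_comm]

lemma IsSlowWeight.integrable_mul_abs_rpow (hw : IsSlowWeight w δ) (hp : 1 < p) (hu : Continuous u)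
    (hB : ∀ x, |u x| ≤ B) : Integrable fun x => w x * |u x| ^ p :=
  integrable_mul_of_bounded (M := B ^ p) hw.integrable
    ((contDiff_abs_rpow hp).continuous.comp hu).measurable fun x => by
      rw [abs_of_nonneg (by positivity)]
      exact Real.rpow_le_rpow (abs_nonneg _) (hB x) (by linarith)

lemma IsSlowWeight.integrable_prod_secondDiff [NeZero d] (hw : IsSlowWeight w δ) :
    Integrable (fun q : Rd d × Rd d => |secondDiff w q.1 q.2| * levyDensity q.2)
      (volume.prod volume) := by
  obtain ⟨C, hC⟩ := hw.secondDiff_le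
  have hm : AEStronglyMeasurable (fun q : Rd d × Rd d => |secondDiff w q.1 q.2| * levyDensity q.2)
      (volume.prod volume) :=
    ((continuous_secondDiff hw.contDiff.continuous).abs.measurable.mul
      (measurable_levyDensity.comp measurable_snd)).aestronglyMeasurable
  refine (integrable_prod_iff hm).2 ⟨Eventually.of_forall fun x => ?_, ?_⟩
  · refine integrable_mul_levyDensity_of_le (C := C) ?_ fun z => by rw [abs_abs]; exact hC x z
    exact ((continuous_secondDiff hw.contDiff.continuous).comp
      (Continuous.prodMk_right x)).abs.aestronglyMeasurable
  · refine (hw.integrable.const_mul δ).mono' hm.norm.integral_prod_right'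
      (Eventually.of_forall fun x => ?_)
    rw [Real.norm_of_nonneg (integral_nonneg fun _ => norm_nonneg _)]
    refine le_trans (le_of_eq ?_) (hw.integral_le x)
    congr 1; funext z
    exact Real.norm_of_nonneg (mul_nonneg (abs_nonneg _) (levyDensity_nonneg z))

/-- The nonlocal dissipation is almost nonnegative against a slowly varying weight. -/
lemma IsSlowWeight.diffusion_ge [NeZero d] (hw : IsSlowWeight w δ) (hp : 1 < p)
    (hu : Continuous u) (hB : ∀ x, |u x| ≤ B)
    (hD : ∀ x z, |secondDiff u x z| ≤ D * min 1 (‖z‖ ^ 2)) {μ : Rd d → ℝ} (hμ : AEStronglyMeasurable μ)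
    (hμ0 : ∀ᵐ z, 0 ≤ μ z) (hμ1 : ∀ᵐ z, μ z ≤ levyDensity z) :
    Integrable (fun x => w x * (powDeriv p (u x) * ∫ z, secondDiff u x z * μ z)) ∧
    -(δ * ∫ x, w x * |u x| ^ p) ≤
      ∫ x, w x * (powDeriv p (u x) * ∫ z, secondDiff u x z * μ z) := by
  have hwc := hw.contDiff.continuous
  have hB0 : 0 ≤ B := (abs_nonneg _).trans (hB 0)
  have hup : Continuous fun x => |u x| ^ p := (contDiff_abs_rpow hp).continuous.comp hu
  have hupB : ∀ x, |(|u x| ^ p)| ≤ B ^ p := fun x => by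
    rw [abs_of_nonneg (by positivity)]
    exact Real.rpow_le_rpow (abs_nonneg _) (hB x) (by linarith)
  have hβ : Continuous fun x => powDeriv p (u x) := (continuous_powDeriv hp).comp hu
  have hμp : AEStronglyMeasurable (fun q : Rd d × Rd d => μ q.2) (volume.prod volume) :=
    hμ.comp_snd
  have hμ0' : ∀ᵐ q : Rd d × Rd d ∂(volume.prod volume), 0 ≤ μ q.2 :=
    Measure.quasiMeasurePreserving_snd.ae hμ0
  have hμ1' : ∀ᵐ q : Rd d × Rd d ∂(volume.prod volume), μ q.2 ≤ levyDensity q.2 :=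
    Measure.quasiMeasurePreserving_snd.ae hμ1
  let G : Rd d → Rd d → ℝ := fun x z => w x * (powDeriv p (u x) * (secondDiff u x z * μ z))
  have hG : Integrable (Function.uncurry G) (volume.prod volume) := by
    have hi := (hw.integrable.const_mul (p * B ^ (p - 1) * D)).mul_prod
      (integrable_mul_levyDensity (integrable_min_levy (d := d)))
    refine hi.mono' ?_ ?_
    · exact (hwc.comp continuous_fst).aestronglyMeasurable.mul
        ((hβ.comp continuous_fst).aestronglyMeasurable.mul
          ((continuous_secondDiff hu).aestronglyMeasurable.mul hμp))
    · filter_upwards [hμ0', hμ1'] with q h0 h1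
      simp only [Function.uncurry, G]
      rw [norm_mul, norm_mul, norm_mul, Real.norm_of_nonneg (hw.pos _).le, Real.norm_of_nonneg h0,
        Real.norm_eq_abs, Real.norm_eq_abs]
      have hD0 := (abs_nonneg _).trans (hD q.1 q.2)
      have hw0 := (hw.pos q.1).le
      calc w q.1 * (|powDeriv p (u q.1)| * (|secondDiff u q.1 q.2| * μ q.2))
          ≤ w q.1 * ((p * B ^ (p - 1)) * ((D * min 1 (‖q.2‖ ^ 2)) * levyDensity q.2)) := by
            refine mul_le_mul_of_nonneg_left (mul_le_mul (abs_powDeriv_le hp (hB _))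
              (mul_le_mul (hD _ _) h1 h0 hD0) (by positivity) (by positivity)) hw0
        _ = _ := by ring
  -- H bounds the error created when the second difference is shifted from |u|^p to the weight; the
  -- slow variation of w controls its total mass.
  let H : Rd d → Rd d → ℝ := fun x z => |u x| ^ p * (|secondDiff w x z| * levyDensity z)
  have hH : Integrable (Function.uncurry H) (volume.prod volume) :=
    hw.integrable_prod_secondDiff.bdd_mul (c := B ^ p) (hup.comp continuous_fst).aestronglyMeasurable
      (Eventually.of_forall fun q => hupB q.1)
  have e : ∀ x, ∫ z, G x z = w x * (powDeriv p (u x) * ∫ z, secondDiff u x z * μ z) := fun x => by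
    simp only [G]; rw [integral_const_mul, integral_const_mul]
  have hGi := hG.integral_prod_left
  simp only [Function.uncurry_apply_pair, e] at hGi
  refine ⟨hGi, ?_⟩
  simp_rw [← e]
  rw [integral_integral_swap hG]
  have hHle : ∫ x, ∫ z, H x z ≤ δ * ∫ x, w x * |u x| ^ p := by
    rw [← integral_const_mul]
    refine integral_mono hH.integral_prod_left
      ((hw.integrable_mul_abs_rpow hp hu hB).const_mul δ) fun x => ?_
    simp only [H]
    rw [integral_const_mul]
    calc |u x| ^ p * ∫ z, |secondDiff w x z| * levyDensity z ≤ |u x| ^ p * (δ * w x) :=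
          mul_le_mul_of_nonneg_left (hw.integral_le x) (by positivity)
      _ = _ := by ring
  rw [integral_integral_swap hH] at hHle
  refine (neg_le_neg hHle).trans ?_
  rw [← integral_neg]
  refine integral_mono_ae hH.integral_prod_right.neg hG.integral_prod_right ?_
  filter_upwards [hμ0, hμ1, hH.prod_left_ae, hG.prod_left_ae] with z h0 h1 hi hGz
  simp only [Function.uncurry_apply_pair] at hi hGz ⊢
  have hsd : ∀ x, |secondDiff (fun x => |u x| ^ p) x z| ≤ 2 * B ^ p :=
    fun x => abs_secondDiff_le_two_mul hupB x z
  have hsc : Continuous fun x => secondDiff (fun x => |u x| ^ p) x z :=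
    (continuous_secondDiff hup).comp (Continuous.prodMk_left z)
  have i1 : Integrable fun x => w x * secondDiff (fun x => |u x| ^ p) x z :=
    integrable_mul_of_bounded hw.integrable hsc.measurable hsd
  -- For a fixed step z: use μ ≤ ν in the error, move the second difference by symmetry, then apply
  -- convexity.
  calc -∫ x, H x z ≤ μ z * ∫ x, |u x| ^ p * secondDiff w x z := by
        rw [← integral_neg, ← integral_const_mul]
        have i2 : Integrable fun x => |u x| ^ p * secondDiff w x z := by
          have h2 : Integrable fun x => secondDiff w x z :=
            hw.integrable.sub (((hw.integrable.comp_add_right z).add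
              (hw.integrable.comp_sub_right z)).div_const 2)
          exact h2.bdd_mul (c := B ^ p) hup.aestronglyMeasurable (Eventually.of_forall hupB)
        refine integral_mono hi.neg (i2.const_mul _) fun x => ?_
        have h3 : -(|secondDiff w x z| * levyDensity z) ≤ μ z * secondDiff w x z := by
          have h4 := neg_abs_le (secondDiff w x z)
          have h5 := mul_le_mul_of_nonneg_left h1 (abs_nonneg (secondDiff w x z))
          have h6 := mul_le_mul_of_nonneg_left h4 h0
          linarith
        calc -H x z = |u x| ^ p * -(|secondDiff w x z| * levyDensity z) := by simp only [H]; ring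
          _ ≤ |u x| ^ p * (μ z * secondDiff w x z) :=
              mul_le_mul_of_nonneg_left h3 (by positivity)
          _ = _ := by ring
    _ = μ z * ∫ x, w x * secondDiff (fun x => |u x| ^ p) x z := by
        rw [integral_mul_secondDiff_comm hw.integrable hup hupB]
    _ ≤ ∫ x, G x z := by
        rw [← integral_const_mul]
        refine integral_mono (i1.const_mul _) hGz fun x => ?_
        calc μ z * (w x * secondDiff (fun x => |u x| ^ p) x z)
            = (μ z * w x) * secondDiff (fun x => |u x| ^ p) x z := by ring
          _ ≤ (μ z * w x) * (powDeriv p (u x) * secondDiff u x z) :=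
              mul_le_mul_of_nonneg_left (secondDiff_abs_rpow_le hp u x z)
                (mul_nonneg h0 (hw.pos x).le)
          _ = G x z := by simp only [G]; ring

/-- Transport by a bounded divergence-free field against a slowly varying weight. -/
lemma IsSlowWeight.transport_ge (hw : IsSlowWeight w δ) (hp : 1 < p)
    (hu : ContDiff ℝ 1 u) (hB : ∀ x, |u x| ≤ B) (hB' : ∀ x, ‖fderiv ℝ u x‖ ≤ B)
    {v : Rd d → Rd d} {V : ℝ} (hv : ContDiff ℝ 1 v) (hV : ∀ x, ‖v x‖ ≤ V)
    (hdiv : ∀ x, divergence v x = 0) :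
    Integrable (fun x => w x * (powDeriv p (u x) * fderiv ℝ u x (v x))) ∧
    -(δ * V * ∫ x, w x * |u x| ^ p) ≤ ∫ x, w x * (powDeriv p (u x) * fderiv ℝ u x (v x)) := by
  have hB0 : 0 ≤ B := (abs_nonneg _).trans (hB 0)
  have hV0 : 0 ≤ V := (norm_nonneg _).trans (hV 0)
  have hDu : Continuous fun x => fderiv ℝ u x (v x) :=
    (hu.continuous_fderiv (by simp)).clm_apply hv.continuous
  have hDw : Continuous fun x => fderiv ℝ w x (v x) :=
    (hw.contDiff.continuous_fderiv (by simp)).clm_apply hv.continuous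
  have hup : ContDiff ℝ 1 fun x => |u x| ^ p := (contDiff_abs_rpow hp).comp hu
  have i1 : Integrable fun x => w x * (powDeriv p (u x) * fderiv ℝ u x (v x)) := by
    refine integrable_mul_of_bounded (M := p * B ^ (p - 1) * (B * V)) hw.integrable
      (((continuous_powDeriv hp).comp hu.continuous).mul hDu).measurable fun x => ?_
    rw [abs_mul]
    refine mul_le_mul (abs_powDeriv_le hp (hB x)) ?_ (abs_nonneg _) (by positivity)
    exact ((fderiv ℝ u x).le_opNorm _).trans (mul_le_mul (hB' x) (hV x) (norm_nonneg _) hB0)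
  have hwD : ∀ x, |fderiv ℝ w x (v x)| ≤ δ * V * w x := fun x =>
    ((fderiv ℝ w x).le_opNorm _).trans ((mul_le_mul (hw.norm_fderiv_le x) (hV x) (norm_nonneg _)
      ((norm_nonneg _).trans (hw.norm_fderiv_le x))).trans_eq (by ring))
  have i0 := hw.integrable_mul_abs_rpow hp hu.continuous hB
  have i2 : Integrable fun x => |u x| ^ p * fderiv ℝ w x (v x) := by
    refine (i0.const_mul (δ * V)).mono' (hup.continuous.mul hDw).aestronglyMeasurable
      (Eventually.of_forall fun x => ?_)
    rw [norm_mul, Real.norm_of_nonneg (by positivity), Real.norm_eq_abs]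
    exact (mul_le_mul_of_nonneg_left (hwD x) (by positivity)).trans_eq (by ring)
  -- The field w|u|^p v has integrable divergence with total integral zero, so the transport term
  -- equals the negative of an integral involving only ∇w.
  let f : Rd d → ℝ := fun x => w x * |u x| ^ p
  have hf : ContDiff ℝ 1 f := hw.contDiff.mul hup
  have hfd : ∀ x, fderiv ℝ f x (v x) =
      w x * (powDeriv p (u x) * fderiv ℝ u x (v x)) + |u x| ^ p * fderiv ℝ w x (v x) := fun x => by
    have h1 := (hasDerivAt_powDeriv hp (u x)).comp_hasFDerivAt x
      (hu.differentiable (by simp) x).hasFDerivAt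
    have h2 : HasFDerivAt f _ x := (hw.contDiff.differentiable (by simp) x).hasFDerivAt.mul h1
    rw [h2.fderiv]
    simp
  have hdivX : divergence (fun x => f x • v x) = fun x => fderiv ℝ f x (v x) := by
    funext x
    rw [divergence_smul (hf.differentiable (by simp) x) (hv.differentiable (by simp) x), hdiv,
      mul_zero, zero_add]
  have h := integral_divergence_eq_zero (X := fun x => f x • v x) (hf.smul hv)
    ((i0.norm.mul_const V).mono' (hf.continuous.smul hv.continuous).aestronglyMeasurable
      (Eventually.of_forall fun x => by
        rw [norm_smul]; exact mul_le_mul_of_nonneg_left (hV x) (norm_nonneg _)))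
    (by rw [hdivX]; simp only [hfd]; exact i1.add i2)
  rw [hdivX] at h
  simp only [hfd] at h
  rw [integral_add i1 i2] at h
  refine ⟨i1, ?_⟩
  have h3 : ∫ x, |u x| ^ p * fderiv ℝ w x (v x) ≤ δ * V * ∫ x, w x * |u x| ^ p := by
    rw [← integral_const_mul]
    refine integral_mono i2 (i0.const_mul _) fun x => ?_
    exact (mul_le_mul_of_nonneg_left ((le_abs_self _).trans (hwD x)) (by positivity)).trans_eq
      (by ring)
  linarith

/-- Hölder's inequality for the forcing term. -/
lemma IsSlowWeight.forcing_le (hw : IsSlowWeight w δ) (hp : 1 < p) (hu : Continuous u)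
    (hB : ∀ x, |u x| ≤ B) {F : Rd d → ℝ} {K : ℝ} (hF : Measurable F) (hK : ∀ x, |F x| ≤ K) :
    ∫ x, w x * (powDeriv p (u x) * F x) ≤
      p * ((∫ x, w x * |u x| ^ p) ^ (1 - 1 / p) * (∫ x, w x * |F x| ^ p) ^ (1 / p)) := by
  have hp0 : 0 < p := by linarith
  have hp1 : 0 < p - 1 := by linarith
  have hB0 : 0 ≤ B := (abs_nonneg _).trans (hB 0)
  have hpq : (p / (p - 1)).HolderConjugate p := (Real.HolderConjugate.conjExponent hp).symm
  have hwc := hw.contDiff.continuous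
  -- The weight is split as w^(1-1/p) w^(1/p), so that both Hölder factors become weighted p-th
  -- moments.
  let f : Rd d → ℝ := fun x => w x ^ (1 - 1 / p) * |u x| ^ (p - 1)
  let g : Rd d → ℝ := fun x => w x ^ (1 / p) * |F x|
  have hf0 : ∀ x, 0 ≤ f x := fun x => mul_nonneg (Real.rpow_nonneg (hw.pos x).le _) (by positivity)
  have hg0 : ∀ x, 0 ≤ g x := fun x => mul_nonneg (Real.rpow_nonneg (hw.pos x).le _) (abs_nonneg _)
  have hfp : ∀ x, f x ^ (p / (p - 1)) = w x * |u x| ^ p := fun x => by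
    have h1 : (1 - 1 / p) * (p / (p - 1)) = 1 := by field_simp
    have h2 : (p - 1) * (p / (p - 1)) = p := by field_simp
    simp only [f]
    rw [Real.mul_rpow (Real.rpow_nonneg (hw.pos x).le _) (by positivity),
      ← Real.rpow_mul (hw.pos x).le, ← Real.rpow_mul (abs_nonneg _), h1, h2, Real.rpow_one]
  have hgp : ∀ x, g x ^ p = w x * |F x| ^ p := fun x => by
    simp only [g]
    rw [Real.mul_rpow (Real.rpow_nonneg (hw.pos x).le _) (by positivity),
      ← Real.rpow_mul (hw.pos x).le, one_div, inv_mul_cancel₀ hp0.ne', Real.rpow_one]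
  have hfm : AEStronglyMeasurable f :=
    ((hwc.rpow_const fun x => Or.inl (hw.pos x).ne').mul
      (hu.abs.rpow_const fun x => Or.inr hp1.le)).aestronglyMeasurable
  have hgm : AEStronglyMeasurable g :=
    ((hwc.rpow_const fun x => Or.inl (hw.pos x).ne').measurable.mul
      hF.abs).aestronglyMeasurable
  have hiF : Integrable fun x => w x * |F x| ^ p :=
    integrable_mul_of_bounded (M := K ^ p) hw.integrable (hF.abs.pow_const p) fun x => by
      rw [abs_of_nonneg (by positivity)]
      exact Real.rpow_le_rpow (abs_nonneg _) (hK x) hp0.le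
  have hmf : MemLp f (ENNReal.ofReal (p / (p - 1))) := by
    refine (integrable_norm_rpow_iff hfm (by simp; positivity) (by simp)).1 ?_
    rw [ENNReal.toReal_ofReal (by positivity)]
    refine (hw.integrable_mul_abs_rpow hp hu hB).congr (Eventually.of_forall fun x => ?_)
    simp only
    rw [Real.norm_of_nonneg (hf0 x), hfp]
  have hmg : MemLp g (ENNReal.ofReal p) := by
    refine (integrable_norm_rpow_iff hgm (by simp; positivity) (by simp)).1 ?_
    rw [ENNReal.toReal_ofReal (by positivity)]
    refine hiF.congr (Eventually.of_forall fun x => ?_)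
    simp only
    rw [Real.norm_of_nonneg (hg0 x), hgp]
  have h := integral_mul_le_Lp_mul_Lq_of_nonneg hpq (Eventually.of_forall hf0)
    (Eventually.of_forall hg0) hmf hmg
  simp only [hfp, hgp] at h
  rw [show 1 / (p / (p - 1)) = 1 - 1 / p by field_simp] at h
  refine le_trans ?_ (mul_le_mul_of_nonneg_left h hp0.le)
  rw [← integral_const_mul]
  have hfg : ∀ x, p * (f x * g x) = w x * (p * |u x| ^ (p - 1) * |F x|) := fun x => by
    have : w x ^ (1 - 1 / p) * w x ^ (1 / p) = w x := by
      rw [← Real.rpow_add (hw.pos x), sub_add_cancel, Real.rpow_one]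
    calc p * (f x * g x) = (w x ^ (1 - 1 / p) * w x ^ (1 / p)) * (p * |u x| ^ (p - 1) * |F x|) := by
          simp only [f, g]; ring
      _ = _ := by rw [this]
  have hle : ∀ x, |powDeriv p (u x) * F x| ≤ p * |u x| ^ (p - 1) * |F x| := fun x => by
    rw [abs_mul, abs_powDeriv hp]
  have hM : ∀ x, p * |u x| ^ (p - 1) * |F x| ≤ p * B ^ (p - 1) * K := fun x =>
    mul_le_mul (by rw [← abs_powDeriv hp]; exact abs_powDeriv_le hp (hB x)) (hK x) (abs_nonneg _)
      (by positivity)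
  refine integral_mono ?_ ?_ fun x => ?_
  · exact integrable_mul_of_bounded hw.integrable
      (((continuous_powDeriv hp).comp hu).measurable.mul hF) fun x => (hle x).trans (hM x)
  · simp only [hfg]
    refine integrable_mul_of_bounded (M := p * B ^ (p - 1) * K) hw.integrable
      (((hu.abs.rpow_const fun x => Or.inr hp1.le).measurable.const_mul p).mul hF.abs) fun x => ?_
    rw [abs_of_nonneg (by positivity)]
    exact hM x
  · simp only [hfg]
    exact mul_le_mul_of_nonneg_left ((le_abs_self _).trans (hle x)) (hw.pos x).le

/-- The energy inequality for a function annihilated by a part `η` of the Lévy density. -/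
lemma IsSlowWeight.energy_le [NeZero d] (hw : IsSlowWeight w δ) (hp : 1 < p)
    (hu : ContDiff ℝ 1 u) (hB : ∀ x, |u x| ≤ B) (hB' : ∀ x, ‖fderiv ℝ u x‖ ≤ B)
    (hD : ∀ x z, |secondDiff u x z| ≤ D * min 1 (‖z‖ ^ 2))
    {v : Rd d → Rd d} {V : ℝ} (hv : ContDiff ℝ 1 v) (hV : ∀ x, ‖v x‖ ≤ V)
    (hdiv : ∀ x, divergence v x = 0)
    {η : Rd d → ℝ} (hη : Continuous η) (hη0 : ∀ z, 0 ≤ η z) (hηe : ∀ z, η (-z) = η z)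
    (hηi : Integrable η) (hηl : ∀ z, z ≠ 0 → η z ≤ levyDensity z)
    (hηu : ∀ x, kernelConv η u x = 0)
    {u' F : Rd d → ℝ} (hu' : Measurable u') (hu'B : ∀ x, |u' x| ≤ B)
    (heq : ∀ x, u' x + fderiv ℝ u x (v x) + levyOp u x = F x) :
    ∫ x, w x * (powDeriv p (u x) * u' x) ≤
      -(p * (∫ z, η z) - δ * (V + 1)) * (∫ x, w x * |u x| ^ p) +
        p * ((∫ x, w x * |u x| ^ p) ^ (1 - 1 / p) * (∫ x, w x * |F x| ^ p) ^ (1 / p)) := by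
  have huc := hu.continuous
  have hB0 : 0 ≤ B := (abs_nonneg _).trans (hB 0)
  -- At the origin the Lévy density takes the conventional value 0, so η ≤ ν holds only off this
  -- null set.
  have hne : ∀ᵐ z : Rd d, z ≠ 0 := by
    rw [ae_iff]; simp
  have hsec : ∀ x, Integrable fun z => secondDiff u x z * levyDensity z := fun x =>
    integrable_mul_levyDensity_of_le ((continuous_secondDiff huc).comp
      (Continuous.prodMk_right x)).aestronglyMeasurable (hD x)
  have hiη : ∀ x, Integrable fun z => η z * secondDiff u x z := fun x =>
    integrable_mul_of_bounded hηi ((continuous_secondDiff huc).comp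
      (Continuous.prodMk_right x)).measurable (abs_secondDiff_le_two_mul hB x)
  -- Both shifted terms vanish, u(x-z) by the annihilation hypothesis and u(x+z) by evenness of η.
  -- What remains is the damping term (∫η)u.
  have hηs : ∀ x, ∫ z, η z * secondDiff u x z = (∫ z, η z) * u x := by
    intro x
    have hm : ∫ z, η z * u (x - z) = 0 := by rw [← kernelConv_eq]; exact hηu x
    have hpl : ∫ z, η z * u (x + z) = 0 := by
      rw [← integral_neg_eq_self, ← hm]
      simp only [hηe, ← sub_eq_add_neg]
    have i1 : Integrable fun z => η z * u (x + z) :=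
      integrable_mul_of_bounded hηi (huc.comp (by fun_prop)).measurable fun z => hB _
    have i2 : Integrable fun z => η z * u (x - z) :=
      integrable_mul_of_bounded hηi (huc.comp (by fun_prop)).measurable fun z => hB _
    have i3 : Integrable fun z => η z * u x := hηi.mul_const _
    have e : (fun z => η z * secondDiff u x z) =
        fun z => η z * u x - (η z * u (x + z) + η z * u (x - z)) / 2 := by
      funext z; unfold secondDiff; ring
    have i4 : Integrable fun z => (η z * u (x + z) + η z * u (x - z)) / 2 := (i1.add i2).div_const 2
    rw [e, integral_sub i3 i4, integral_div, integral_add i1 i2, hm, hpl, integral_mul_const]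
    simp
  -- The remaining density is nonnegative and below the Lévy density, which is all that
  -- `IsSlowWeight.diffusion_ge` asks for.
  let μ : Rd d → ℝ := fun z => levyDensity z - η z
  have hlevy : ∀ x, levyOp u x = (∫ z, η z) * u x + ∫ z, secondDiff u x z * μ z := by
    intro x
    have e : (fun z => secondDiff u x z * μ z) =
        fun z => secondDiff u x z * levyDensity z - η z * secondDiff u x z := by
      funext z; simp only [μ]; ring
    rw [e, integral_sub (hsec x) (hiη x), hηs]
    unfold levyOp; ring
  have hμm : Measurable μ := measurable_levyDensity.sub hη.measurable
  obtain ⟨iD, hdiff⟩ := hw.diffusion_ge hp huc hB hD (μ := μ) hμm.aestronglyMeasurable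
    (hne.mono fun z hz => by simpa [μ] using hηl z hz)
    (Eventually.of_forall fun z => by simpa [μ] using hη0 z)
  obtain ⟨iT, htr⟩ := hw.transport_ge hp hu hB hB' hv hV hdiv
  have iE := hw.integrable_mul_abs_rpow hp huc hB
  have hβ : Continuous fun x => powDeriv p (u x) := (continuous_powDeriv hp).comp huc
  have iu : Integrable fun x => w x * (powDeriv p (u x) * u' x) :=
    integrable_mul_of_bounded (M := p * B ^ (p - 1) * B) hw.integrable (hβ.measurable.mul hu')
      fun x => by
        rw [abs_mul]
        exact mul_le_mul (abs_powDeriv_le hp (hB x)) (hu'B x) (abs_nonneg _) (by positivity)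
  have hDm : Measurable fun x => ∫ z, secondDiff u x z * μ z :=
    (StronglyMeasurable.integral_prod_right' (f := fun q : Rd d × Rd d => secondDiff u q.1 q.2 * μ q.2)
      (((continuous_secondDiff huc).measurable.mul
        (hμm.comp measurable_snd)).stronglyMeasurable)).measurable
  have hLm : Measurable (levyOp u) := by
    rw [show levyOp u = fun x => (∫ z, η z) * u x + ∫ z, secondDiff u x z * μ z from funext hlevy]
    exact (huc.measurable.const_mul _).add hDm
  have hDu : Continuous fun x => fderiv ℝ u x (v x) :=
    (hu.continuous_fderiv (by simp)).clm_apply hv.continuous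
  have hFm : Measurable F := by
    rw [show F = fun x => u' x + fderiv ℝ u x (v x) + levyOp u x from (funext heq).symm]
    exact (hu'.add hDu.measurable).add hLm
  have hFK : ∀ x, |F x| ≤ B + B * V + D * ∫ z : Rd d, min 1 (‖z‖ ^ 2) * levyDensity z := fun x => by
    rw [← heq]
    have h1 : |levyOp u x| ≤ D * ∫ z : Rd d, min 1 (‖z‖ ^ 2) * levyDensity z := by
      unfold levyOp
      rw [← integral_const_mul, ← Real.norm_eq_abs]
      refine norm_integral_le_of_norm_le
        ((integrable_mul_levyDensity (integrable_min_levy (d := d))).const_mul D)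
        (Eventually.of_forall fun z => ?_)
      rw [norm_mul, Real.norm_of_nonneg (levyDensity_nonneg z), ← mul_assoc]
      exact mul_le_mul_of_nonneg_right (hD x z) (levyDensity_nonneg z)
    have h2 : |fderiv ℝ u x (v x)| ≤ B * V := ((fderiv ℝ u x).le_opNorm (v x)).trans
      (mul_le_mul (hB' x) (hV x) (norm_nonneg _) hB0)
    exact (abs_add_three _ _ _).trans (add_le_add (add_le_add (hu'B x) h2) h1)
  have hforce := hw.forcing_le hp huc hB hFm hFK
  have hsplit : ∫ x, w x * (powDeriv p (u x) * F x) =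
      (∫ x, w x * (powDeriv p (u x) * u' x)) +
        (∫ x, w x * (powDeriv p (u x) * fderiv ℝ u x (v x))) +
        (p * (∫ z, η z) * ∫ x, w x * |u x| ^ p) +
        ∫ x, w x * (powDeriv p (u x) * ∫ z, secondDiff u x z * μ z) := by
    rw [← integral_const_mul, ← integral_add iu iT,
      ← integral_add (f := fun x => _ + _) (iu.add iT) (iE.const_mul _),
      ← integral_add (f := fun x => _ + _) ((iu.add iT).add (iE.const_mul _)) iD]
    congr 1; funext x
    have h := powDeriv_mul_self hp (u x)
    rw [← heq, hlevy]
    linear_combination (w x * ∫ z, η z) * h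
  linarith

end Energy

/-! ### Convolution of a time-dependent function with a fixed kernel -/

section KernelTime
variable {d : ℕ} {C M : ℝ} {k f : Rd d → ℝ}

namespace IsDecayingKernel

lemma fderiv_kernelConv (hk : IsDecayingKernel k C) (hf : Continuous f) (hM : ∀ y, |f y| ≤ M)
    (x : Rd d) : fderiv ℝ (kernelConv k f) x = ∫ z, f (x - z) • fderiv ℝ k z := by
  rw [(hasFDerivAt_kernelConv (hk.contDiff.of_le (by norm_num)) hk.integrable hk.bound_fderiv
    hf.measurable hM x).fderiv,
    ← integral_sub_left_eq_self (fun z => f (x - z) • fderiv ℝ k z) volume x]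
  simp

lemma norm_smul_fderiv_le (hk : IsDecayingKernel k C) (hM : ∀ y, |f y| ≤ M) (x z : Rd d) :
    ‖f (x - z) • fderiv ℝ k z‖ ≤ M * (C * polyDecay (d + 1) z) := by
  rw [norm_smul]
  exact mul_le_mul (hM _) (hk.bound_fderiv z) (norm_nonneg _) ((abs_nonneg _).trans (hM 0))

lemma norm_fderiv_kernelConv_le (hk : IsDecayingKernel k C) (hf : Continuous f)
    (hM : ∀ y, |f y| ≤ M) (x : Rd d) :
    ‖fderiv ℝ (kernelConv k f) x‖ ≤ ∫ z : Rd d, M * (C * polyDecay (d + 1) z) := by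
  rw [hk.fderiv_kernelConv hf hM]
  exact norm_integral_le_of_norm_le
    (((integrable_polyDecay (Nat.lt_succ_self d)).const_mul C).const_mul M)
    (Eventually.of_forall fun z => hk.norm_smul_fderiv_le hM x z)

lemma contDiff_kernelConv (hk : IsDecayingKernel k C) (hf : Continuous f) (hM : ∀ y, |f y| ≤ M) :
    ContDiff ℝ 1 (kernelConv k f) := by
  refine contDiff_one_iff_fderiv.2 ⟨fun x => (hasFDerivAt_kernelConv
    (hk.contDiff.of_le (by norm_num)) hk.integrable hk.bound_fderiv
    hf.measurable hM x).differentiableAt, ?_⟩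
  rw [show fderiv ℝ (kernelConv k f) = fun x => ∫ z, f (x - z) • fderiv ℝ k z from
    funext (hk.fderiv_kernelConv hf hM)]
  have hc : Continuous (fderiv ℝ k) := hk.contDiff.continuous_fderiv (by simp)
  refine continuous_of_dominated (bound := fun z => M * (C * polyDecay (d + 1) z))
    (fun x => Continuous.aestronglyMeasurable (by fun_prop))
    (fun x => Eventually.of_forall fun z => hk.norm_smul_fderiv_le hM x z)
    (((integrable_polyDecay (Nat.lt_succ_self d)).const_mul C).const_mul M)
    (Eventually.of_forall fun z => by fun_prop)

end IsDecayingKernel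

lemma hasDerivAt_kernelConv_right {S : Set ℝ} {s₀ : ℝ} (hS : S ∈ 𝓝 s₀) (hkc : Continuous k)
    (hk : Integrable k) {f f' : ℝ → Rd d → ℝ} (hf : ∀ s ∈ S, Continuous (f s))
    (hf' : ∀ s ∈ S, Continuous (f' s)) (hM : ∀ s ∈ S, ∀ y, |f s y| ≤ M)
    (hM' : ∀ s ∈ S, ∀ y, |f' s y| ≤ M) (hder : ∀ s ∈ S, ∀ y, HasDerivAt (fun r => f r y) (f' s y) s)
    (x : Rd d) : HasDerivAt (fun s => kernelConv k (f s) x) (kernelConv k (f' s₀) x) s₀ := by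
  have hs₀ := mem_of_mem_nhds hS
  unfold kernelConv
  refine (hasDerivAt_integral_of_dominated_loc_of_deriv_le (F := fun s y => k (x - y) * f s y)
    (F' := fun s y => k (x - y) * f' s y) (bound := fun y => |k (x - y)| * M) hS ?_
    (integrable_kernelConv hk (hf _ hs₀).measurable (hM _ hs₀) x) ?_ ?_
    ((hk.comp_sub_left x).abs.mul_const M) ?_).2
  · filter_upwards [hS] with s hs
    have := hf s hs
    exact Continuous.aestronglyMeasurable (by fun_prop)
  · have := hf' _ hs₀
    exact Continuous.aestronglyMeasurable (by fun_prop)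
  · refine Eventually.of_forall fun y s hs => ?_
    rw [norm_mul]
    exact mul_le_mul_of_nonneg_left (hM' s hs y) (abs_nonneg _)
  · exact Eventually.of_forall fun y s hs => (hder s hs y).const_mul _

lemma continuousOn_kernelConv_right {S : Set ℝ} (hkc : Continuous k) (hk : Integrable k)
    {f : ℝ → Rd d → ℝ} (hf : ∀ s ∈ S, Continuous (f s)) (hM : ∀ s ∈ S, ∀ y, |f s y| ≤ M)
    (hc : ∀ y, ContinuousOn (fun s => f s y) S) (x : Rd d) :
    ContinuousOn (fun s => kernelConv k (f s) x) S := by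
  unfold kernelConv
  refine continuousOn_of_dominated (bound := fun y => |k (x - y)| * M) (fun s hs => ?_)
    (fun s hs => Eventually.of_forall fun y => ?_) ((hk.comp_sub_left x).abs.mul_const M)
    (Eventually.of_forall fun y => continuousOn_const.mul (hc y))
  · have := hf s hs
    exact Continuous.aestronglyMeasurable (by fun_prop)
  · rw [norm_mul]
    exact mul_le_mul_of_nonneg_left (hM s hs y) (abs_nonneg _)

end KernelTime

/-! ### Decay of the space-time norm -/

section SpaceTime
variable {d : ℕ}

lemma tendsto_baseWeight_smul (x : Rd d) :
    Tendsto (fun n : ℕ => baseWeight ((1 / ((n : ℝ) + 1)) • x)) atTop (𝓝 1) := by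
  have h : Tendsto (fun n : ℕ => baseWeight ((1 / ((n : ℝ) + 1)) • x)) atTop
      (𝓝 (baseWeight ((0 : ℝ) • x))) :=
    ((contDiff_japanese (n := 0) _).continuous.tendsto _).comp
      ((tendsto_one_div_add_atTop_nhds_zero_nat (𝕜 := ℝ)).smul_const x)
  simpa [baseWeight, japanese] using h

lemma monotone_baseWeight_smul (x : Rd d) :
    Monotone fun n : ℕ => baseWeight ((1 / ((n : ℝ) + 1)) • x) := by
  intro m n hmn
  refine Real.rpow_le_rpow_of_nonpos (by positivity) ?_ (by rw [neg_nonpos]; positivity)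
  rw [norm_smul, norm_smul]
  have : ‖1 / ((n : ℝ) + 1)‖ ≤ ‖1 / ((m : ℝ) + 1)‖ := by
    rw [Real.norm_of_nonneg (by positivity), Real.norm_of_nonneg (by positivity)]
    exact one_div_le_one_div_of_le (by positivity) (by gcongr)
  gcongr

lemma ofReal_abs_rpow {p : ℝ} (hp : 0 ≤ p) (a : ℝ) : ENNReal.ofReal (|a| ^ p) = ‖a‖ₑ ^ p := by
  rw [← ENNReal.ofReal_rpow_of_nonneg (abs_nonneg a) hp, ← Real.norm_eq_abs, ofReal_norm]

lemma ofReal_weighted_rpow_le {p : ℝ} (hp : 0 < p) {w g : Rd d → ℝ} (hw0 : ∀ x, 0 ≤ w x)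
    (hw : ∀ x, w x ≤ 1) :
    ENNReal.ofReal ((∫ x, w x * |g x| ^ p) ^ (1 / p)) ≤ (∫⁻ x, ‖g x‖ₑ ^ p) ^ (1 / p) := by
  have h0 : 0 ≤ ∫ x, w x * |g x| ^ p :=
    integral_nonneg fun x => mul_nonneg (hw0 x) (by positivity)
  rw [← ENNReal.ofReal_rpow_of_nonneg h0 (by positivity)]
  refine ENNReal.rpow_le_rpow (ofReal_integral_le_lintegral.trans (lintegral_mono fun x => ?_))
    (by positivity)
  rw [← ofReal_abs_rpow hp.le]
  exact ENNReal.ofReal_le_ofReal (mul_le_of_le_one_left (by positivity) (hw x))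

/-- The dilated weights increase to 1, so monotone convergence recovers the unweighted norm,
possibly infinite. -/
lemma tendsto_weighted_rpow {p B : ℝ} (hp : 1 < p) [NeZero d] {g : Rd d → ℝ} (hg : Continuous g)
    (hB : ∀ x, |g x| ≤ B) :
    Monotone (fun n : ℕ => ENNReal.ofReal
      ((∫ x, baseWeight ((1 / ((n : ℝ) + 1)) • x) * |g x| ^ p) ^ (1 / p))) ∧
    Tendsto (fun n : ℕ => ENNReal.ofReal
      ((∫ x, baseWeight ((1 / ((n : ℝ) + 1)) • x) * |g x| ^ p) ^ (1 / p))) atTop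
      (𝓝 ((∫⁻ x, ‖g x‖ₑ ^ p) ^ (1 / p))) := by
  have hp0 : 0 < p := by linarith
  obtain ⟨δ, -, hw⟩ := exists_isSlowWeight_baseWeight (d := d)
  have hr : ∀ n : ℕ, (0 : ℝ) < 1 / ((n : ℝ) + 1) := fun n => by positivity
  have hr1 : ∀ n : ℕ, 1 / ((n : ℝ) + 1) ≤ 1 := fun n => by
    rw [div_le_one (by positivity)]; linarith [n.cast_nonneg (α := ℝ)]
  have e : ∀ n : ℕ, ENNReal.ofReal
      ((∫ x, baseWeight ((1 / ((n : ℝ) + 1)) • x) * |g x| ^ p) ^ (1 / p)) =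
      (∫⁻ x, ENNReal.ofReal (baseWeight ((1 / ((n : ℝ) + 1)) • x)) * ‖g x‖ₑ ^ p) ^ (1 / p) := by
    intro n
    have hwn := hw.scale (hr n) (hr1 n)
    have hnn : ∀ x, 0 ≤ baseWeight ((1 / ((n : ℝ) + 1)) • x) * |g x| ^ p := fun x =>
      mul_nonneg (baseWeight_pos _).le (by positivity)
    rw [← ENNReal.ofReal_rpow_of_nonneg (integral_nonneg hnn) (by positivity),
      ofReal_integral_eq_lintegral_ofReal (hwn.integrable_mul_abs_rpow hp hg hB)
        (Eventually.of_forall hnn)]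
    congr 1
    refine lintegral_congr fun x => ?_
    rw [ENNReal.ofReal_mul (baseWeight_pos _).le, ofReal_abs_rpow hp0.le]
  simp only [e]
  have hmono : ∀ x, Monotone fun n : ℕ =>
      ENNReal.ofReal (baseWeight ((1 / ((n : ℝ) + 1)) • x)) * ‖g x‖ₑ ^ p := fun x m n hmn =>
    mul_le_mul_left (ENNReal.ofReal_le_ofReal (monotone_baseWeight_smul x hmn)) _
  refine ⟨fun m n hmn => ENNReal.rpow_le_rpow (lintegral_mono fun x => hmono x hmn)
    (by positivity), ?_⟩
  refine ((ENNReal.continuous_rpow_const (y := 1 / p)).tendsto _).comp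
    (lintegral_tendsto_of_tendsto_of_monotone (fun n => ?_) (Eventually.of_forall hmono)
      (Eventually.of_forall fun x => ?_))
  · have := (hw.scale (hr n) (hr1 n)).contDiff.continuous
    exact (this.measurable.ennreal_ofReal.mul (hg.measurable.enorm.pow_const p)).aemeasurable
  · have h := ENNReal.Tendsto.mul_const (b := ‖g x‖ₑ ^ p)
      (ENNReal.tendsto_ofReal (tendsto_baseWeight_smul x))
      (Or.inr (ENNReal.rpow_ne_top_of_nonneg hp0.le enorm_ne_top))
    simpa using h

/-- A bounded solution of a forced transport-diffusion equation which is annihilated by a part `η`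
of the Lévy density decays at rate `∫ η`. -/
theorem lintegral_rpow_le_of_transport_levyOp [NeZero d] {T p V B : ℝ} (hT : 0 < T) (hp : 1 < p)
    {u u' F : ℝ → Rd d → ℝ} {v : ℝ → Rd d → Rd d} {η : Rd d → ℝ}
    (hu : ∀ t ∈ Icc 0 T, ContDiff ℝ 1 (u t)) (hB : ∀ t ∈ Icc 0 T, ∀ x, |u t x| ≤ B)
    (hB' : ∀ t ∈ Icc 0 T, ∀ x, ‖fderiv ℝ (u t) x‖ ≤ B)
    (hD : ∀ t ∈ Icc 0 T, ∃ D, ∀ x z, |secondDiff (u t) x z| ≤ D * min 1 (‖z‖ ^ 2))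
    (hu' : ∀ t ∈ Icc 0 T, Measurable (u' t)) (hu'B : ∀ t ∈ Icc 0 T, ∀ x, |u' t x| ≤ B)
    (hc : ∀ x, ContinuousOn (fun t => u t x) (Icc 0 T))
    (hder : ∀ t ∈ Ioo 0 T, ∀ x, HasDerivAt (fun s => u s x) (u' t x) t)
    (hv : ∀ t ∈ Icc 0 T, ContDiff ℝ 1 (v t)) (hV : ∀ t ∈ Icc 0 T, ∀ x, ‖v t x‖ ≤ V)
    (hdiv : ∀ t ∈ Icc 0 T, ∀ x, divergence (v t) x = 0)
    (hη : Continuous η) (hη0 : ∀ z, 0 ≤ η z) (hηe : ∀ z, η (-z) = η z) (hηi : Integrable η)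
    (hηp : 0 < ∫ z, η z) (hηl : ∀ z, z ≠ 0 → η z ≤ levyDensity z)
    (hηu : ∀ t ∈ Icc 0 T, ∀ x, kernelConv η (u t) x = 0)
    (heq : ∀ t ∈ Icc 0 T, ∀ x, u' t x + fderiv ℝ (u t) x (v t x) + levyOp (u t) x = F t x) :
    ENNReal.ofReal (∫ z, η z) * ∫⁻ t in Icc 0 T, (∫⁻ x, ‖u t x‖ₑ ^ p) ^ (1 / p) ≤
      (∫⁻ x, ‖u 0 x‖ₑ ^ p) ^ (1 / p) + ∫⁻ t in Icc 0 T, (∫⁻ x, ‖F t x‖ₑ ^ p) ^ (1 / p) := by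
  have hp0 : 0 < p := by linarith
  have h0T : (0 : ℝ) ∈ Icc 0 T := ⟨le_rfl, hT.le⟩
  have hB0 : 0 ≤ B := (abs_nonneg _).trans (hB 0 h0T 0)
  obtain ⟨δ, -, hw⟩ := exists_isSlowWeight_baseWeight (d := d)
  let r : ℕ → ℝ := fun n => 1 / ((n : ℝ) + 1)
  have hr : ∀ n, 0 < r n := fun n => by simp only [r]; positivity
  have hr1 : ∀ n, r n ≤ 1 := fun n => by
    simp only [r]; rw [div_le_one (by positivity)]; linarith [n.cast_nonneg (α := ℝ)]
  have hwn : ∀ n, IsSlowWeight (fun x : Rd d => baseWeight (r n • x)) (r n * δ) :=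
    fun n => hw.scale (hr n) (hr1 n)
  let E : ℕ → ℝ → ℝ := fun n t => ∫ x, baseWeight (r n • x) * |u t x| ^ p
  have hcp : Continuous fun a : ℝ => |a| ^ p := (contDiff_abs_rpow hp).continuous
  have hcont : ∀ n, ContinuousOn (E n) (Icc 0 T) := by
    intro n
    refine continuousOn_of_dominated (bound := fun x => baseWeight (r n • x) * B ^ p)
      (fun t ht => ((hwn n).contDiff.continuous.mul
        (hcp.comp (hu t ht).continuous)).aestronglyMeasurable)
      (fun t ht => Eventually.of_forall fun x => ?_) ((hwn n).integrable.mul_const _)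
      (Eventually.of_forall fun x => continuousOn_const.mul (hcp.comp_continuousOn (hc x)))
    rw [norm_mul, Real.norm_of_nonneg (baseWeight_pos _).le, Real.norm_of_nonneg (by positivity)]
    exact mul_le_mul_of_nonneg_left (Real.rpow_le_rpow (abs_nonneg _) (hB t ht x) hp0.le)
      (baseWeight_pos _).le
  have hβB : ∀ t ∈ Icc 0 T, ∀ x, |powDeriv p (u t x) * u' t x| ≤ p * B ^ (p - 1) * B := by
    intro t ht x
    rw [abs_mul]
    exact mul_le_mul (abs_powDeriv_le hp (hB t ht x)) (hu'B t ht x) (abs_nonneg _) (by positivity)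
  have hderE : ∀ n, ∀ t ∈ Ioo 0 T, HasDerivAt (E n)
      (∫ x, baseWeight (r n • x) * (powDeriv p (u t x) * u' t x)) t := by
    intro n t ht
    have htI := Ioo_subset_Icc_self ht
    refine (hasDerivAt_integral_of_dominated_loc_of_deriv_le
      (F := fun t x => baseWeight (r n • x) * |u t x| ^ p)
      (F' := fun t x => baseWeight (r n • x) * (powDeriv p (u t x) * u' t x))
      (bound := fun x => baseWeight (r n • x) * (p * B ^ (p - 1) * B)) (Ioo_mem_nhds ht.1 ht.2)
      ?_ ((hwn n).integrable_mul_abs_rpow hp (hu t htI).continuous (hB t htI)) ?_ ?_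
      ((hwn n).integrable.mul_const _) ?_).2
    · filter_upwards [Ioo_mem_nhds ht.1 ht.2] with s hs
      exact ((hwn n).integrable_mul_abs_rpow hp (hu s (Ioo_subset_Icc_self hs)).continuous
        (hB s (Ioo_subset_Icc_self hs))).aestronglyMeasurable
    · exact ((hwn n).contDiff.continuous.measurable.mul (((continuous_powDeriv hp).comp
        (hu t htI).continuous).measurable.mul (hu' t htI))).aestronglyMeasurable
    · refine Eventually.of_forall fun x s hs => ?_
      rw [norm_mul, Real.norm_of_nonneg (baseWeight_pos _).le]
      exact mul_le_mul_of_nonneg_left (hβB s (Ioo_subset_Icc_self hs) x) (baseWeight_pos _).le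
    · exact Eventually.of_forall fun x s hs =>
        ((hasDerivAt_powDeriv hp _).comp s (hder s hs x)).const_mul _
  have hstep : ∀ n, ENNReal.ofReal ((∫ z, η z) - r n * δ * (V + 1) / p) *
      ∫⁻ t in Icc 0 T, ENNReal.ofReal (E n t ^ (1 / p)) ≤
      (∫⁻ x, ‖u 0 x‖ₑ ^ p) ^ (1 / p) + ∫⁻ t in Icc 0 T, (∫⁻ x, ‖F t x‖ₑ ^ p) ^ (1 / p) := by
    intro n
    -- While the weight is not yet flat enough its error may exceed the damping; the bound is then
    -- trivial.
    rcases le_total ((∫ z, η z) - r n * δ * (V + 1) / p) 0 with hneg | hpos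
    · rw [ENNReal.ofReal_of_nonpos hneg, zero_mul]; exact zero_le
    have hE0 : ∀ t, 0 ≤ E n t := fun t =>
      integral_nonneg fun x => mul_nonneg (baseWeight_pos _).le (by positivity)
    refine (lintegral_rpow_le_of_deriv_le (p := p)
      (B := ∫ x : Rd d, baseWeight (r n • x) * (p * B ^ (p - 1) * B))
      (Φ := fun t => (∫ x, baseWeight (r n • x) * |F t x| ^ p) ^ (1 / p)) hT hp hpos (hcont n)
      (fun t _ => hE0 t) (hderE n) (fun t ht => ?_) (fun t ht => ?_) (fun t ht => ?_)).trans ?_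
    · rw [← Real.norm_eq_abs]
      refine norm_integral_le_of_norm_le ((hwn n).integrable.mul_const _)
        (Eventually.of_forall fun x => ?_)
      rw [norm_mul, Real.norm_of_nonneg (baseWeight_pos _).le]
      exact mul_le_mul_of_nonneg_left (hβB t (Ioo_subset_Icc_self ht) x) (baseWeight_pos _).le
    · exact Real.rpow_nonneg (integral_nonneg fun x =>
        mul_nonneg (baseWeight_pos _).le (by positivity)) _
    · have ht' := Ioo_subset_Icc_self ht
      obtain ⟨D, hDt⟩ := hD t ht'
      refine ((hwn n).energy_le hp (hu t ht') (hB t ht') (hB' t ht') hDt (hv t ht') (hV t ht')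
        (hdiv t ht') hη hη0 hηe hηi hηl (hηu t ht') (hu' t ht') (hu'B t ht') (heq t ht')).trans_eq ?_
      congr 2
      field_simp
    · exact add_le_add (ofReal_weighted_rpow_le hp0 (fun x => (baseWeight_pos _).le)
        fun x => (hwn n).le_one x) (lintegral_mono fun t => ofReal_weighted_rpow_le hp0
          (fun x => (baseWeight_pos _).le) fun x => (hwn n).le_one x)
  have hlimE : Tendsto (fun n => ∫⁻ t in Icc 0 T, ENNReal.ofReal (E n t ^ (1 / p))) atTop
      (𝓝 (∫⁻ t in Icc 0 T, (∫⁻ x, ‖u t x‖ₑ ^ p) ^ (1 / p))) := by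
    refine lintegral_tendsto_of_tendsto_of_monotone (fun n => ?_) ?_ ?_
    · exact (((hcont n).rpow_const fun t _ => Or.inr (by positivity)).aemeasurable
        measurableSet_Icc).ennreal_ofReal
    · exact (ae_restrict_mem measurableSet_Icc).mono fun t ht =>
        (tendsto_weighted_rpow hp (hu t ht).continuous (hB t ht)).1
    · exact (ae_restrict_mem measurableSet_Icc).mono fun t ht =>
        (tendsto_weighted_rpow hp (hu t ht).continuous (hB t ht)).2
  have hlimγ : Tendsto (fun n => ENNReal.ofReal ((∫ z, η z) - r n * δ * (V + 1) / p)) atTop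
      (𝓝 (ENNReal.ofReal (∫ z, η z))) := by
    refine ENNReal.tendsto_ofReal ?_
    have h := (((tendsto_one_div_add_atTop_nhds_zero_nat (𝕜 := ℝ)).mul_const δ).mul_const
      (V + 1)).div_const p
    simpa [r] using h.const_sub (∫ z, η z)
  -- The limiting rate is finite and nonzero, so the product passes to the limit even if the
  -- space-time norm is infinite.
  exact le_of_tendsto (ENNReal.Tendsto.mul hlimγ (Or.inl (by simpa using hηp)) hlimE
    (Or.inr ENNReal.ofReal_ne_top)) (Eventually.of_forall hstep)

end SpaceTime

/-! ### Smooth solutions -/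

section Solution
variable {d : ℕ} {T : ℝ} {v : ℝ → Rd d → Rd d} {θ : ℝ → Rd d → ℝ}

lemma contDiff_slice {F : Type*} [NormedAddCommGroup F] [NormedSpace ℝ F] {f : ℝ → Rd d → F}
    (h : ContDiffOn ℝ ∞ (fun z : ℝ × Rd d => f z.1 z.2) (Icc 0 T ×ˢ univ)) {t : ℝ}
    (ht : t ∈ Icc 0 T) : ContDiff ℝ ∞ (f t) :=
  h.comp_contDiff (f := fun x => (t, x)) (by fun_prop) fun x => ⟨ht, mem_univ x⟩

lemma IsSmoothSolution.hasDerivWithinAt_fderivWithin (hθ : IsSmoothSolution T v θ) {t : ℝ}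
    (ht : t ∈ Icc 0 T) (x : Rd d) :
    HasDerivWithinAt (fun s => θ s x)
      (fderivWithin ℝ (fun z : ℝ × Rd d => θ z.1 z.2) (Icc 0 T ×ˢ univ) (t, x) (1, 0))
      (Icc 0 T) t := by
  have h1 := ((hθ.smooth.differentiableOn (by simp)) (t, x) ⟨ht, mem_univ x⟩).hasFDerivWithinAt
  have h2 : HasDerivWithinAt (fun s : ℝ => (s, x)) ((1 : ℝ), (0 : Rd d)) (Icc 0 T) t :=
    (hasDerivWithinAt_id t _).prodMk (hasDerivWithinAt_const t _ x)
  exact h1.comp_hasDerivWithinAt t h2 (t := Icc 0 T ×ˢ univ)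
    fun s hs => mk_mem_prod hs (mem_univ x)

lemma IsSmoothSolution.timeDeriv_eq (hT : 0 < T) (hθ : IsSmoothSolution T v θ) {t : ℝ}
    (ht : t ∈ Icc 0 T) (x : Rd d) : timeDeriv T θ t x =
      fderivWithin ℝ (fun z : ℝ × Rd d => θ z.1 z.2) (Icc 0 T ×ˢ univ) (t, x) (1, 0) :=
  (hθ.hasDerivWithinAt_fderivWithin ht x).derivWithin (uniqueDiffOn_Icc hT t ht)

lemma IsSmoothSolution.hasDerivWithinAt (hT : 0 < T) (hθ : IsSmoothSolution T v θ) {t : ℝ}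
    (ht : t ∈ Icc 0 T) (x : Rd d) :
    HasDerivWithinAt (fun s => θ s x) (timeDeriv T θ t x) (Icc 0 T) t := by
  rw [hθ.timeDeriv_eq hT ht]
  exact hθ.hasDerivWithinAt_fderivWithin ht x

lemma IsSmoothSolution.continuous_timeDeriv (hT : 0 < T) (hθ : IsSmoothSolution T v θ) {t : ℝ}
    (ht : t ∈ Icc 0 T) : Continuous (timeDeriv T θ t) := by
  rw [show timeDeriv T θ t = _ from funext fun x => hθ.timeDeriv_eq hT ht x]
  have h := hθ.smooth.continuousOn_fderivWithin
    ((uniqueDiffOn_Icc hT).prod uniqueDiffOn_univ) (by simp)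
  exact (h.comp_continuous (f := fun x => (t, x)) (by fun_prop)
    fun x => ⟨ht, mem_univ x⟩).clm_apply continuous_const

lemma levyOp_neg (f : Rd d → ℝ) (x : Rd d) : levyOp (fun y => -f y) x = -levyOp f x := by
  unfold levyOp
  rw [← integral_neg]
  congr 1; funext z; simp only [secondDiff]; ring

lemma IsSmoothSolution.levyOp_eq [NeZero d] (hT : 0 < T) (hv : IsSmoothDivFree T v)
    (hθ : IsSmoothSolution T v θ) {t : ℝ} (ht : t ∈ Icc 0 T) (x : Rd d) :
    timeDeriv T θ t x + fderiv ℝ (θ t) x (v t x) + levyOp (θ t) x = 0 := by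
  obtain ⟨K, hK⟩ := hθ.bounded
  have hs := contDiff_slice hθ.smooth ht
  have hc : Continuous fun x => -(timeDeriv T θ t x + fderiv ℝ (θ t) x (v t x)) :=
    ((hθ.continuous_timeDeriv hT ht).add ((hs.continuous_fderiv (by simp)).clm_apply
      (contDiff_slice hv.smooth ht).continuous)).neg
  rw [← (hθ.equation t ht).eq_levyOp (hs.of_le (WithTop.coe_le_coe.2 le_top))
    (fun y => (hK t ht y).1) hc x]
  ring

/-- The maximum principle for smooth solutions. -/
lemma IsSmoothSolution.abs_le [NeZero d] (hT : 0 < T) (hv : IsSmoothDivFree T v)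
    (hθ : IsSmoothSolution T v θ) {M : ℝ} (h0 : ∀ x, |θ 0 x| ≤ M) {t : ℝ} (ht : t ∈ Icc 0 T)
    (x : Rd d) : |θ t x| ≤ M := by
  obtain ⟨K, hK⟩ := hθ.bounded
  obtain ⟨V, hV⟩ := hv.bounded
  have hsm : ∀ t ∈ Icc 0 T, ContDiff ℝ 2 (θ t) := fun t ht =>
    (contDiff_slice hθ.smooth ht).of_le (WithTop.coe_le_coe.2 le_top)
  refine abs_le'.2 ⟨?_, ?_⟩
  · exact le_of_transport_levyOp hθ.smooth.continuousOn hsm (fun t ht x => (hK t ht x).1) hV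
      (fun t ht x => hθ.hasDerivWithinAt hT ht x) (fun t ht x => hθ.levyOp_eq hT hv ht x)
      (fun x => (le_abs_self _).trans (h0 x)) ht x
  -- The equation is linear in θ, so the upper bound for -θ is the lower bound for θ.
  · refine le_of_transport_levyOp (θ := fun t x => -θ t x) (θ' := fun t x => -timeDeriv T θ t x)
      hθ.smooth.continuousOn.neg (fun t ht => (hsm t ht).neg)
      (fun t ht x => (abs_neg _).trans_le (hK t ht x).1) hV
      (fun t ht x => (hθ.hasDerivWithinAt hT ht x).neg) (fun t ht x => ?_)
      (fun x => (neg_le_abs _).trans (h0 x)) ht x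
    rw [levyOp_neg, fderiv_fun_neg, neg_apply]
    linarith [hθ.levyOp_eq hT hv ht x]

/-- The almost everywhere bound holds on a dense set, and for continuous f the set where it holds is
closed. This gives the everywhere bound that the maximum principle starts from. -/
lemma enorm_le_eLpNorm_top {f : Rd d → ℝ} (hf : Continuous f) (x : Rd d) :
    ‖f x‖ₑ ≤ eLpNorm f ⊤ volume := by
  have hd := Measure.dense_of_ae (enorm_ae_le_eLpNormEssSup f (volume : Measure (Rd d)))
  have hcl : IsClosed {x | ‖f x‖ₑ ≤ eLpNormEssSup f volume} :=
    isClosed_le hf.enorm continuous_const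
  rw [eLpNorm_exponent_top]
  have : x ∈ closure {x | ‖f x‖ₑ ≤ eLpNormEssSup f volume} := hd x
  rwa [hcl.closure_eq] at this

lemma eLpNorm_eq_lintegral_ofReal {F : Type*} [NormedAddCommGroup F] {p : ℝ≥0∞} (hp : 1 < p)
    (hp' : p ≠ ⊤) (f : Rd d → F) :
    eLpNorm f p volume = (∫⁻ x, ‖f x‖ₑ ^ p.toReal) ^ (1 / p.toReal) :=
  eLpNorm_eq_lintegral_rpow_enorm_toReal (zero_lt_one.trans hp).ne' hp'

lemma ENNReal.rpow_inv_le_mul {p : ℝ} (hp : 0 < p) {A a b : ℝ≥0∞} (h : A ≤ a ^ p * b) :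
    A ^ (1 / p) ≤ a * b ^ (1 / p) := by
  refine (ENNReal.rpow_le_rpow h (by positivity)).trans_eq ?_
  rw [ENNReal.mul_rpow_of_nonneg _ _ (by positivity), ← ENNReal.rpow_mul,
    mul_one_div_cancel hp.ne', ENNReal.rpow_one]

/-- The gain of one derivative for a dyadic block of a smooth solution. -/
theorem IsSmoothSolution.exists_dyadicBlock_le [NeZero d] (P : DyadicPartition d) {p : ℝ≥0∞}
    (hp : 1 < p) (hp' : p ≠ ⊤) : ∃ c : ℝ, 0 < c ∧ ∀ (T : ℝ) (v : ℝ → Rd d → Rd d)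
      (θ : ℝ → Rd d → ℝ), 0 < T → IsSmoothDivFree T v → IsSmoothSolution T v θ → ∀ q : ℕ,
      ENNReal.ofReal (c * 2 ^ q) * normL1Lp T p (fun t => dyadicBlock P q (θ t)) ≤
        (∫⁻ z, ‖blockKer P 0 z‖ₑ) * eLpNorm (θ 0) p volume +
          ∫⁻ t in Icc 0 T, eLpNorm (θ 0) ⊤ volume *
            (∫⁻ z, ‖z‖ₑ * ‖fderiv ℝ (blockKer P 0) z‖ₑ) * eLpNorm (fderiv ℝ (v t)) p volume := by
  obtain ⟨c, hc0, hη⟩ := exists_gain_kernel P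
  refine ⟨c, hc0, fun T v θ hT hv hθ q => ?_⟩
  obtain ⟨η, hηc, hη0, hηe, hηi, hηint, hηl, hηk⟩ := hη q
  obtain ⟨K, hK⟩ := hθ.bounded
  obtain ⟨V, hV⟩ := hv.bounded
  have hp1 : 1 < p.toReal := by
    rw [← ENNReal.toReal_one]; exact (ENNReal.toReal_lt_toReal (by simp) hp').2 hp
  have hpr : 0 < p.toReal := by linarith
  have h0T : (0 : ℝ) ∈ Icc 0 T := ⟨le_rfl, hT.le⟩
  have hK0 : 0 ≤ K := (abs_nonneg _).trans (hK 0 h0T 0).1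
  have hθs : ∀ t ∈ Icc 0 T, ContDiff ℝ 1 (θ t) := fun t ht =>
    (contDiff_slice hθ.smooth ht).of_le (by exact_mod_cast le_top)
  have hvs : ∀ t ∈ Icc 0 T, ContDiff ℝ 1 (v t) := fun t ht =>
    (contDiff_slice hv.smooth ht).of_le (by exact_mod_cast le_top)
  have hθb : ∀ t ∈ Icc 0 T, ∀ x, |θ t x| ≤ K := fun t ht x => (hK t ht x).1
  have hθ'b : ∀ t ∈ Icc 0 T, ∀ x, |timeDeriv T θ t x| ≤ K := fun t ht x => (hK t ht x).2.2
  have hθ'c : ∀ t ∈ Icc 0 T, Continuous (timeDeriv T θ t) := fun t ht =>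
    hθ.continuous_timeDeriv hT ht
  obtain ⟨C, hk⟩ := (blockKer P q).exists_isDecayingKernel
  have hder : ∀ t ∈ Ioo 0 T, ∀ x, HasDerivAt (fun s => θ s x) (timeDeriv T θ t x) t :=
    fun t ht x => (hθ.hasDerivWithinAt hT (Ioo_subset_Icc_self ht) x).hasDerivAt
      (Icc_mem_nhds ht.1 ht.2)
  let B₁ : ℝ := (∫ z, |blockKer P q z|) * K
  let B₂ : ℝ := ∫ z : Rd d, K * (C * polyDecay (d + 1) z)
  have hfin : eLpNorm (θ 0) ⊤ volume ≠ ⊤ := by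
    rw [eLpNorm_exponent_top]
    refine (lt_of_le_of_lt (eLpNormEssSup_le_of_ae_bound (C := K)
      (Eventually.of_forall (hθb 0 h0T))) ENNReal.ofReal_lt_top).ne
  have hmax : ∀ t ∈ Icc 0 T, ∀ x, |θ t x| ≤ (eLpNorm (θ 0) ⊤ volume).toReal := fun t ht x =>
    hθ.abs_le hT hv (fun y => by
      have h := ENNReal.toReal_mono hfin (enorm_le_eLpNorm_top (hθs 0 h0T).continuous y)
      rwa [toReal_enorm, Real.norm_eq_abs] at h) ht x
  -- The block of θ solves the equation forced by the commutator. The kernel supplies bounds on its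
  -- space derivatives and second differences from boundedness of θ alone, and time differentiation
  -- passes under the convolution.
  have key := lintegral_rpow_le_of_transport_levyOp (B := max B₁ B₂) (V := V) hT hp1
    (u := fun t => kernelConv (blockKer P q) (θ t))
    (u' := fun t => kernelConv (blockKer P q) (timeDeriv T θ t))
    (F := fun t => transportCommutator (blockKer P q) (v t) (θ t)) (v := v) (η := η)
    (fun t ht => hk.contDiff_kernelConv (hθs t ht).continuous (hθb t ht))
    (fun t ht x => (abs_kernelConv_le hk.integrable (hθb t ht) x).trans (le_max_left _ _))
    (fun t ht x => (hk.norm_fderiv_kernelConv_le (hθs t ht).continuous (hθb t ht) x).trans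
      (le_max_right _ _))
    (fun t ht => by
      obtain ⟨D, -, hD⟩ := hk.exists_abs_secondDiff_kernelConv_le
        (hθs t ht).continuous.measurable (hθb t ht)
      exact ⟨D, hD⟩)
    (fun t ht => (hk.contDiff_kernelConv (hθ'c t ht) (hθ'b t ht)).continuous.measurable)
    (fun t ht x => (abs_kernelConv_le hk.integrable (hθ'b t ht) x).trans (le_max_left _ _))
    (fun x => continuousOn_kernelConv_right hk.continuous hk.integrable
      (fun t ht => (hθs t ht).continuous) hθb
      (fun y t ht => (hθ.hasDerivWithinAt hT ht y).continuousWithinAt) x)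
    (fun t ht x => hasDerivAt_kernelConv_right (S := Ioo 0 T) (M := K) (Ioo_mem_nhds ht.1 ht.2)
      hk.continuous hk.integrable (fun s hs => (hθs s (Ioo_subset_Icc_self hs)).continuous)
      (fun s hs => hθ'c s (Ioo_subset_Icc_self hs)) (fun s hs => hθb s (Ioo_subset_Icc_self hs))
      (fun s hs => hθ'b s (Ioo_subset_Icc_self hs)) hder x)
    hvs hV hv.div_eq_zero hηc hη0 hηe hηi (by rw [hηint]; positivity) hηl
    (fun t ht x => by
      -- Annihilating the kernel of the block annihilates the block of any bounded function, by
      -- associativity.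
      rw [kernelConv_assoc hηi hk.integrable (hθs t ht).continuous.measurable (hθb t ht),
        show kernelConv η (blockKer P q) = fun _ => 0 from funext hηk]
      simp [kernelConv])
    (fun t ht x => kernelConv_equation (blockKer P q) (hθs t ht) (hθb t ht)
      (fun y => (hK t ht y).2.1) (hvs t ht) (hV t ht) (hv.div_eq_zero t ht) (hθ'c t ht)
      (hθ'b t ht) (hθ.equation t ht) x)
  rw [hηint] at key
  have hblock : ∀ t, eLpNorm (dyadicBlock P q (θ t)) p volume =
      (∫⁻ x, ‖kernelConv (blockKer P q) (θ t) x‖ₑ ^ p.toReal) ^ (1 / p.toReal) := fun t => by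
    rw [eLpNorm_eq_lintegral_ofReal hp hp']
    congr 1
    refine lintegral_congr fun x => ?_
    rw [dyadicBlock_eq, ← ofReal_norm, Complex.norm_real, ofReal_norm]
  unfold normL1Lp
  simp only [hblock]
  refine key.trans (add_le_add ?_ (setLIntegral_mono' measurableSet_Icc fun t ht => ?_))
  · rw [← lintegral_blockKer P q, eLpNorm_eq_lintegral_ofReal hp hp']
    exact ENNReal.rpow_inv_le_mul hpr (lintegral_rpow_kernelConv_le hp1.le
      hk.continuous.measurable (hθs 0 h0T).continuous.measurable)
  · rw [eLpNorm_eq_lintegral_ofReal hp hp' (fderiv ℝ (v t)), ← lintegral_norm_mul_fderiv_blockKer P q]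
    have h := lintegral_transportCommutator_rpow_le hp1.le (hk.contDiff.of_le (by norm_num))
      (hmax t ht) (hvs t ht)
    rw [ENNReal.ofReal_toReal hfin] at h
    exact ENNReal.rpow_inv_le_mul hpr h

/-- The origin is the only frequency, and φ vanishes there. -/
lemma dyadicBlock_eq_zero_of_dim_zero (P : DyadicPartition 0) (q : ℕ) (f : Rd 0 → ℝ) :
    dyadicBlock P q f = 0 := by
  funext x
  have h0 : P.φ 0 = 0 := image_eq_zero_of_notMem_tsupport P.φ_away
  have h1 : (fun ξ : Rd 0 => (dyadicDilate P.φ q ((2 * Real.pi) • ξ) : ℂ)) = fun _ => 0 := by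
    funext ξ
    simp [dyadicDilate, Subsingleton.elim ξ 0, h0]
  have h2 : blockKernel P q = 0 := by
    funext y
    simp only [blockKernel, h1]
    rw [Real.fourierInv_eq']
    simp
  simp [dyadicBlock, h2]

end Solution

/-! ### Conclusion: damping, commutator and elliptic estimates combined -/

theorem theorem4p2 (d : ℕ) (P : DyadicPartition d) (p : ℝ≥0∞) (hp : 1 < p) (hp' : p ≠ ⊤) :
    ∃ C : ℝ≥0, ∀ (T : ℝ) (v : ℝ → Rd d → Rd d) (θ : ℝ → Rd d → ℝ), 0 < T →
      IsSmoothDivFree T v → IsSmoothSolution T v θ →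
      (⨆ q : ℕ, (2 : ℝ≥0∞) ^ q * normL1Lp T p (fun t => dyadicBlock P q (θ t))) ≤
        C * eLpNorm (θ 0) p volume +
          C * eLpNorm (θ 0) ⊤ volume * normL1Lp T p (fun t => vorticity (v t)) := by
  rcases Nat.eq_zero_or_pos d with rfl | hd
  · refine ⟨0, fun T v θ _ _ _ => iSup_le fun q => ?_⟩
    simp [normL1Lp, dyadicBlock_eq_zero_of_dim_zero]
  have : NeZero d := ⟨hd.ne'⟩
  obtain ⟨c, hc, hmain⟩ := IsSmoothSolution.exists_dyadicBlock_le P hp hp'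
  obtain ⟨A, hA⟩ := eLpNorm_fderiv_le_vorticity d hp hp'
  have hI₀ := lintegral_blockKer_lt_top P
  have hI₁ := lintegral_norm_mul_fderiv_blockKer_lt_top P
  set I₀ := ∫⁻ z, ‖blockKer P 0 z‖ₑ
  set I₁ := ∫⁻ z, ‖z‖ₑ * ‖fderiv ℝ (blockKer P 0) z‖ₑ
  have hc' : (ENNReal.ofReal c)⁻¹ ≠ ⊤ := by simpa using hc
  have hCtop : (ENNReal.ofReal c)⁻¹ * (I₀ + I₁ * A) ≠ ⊤ :=
    ENNReal.mul_ne_top hc' (ENNReal.add_ne_top.2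
      ⟨hI₀.ne, ENNReal.mul_ne_top hI₁.ne ENNReal.coe_ne_top⟩)
  -- I₀ comes from Young's inequality for the initial block, I₁A from the commutator and the
  -- elliptic estimate, and c from the damping rate; none of them depends on q, T, v or θ.
  refine ⟨((ENNReal.ofReal c)⁻¹ * (I₀ + I₁ * A)).toNNReal, fun T v θ hT hv hθ =>
    iSup_le fun q => ?_⟩
  rw [ENNReal.coe_toNNReal hCtop]
  obtain ⟨V, hV⟩ := hv.bounded
  obtain ⟨K, hK⟩ := hθ.bounded
  set N := eLpNorm (θ 0) p volume
  set M := eLpNorm (θ 0) ⊤ volume with hMdef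
  set L := normL1Lp T p (fun t => dyadicBlock P q (θ t)) with hL
  set W := normL1Lp T p (fun t => vorticity (v t)) with hW
  -- Finiteness of the sup norm allows the constant to leave the time integral without measurability
  -- of the norm in time.
  have hfin : M ≠ ⊤ := by
    rw [hMdef, eLpNorm_exponent_top]
    exact (lt_of_le_of_lt (eLpNormEssSup_le_of_ae_bound (C := K) (Eventually.of_forall
      fun x => (hK 0 ⟨le_rfl, hT.le⟩ x).1)) ENNReal.ofReal_lt_top).ne
  have h1 : ENNReal.ofReal c * ((2 : ℝ≥0∞) ^ q * L) ≤ I₀ * N + M * I₁ * A * W := by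
    calc ENNReal.ofReal c * ((2 : ℝ≥0∞) ^ q * L) = ENNReal.ofReal (c * 2 ^ q) * L := by
          rw [ENNReal.ofReal_mul hc.le, ENNReal.ofReal_pow (by norm_num), ENNReal.ofReal_ofNat,
            mul_assoc]
      _ ≤ _ := hmain T v θ hT hv hθ q
      _ ≤ I₀ * N + ∫⁻ t in Icc 0 T, M * I₁ * A * eLpNorm (vorticity (v t)) p volume := by
          refine add_le_add le_rfl (setLIntegral_mono' measurableSet_Icc fun t ht => ?_)
          rw [mul_assoc (M * I₁)]
          gcongr
          exact hA (v t) V ((contDiff_slice hv.smooth ht).of_le (by exact_mod_cast le_top))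
            (hV t ht) (hv.div_eq_zero t ht)
      _ = _ := by
          rw [lintegral_const_mul' _ _ (ENNReal.mul_ne_top (ENNReal.mul_ne_top hfin hI₁.ne)
            ENNReal.coe_ne_top)]
          rfl
  have hc0 : ENNReal.ofReal c ≠ 0 := by simpa using hc
  calc (2 : ℝ≥0∞) ^ q * L = (ENNReal.ofReal c)⁻¹ * (ENNReal.ofReal c * ((2 : ℝ≥0∞) ^ q * L)) := by
        rw [← mul_assoc, ENNReal.inv_mul_cancel hc0 ENNReal.ofReal_ne_top, one_mul]
    _ ≤ (ENNReal.ofReal c)⁻¹ * (I₀ * N + M * I₁ * A * W) := mul_le_mul_right h1 _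
    _ = (ENNReal.ofReal c)⁻¹ * I₀ * N + (ENNReal.ofReal c)⁻¹ * (I₁ * A) * M * W := by ring
    _ ≤ _ := by
        gcongr
        · exact le_self_add
        · exact le_add_self

end
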